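/- Let $N,M\ge 1$ be integers, $\omega=e^{2\pi i/N}$, $\omega^{1/2}=e^{\pi i/N}$. On $V=(\mathbb C^N)^{\otimes M}$ with basis $|\alpha\rangle$, $\alpha\in(\mathbb Z/N)^{\mathbb Z/M}$, let $\mathbf x_m|\alpha\rangle=\omega^{\alpha_m}|\alpha\rangle$, $\mathbf z_m|\alpha\rangle=|\alpha+e_m\rangle$. For $\kappa\in\mathbb C$, $u,w\in\mathbb C^{\mathbb Z/M}$ and $\lambda\neq 0$ the transfer matrix of the quantum relativistic Toda chain is $$\mathbf t(\lambda;u,w)=\operatorname{tr}\,\ell_1(\lambda)\cdots\ell_M(\lambda),\qquad \ell_m(\lambda)=\begin{pmatrix}1+\frac{\kappa}{\lambda}u_mw_m\mathbf x_m\mathbf z_m & -\frac{\omega^{1/2}}{\lambda}u_m\mathbf x_m\\ w_m\mathbf z_m&0\end{pmatrix}.$$ Assume $\kappa\ne0$ and $\kappa^N+\cos^2(\pi l/M)\neq0$ for $l=0,\dots,M-1$, and fix a branch of the square root on $\mathbb C$. For $\phi\in\mathfrak F=\{\pi/M,2\pi/M,\dots,(M-1)\pi/M\}$ put $$\Delta_\phi=e^{i\phi}\bigl(\sqrt{\cos^2\phi+\kappa^N}+\cos\phi\bigr),\quad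 \Delta^*_\phi=e^{-i\phi}\bigl(\sqrt{\cos^2\phi+\kappa^N}+\cos\phi\bigr),\quad s_\phi(\xi)=\frac{\Delta^*_\phi}{\Delta_\phi}\,\frac{\Delta_\phi-\xi}{\Delta^*_\phi-\xi},$$ $$d_{\phi,\phi'}=\frac{(\Delta_\phi-\Delta_{\phi'})(\Delta^*_\phi-\Delta^*_{\phi'})}{(\Delta_\phi-\Delta^*_{\phi'})(\Delta^*_\phi-\Delta_{\phi'})},$$ and fix roots $\delta_\phi^N=\Delta_\phi$, $\lambda_\phi^N=\Delta_\phi\Delta^*_\phi$, $c_\phi^N=(\Delta_\phi^*-1)/\Delta_\phi^*$. To every $\phi\in\mathfrak F$ let an amplitude $g_\phi\in\mathbb C$ be attached, and let $(\phi_1,\dots,\phi_{M-1})$ be an ordering of $\mathfrak F$; write $g_k=g_{\phi_k}$, $\delta_k=\delta_{\phi_k}$, and so on. Define recursively $\Theta^{(0)}_m=1$, $$\Theta^{(n)}_m(\{f_k\}_{k\le n})=\Theta^{(n-1)}_m(\{f_k\}_{k<n})-f_ne^{2im\phi_n}\,\Theta_m^{(n-1)}(\{d_{\phi_k,\phi_n}f_k\}_{k<n}),$$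 and let $\Theta^{(n)}_m[g]$ denote its value at $f_k=g_k\prod_{j\le n,\,j\ne k}s_{\phi_k}(\Delta^*_{\phi_j})$. Let $\tau^{(0)}_m=\theta_m^{(0)}=1$ and, for $1\le n\le M-1$, $m\in\mathbb Z/M$, choose arbitrary roots $$(\tau^{(n)}_m)^N=\Theta_m^{(n)}[\{g_k\}],\qquad(\theta_m^{(n)})^N=\Theta_m^{(n)}[\{g_ks_{\phi_k}(1)\}],\qquad u_m^{(n)}=-\omega^{-1/2}\frac{\tau^{(n)}_{m-1}}{\tau^{(n)}_m},\quad w^{(n)}_m=-\frac{\theta_m^{(n)}}{\theta_{m-1}^{(n)}}.$$ For $1\le n\le M-1$ let $p_{j,m}^{(n)}=(x_{j,m}^{(n)},y_{j,m}^{(n)})$, $j=1,2,3$, be points of the Fermat curve $x^N+y^N=1$ with $y\neq 0$ and $$x_{1,m}^{(n)}=\omega^{-1/2}\frac{\delta_n}{\kappa}\frac{\tau_m^{(n-1)}\tau_{m-1}^{(n)}}{\tau_{m-1}^{(n-1)}\tau_m^{(n)}},\quad x_{2,m}^{(n)}=\omega^{-1/2}\kappa\frac{(\tau_m^{(n)})^2}{\tau_{m-1}^{(n)}\tau_{m+1}^{(n)}},\quad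 x_{3,m}^{(n)}=\omega^{-1}\delta_n\frac{\tau_m^{(n-1)}\tau_m^{(n)}}{\tau_{m-1}^{(n-1)}\tau_{m+1}^{(n)}},$$ $$\frac{y_{3,m}^{(n)}}{y_{2,m}^{(n)}}=\omega^{-1/2}\frac{\delta_n}{\lambda_nc_n}\frac{\theta_m^{(n-1)}\tau_{m-1}^{(n)}}{\tau_{m-1}^{(n-1)}\theta_m^{(n)}},\qquad \frac{y_{1,m}^{(n)}}{y_{3,m}^{(n)}}=\omega^{1/2}\frac{\lambda_n}{\kappa\delta_n}\frac{\theta_{m-1}^{(n-1)}\tau_{m+1}^{(n)}}{\theta_m^{(n-1)}\tau_m^{(n)}}.$$ With $w_{(x,y)}(0)=1$ and $w_{(x,y)}(k)/w_{(x,y)}(k-1)=y/(1-x\omega^k)$, the modified $Q$-operators and $\mathbf K$ are $$\langle\alpha|\mathbf Q^{(n)}|\beta\rangle=\prod_{m\in\mathbb Z/M}\omega^{(\alpha_m-\beta_m)\beta_{m+1}}\frac{w_{p^{(n)}_{1,m}}(\beta_m-\alpha_m)\,w_{p^{(n)}_{2,m}}(\beta_{m+1}-\beta_m)}{w_{p^{(n)}_{3,m}}(\beta_{m+1}-\alpha_m)},\qquad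 \mathbf K=\mathbf Q^{(1)}\mathbf Q^{(2)}\cdots\mathbf Q^{(M-1)}.$$ Call such data (an ordering, roots $\tau,\theta$, coordinates $y$) regular if all $\tau_m^{(n)},\theta_m^{(n)}$ are nonzero and the points $p_{j,m}^{(n)}$ are as above. Then: 1. There is a nonzero polynomial $P$ in the $M-1$ amplitudes such that, if $P(g)\ne0$, then for every ordering and all choices of $\delta,\lambda,c$ and of the roots $\tau,\theta$, all $\tau_m^{(n)},\theta^{(n)}_m$ are nonzero and points $p_{j,m}^{(n)}$ as above exist. 2. $\Theta_m^{(M-1)}[\{g_k\}]$ and $\Theta_m^{(M-1)}[\{g_ks_{\phi_k}(1)\}]$ do not depend on the ordering. 3. For all regular data and all $\lambda\ne0$, with $\mathbf t^{(0)}(\lambda)=\mathbf t(\lambda;-\omega^{-1/2},-1)$ (the homogeneous chain) and $\mathbf t^{(M-1)}(\lambda)=\mathbf t(\lambda;u^{(M-1)},w^{(M-1)})$, $$\mathbf t^{(0)}(\lambda)\,\mathbf K=\mathbf K\,\mathbf t^{(M-1)}(\lambda);$$ hence $\mathbf K^{-1}\mathbf t^{(0)}(\lambda)\mathbf K=\mathbf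 t^{(M-1)}(\lambda)$ whenever $\mathbf K$ is invertible. In all cases $\mathbf t^{(0)}(\lambda)$ and $\mathbf t^{(M-1)}(\lambda)$ have the same characteristic polynomial. 4. $\mathbf K$ does not depend on the ordering of the pairs $(g_\phi,\phi)$, up to a multiplier: let $\mathbf K,\mathbf K'$ be built from regular data with the same $g_\phi,\delta_\phi,\lambda_\phi,c_\phi$, but possibly different orderings and different phases of $\tau,\theta$. If the final parameters $u^{(M-1)},w^{(M-1)}$ agree for the two sets of data, then $\mathbf K'=c\,\mathbf K$ with a scalar $c\neq0$. In general there are $a,b\in(\mathbb Z/N)^{\mathbb Z/M}$ and $c\ne0$ such that $u_m'^{(M-1)}=\omega^{a_m}u_m^{(M-1)}$, $w_m'^{(M-1)}=\omega^{b_m}w_m^{(M-1)}$ for all $m$, and $\mathbf K'=c\,\mathbf K\prod_m\mathbf z_m^{a_m}\mathbf x_m^{-b_m}$. -/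

import Mathlib

open scoped Matrix

noncomputable section

namespace RelToda

/-- The primitive root of unity `ω = exp (2πi / N)`. -/
def om (N : ℕ) : ℂ := Complex.exp (2 * Real.pi * Complex.I / N)

/-- Its square root `ω^{1/2} = exp (πi / N)`. -/
def omHalf (N : ℕ) : ℂ := Complex.exp (Real.pi * Complex.I / N)

/-- Labels `α = (α_m)` of the basis vectors `|α⟩` of the `N^M`-dimensional quantum space;
sites are labelled by `ZMod M` and spins by `ZMod N`. -/
abbrev Conf (N M : ℕ) : Type := ZMod M → ZMod N

/-- Operators on the quantum space, in the basis `|α⟩`; the entry `A α β` is `⟨α|A|β⟩`. -/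
abbrev Op (N M : ℕ) : Type := Matrix (Conf N M) (Conf N M) ℂ

/-- `x_m |β⟩ = ω^{β_m} |β⟩`. -/
def xOp (N M : ℕ) [NeZero M] (m : ZMod M) : Op N M :=
  Matrix.diagonal fun β => om N ^ (β m).val

/-- `z_m |β⟩ = |β + e_m⟩`. -/
def zOp (N M : ℕ) [NeZero M] (m : ZMod M) : Op N M :=
  Matrix.of fun α β => if α = β + Pi.single m 1 then 1 else 0

/-- The Weyl monomial `∏_m z_m^{a_m} x_m^{-b_m}`, which sends `|β⟩` to
`ω^{-∑ b_m β_m} |β + a⟩`. -/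
def weylOp (N M : ℕ) [NeZero M] (a b : Conf N M) : Op N M :=
  Matrix.of fun α β => if α = β + a then ∏ m, (om N ^ ((b m).val * (β m).val))⁻¹ else 0

/-- The local Lax matrix of the quantum relativistic Toda chain at the site `m`, with
`𝐮_m = u x_m` and `𝐰_m = w z_m`. -/
def lax (N M : ℕ) [NeZero M] [NeZero N] (κ lam u w : ℂ) (m : ZMod M) :
    Matrix (Fin 2) (Fin 2) (Op N M) :=
  !![1 + (κ / lam) • ((u • xOp N M m) * (w • zOp N M m)),
      -((omHalf N / lam) • (u • xOp N M m));
    w • zOp N M m, 0]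

/-- The transfer matrix: the trace of the ordered product `ℓ_1(λ) ℓ_2(λ) ⋯ ℓ_M(λ)`
(site `M` is `0` in `ZMod M`). -/
def transfer (N M : ℕ) [NeZero M] [NeZero N] (κ : ℂ) (u w : ZMod M → ℂ) (lam : ℂ) : Op N M :=
  Matrix.trace ((List.range M).map fun j : ℕ =>
    lax N M κ lam (u ((j + 1 : ℕ) : ZMod M)) (w ((j + 1 : ℕ) : ZMod M))
      ((j + 1 : ℕ) : ZMod M)).prod

/-- The function `w_p(n)`, `p = (x, y)` on the Fermat curve `x^N + y^N = 1`: `w_p(0) = 1` and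
`w_p(n) / w_p(n-1) = y / (1 - x ω^n)`. -/
def wFun (N : ℕ) (x y : ℂ) (n : ZMod N) : ℂ :=
  ∏ j ∈ Finset.range n.val, y / (1 - x * om N ^ (j + 1))

/-! The rational solitonic functions. `rt` is the chosen branch of the complex square root. -/

/-- The angles `φ ∈ {π/M, 2π/M, …, (M-1)π/M}`, labelled by `Fin (M - 1)`. -/
def phi (M : ℕ) (l : Fin (M - 1)) : ℝ := Real.pi * (l.val + 1) / M

/-- `Δ_φ = e^{iφ} (√(cos²φ + κ^N) + cos φ)`. -/
def Del (N M : ℕ) (κ : ℂ) (rt : ℂ → ℂ) (l : Fin (M - 1)) : ℂ :=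
  Complex.exp (Complex.I * phi M l) *
    (rt ((Real.cos (phi M l) : ℂ) ^ 2 + κ ^ N) + Real.cos (phi M l))

/-- `Δ*_φ = e^{-iφ} (√(cos²φ + κ^N) + cos φ)`. -/
def DelStar (N M : ℕ) (κ : ℂ) (rt : ℂ → ℂ) (l : Fin (M - 1)) : ℂ :=
  Complex.exp (-(Complex.I * phi M l)) *
    (rt ((Real.cos (phi M l) : ℂ) ^ 2 + κ ^ N) + Real.cos (phi M l))

/-- The phase shift `d_{φ,φ'}`. -/
def shift (N M : ℕ) (κ : ℂ) (rt : ℂ → ℂ) (l k : Fin (M - 1)) : ℂ :=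
  ((Del N M κ rt l - Del N M κ rt k) * (DelStar N M κ rt l - DelStar N M κ rt k)) /
    ((Del N M κ rt l - DelStar N M κ rt k) * (DelStar N M κ rt l - Del N M κ rt k))

/-- `s_φ(ξ) = (Δ*_φ / Δ_φ) (Δ_φ - ξ) / (Δ*_φ - ξ)`. -/
def sFun (N M : ℕ) (κ : ℂ) (rt : ℂ → ℂ) (l : Fin (M - 1)) (ξ : ℂ) : ℂ :=
  DelStar N M κ rt l / Del N M κ rt l *
    ((Del N M κ rt l - ξ) / (DelStar N M κ rt l - ξ))

/-- The rational `Θ`-function `Θ_m^{(n)}({f_k, φ_k}_{k=1}^n)`, by recursion on `n`; `l k` is the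
label of the `k`-th angle of the sequence. -/
def Theta (N M : ℕ) (κ : ℂ) (rt : ℂ → ℂ) :
    (n : ℕ) → (Fin n → ℂ) → (Fin n → Fin (M - 1)) → ZMod M → ℂ
  | 0, _, _, _ => 1
  | n + 1, f, l, m =>
      Theta N M κ rt n (fun k => f k.castSucc) (fun k => l k.castSucc) m
        - f (Fin.last n) * Complex.exp (2 * Complex.I * m.val * phi M (l (Fin.last n))) *
          Theta N M κ rt n
            (fun k => shift N M κ rt (l k.castSucc) (l (Fin.last n)) * f k.castSucc)
            (fun k => l k.castSucc) m

/-- `Θ_m^{(n)}({g})`: the amplitudes are `f_k = g_k ∏_{j ≠ k} s_{k,j}` with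
`s_{k,j} = s_{φ_k}(Δ*_{φ_j})`. -/
def ThetaG (N M : ℕ) (κ : ℂ) (rt : ℂ → ℂ) (n : ℕ) (g : Fin n → ℂ) (l : Fin n → Fin (M - 1))
    (m : ZMod M) : ℂ :=
  Theta N M κ rt n
    (fun k => g k * ∏ j ∈ Finset.univ.erase k,
      sFun N M κ rt (l k) (DelStar N M κ rt (l j))) l m

/-- The first `n` angles of the ordering `σ`. -/
def modes {M : ℕ} (σ : Equiv.Perm (Fin (M - 1))) (n : ℕ) (hn : n ≤ M - 1) :
    Fin n → Fin (M - 1) :=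
  fun k => σ (Fin.castLE hn k)

/-- The prescribed value of `(τ_m^{(n)})^N` when the pairs `(g_φ, φ)` are taken in the
order `σ`. -/
def tauPow (N M : ℕ) (κ : ℂ) (rt : ℂ → ℂ) (g : Fin (M - 1) → ℂ)
    (σ : Equiv.Perm (Fin (M - 1))) (n : ℕ) (hn : n ≤ M - 1) (m : ZMod M) : ℂ :=
  ThetaG N M κ rt n (fun k => g (modes σ n hn k)) (modes σ n hn) m

/-- The prescribed value of `(θ_m^{(n)})^N`: here `g_φ` is replaced by `g_φ s_φ(1)`. -/
def thetaPow (N M : ℕ) (κ : ℂ) (rt : ℂ → ℂ) (g : Fin (M - 1) → ℂ)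
    (σ : Equiv.Perm (Fin (M - 1))) (n : ℕ) (hn : n ≤ M - 1) (m : ZMod M) : ℂ :=
  ThetaG N M κ rt n
    (fun k => g (modes σ n hn k) * sFun N M κ rt (modes σ n hn k) 1) (modes σ n hn) m

/-- A choice of the `N`-th roots `δ_φ, λ_φ, c_φ`, one for each angle. -/
structure Roots (M : ℕ) where
  δ : Fin (M - 1) → ℂ
  lam : Fin (M - 1) → ℂ
  c : Fin (M - 1) → ℂ

/-- `δ^N = Δ_φ`, `λ^N = Λ_φ = Δ_φ Δ*_φ`, `c^N = (Δ*_φ - 1) / Δ*_φ`. -/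
structure Roots.Valid {M : ℕ} (N : ℕ) (κ : ℂ) (rt : ℂ → ℂ) (R : Roots M) : Prop where
  δ_pow : ∀ l, R.δ l ^ N = Del N M κ rt l
  lam_pow : ∀ l, R.lam l ^ N = Del N M κ rt l * DelStar N M κ rt l
  c_pow : ∀ l, R.c l ^ N = (DelStar N M κ rt l - 1) / DelStar N M κ rt l

/-- Families `τ_m^{(n)}`, `θ_m^{(n)}`, used for `0 ≤ n ≤ M - 1`. -/
structure TauTheta (M : ℕ) where
  τ : ℕ → ZMod M → ℂ
  θ : ℕ → ZMod M → ℂ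

/-- `τ^{(n)}`, `θ^{(n)}` are `N`-th roots, of arbitrary phases, of the `Θ`-functions; the state
`n = 0` is the homogeneous one. -/
structure TauTheta.Valid {M : ℕ} (N : ℕ) (κ : ℂ) (rt : ℂ → ℂ) (g : Fin (M - 1) → ℂ)
    (σ : Equiv.Perm (Fin (M - 1))) (T : TauTheta M) : Prop where
  τ_zero : ∀ m, T.τ 0 m = 1
  θ_zero : ∀ m, T.θ 0 m = 1
  τ_pow : ∀ (n : ℕ) (hn : n ≤ M - 1) (m : ZMod M), T.τ n m ^ N = tauPow N M κ rt g σ n hn m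
  θ_pow : ∀ (n : ℕ) (hn : n ≤ M - 1) (m : ZMod M), T.θ n m ^ N = thetaPow N M κ rt g σ n hn m

/-- No `τ_m^{(n)}`, `θ_m^{(n)}` vanishes, so that all the quotients below make sense. -/
def TauTheta.Nonvanishing {M : ℕ} (T : TauTheta M) : Prop :=
  ∀ n ≤ M - 1, ∀ m, T.τ n m ≠ 0 ∧ T.θ n m ≠ 0

/-- `u_m^{(n)} = -ω^{-1/2} τ_{m-1}^{(n)} / τ_m^{(n)}`. -/
def TauTheta.u {M : ℕ} (N : ℕ) (T : TauTheta M) (n : ℕ) (m : ZMod M) : ℂ :=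
  -(omHalf N)⁻¹ * (T.τ n (m - 1) / T.τ n m)

/-- `w_m^{(n)} = -θ_m^{(n)} / θ_{m-1}^{(n)}`. -/
def TauTheta.w {M : ℕ} (T : TauTheta M) (n : ℕ) (m : ZMod M) : ℂ :=
  -(T.θ n m / T.θ n (m - 1))

/-! The points `p_{1,m}^{(n)}, p_{2,m}^{(n)}, p_{3,m}^{(n)}` of the Fermat curve. The index
`n : Fin (M - 1)` stands for the step from the state `n` to the state `n + 1`, which uses the
angle labelled `σ n`. -/

/-- The coordinates `x_{1,m}`. -/
def x₁ {M : ℕ} (N : ℕ) (κ : ℂ) (R : Roots M) (σ : Equiv.Perm (Fin (M - 1))) (T : TauTheta M)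
    (n : Fin (M - 1)) (m : ZMod M) : ℂ :=
  (omHalf N)⁻¹ * (R.δ (σ n) / κ) *
    ((T.τ n m * T.τ (n + 1) (m - 1)) / (T.τ n (m - 1) * T.τ (n + 1) m))

/-- The coordinates `x_{2,m}`. -/
def x₂ {M : ℕ} (N : ℕ) (κ : ℂ) (T : TauTheta M) (n : Fin (M - 1)) (m : ZMod M) : ℂ :=
  (omHalf N)⁻¹ * κ *
    (T.τ (n + 1) m ^ 2 / (T.τ (n + 1) (m - 1) * T.τ (n + 1) (m + 1)))

/-- The coordinates `x_{3,m}`. -/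
def x₃ {M : ℕ} (N : ℕ) (R : Roots M) (σ : Equiv.Perm (Fin (M - 1))) (T : TauTheta M)
    (n : Fin (M - 1)) (m : ZMod M) : ℂ :=
  (om N)⁻¹ * R.δ (σ n) *
    ((T.τ n m * T.τ (n + 1) m) / (T.τ n (m - 1) * T.τ (n + 1) (m + 1)))

/-- Second coordinates of the points `p_{1,m}, p_{2,m}, p_{3,m}` for all steps. -/
structure YCoords (M : ℕ) where
  y₁ : Fin (M - 1) → ZMod M → ℂ
  y₂ : Fin (M - 1) → ZMod M → ℂ
  y₃ : Fin (M - 1) → ZMod M → ℂ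

/-- The points lie on the Fermat curve, the ratios of their `y`-coordinates have the prescribed
values, and the values of `w_p` at them are finite and nonzero (`y ≠ 0`). -/
structure YCoords.Valid {M : ℕ} (N : ℕ) (κ : ℂ) (R : Roots M) (σ : Equiv.Perm (Fin (M - 1)))
    (T : TauTheta M) (Y : YCoords M) : Prop where
  fermat₁ : ∀ n m, x₁ N κ R σ T n m ^ N + Y.y₁ n m ^ N = 1
  fermat₂ : ∀ n m, x₂ N κ T n m ^ N + Y.y₂ n m ^ N = 1
  fermat₃ : ∀ n m, x₃ N R σ T n m ^ N + Y.y₃ n m ^ N = 1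
  ne_zero : ∀ n m, Y.y₁ n m ≠ 0 ∧ Y.y₂ n m ≠ 0 ∧ Y.y₃ n m ≠ 0
  ratio₃₂ : ∀ n m, Y.y₃ n m / Y.y₂ n m =
    (omHalf N)⁻¹ * (R.δ (σ n) / (R.lam (σ n) * R.c (σ n))) *
      ((T.θ n m * T.τ (n + 1) (m - 1)) / (T.τ n (m - 1) * T.θ (n + 1) m))
  ratio₁₃ : ∀ n m, Y.y₁ n m / Y.y₃ n m =
    omHalf N * (R.lam (σ n) / (κ * R.δ (σ n))) *
      ((T.θ n (m - 1) * T.τ (n + 1) (m + 1)) / (T.θ n m * T.τ (n + 1) m))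

/-- The modified `Q`-operator of the step `n`, by its matrix elements. -/
def Qop {M : ℕ} (N : ℕ) [NeZero M] (κ : ℂ) (R : Roots M) (σ : Equiv.Perm (Fin (M - 1)))
    (T : TauTheta M) (Y : YCoords M) (n : Fin (M - 1)) : Op N M :=
  Matrix.of fun α β => ∏ m : ZMod M,
    om N ^ ((α m - β m) * β (m + 1)).val *
      ((wFun N (x₁ N κ R σ T n m) (Y.y₁ n m) (β m - α m) *
          wFun N (x₂ N κ T n m) (Y.y₂ n m) (β (m + 1) - β m)) /
        wFun N (x₃ N R σ T n m) (Y.y₃ n m) (β (m + 1) - α m))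

/-- `K = Q^{(1)} Q^{(2)} ⋯ Q^{(M-1)}`. -/
def Kop {M : ℕ} (N : ℕ) [NeZero M] [NeZero N] (κ : ℂ) (R : Roots M)
    (σ : Equiv.Perm (Fin (M - 1))) (T : TauTheta M) (Y : YCoords M) : Op N M :=
  (List.ofFn fun n : Fin (M - 1) => Qop N κ R σ T Y n).prod

end RelToda

end

noncomputable section

open scoped Matrix Topology

open Filter

set_option linter.unusedSectionVars false

/-! A state of the chain is a set of modes together with `N`-th roots `τ`, `θ` of the corresponding
Θ-functions. Adding a mode is a Bäcklund transformation of the classical data, and the `Q`-operator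
of a step is its quantum counterpart. `K` is thus attached to a path in the lattice of subsets of
modes, from the empty set to the full one, and the theorem says what depends on the path and what
does not.

Intertwining. On the space (intermediate spin) × (auxiliary index), a gauge matrix carries the Lax
matrix acting on the local factor of `Q` into the Lax matrix of the next state (`Step.laxQ_gauge`).
A trace around a closed chain is gauge invariant (`pathSum_gauge`), which gives `t Q = Q t'`
(`Step.intertwine`). The parameters have to lie on Fermat curves; the `N`-th powers of these
conditions are three bilinear relations between Θ-functions (`IsBacklund`). Each of them is a case
of Fay's identity (`fay`), which is a three-term Plücker relation: Θ-functions are values of a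
decomposable form on the moment curve (`exists_form`). The curve `(Δ - 1)(Δ* - 1) = 1 + κ^N` turns
the special points `1` and `-κ^N` of the identity into lattice shifts.

Order. A Θ-function is a sum over subsets of modes (`th_comp`), hence symmetric in them. For the
operators it suffices to compare the two ways around one square of the lattice. After a Fourier
transform of the local factor, two star-triangle relations exchange the two spectral parameters site
by site, and the proportionality factors cancel around the chain (`Exchange.exists_smul`).
`Reach.unique` glues squares together. Changing the phases of the final roots multiplies the last
`Q` by a Weyl monomial (`Twist.exists_smul`).

Genericity. The exchange needs inequalities that regular data may violate. They are polynomial in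
the amplitudes and hold at amplitude zero, where every Θ is `1`; so they hold off a hypersurface,
and arbitrary data are limits of generic ones. In the limit the scalar must not escape to `0` or
infinity. As a `Q`-operator need not be invertible, the scalar is controlled by `Step.rho`, a
product of moduli of local determinants which never vanish: `‖c‖ ^ N` is a ratio of such
normalisations.

Isospectrality. When `K` is singular the intertwining relation is not enough. Each edge belongs to a
family of Bäcklund transforms of its final state with a free parameter `D`. Near `D = 0` the
`Q`-operator is close to an invertible one, so the spectra agree there; the characteristic
polynomial is analytic in `D` off a finite set, and analytic continuation reaches the edge
(`IsEdge.charpoly_eq`). -/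

namespace RelToda

/-! ### Characters of `ZMod N` and first-order cyclic recursions -/

section Character

variable {N : ℕ} [NeZero N]

/-- The additive character `n ↦ ω ^ n` of `ZMod N`. -/
def chi (n : ZMod N) : ℂ := om N ^ n.val

theorem om_primitive : IsPrimitiveRoot (om N) N :=
  Complex.isPrimitiveRoot_exp N (NeZero.ne N)

theorem om_pow_card : om N ^ N = 1 := om_primitive.pow_eq_one

theorem om_ne_zero : om N ≠ 0 := Complex.exp_ne_zero _

theorem omHalf_ne_zero : omHalf N ≠ 0 := Complex.exp_ne_zero _

theorem omHalf_sq : omHalf N ^ 2 = om N := by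
  rw [omHalf, om, ← Complex.exp_nat_mul]
  congr 1; push_cast; ring

theorem omHalf_pow_card : omHalf N ^ N = -1 := by
  rw [omHalf, ← Complex.exp_nat_mul]
  have h : (N : ℂ) ≠ 0 := Nat.cast_ne_zero.mpr (NeZero.ne N)
  rw [mul_div_cancel₀ _ h, Complex.exp_pi_mul_I]

theorem om_pow_mod (k : ℕ) : om N ^ (k % N) = om N ^ k :=
  (pow_eq_pow_mod k om_pow_card).symm

theorem chi_add (a b : ZMod N) : chi (a + b) = chi a * chi b := by
  rw [chi, ZMod.val_add, om_pow_mod, pow_add, chi, chi]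

@[simp] theorem chi_zero : chi (0 : ZMod N) = 1 := by simp [chi]

theorem chi_ne_zero (a : ZMod N) : chi a ≠ 0 := pow_ne_zero _ om_ne_zero

theorem chi_neg (a : ZMod N) : chi (-a) = (chi a)⁻¹ :=
  eq_inv_of_mul_eq_one_left (by rw [← chi_add]; simp)

theorem chi_sub (a b : ZMod N) : chi (a - b) = chi a / chi b := by
  rw [sub_eq_add_neg, chi_add, chi_neg, div_eq_mul_inv]

theorem chi_pow_card (a : ZMod N) : chi a ^ N = 1 := by
  rw [chi, ← pow_mul, mul_comm, pow_mul, om_pow_card, one_pow]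

theorem chi_natCast (k : ℕ) : chi (k : ZMod N) = om N ^ k := by
  rw [chi, ZMod.val_natCast, om_pow_mod]

@[simp] theorem chi_one : chi (1 : ZMod N) = om N := by
  simpa using chi_natCast (N := N) 1

theorem chi_sum {ι : Type*} (s : Finset ι) (f : ι → ZMod N) :
    chi (∑ i ∈ s, f i) = ∏ i ∈ s, chi (f i) := by
  classical
  induction s using Finset.induction_on with
  | empty => simp
  | insert a s ha ih => rw [Finset.sum_insert ha, Finset.prod_insert ha, chi_add, ih]

theorem chi_injective : Function.Injective (chi : ZMod N → ℂ) := fun a b h =>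
  ZMod.val_injective N (om_primitive.pow_inj (ZMod.val_lt a) (ZMod.val_lt b) h)

theorem exists_chi_eq {z : ℂ} (h : z ^ N = 1) : ∃ a : ZMod N, z = chi a := by
  obtain ⟨i, -, hi⟩ := (om_primitive (N := N)).eq_pow_of_pow_eq_one h
  exact ⟨i, by rw [chi_natCast, hi]⟩

theorem exists_chi_mul {a b : ℂ} (hb : b ≠ 0) (h : a ^ N = b ^ N) : ∃ s : ZMod N, a = chi s * b := by
  obtain ⟨s, hs⟩ := exists_chi_eq (N := N) (z := a / b)
    (by rw [div_pow, h, div_self (pow_ne_zero _ hb)])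
  exact ⟨s, by rw [← hs, div_mul_cancel₀ _ hb]⟩

theorem sum_chi_mul (n : ZMod N) : ∑ j : ZMod N, chi (j * n) = if n = 0 then (N : ℂ) else 0 := by
  split_ifs with h
  · simp [h, ZMod.card]
  · have h1 : chi n ≠ 1 := fun h' => h (chi_injective (by rw [h', chi_zero]))
    have h2 : chi n * ∑ j : ZMod N, chi (j * n) = ∑ j : ZMod N, chi (j * n) := by
      rw [Finset.mul_sum, ← Equiv.sum_comp (Equiv.addRight (1 : ZMod N)) fun j => chi (j * n)]
      refine Finset.sum_congr rfl fun j _ => ?_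
      rw [← chi_add]; congr 1; simp [add_mul, add_comm]
    have h3 : (chi n - 1) * ∑ j : ZMod N, chi (j * n) = 0 := by rw [sub_mul, h2]; ring
    exact (mul_eq_zero.mp h3).resolve_left (sub_ne_zero.mpr h1)

/-- Injectivity of the Fourier transform. -/
theorem eq_zero_of_fourier {f : ZMod N → ℂ} (h : ∀ n, ∑ j, f j * chi (j * n) = 0) (k : ZMod N) :
    f k = 0 := by
  have h1 : ∑ n : ZMod N, chi (-(k * n)) * ∑ j, f j * chi (j * n) = N * f k := by
    simp_rw [Finset.mul_sum]
    rw [Finset.sum_comm]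
    have : ∀ j, ∑ n : ZMod N, chi (-(k * n)) * (f j * chi (j * n)) =
        f j * if j - k = 0 then (N : ℂ) else 0 := by
      intro j
      rw [← sum_chi_mul, Finset.mul_sum]
      refine Finset.sum_congr rfl fun n _ => ?_
      have : chi (n * (j - k)) = chi (-(k * n)) * chi (j * n) := by
        rw [← chi_add]; congr 1; ring
      rw [this]; ring
    simp_rw [this, sub_eq_zero, mul_ite, mul_zero]
    rw [Finset.sum_ite_eq' Finset.univ k]
    simp [mul_comm]
  simp_rw [h, mul_zero, Finset.sum_const_zero] at h1
  exact (mul_eq_zero.mp h1.symm).resolve_left (Nat.cast_ne_zero.mpr (NeZero.ne N))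

theorem prod_one_sub_mul_chi (x : ℂ) : ∏ k : ZMod N, (1 - x * chi k) = 1 - x ^ N := by
  have h := (om_primitive (N := N)).pow_sub_pow_eq_prod_sub_mul 1 x (Nat.pos_of_ne_zero (NeZero.ne N))
  rw [one_pow] at h
  rw [h]
  refine Finset.prod_bij (fun k _ => chi k) (fun k _ => ?_) (fun a _ b _ hab => chi_injective hab)
    (fun b hb => ?_) (fun k _ => by ring)
  · rw [Polynomial.mem_nthRootsFinset (Nat.pos_of_ne_zero (NeZero.ne N))]
    exact chi_pow_card k
  · rw [Polynomial.mem_nthRootsFinset (Nat.pos_of_ne_zero (NeZero.ne N))] at hb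
    obtain ⟨a, ha⟩ := exists_chi_eq hb
    exact ⟨a, Finset.mem_univ _, ha.symm⟩

theorem one_sub_mul_chi_ne_zero {x : ℂ} (hx : x ^ N ≠ 1) (k : ZMod N) : 1 - x * chi k ≠ 0 := by
  intro h
  apply hx
  have : x * chi k = 1 := (sub_eq_zero.mp h).symm
  rw [← one_pow N, ← this, mul_pow, chi_pow_card, mul_one]

/-- The function on `ZMod N` with `f 0 = 1` and `f n / f (n - 1) = a n`. -/
def cyc (a : ZMod N → ℂ) (n : ZMod N) : ℂ := ∏ j ∈ Finset.range n.val, a ((j : ZMod N) + 1)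

theorem prod_range_add_one (a : ZMod N → ℂ) :
    ∏ j ∈ Finset.range N, a ((j : ZMod N) + 1) = ∏ k, a k := by
  rw [← Equiv.prod_comp (Equiv.addRight (1 : ZMod N)) a]
  refine Finset.prod_bij (fun j _ => (j : ZMod N)) (fun _ _ => Finset.mem_univ _) ?_ ?_ (fun _ _ => rfl)
  · intro i hi j hj hij
    have := congrArg ZMod.val hij
    rwa [ZMod.val_natCast, ZMod.val_natCast, Nat.mod_eq_of_lt (Finset.mem_range.mp hi),
      Nat.mod_eq_of_lt (Finset.mem_range.mp hj)] at this
  · exact fun b _ => ⟨b.val, Finset.mem_range.mpr (ZMod.val_lt b), ZMod.natCast_zmod_val b⟩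

/-- The definition through `val` contains the recursion everywhere except at the passage from `N -
1` to `0`. There the product over a full period has to be `1`. -/
theorem cyc_rec {a : ZMod N → ℂ} (h : ∏ k, a k = 1) (n : ZMod N) : cyc a n = a n * cyc a (n - 1) := by
  have key : ∀ m : ℕ, m < N → cyc a ((m : ZMod N) + 1) = a ((m : ZMod N) + 1) * cyc a m := by
    intro m hm
    have hv : (m : ZMod N).val = m := by rw [ZMod.val_natCast, Nat.mod_eq_of_lt hm]
    have e : cyc a m = ∏ j ∈ Finset.range m, a ((j : ZMod N) + 1) := by rw [cyc, hv]
    rw [e, mul_comm, ← Finset.prod_range_succ fun j : ℕ => a ((j : ZMod N) + 1)]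
    rcases Nat.lt_or_ge (m + 1) N with h1 | h1
    · have : ((m : ZMod N) + 1).val = m + 1 := by
        rw [← Nat.cast_succ, ZMod.val_natCast, Nat.mod_eq_of_lt h1]
      rw [cyc, this]
    · have h2 : m + 1 = N := by omega
      rw [h2, prod_range_add_one, h]
      have : (m : ZMod N) + 1 = 0 := by
        rw [← Nat.cast_succ, Nat.succ_eq_add_one, h2]; simp
      simp [this, cyc]
  have := key (n - 1).val (ZMod.val_lt _)
  rwa [ZMod.natCast_zmod_val, sub_add_cancel] at this

theorem cyc_ne_zero {a : ZMod N → ℂ} (h : ∀ n, a n ≠ 0) (n : ZMod N) : cyc a n ≠ 0 :=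
  Finset.prod_ne_zero_iff.mpr fun _ _ => h _

@[simp] theorem cyc_zero (a : ZMod N → ℂ) : cyc a 0 = 1 := by simp [cyc]

theorem wFun_eq_cyc (x y : ℂ) : wFun N x y = cyc fun n => y / (1 - x * chi n) := by
  funext n
  refine Finset.prod_congr rfl fun j _ => ?_
  simp only
  rw [← Nat.cast_succ, chi_natCast]

/-- A point of the Fermat curve with nonzero second coordinate. -/
structure Fermat (N : ℕ) (x y : ℂ) : Prop where
  eq : x ^ N + y ^ N = 1
  ne : y ≠ 0

variable {x y : ℂ}

theorem Fermat.pow_ne_one (h : Fermat N x y) : x ^ N ≠ 1 := fun h' =>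
  pow_ne_zero N h.ne (by linear_combination h.eq - h')

theorem Fermat.one_sub_ne_zero (h : Fermat N x y) (n : ZMod N) : 1 - x * chi n ≠ 0 :=
  one_sub_mul_chi_ne_zero h.pow_ne_one n

theorem Fermat.wFun_ne_zero (h : Fermat N x y) (n : ZMod N) : wFun N x y n ≠ 0 := by
  rw [wFun_eq_cyc]
  exact cyc_ne_zero (fun n => div_ne_zero h.ne (h.one_sub_ne_zero n)) n

@[simp] theorem wFun_zero (x y : ℂ) : wFun N x y 0 = 1 := by simp [wFun]

/-- On the Fermat curve the product of `y / (1 - x ω^k)` over a period is `y^N / (1 - x^N) = 1`, so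
the recursion closes up on all of `ZMod N`. -/
theorem Fermat.wFun_rec (h : Fermat N x y) (n : ZMod N) :
    wFun N x y n * (1 - x * chi n) = y * wFun N x y (n - 1) := by
  have hp : ∏ k : ZMod N, y / (1 - x * chi k) = 1 := by
    rw [Finset.prod_div_distrib, prod_one_sub_mul_chi]
    rw [Finset.prod_const, Finset.card_univ, ZMod.card, div_eq_one_iff_eq (sub_ne_zero.mpr h.pow_ne_one.symm)]
    linear_combination h.eq
  rw [wFun_eq_cyc, cyc_rec hp n]
  have := h.one_sub_ne_zero n
  field_simp

/-- A function on `ZMod N` with a nonvanishing first order recursion is determined by one value. -/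
theorem eq_of_rec {f g a b : ZMod N → ℂ} (ha : ∀ n, a n ≠ 0)
    (hf : ∀ n, f n * a n = b n * f (n - 1)) (hg : ∀ n, g n * a n = b n * g (n - 1))
    {n₀ : ZMod N} (h : f n₀ = g n₀) (n : ZMod N) : f n = g n := by
  -- Upward steps alone reach every residue, so only `a` must not vanish; `b` is allowed to have
  -- zeros.
  have : ∀ k : ℕ, f (n₀ + k) = g (n₀ + k) := by
    intro k
    induction k with
    | zero => simpa using h
    | succ k ih =>
      have e : n₀ + ((k + 1 : ℕ) : ZMod N) - 1 = n₀ + k := by push_cast; ring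
      refine mul_right_cancel₀ (ha (n₀ + (k + 1 : ℕ))) ?_
      rw [hf, hg, e, ih]
  have := this (n - n₀).val
  rwa [ZMod.natCast_zmod_val, add_sub_cancel] at this

theorem eq_smul_of_rec {f g a b : ZMod N → ℂ} (ha : ∀ n, a n ≠ 0)
    (hf : ∀ n, f n * a n = b n * f (n - 1)) (hg : ∀ n, g n * a n = b n * g (n - 1))
    (h0 : g 0 ≠ 0) (n : ZMod N) : f n = f 0 / g 0 * g n := by
  refine eq_of_rec (g := fun n => f 0 / g 0 * g n) ha hf (fun n => ?_) (n₀ := 0) ?_ n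
  · linear_combination f 0 / g 0 * hg n
  · field_simp

end Character

/-! ### Traces along a closed chain and their gauge invariance -/

section PathSum

variable {M : ℕ} [NeZero M] {S : Type*} [Fintype S]

/-- The trace of an ordered product of matrices along the closed chain `ZMod M`. -/
def pathSum (A : ZMod M → Matrix S S ℂ) : ℂ := ∑ i : ZMod M → S, ∏ m, A m (i m) (i (m + 1))

theorem prod_shift (f : ZMod M → ℂ) : ∏ m, f (m + 1) = ∏ m, f m :=
  Equiv.prod_comp (Equiv.addRight (1 : ZMod M)) f

/-- Gauge invariance of the trace along a closed chain. -/
theorem pathSum_gauge [DecidableEq S] {X Y G : ZMod M → Matrix S S ℂ}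
    (hG : ∀ m, IsUnit (G m).det) (h : ∀ m, X m * G (m + 1) = G m * Y m) :
    pathSum X = pathSum Y := by
  have hY : ∀ m, Y m = (G m)⁻¹ * X m * G (m + 1) := fun m => by
    rw [Matrix.mul_assoc, h, ← Matrix.mul_assoc, Matrix.nonsing_inv_mul _ (hG m), Matrix.one_mul]
  -- Each factor `G⁻¹ X G` gets its own pair of summation indices `j m`, `k m`. Regrouped by sites,
  -- `i m` occurs only in a product of `G m` and `(G m)⁻¹`, and summing over it identifies `k (m -
  -- 1)` with `j m`.
  have e : ∀ i : ZMod M → S, ∏ m, Y m (i m) (i (m + 1)) =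
      ∑ j : ZMod M → S, ∑ k : ZMod M → S,
        ∏ m, (X m (j m) (k m) * (G m (k (m - 1)) (i m) * (G m)⁻¹ (i m) (j m))) := by
    intro i
    have e1 : ∀ m, Y m (i m) (i (m + 1)) =
        ∑ p : S × S, (G m)⁻¹ (i m) p.1 * X m p.1 p.2 * G (m + 1) p.2 (i (m + 1)) := by
      intro m
      rw [hY, Matrix.mul_apply, Fintype.sum_prod_type_right]
      refine Finset.sum_congr rfl fun k _ => ?_
      rw [Matrix.mul_apply, Finset.sum_mul]
    simp_rw [e1]
    rw [Finset.prod_univ_sum, Fintype.piFinset_univ, ← Fintype.sum_prod_type',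
      ← (Equiv.arrowProdEquivProdArrow (ZMod M) (fun _ => S) (fun _ => S)).sum_comp]
    refine Finset.sum_congr rfl fun p _ => ?_
    simp only [Equiv.arrowProdEquivProdArrow, Equiv.coe_fn_mk, Finset.prod_mul_distrib]
    rw [← prod_shift (fun m => G m (p (m - 1)).2 (i m))]
    simp only [add_sub_cancel_right]
    ring
  unfold pathSum
  simp_rw [e]
  rw [Finset.sum_comm]
  refine Finset.sum_congr rfl fun j _ => ?_
  rw [Finset.sum_comm]
  have e2 : ∀ k : ZMod M → S, ∑ i : ZMod M → S,
      ∏ m, (X m (j m) (k m) * (G m (k (m - 1)) (i m) * (G m)⁻¹ (i m) (j m))) =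
      if k = (fun m => j (m + 1)) then ∏ m, X m (j m) (k m) else 0 := by
    intro k
    simp_rw [Finset.prod_mul_distrib (f := fun m => X m (j m) (k m))]
    rw [← Finset.mul_sum]
    have := Finset.prod_univ_sum (fun _ : ZMod M => (Finset.univ : Finset S))
      (fun m s => G m (k (m - 1)) s * (G m)⁻¹ s (j m))
    rw [Fintype.piFinset_univ] at this
    rw [← this]
    simp_rw [← Matrix.mul_apply, Matrix.mul_nonsing_inv _ (hG _), Matrix.one_apply]
    rw [Finset.prod_ite_zero]
    have hiff : (∀ m ∈ (Finset.univ : Finset (ZMod M)), k (m - 1) = j m) ↔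
        k = fun m => j (m + 1) :=
      ⟨fun h' => funext fun m => by simpa using h' (m + 1) (Finset.mem_univ _),
        fun h' m _ => by simp [h']⟩
    simp only [hiff]
    split_ifs <;> simp
  simp_rw [e2]
  rw [Finset.sum_ite_eq' Finset.univ]
  simp

end PathSum

/-! ### Matrix elements of the transfer matrix as numerical traces -/

section Transfer

theorem list_prod_range_apply {S : Type*} [Fintype S] [DecidableEq S] (B : ℕ → Matrix S S ℂ)
    (k : ℕ) (a b : S) :
    ((List.range k).map B).prod a b =
      ∑ p : Fin (k + 1) → S, if p 0 = a ∧ p (Fin.last k) = b then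
        ∏ j : Fin k, B j (p j.castSucc) (p j.succ) else 0 := by
  induction k generalizing b with
  | zero =>
    rw [← (Equiv.funUnique (Fin 1) S).symm.sum_comp]
    simp only [List.range_zero, List.map_nil, List.prod_nil, Matrix.one_apply,
      Finset.univ_eq_empty, Finset.prod_empty]
    by_cases h : a = b
    · subst h
      rw [Finset.sum_eq_single a] <;> simp +contextual [Equiv.funUnique]
    · rw [if_neg h, eq_comm]
      refine Finset.sum_eq_zero fun c _ => if_neg ?_
      rintro ⟨h1, h2⟩
      exact h (h1.symm.trans h2)
  | succ k ih =>
    rw [List.range_succ, List.map_append, List.prod_append, List.map_singleton, List.prod_singleton,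
      Matrix.mul_apply, ← (Fin.snocEquiv fun _ : Fin (k + 2) => S).sum_comp,
      Fintype.sum_prod_type]
    have : ∀ c : S, ∑ p : Fin (k + 1) → S,
        (if (Fin.snocEquiv fun _ : Fin (k + 2) => S) (c, p) 0 = a ∧
            (Fin.snocEquiv fun _ : Fin (k + 2) => S) (c, p) (Fin.last (k + 1)) = b then
          ∏ j : Fin (k + 1), B j ((Fin.snocEquiv fun _ : Fin (k + 2) => S) (c, p) j.castSucc)
            ((Fin.snocEquiv fun _ : Fin (k + 2) => S) (c, p) j.succ) else 0) =
        if c = b then ∑ p : Fin (k + 1) → S, (if p 0 = a then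
          (∏ j : Fin k, B j (p j.castSucc) (p j.succ)) * B k (p (Fin.last k)) b else 0) else 0 := by
      intro c
      have h0 : ∀ p : Fin (k + 1) → S,
          (Fin.snocEquiv fun _ : Fin (k + 2) => S) (c, p) 0 = p 0 := fun p => by
        simp [Fin.snocEquiv]
      split_ifs with h
      · subst h
        refine Finset.sum_congr rfl fun p _ => ?_
        rw [h0]
        simp only [Fin.snocEquiv, Equiv.coe_fn_mk, Fin.snoc_last, and_true]
        split_ifs
        · rw [Fin.prod_univ_castSucc]
          simp [Fin.snoc_castSucc, Fin.succ_castSucc, -Fin.castSucc_succ, Fin.succ_last]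
        · rfl
      · refine Finset.sum_eq_zero fun p _ => if_neg fun h' => h ?_
        simpa [Fin.snocEquiv] using h'.2
    simp_rw [this]
    rw [Finset.sum_ite_eq' Finset.univ]
    simp_rw [ih, Finset.sum_mul]
    rw [Finset.sum_comm]
    simp only [Finset.mem_univ, if_true]
    refine Finset.sum_congr rfl fun p _ => ?_
    by_cases h : p 0 = a
    · simp only [h, true_and, ite_mul, zero_mul, if_true]
      rw [Finset.sum_ite_eq Finset.univ]
      simp
    · simp [h]

/-- The ordered product begins at site `1`. The trace identifies the two ends of the open path, and
relabelling both the path and the sites by the shift by one gives the closed chain. -/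
theorem trace_list_prod {M : ℕ} [NeZero M] {S : Type*} [Fintype S] [DecidableEq S]
    (A : ZMod M → Matrix S S ℂ) :
    Matrix.trace ((List.range M).map fun j : ℕ => A ((j + 1 : ℕ) : ZMod M)).prod = pathSum A := by
  obtain ⟨n, rfl⟩ : ∃ n, M = n + 1 := Nat.exists_eq_succ_of_ne_zero (NeZero.ne M)
  rw [Matrix.trace]
  simp_rw [Matrix.diag_apply, list_prod_range_apply (fun j => A ((j + 1 : ℕ) : ZMod (n + 1)))]
  rw [Finset.sum_comm, ← (Fin.snocEquiv fun _ : Fin (n + 2) => S).sum_comp,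
      Fintype.sum_prod_type_right, pathSum,
      ← Equiv.sum_comp (Equiv.arrowCongr (Equiv.addRight (1 : ZMod (n + 1))) (Equiv.refl S))]
  refine Finset.sum_congr rfl fun q _ => ?_
  have h0 : ∀ c, (Fin.snocEquiv fun _ : Fin (n + 2) => S) (c, q) 0 = q 0 := fun c => by
    simp [Fin.snocEquiv]
  have hl : ∀ c, (Fin.snocEquiv fun _ : Fin (n + 2) => S) (c, q) (Fin.last (n + 1)) = c := fun c => by
    simp [Fin.snocEquiv]
  simp_rw [h0, hl]
  have e : ∀ c, ∑ a : S, (if q 0 = a ∧ c = a then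
      ∏ j : Fin (n + 1), A ((j + 1 : ℕ) : ZMod (n + 1))
        ((Fin.snocEquiv fun _ : Fin (n + 2) => S) (c, q) j.castSucc)
        ((Fin.snocEquiv fun _ : Fin (n + 2) => S) (c, q) j.succ) else 0) =
      if c = q 0 then ∏ j : Fin (n + 1), A ((j + 1 : ℕ) : ZMod (n + 1))
        ((Fin.snocEquiv fun _ : Fin (n + 2) => S) (q 0, q) j.castSucc)
        ((Fin.snocEquiv fun _ : Fin (n + 2) => S) (q 0, q) j.succ) else 0 := by
    intro c
    by_cases h : c = q 0
    · subst h; simp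
    · rw [if_neg h]
      exact Finset.sum_eq_zero fun a _ => if_neg fun h' => h (h'.2.trans h'.1.symm)
  simp_rw [e]
  rw [Finset.sum_ite_eq' Finset.univ]
  simp only [Finset.mem_univ, if_true]
  rw [← Equiv.prod_comp (Equiv.addRight (1 : ZMod (n + 1)))]
  refine Finset.prod_congr rfl fun j _ => ?_
  have h1 : ((j.val + 1 : ℕ) : ZMod (n + 1)) = (show ZMod (n + 1) from j) + 1 := by
    push_cast
    congr 1
    exact ZMod.natCast_zmod_val (n := n + 1) j
  rw [h1]
  have h2 : (Fin.snocEquiv fun _ : Fin (n + 2) => S) (q 0, q) j.castSucc = q j := by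
    simp [Fin.snocEquiv]
  have h3 : (Fin.snocEquiv fun _ : Fin (n + 2) => S) (q 0, q) j.succ = q (j + 1) := by
    by_cases hj : j = Fin.last n
    · subst hj
      have e1 : (Fin.last n).succ = Fin.last (n + 1) := rfl
      rw [e1, hl, Fin.last_add_one]
    · obtain ⟨i, rfl⟩ := Fin.exists_castSucc_eq.mpr hj
      rw [Fin.coeSucc_eq_succ, Fin.succ_castSucc]
      simp only [Fin.snocEquiv, Equiv.coe_fn_mk]
      exact Fin.snoc_castSucc (α := fun _ : Fin (n + 2) => S) _ _ i.succ
  rw [h2, h3]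
  have h4 : ∀ x : ZMod (n + 1), (Equiv.arrowCongr (Equiv.addRight (1 : ZMod (n + 1)))
      (Equiv.refl S)) q (x + 1) = q x := fun x => by
    exact congrArg q (add_neg_cancel_right x (1 : ZMod (n + 1)))
  exact (congrArg₂ (fun a b => A ((show ZMod (n + 1) from j) + (1 : ZMod (n + 1))) a b) (h4 j)
    (h4 ((show ZMod (n + 1) from j) + (1 : ZMod (n + 1))))).symm

variable {N M : ℕ} [NeZero N] [NeZero M]

/-- Matrix elements of the Lax matrix between spin states. -/
def laxE (κ lam u w : ℂ) (a b : ZMod N) : Matrix (Fin 2) (Fin 2) ℂ :=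
  !![(if a = b then 1 else 0) + κ / lam * (u * w) * (if a = b + 1 then chi a else 0),
      -(omHalf N / lam * u * (if a = b then chi a else 0));
    if a = b + 1 then w else 0, 0]

theorem lax_apply (κ lam u w : ℂ) (m : ZMod M) (i j : Fin 2) (α β : Conf N M) :
    lax N M κ lam u w m i j α β =
      if ∀ m', m' ≠ m → α m' = β m' then laxE κ lam u w (α m) (β m) i j else 0 := by
  have h1 : α = β ↔ (∀ m', m' ≠ m → α m' = β m') ∧ α m = β m := by
    constructor
    · rintro rfl; simp
    · rintro ⟨h, h'⟩
      funext m'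
      by_cases e : m' = m
      · rw [e, h']
      · exact h m' e
  have h2 : α = β + Pi.single m 1 ↔ (∀ m', m' ≠ m → α m' = β m') ∧ α m = β m + 1 := by
    constructor
    · rintro rfl
      exact ⟨fun m' h => by simp [h], by simp⟩
    · rintro ⟨h, h'⟩
      funext m'
      by_cases e : m' = m
      · rw [e, h']; simp
      · rw [h m' e]; simp [e]
  have hD : ∀ f : Conf N M → ℂ, Matrix.diagonal f α β = if α = β then f α else 0 := fun f => by
    rw [Matrix.diagonal_apply]
  by_cases h : ∀ m', m' ≠ m → α m' = β m'
  · have h1' := propext (h1.trans (and_iff_right h))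
    have h2' := propext (h2.trans (and_iff_right h))
    rw [if_pos h]
    fin_cases i <;> fin_cases j <;>
      simp [lax, laxE, xOp, zOp, Matrix.one_apply, hD, h1', h2', chi] <;> (try split_ifs) <;> (try simp) <;> (try ring)
  · have h1' := eq_false (fun e => h (h1.mp e).1)
    have h2' := eq_false (fun e => h (h2.mp e).1)
    rw [if_neg h]
    fin_cases i <;> fin_cases j <;>
      simp [lax, xOp, zOp, h1', h2']

/-- A Lax operator changes only the spin at its own site, and the sites are distinct. All
intermediate configurations are therefore forced, and what remains is a trace of numerical 2×2
matrices. -/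
theorem transfer_apply (κ : ℂ) (u w : ZMod M → ℂ) (lam : ℂ) (α β : Conf N M) :
    transfer N M κ u w lam α β = pathSum fun m => laxE κ lam (u m) (w m) (α m) (β m) := by
  have key : ∀ k ≤ M, ∀ (i j : Fin 2) (β : Conf N M),
      ((List.range k).map fun j : ℕ => lax N M κ lam (u ((j + 1 : ℕ) : ZMod M))
        (w ((j + 1 : ℕ) : ZMod M)) ((j + 1 : ℕ) : ZMod M)).prod i j α β =
      if ∀ m : ZMod M, (∀ j < k, m ≠ ((j + 1 : ℕ) : ZMod M)) → α m = β m then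
        ((List.range k).map fun j : ℕ => laxE κ lam (u ((j + 1 : ℕ) : ZMod M))
        (w ((j + 1 : ℕ) : ZMod M)) (α ((j + 1 : ℕ) : ZMod M)) (β ((j + 1 : ℕ) : ZMod M))).prod i j
      else 0 := by
    intro k
    induction k with
    | zero =>
      intro _ i j β
      have hz : (∀ m : ZMod M, (∀ j < 0, m ≠ ((j + 1 : ℕ) : ZMod M)) → α m = β m) ↔ α = β :=
        ⟨fun h => funext fun m => h m fun j hj => absurd hj (Nat.not_lt_zero j), fun h m _ => by rw [h]⟩
      simp only [List.range_zero, List.map_nil, List.prod_nil, hz]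
      by_cases h : i = j
      · subst h; simp [Matrix.one_apply]
      · simp [h]
    | succ k ih =>
      intro hk i j β
      have hs : ∀ l < k, ((l + 1 : ℕ) : ZMod M) ≠ ((k + 1 : ℕ) : ZMod M) := by
        intro l hl h
        rw [Nat.cast_add, Nat.cast_add, add_left_inj] at h
        have := congrArg ZMod.val h
        rw [ZMod.val_natCast, ZMod.val_natCast, Nat.mod_eq_of_lt (by omega),
          Nat.mod_eq_of_lt (by omega)] at this
        omega
      set s : ZMod M := ((k + 1 : ℕ) : ZMod M) with hsdef
      rw [List.range_succ, List.map_append, List.prod_append, List.map_singleton,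
        List.prod_singleton, List.map_append, List.prod_append, List.map_singleton,
        List.prod_singleton, Matrix.mul_apply, Matrix.mul_apply, Matrix.sum_apply]
      simp_rw [Matrix.mul_apply, ih (by omega), lax_apply]
      have hcond : (∀ m : ZMod M, (∀ j < k, m ≠ ((j + 1 : ℕ) : ZMod M)) →
            α m = Function.update β s (α s) m) ↔
          (∀ m : ZMod M, (∀ j < k + 1, m ≠ ((j + 1 : ℕ) : ZMod M)) → α m = β m) := by
        constructor
        · intro h m hm
          have := h m fun j hj => hm j (by omega)
          rwa [Function.update_of_ne (hm k (by omega))] at this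
        · intro h m hm
          by_cases e : m = s
          · rw [e]; simp
          · rw [Function.update_of_ne e]
            refine h m fun j hj => ?_
            rcases Nat.lt_succ_iff_lt_or_eq.mp hj with h' | h'
            · exact hm j h'
            · rw [h']; exact e
      have hmap : (List.range k).map (fun j : ℕ => laxE κ lam (u ((j + 1 : ℕ) : ZMod M))
          (w ((j + 1 : ℕ) : ZMod M)) (α ((j + 1 : ℕ) : ZMod M))
          (Function.update β s (α s) ((j + 1 : ℕ) : ZMod M))) =
          (List.range k).map (fun j : ℕ => laxE κ lam (u ((j + 1 : ℕ) : ZMod M))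
          (w ((j + 1 : ℕ) : ZMod M)) (α ((j + 1 : ℕ) : ZMod M)) (β ((j + 1 : ℕ) : ZMod M))) :=
        List.map_congr_left fun l hl => by
          rw [Function.update_of_ne (hs l (List.mem_range.mp hl))]
      have hsum : ∀ c : Fin 2, ∑ γ : Conf N M,
          (if ∀ m : ZMod M, (∀ j < k, m ≠ ((j + 1 : ℕ) : ZMod M)) → α m = γ m then
            ((List.range k).map fun j : ℕ => laxE κ lam (u ((j + 1 : ℕ) : ZMod M))
            (w ((j + 1 : ℕ) : ZMod M)) (α ((j + 1 : ℕ) : ZMod M)) (γ ((j + 1 : ℕ) : ZMod M))).prod i c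
            else 0) *
          (if ∀ m', m' ≠ s → γ m' = β m' then laxE κ lam (u s) (w s) (γ s) (β s) c j else 0) =
          if ∀ m : ZMod M, (∀ j < k + 1, m ≠ ((j + 1 : ℕ) : ZMod M)) → α m = β m then
            ((List.range k).map fun j : ℕ => laxE κ lam (u ((j + 1 : ℕ) : ZMod M))
            (w ((j + 1 : ℕ) : ZMod M)) (α ((j + 1 : ℕ) : ZMod M)) (β ((j + 1 : ℕ) : ZMod M))).prod i c *
            laxE κ lam (u s) (w s) (α s) (β s) c j else 0 := by
        intro c
        -- The last factor acts at `s` only and the earlier ones leave `s` alone, so the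
        -- intermediate configuration equals `β` away from `s` and `α` at `s`.
        rw [Finset.sum_eq_single (Function.update β s (α s))]
        · rw [hmap]
          simp only [hcond]
          have : ∀ m', m' ≠ s → Function.update β s (α s) m' = β m' := fun m' h =>
            Function.update_of_ne h _ _
          rw [if_pos this, ite_mul, zero_mul]
          simp
        · intro γ _ hγ
          by_cases h : ∀ m', m' ≠ s → γ m' = β m'
          · rw [if_neg, zero_mul]
            intro h'
            apply hγ
            funext m'
            by_cases e : m' = s
            · rw [e, ← h' s fun j hj => (hs j hj).symm]; simp
            · rw [h m' e, Function.update_of_ne e]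
          · rw [if_neg h, mul_zero]
        · intro h; exact absurd (Finset.mem_univ _) h
      rw [Finset.sum_congr rfl fun c _ => hsum c]
      rw [Finset.sum_ite_irrel, Finset.sum_const_zero]
  rw [transfer, Matrix.trace, Matrix.sum_apply]
  simp_rw [Matrix.diag_apply, key M le_rfl]
  have hall : ∀ m : ZMod M, (∀ j < M, m ≠ ((j + 1 : ℕ) : ZMod M)) → α m = β m := by
    intro m hm
    exact absurd (by rw [Nat.cast_succ, ZMod.natCast_zmod_val, sub_add_cancel])
      (hm (m - 1).val (ZMod.val_lt _))
  simp only [if_pos hall]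
  exact trace_list_prod fun m => laxE κ lam (u m) (w m) (α m) (β m)

end Transfer

/-! ### The Darboux gauge transformation and the intertwining relation of one step -/

section Step

variable {N M : ℕ} [NeZero N] [NeZero M]

/-- The local factor of the modified `Q`-operator. -/
def qLoc (x1 y1 x2 y2 x3 y3 : ℂ) (a b b' : ZMod N) : ℂ :=
  chi ((a - b) * b') * ((wFun N x1 y1 (b - a) * wFun N x2 y2 (b' - b)) / wFun N x3 y3 (b' - a))

/-- The data of one Bäcklund step: the parameters `u, w` and `u', w'` of the states before and
after, and points of the Fermat curve. -/
structure Step (N M : ℕ) (κ : ℂ) where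
  (u w u' w' x1 y1 x2 y2 x3 y3 : ZMod M → ℂ)
  (δ μ : ℂ)
  f1 : ∀ m, Fermat N (x1 m) (y1 m)
  f2 : ∀ m, Fermat N (x2 m) (y2 m)
  f3 : ∀ m, Fermat N (x3 m) (y3 m)
  u_ne : ∀ m, u m ≠ 0
  w_ne : ∀ m, w m ≠ 0
  u'_ne : ∀ m, u' m ≠ 0
  w'_ne : ∀ m, w' m ≠ 0
  x1_eq : ∀ m, x1 m * (omHalf N * κ * u m) = δ * u' m
  x2_eq : ∀ m, x2 m * (omHalf N * u' m) = κ * u' (m + 1)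
  x3_eq : ∀ m, x3 m * (om N * u m) = δ * u' (m + 1)
  y13 : ∀ m, y1 m * (κ * w m * u' (m + 1)) = μ * y3 m
  gauge : ∀ m, w (m + 1) / w' (m + 1) * (y2 (m + 1) / y3 (m + 1)) = u' m / u m * (y2 m / y3 m)

variable {κ : ℂ}

/-- The modified `Q`-operator of a Bäcklund step. -/
def Step.Q (S : Step N M κ) : Op N M := Matrix.of fun α β => ∏ m : ZMod M,
  qLoc (S.x1 m) (S.y1 m) (S.x2 m) (S.y2 m) (S.x3 m) (S.y3 m) (α m) (β m) (β (m + 1))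

section Local

variable {x1 y1 x2 y2 x3 y3 : ℂ} (h1 : Fermat N x1 y1) (h2 : Fermat N x2 y2) (h3 : Fermat N x3 y3)

include h1 h2 h3

/-- A unit shift of one spin changes two of the three weights by one step of `Fermat.wFun_rec`, and
the exponential prefactor by a character. This and the next two formulas make every identity about
`qLoc` rational in the phases of the spins. -/
theorem qLoc_sub_left (a b b' : ZMod N) : qLoc x1 y1 x2 y2 x3 y3 (a - 1) b b' =
    qLoc x1 y1 x2 y2 x3 y3 a b b' * ((y1 / y3) * (1 - x3 * (om N * chi b' / chi a)) /
      (chi b' * (1 - x1 * (om N * chi b / chi a)))) := by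
  have e1 := h1.wFun_rec (b - a + 1)
  have e3 := h3.wFun_rec (b' - a + 1)
  have n1 := h1.one_sub_ne_zero (b - a + 1)
  have n3 := h3.one_sub_ne_zero (b' - a + 1)
  rw [add_sub_cancel_right] at e1 e3
  have k1 : chi (b - a + 1) = om N * chi b / chi a := by
    rw [chi_add, chi_sub, chi_one]; ring
  have k3 : chi (b' - a + 1) = om N * chi b' / chi a := by
    rw [chi_add, chi_sub, chi_one]; ring
  have k0 : chi ((a - 1 - b) * b') = chi ((a - b) * b') / chi b' := by
    rw [← chi_sub]; congr 1; ring
  have j1 : b - (a - 1) = b - a + 1 := by ring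
  have j3 : b' - (a - 1) = b' - a + 1 := by ring
  have w1 : wFun N x1 y1 (b - a + 1) = y1 * wFun N x1 y1 (b - a) / (1 - x1 * chi (b - a + 1)) := by
    rw [eq_div_iff n1, e1]
  have w3 : wFun N x3 y3 (b' - a + 1) = y3 * wFun N x3 y3 (b' - a) / (1 - x3 * chi (b' - a + 1)) := by
    rw [eq_div_iff n3, e3]
  rw [qLoc, qLoc, k0, j1, j3, w1, w3, ← k1, ← k3]
  have := h3.wFun_ne_zero (b' - a)
  have := h3.ne
  have := chi_ne_zero b'
  field_simp

theorem qLoc_add_mid (a b b' : ZMod N) : qLoc x1 y1 x2 y2 x3 y3 a (b + 1) b' =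
    qLoc x1 y1 x2 y2 x3 y3 a b b' * ((y1 / y2) * (1 - x2 * (chi b' / chi b)) /
      (chi b' * (1 - x1 * (om N * chi b / chi a)))) := by
  have e1 := h1.wFun_rec (b - a + 1)
  have e2 := h2.wFun_rec (b' - b)
  have n1 := h1.one_sub_ne_zero (b - a + 1)
  have n2 := h2.one_sub_ne_zero (b' - b)
  rw [add_sub_cancel_right] at e1
  have k1 : chi (b - a + 1) = om N * chi b / chi a := by
    rw [chi_add, chi_sub, chi_one]; ring
  have k0 : chi ((a - (b + 1)) * b') = chi ((a - b) * b') / chi b' := by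
    rw [← chi_sub]; congr 1; ring
  have j1 : b + 1 - a = b - a + 1 := by ring
  have j2 : b' - (b + 1) = b' - b - 1 := by ring
  have w1 : wFun N x1 y1 (b - a + 1) = y1 * wFun N x1 y1 (b - a) / (1 - x1 * chi (b - a + 1)) := by
    rw [eq_div_iff n1, e1]
  have w2 : wFun N x2 y2 (b' - b - 1) = wFun N x2 y2 (b' - b) * (1 - x2 * chi (b' - b)) / y2 := by
    rw [eq_div_iff h2.ne, e2]; ring
  rw [qLoc, qLoc, k0, j1, j2, w1, w2, ← k1, ← chi_sub b' b]
  have := h3.wFun_ne_zero (b' - a)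
  have := h2.ne
  have := chi_ne_zero b'
  field_simp

theorem qLoc_sub_right (a b b' : ZMod N) : qLoc x1 y1 x2 y2 x3 y3 a b (b' - 1) =
    qLoc x1 y1 x2 y2 x3 y3 a b b' * ((chi b / chi a) * (y3 / y2) * (1 - x2 * (chi b' / chi b)) /
      (1 - x3 * (chi b' / chi a))) := by
  have e2 := h2.wFun_rec (b' - b)
  have e3 := h3.wFun_rec (b' - a)
  have n2 := h2.one_sub_ne_zero (b' - b)
  have n3 := h3.one_sub_ne_zero (b' - a)
  have k0 : chi ((a - b) * (b' - 1)) = chi ((a - b) * b') * (chi b / chi a) := by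
    rw [← chi_sub, ← chi_add]; congr 1; ring
  have j2 : b' - 1 - b = b' - b - 1 := by ring
  have j3 : b' - 1 - a = b' - a - 1 := by ring
  have w2 : wFun N x2 y2 (b' - b - 1) = wFun N x2 y2 (b' - b) * (1 - x2 * chi (b' - b)) / y2 := by
    rw [eq_div_iff h2.ne, e2]; ring
  have w3 : wFun N x3 y3 (b' - a - 1) = wFun N x3 y3 (b' - a) * (1 - x3 * chi (b' - a)) / y3 := by
    rw [eq_div_iff h3.ne, e3]; ring
  rw [qLoc, qLoc, k0, j2, j3, w2, w3, ← chi_sub, ← chi_sub, ← chi_sub]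
  have := h3.wFun_ne_zero (b' - a)
  have := h2.ne
  have := h3.ne
  have := chi_ne_zero b'
  have := chi_ne_zero a
  field_simp

end Local

/-- The Lax matrix acting on the local factor of the `Q`-operator. -/
def laxQ (κ lam u w : ℂ) (q : ZMod N → ℂ) (a : ZMod N) : Matrix (Fin 2) (Fin 2) ℂ :=
  !![q a + κ / lam * (u * w) * chi a * q (a - 1), -(omHalf N / lam * u * chi a * q a);
    w * q (a - 1), 0]

theorem sum_laxE_mul (κ lam u w : ℂ) (q : ZMod N → ℂ) (a : ZMod N) (i j : Fin 2) :
    ∑ b, laxE κ lam u w a b i j * q b = laxQ κ lam u w q a i j := by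
  have h2 : ∀ b : ZMod N, a = b + 1 ↔ a - 1 = b := fun b => sub_eq_iff_eq_add.symm
  fin_cases i <;> fin_cases j <;>
    simp [laxE, laxQ, add_mul, Finset.sum_add_distrib, h2, mul_assoc]

/-- The gauge matrix relating the Lax matrices of two neighbouring states. -/
def gaugeMat (A0 A1 : ZMod N → ℂ) (B0 B1 : ZMod N → ℂ) (r : ZMod N → ℂ) :
    Matrix (ZMod N × Fin 2) (ZMod N × Fin 2) ℂ :=
  Matrix.of fun p p' =>
    (if p'.1 = p.1 then ![A0 p.1, A1 p.1] p.2 * ![1, r p.1] p'.2 else 0) +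
      if p'.1 = p.1 + 1 then ![B0 p.1, B1 p.1] p.2 * ![0, 1] p'.2 else 0

/-- The matrix sends `v` to the combination of the columns `(A0, A1)` and `(B0, B1)` with
coefficients `v (b, 0) + r b * v (b, 1)` and `v (b + 1, 1)`. These coefficients determine `v`, so
only the 2×2 determinants matter. -/
theorem gaugeMat_isUnit {A0 A1 B0 B1 r : ZMod N → ℂ} (h : ∀ b, A0 b * B1 b - A1 b * B0 b ≠ 0) :
    IsUnit (gaugeMat A0 A1 B0 B1 r).det := by
  rw [← Matrix.isUnit_iff_isUnit_det, ← Matrix.mulVec_injective_iff_isUnit,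
    ← Matrix.coe_mulVecLin, injective_iff_map_eq_zero]
  intro v hv
  have e : ∀ b : ZMod N, ∀ i : Fin 2, ![A0 b, A1 b] i * (v (b, 0) + r b * v (b, 1)) +
      ![B0 b, B1 b] i * v (b + 1, 1) = 0 := by
    intro b i
    have := congrFun hv (b, i)
    simp only [Matrix.mulVecLin_apply, Matrix.mulVec, dotProduct, gaugeMat, Matrix.of_apply,
      Fintype.sum_prod_type, Pi.zero_apply, Fin.sum_univ_two, add_mul, ite_mul, zero_mul,
      Finset.sum_add_distrib, Finset.sum_ite_eq', Finset.mem_univ, if_true, Matrix.cons_val_zero,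
      Matrix.cons_val_one] at this
    linear_combination this
  have e0 : ∀ b : ZMod N, v (b, 0) + r b * v (b, 1) = 0 := fun b => by
    have h0 := e b 0
    have h1 := e b 1
    simp only [Matrix.cons_val_zero, Matrix.cons_val_one] at h0 h1
    exact (mul_eq_zero.mp (show (A0 b * B1 b - A1 b * B0 b) * (v (b, 0) + r b * v (b, 1)) = 0 by
      linear_combination B1 b * h0 - B0 b * h1)).resolve_left (h b)
  have e1 : ∀ b : ZMod N, v (b, 1) = 0 := fun b => by
    have h0 := e (b - 1) 0
    have h1 := e (b - 1) 1
    simp only [Matrix.cons_val_zero, Matrix.cons_val_one, sub_add_cancel] at h0 h1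
    exact (mul_eq_zero.mp (show (A0 (b - 1) * B1 (b - 1) - A1 (b - 1) * B0 (b - 1)) * v (b, 1) = 0 by
      linear_combination A0 (b - 1) * h1 - A1 (b - 1) * h0)).resolve_left (h (b - 1))
  funext ⟨b, i⟩
  fin_cases i
  · simpa [e1 b] using e0 b
  · exact e1 b

/-- Reduction of the gauge equivalence to its nontrivial blocks. -/
theorem pathSum_eq_of_gauge {κ lam : ℂ} {γ : ZMod M → ZMod N} {u' w' : ZMod M → ℂ}
    {P : ZMod M → ZMod N → Matrix (Fin 2) (Fin 2) ℂ} {q : ZMod M → ZMod N → ZMod N → ℂ}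
    {A0 A1 B0 B1 : ZMod M → ZMod N → ℂ}
    (hdet : ∀ m b, A0 m b * B1 m b - A1 m b * B0 m b ≠ 0)
    (e0 : ∀ m i c, P m c i 0 * A0 (m + 1) c + P m c i 1 * A1 (m + 1) c =
      ![A0 m (γ m), A1 m (γ m)] i * q m (γ m) c +
        ![B0 m (γ m), B1 m (γ m)] i * q m (γ m + 1) c * w' m)
    (e1 : ∀ m i c, (P m c i 0 * A0 (m + 1) c + P m c i 1 * A1 (m + 1) c) *
        (-(κ / lam * u' (m + 1) * chi c)) +
      (P m (c - 1) i 0 * B0 (m + 1) (c - 1) + P m (c - 1) i 1 * B1 (m + 1) (c - 1)) =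
      ![A0 m (γ m), A1 m (γ m)] i * q m (γ m) c * (-(omHalf N / lam * u' m * chi (γ m)))) :
    pathSum (fun m => P m (γ (m + 1))) =
      ∑ β : Conf N M, pathSum (fun m => q m (β m) (β (m + 1)) • laxE κ lam (u' m) (w' m) (β m) (γ m)) := by
  -- The left side is lifted to the index set `ZMod N × Fin 2` by letting only the rows with spin `γ
  -- m` survive; both sides are then traces over the same space.
  have hX : pathSum (fun m => P m (γ (m + 1))) = pathSum (S := ZMod N × Fin 2) fun m =>
      Matrix.of fun p p' => if p.1 = γ m then P m p'.1 p.2 p'.2 else 0 := by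
    rw [pathSum, pathSum, ← (Equiv.arrowProdEquivProdArrow (ZMod M) (fun _ => ZMod N)
      (fun _ => Fin 2)).symm.sum_comp, Fintype.sum_prod_type, Finset.sum_eq_single γ]
    · refine Finset.sum_congr rfl fun i _ => Finset.prod_congr rfl fun m _ => ?_
      simp [Equiv.arrowProdEquivProdArrow]
    · intro β _ hβ
      refine Finset.sum_eq_zero fun i _ => ?_
      obtain ⟨m, hm⟩ := Function.ne_iff.mp hβ
      refine Finset.prod_eq_zero (Finset.mem_univ m) ?_
      simp [Equiv.arrowProdEquivProdArrow, hm]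
    · intro h; exact absurd (Finset.mem_univ _) h
  have hY : ∑ β : Conf N M, pathSum (fun m => q m (β m) (β (m + 1)) •
      laxE κ lam (u' m) (w' m) (β m) (γ m)) = pathSum (S := ZMod N × Fin 2) fun m =>
      Matrix.of fun p p' => q m p.1 p'.1 * laxE κ lam (u' m) (w' m) p.1 (γ m) p.2 p'.2 := by
    simp_rw [pathSum]
    rw [← Fintype.sum_prod_type', ← (Equiv.arrowProdEquivProdArrow (ZMod M) (fun _ => ZMod N)
      (fun _ => Fin 2)).symm.sum_comp]
    rfl
  rw [hX, hY]
  refine pathSum_gauge (G := fun m => gaugeMat (A0 m) (A1 m) (B0 m) (B1 m)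
    fun b => -(κ / lam * u' m * chi b)) (fun m => gaugeMat_isUnit (hdet m)) ?_
  intro m
  ext ⟨b, i⟩ ⟨c, j⟩
  have hc : ∀ x : ZMod N, c = x + 1 ↔ x = c - 1 := fun x => by
    rw [eq_sub_iff_add_eq, eq_comm]
  simp only [Matrix.mul_apply, gaugeMat, Matrix.of_apply, Fintype.sum_prod_type, Fin.sum_univ_two,
    mul_add, add_mul, ite_mul, mul_ite, zero_mul, mul_zero, hc,
    Finset.sum_add_distrib, Finset.sum_ite_eq, Finset.sum_ite_eq', Finset.mem_univ, if_true,
    Matrix.cons_val_zero, Matrix.cons_val_one]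
  by_cases hb : b = γ m
  · subst hb
    have h0 := e0 m i c
    have h1 := e1 m i c
    simp only [if_true]
    fin_cases j <;> simp [laxE] at h0 h1 ⊢
    · split_ifs <;> linear_combination h0
    · linear_combination h1
  · simp only [hb, if_false]
    fin_cases j <;> simp [laxE, hb]
    split_ifs <;> ring

/-- These four equations, two rows by two columns, are the Darboux relation: the Lax matrix on the
local factor times the gauge matrix of site `m + 1` equals the gauge matrix of site `m` times the
new Lax matrix. The field `gauge` makes it consistent along the chain, since it allows the entry `B1
(m + 1)` to be written with the data of site `m`. -/
theorem Step.laxQ_gauge (S : Step N M κ) (hκ : κ ≠ 0) {lam : ℂ} (hl : lam ≠ 0) (m : ZMod M)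
    (a b c : ZMod N)
    (q : ZMod N → ZMod N → ZMod N → ℂ)
    (hq : q = qLoc (S.x1 m) (S.y1 m) (S.x2 m) (S.y2 m) (S.x3 m) (S.y3 m)) :
    let A1 := fun (m : ZMod M) (b : ZMod N) => S.μ / (omHalf N * S.u' m * chi b)
    let B1 := fun (m : ZMod M) => S.w m / S.w' m * (S.y2 m / S.y3 m)
    let B0 := fun (m : ZMod M) (b : ZMod N) => B1 m * (omHalf N * S.δ / lam * S.u' m * chi b)
    let P := fun c => laxQ κ lam (S.u m) (S.w m) (fun a' => q a' b c) a
    (P c 0 0 + P c 0 1 * A1 (m + 1) c = q a b c + B0 m b * q a (b + 1) c * S.w' m) ∧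
    (P c 1 0 + P c 1 1 * A1 (m + 1) c = A1 m b * q a b c + B1 m * q a (b + 1) c * S.w' m) ∧
    ((P c 0 0 + P c 0 1 * A1 (m + 1) c) * (-(κ / lam * S.u' (m + 1) * chi c)) +
      (P (c - 1) 0 0 * B0 (m + 1) (c - 1) + P (c - 1) 0 1 * B1 (m + 1)) =
      q a b c * (-(omHalf N / lam * S.u' m * chi b))) ∧
    ((P c 1 0 + P c 1 1 * A1 (m + 1) c) * (-(κ / lam * S.u' (m + 1) * chi c)) +
      (P (c - 1) 1 0 * B0 (m + 1) (c - 1) + P (c - 1) 1 1 * B1 (m + 1)) =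
      A1 m b * q a b c * (-(omHalf N / lam * S.u' m * chi b))) := by
  intro A1 B1 B0 P
  have hB : B1 (m + 1) = S.u' m / S.u m * (S.y2 m / S.y3 m) := S.gauge m
  have q1 := qLoc_sub_left (S.f1 m) (S.f2 m) (S.f3 m) a b c
  have q2 := qLoc_add_mid (S.f1 m) (S.f2 m) (S.f3 m) a b c
  have q3 := qLoc_sub_right (S.f1 m) (S.f2 m) (S.f3 m) a b c
  have q4 := qLoc_sub_right (S.f1 m) (S.f2 m) (S.f3 m) (a - 1) b c
  have n1 := (S.f1 m).one_sub_ne_zero (b - a + 1)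
  have n3 := (S.f3 m).one_sub_ne_zero (c - a + 1)
  have n3' := (S.f3 m).one_sub_ne_zero (c - a)
  rw [← hq] at q1 q2 q3 q4
  rw [q1] at q4
  simp only [P, laxQ, Matrix.cons_val_zero, Matrix.cons_val_one, Matrix.of_apply, Matrix.cons_val',
    Matrix.cons_val_fin_one, hB, B0, A1, q1, q2, q3, q4, chi_sub, chi_one, chi_add] at n1 n3 n3' ⊢
  have na := chi_ne_zero a
  have nb := chi_ne_zero b
  have nc := chi_ne_zero c
  generalize chi a = ca at *
  generalize chi b = cb at *
  generalize chi c = cc at *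
  generalize q a b c = Q at *
  have y1e := S.y13 m
  have hx1 := S.x1_eq m
  have hx2 := S.x2_eq m
  have hx3 := S.x3_eq m
  have ny1 := (S.f1 m).ne
  have ny2 := (S.f2 m).ne
  have ny3 := (S.f3 m).ne
  have nu := S.u_ne m
  have nu' := S.u'_ne m
  have nu'' := S.u'_ne (m + 1)
  have nw := S.w_ne m
  have nw' := S.w'_ne m
  have nh := omHalf_ne_zero (N := N)
  simp only [B1]
  rw [← omHalf_sq (N := N)] at *
  generalize omHalf N = h at *
  generalize S.x1 m = x1 at *
  generalize S.x2 m = x2 at *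
  generalize S.x3 m = x3 at *
  generalize S.y1 m = y1 at *
  generalize S.y2 m = y2 at *
  generalize S.y3 m = y3 at *
  generalize S.u m = u at *
  generalize S.w m = w at *
  generalize S.u' m = u' at *
  generalize S.w' m = w' at *
  generalize S.u' (m + 1) = u'' at *
  generalize S.δ = δ at *
  generalize S.μ = μ at *
  -- The remaining parameters are eliminated in favour of the Fermat coordinates. The three
  -- equations for the `x`-coordinates then force `x3 = x1 * x2`, and only rational identities in
  -- three phases are left.
  have e0 : u'' = x2 * h * u' / κ := by rw [eq_div_iff hκ]; linear_combination -hx2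
  have e1 : δ = x1 * h * κ * u / u' := by rw [eq_div_iff nu']; linear_combination -hx1
  have e2 : μ = y1 * (κ * w * u'') / y3 := by rw [eq_div_iff ny3]; linear_combination -y1e
  have nx2 : x2 ≠ 0 := by rintro rfl; simp at e0; exact nu'' e0
  subst e0
  have e3 : x3 = x1 * x2 := by
    subst e1
    field_simp at hx3
    exact hx3
  subst e1 e2 e3
  have n1' : ca - h ^ 2 * x1 * cb ≠ 0 := fun e => n1 (by field_simp; linear_combination e)
  have n3a : ca - h ^ 2 * x1 * x2 * cc ≠ 0 := fun e => n3 (by field_simp; linear_combination e)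
  have n3b : ca - x1 * x2 * cc ≠ 0 := fun e => n3' (by field_simp; linear_combination e)
  have k1 : 1 - x1 * (h ^ 2 * cb / ca) = (ca - h ^ 2 * x1 * cb) / ca := by field_simp
  have k2 : 1 - x1 * x2 * (h ^ 2 * cc / ca) = (ca - h ^ 2 * x1 * x2 * cc) / ca := by field_simp
  have k3 : 1 - x1 * x2 * (cc / ca) = (ca - x1 * x2 * cc) / ca := by field_simp
  have k4 : 1 - x1 * x2 * (cc / (ca / h ^ 2)) = (ca - h ^ 2 * x1 * x2 * cc) / ca := by field_simp
  rw [k1, k2, k3, k4]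
  refine ⟨?_, ?_, ?_, ?_⟩
  · field_simp
    ring
  · field_simp
    ring
  · field_simp
    ring
  · field_simp
    ring

theorem transfer_differentiableAt {u w : ℂ → ZMod M → ℂ} {lam : ℂ → ℂ} {z₀ : ℂ}
    (hu : ∀ m, DifferentiableAt ℂ (fun z => u z m) z₀)
    (hw : ∀ m, DifferentiableAt ℂ (fun z => w z m) z₀) (hl : DifferentiableAt ℂ lam z₀)
    (h0 : lam z₀ ≠ 0) (α β : Conf N M) :
    DifferentiableAt ℂ (fun z => transfer N M κ (u z) (w z) (lam z) α β) z₀ := by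
  simp_rw [transfer_apply, pathSum]
  refine DifferentiableAt.fun_sum fun i _ => DifferentiableAt.fun_finsetProd fun m _ => ?_
  have hu := hu m
  have hw := hw m
  generalize i m = k
  generalize i (m + 1) = l
  fin_cases k <;> fin_cases l <;> simp only [laxE, Fin.zero_eta, Fin.mk_one, Matrix.of_apply,
    Matrix.cons_val_zero, Matrix.cons_val_one, Matrix.cons_val', Matrix.cons_val_fin_one, Fin.isValue]
  · fun_prop (disch := assumption)
  · fun_prop (disch := assumption)
  · split_ifs <;> fun_prop
  · fun_prop

/-- Both products are path sums related by a gauge transformation. The determinant of its blocks is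
a nonzero multiple of `(λ - μδ) / λ`, which explains the excluded value. -/
theorem Step.intertwine_of_ne (S : Step N M κ) (hκ : κ ≠ 0) {lam : ℂ} (hl : lam ≠ 0)
    (hμ : lam ≠ S.μ * S.δ) :
    transfer N M κ S.u S.w lam * S.Q = S.Q * transfer N M κ S.u' S.w' lam := by
  ext α γ
  rw [Matrix.mul_apply, Matrix.mul_apply]
  set q : ZMod M → ZMod N → ZMod N → ZMod N → ℂ := fun m =>
    qLoc (S.x1 m) (S.y1 m) (S.x2 m) (S.y2 m) (S.x3 m) (S.y3 m) with hq
  have hL : ∑ β, transfer N M κ S.u S.w lam α β * S.Q β γ =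
      pathSum fun m => laxQ κ lam (S.u m) (S.w m) (fun a => q m a (γ m) (γ (m + 1))) (α m) := by
    simp_rw [transfer_apply, pathSum, ← sum_laxE_mul, Finset.sum_mul]
    rw [Finset.sum_comm]
    refine Finset.sum_congr rfl fun i _ => ?_
    rw [Finset.prod_univ_sum, Fintype.piFinset_univ]
    refine Finset.sum_congr rfl fun β _ => ?_
    rw [Step.Q, Matrix.of_apply, ← Finset.prod_mul_distrib]
  have hR : ∑ β, S.Q α β * transfer N M κ S.u' S.w' lam β γ =
      ∑ β : Conf N M, pathSum (fun m => q m (α m) (β m) (β (m + 1)) •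
        laxE κ lam (S.u' m) (S.w' m) (β m) (γ m)) := by
    refine Finset.sum_congr rfl fun β _ => ?_
    simp_rw [transfer_apply, pathSum, Finset.mul_sum]
    refine Finset.sum_congr rfl fun i _ => ?_
    rw [Step.Q, Matrix.of_apply, ← Finset.prod_mul_distrib]
    rfl
  rw [hL, hR]
  have key := fun m c => S.laxQ_gauge hκ hl m (α m) (γ m) c (q m) rfl
  refine pathSum_eq_of_gauge (lam := lam) (κ := κ) (γ := γ) (u' := S.u') (w' := S.w')
    (q := fun m => q m (α m))
    (P := fun m c => laxQ κ lam (S.u m) (S.w m) (fun a => q m a (γ m) c) (α m))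
    (A0 := fun _ _ => 1) (A1 := fun m b => S.μ / (omHalf N * S.u' m * chi b))
    (B0 := fun m b => S.w m / S.w' m * (S.y2 m / S.y3 m) * (omHalf N * S.δ / lam * S.u' m * chi b))
    (B1 := fun m _ => S.w m / S.w' m * (S.y2 m / S.y3 m)) (fun m b => ?_) (fun m i c => ?_)
    (fun m i c => ?_)
  · have e : (1 : ℂ) * (S.w m / S.w' m * (S.y2 m / S.y3 m)) - S.μ / (omHalf N * S.u' m * chi b) *
        (S.w m / S.w' m * (S.y2 m / S.y3 m) * (omHalf N * S.δ / lam * S.u' m * chi b)) =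
        S.w m / S.w' m * (S.y2 m / S.y3 m) * ((lam - S.μ * S.δ) / lam) := by
      have := omHalf_ne_zero (N := N)
      have := S.u'_ne m
      have := chi_ne_zero b
      field_simp
    simp only [e]
    exact mul_ne_zero (mul_ne_zero (div_ne_zero (S.w_ne m) (S.w'_ne m))
      (div_ne_zero (S.f2 m).ne (S.f3 m).ne)) (div_ne_zero (sub_ne_zero.mpr hμ) hl)
  · obtain ⟨h0, h1, -, -⟩ := key m c
    fin_cases i
    · simp only [Fin.zero_eta, Matrix.cons_val_zero, mul_one, one_mul]
      exact h0
    · simp only [Fin.mk_one, Matrix.cons_val_one, Matrix.cons_val_fin_one, mul_one]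
      exact h1
  · obtain ⟨-, -, h0, h1⟩ := key m c
    fin_cases i
    · simp only [Fin.zero_eta, Matrix.cons_val_zero, mul_one, one_mul]
      exact h0
    · simp only [Fin.mk_one, Matrix.cons_val_one, Matrix.cons_val_fin_one, mul_one]
      exact h1

/-- The `Q`-operator of a step intertwines the transfer matrices of the two states. -/
theorem Step.intertwine (S : Step N M κ) (hκ : κ ≠ 0) {lam : ℂ} (hl : lam ≠ 0) :
    transfer N M κ S.u S.w lam * S.Q = S.Q * transfer N M κ S.u' S.w' lam := by
  by_cases hμ : lam = S.μ * S.δ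
  swap
  · exact S.intertwine_of_ne hκ hl hμ
  -- At the exceptional `λ` the gauge matrix degenerates, but both sides are continuous in `λ ≠ 0`
  -- and agree at all neighbouring values.
  ext α γ
  have hd : ∀ (u w : ZMod M → ℂ) (α β : Conf N M),
      ContinuousAt (fun z => transfer N M κ u w z α β) lam := fun u w α β =>
    (transfer_differentiableAt (u := fun _ => u) (w := fun _ => w) (fun _ => by fun_prop)
      (fun _ => by fun_prop) differentiableAt_id hl α β).continuousAt
  have hc1 : ContinuousAt (fun z => (transfer N M κ S.u S.w z * S.Q) α γ) lam := by
    simp_rw [Matrix.mul_apply]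
    exact tendsto_finsetSum _ fun β _ => (hd S.u S.w α β).mul continuousAt_const
  have hc2 : ContinuousAt (fun z => (S.Q * transfer N M κ S.u' S.w' z) α γ) lam := by
    simp_rw [Matrix.mul_apply]
    exact tendsto_finsetSum _ fun β _ => continuousAt_const.mul (hd S.u' S.w' β γ)
  have he : (fun z => (transfer N M κ S.u S.w z * S.Q) α γ) =ᶠ[nhdsWithin lam {lam}ᶜ]
      fun z => (S.Q * transfer N M κ S.u' S.w' z) α γ := by
    filter_upwards [self_mem_nhdsWithin, mem_nhdsWithin_of_mem_nhds (isOpen_ne.mem_nhds hl)] with z h1 h2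
    rw [S.intertwine_of_ne hκ h2 fun h => h1 (h.trans hμ.symm)]
  exact tendsto_nhds_unique (hc1.tendsto.mono_left nhdsWithin_le_nhds)
    ((hc2.tendsto.mono_left nhdsWithin_le_nhds).congr' he.symm)

end Step

/-! ### Star-triangle recursions by telescoping, and the Fourier form of the local factor -/

section StarTriangle

variable {N : ℕ} [NeZero N]

/-- Each of the four star-triangle recursions is proved by writing the difference of the two
summands as `H b - H (b - 1)` with an explicit `H`. -/
theorem sum_sub_shift (H : ZMod N → ℂ) : ∑ b, (H b - H (b - 1)) = 0 := by
  rw [Finset.sum_sub_distrib, sub_eq_zero]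
  exact (Equiv.sum_comp (Equiv.subRight (1 : ZMod N)) H).symm

/-- Solutions of first order recursions with prescribed coefficients. -/
theorem exists_rec {z p q : ℂ} (hq : q ^ N ≠ 1) (h : z ^ N * (1 - p ^ N) = 1 - q ^ N) :
    ∃ e : ZMod N → ℂ, e 0 = 1 ∧
      ∀ k, e k * (1 - q * chi (-k)) = z * (1 - p * chi (-k)) * e (k - 1) := by
  have hn : ∀ x : ℂ, ∏ k : ZMod N, (1 - x * chi (-k)) = 1 - x ^ N := fun x => by
    rw [← prod_one_sub_mul_chi]
    exact Equiv.prod_comp (Equiv.neg (ZMod N)) fun k => 1 - x * chi k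
  refine ⟨cyc fun k => z * (1 - p * chi (-k)) / (1 - q * chi (-k)), cyc_zero _, fun k => ?_⟩
  -- The relation between `z`, `p` and `q` says exactly that the product of the coefficients over a
  -- period is `1`.
  rw [cyc_rec]
  · rw [mul_right_comm, div_mul_cancel₀ _ (one_sub_mul_chi_ne_zero hq (-k))]
  · rw [Finset.prod_div_distrib, Finset.prod_mul_distrib, hn, hn, Finset.prod_const,
      Finset.card_univ, ZMod.card, h, div_self (sub_ne_zero.mpr hq.symm)]

variable {R R' w w' e : ZMod N → ℂ} {η ζ η' ζ' x y x' y' : ℂ}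

/-- First star-triangle relation: recursion in the outer variable. -/
theorem star_one_rec (hη : η ≠ 0) (hζ : ζ ≠ 0) (hx : x ≠ 0) (hy' : y' ≠ 0)
    (hR : ∀ j, R j * (1 - η * chi (-j)) = ζ * R (j - 1))
    (hw : ∀ n, w n * (1 - x * chi n) = y * w (n - 1))
    (he : ∀ k, e k * (1 - η' / η * chi (-k)) =
      ζ' / y' * (1 - om N * x' / x * chi (-k)) * e (k - 1))
    (cond : ζ' * x' * y * η = x * ζ * y' * η') (β b' : ZMod N) :
    y' * (1 - η' * chi (β - b')) * ∑ b, R (b - β) * w (-b) * e (b' - b) =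
      ζ' * (1 - x' * chi (1 - b')) * ∑ b, R (b - β) * w (-b) * e (b' - 1 - b) := by
  -- The factor `1 - x χ(-b)` of `H` is absorbed by the recursion of `w` once `b` is shifted, and
  -- `cond` converts the resulting constants into those of the recursion of `e`.
  rw [← sub_eq_zero, Finset.mul_sum, Finset.mul_sum, ← Finset.sum_sub_distrib,
    ← sum_sub_shift fun b => R (b - β) * w (-b) * e (b' - b - 1) * (-(ζ' * x' / x)) *
      chi (b + 1 - b') * (1 - x * chi (-b))]
  refine Finset.sum_congr rfl fun b _ => ?_
  have r := hR (b - β)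
  have k := hw (1 - b)
  have l := he (b' - b)
  have c1 : chi (-(b - β)) = chi (β - b) := by congr 1; ring
  have c2 : chi (-(b' - b)) = chi (b - b') := by congr 1; ring
  have c3 : chi (β - b') = chi (β - b) * chi (b - b') := by rw [← chi_add]; congr 1; ring
  have c4 : chi (1 - b') = om N * chi (-b) * chi (b - b') := by
    rw [← chi_one, ← chi_add, ← chi_add]; congr 1; ring
  have c5 : chi (b + 1 - b') = om N * chi (b - b') := by
    rw [← chi_one, ← chi_add]; congr 1; ring
  have c6 : chi (1 - b) = om N * chi (-b) := by rw [← chi_one, ← chi_add]; congr 1; ring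
  have d1 : b - β - 1 = b - 1 - β := by ring
  have d2 : 1 - b - 1 = -b := by ring
  have d3 : b' - 1 - b = b' - b - 1 := by ring
  have d4 : b' - (b - 1) - 1 = b' - b := by ring
  have d5 : -(b - 1) = 1 - b := by ring
  have d6 : b - 1 + 1 - b' = b - b' := by ring
  rw [c1, d1] at r
  rw [c6, d2] at k
  rw [c2] at l
  rw [c3, c4, c5, d3, d4, d5, d6, c6]
  generalize chi (β - b) = A at *
  generalize chi (b - b') = B at *
  generalize chi (-b) = Z at *
  have r' : R (b - 1 - β) = R (b - β) * (1 - η * A) / ζ := by rw [eq_div_iff hζ]; linear_combination -r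
  rw [r']
  have k' : R (b - β) * (1 - η * A) / ζ * w (1 - b) * e (b' - b) * -(ζ' * x' / x) * B *
      (1 - x * (om N * Z)) = R (b - β) * (1 - η * A) / ζ * (y * w (-b)) * e (b' - b) *
        -(ζ' * x' / x) * B := by linear_combination (R (b - β) * (1 - η * A) / ζ * e (b' - b) *
        -(ζ' * x' / x) * B) * k
  rw [k']
  have q1 : ζ' * x' * y / (ζ * x) = y' * (η' / η) := by field_simp; linear_combination cond
  have k'' : R (b - β) * (1 - η * A) / ζ * (y * w (-b)) * e (b' - b) * -(ζ' * x' / x) * B =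
      -(R (b - β) * (1 - η * A) * w (-b) * e (b' - b) * B) * (ζ' * x' * y / (ζ * x)) := by
    field_simp
  rw [k'', q1]
  have l' : y' * (e (b' - b) * (1 - η' / η * B)) = ζ' * (1 - om N * x' / x * B) * e (b' - b - 1) := by
    rw [l]; field_simp
  have q3 : η' = η' / η * η := by field_simp
  have q4 : x' = x' / x * x := by field_simp
  have q5 : om N * x' / x = om N * (x' / x) := by ring
  have q6 : ζ' * x' / x = ζ' * (x' / x) := by ring
  rw [q5] at l'
  rw [q6]
  generalize η' / η = q at *
  generalize x' / x = s at *
  rw [q3, q4]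
  linear_combination R (b - β) * w (-b) * l'

/-- First star-triangle relation: recursion in the inner variable. -/
theorem star_one_rec' (hη : η ≠ 0) (hζ : ζ ≠ 0) (hx : x ≠ 0) (hy' : y' ≠ 0) (hx' : x' ≠ 0)
    (hR : ∀ j, R j * (1 - η * chi (-j)) = ζ * R (j - 1))
    (hw : ∀ n, w n * (1 - x * chi n) = y * w (n - 1))
    (he : ∀ k, e k * (1 - η' / η * chi (-k)) =
      ζ' / y' * (1 - om N * x' / x * chi (-k)) * e (k - 1))
    (cond : ζ' * x' * y * η = x * ζ * y' * η') (β b' : ZMod N) :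
    ζ * (1 - η' / x' * chi (β - 1)) * ∑ b, R (b - β) * w (-b) * e (b' - b) =
      (1 - η / x * chi (β - 1)) * (1 - η' * chi (β - 1 - b')) *
        ∑ b, R (b - (β - 1)) * w (-b) * e (b' - b) := by
  -- Here `H` carries two extra factors; after the shift they are absorbed by the recursions of `w`
  -- and of `e`.
  rw [← sub_eq_zero, Finset.mul_sum, Finset.mul_sum, ← Finset.sum_sub_distrib,
    ← sum_sub_shift fun b => η / x * chi (β - 1) * R (b - β + 1) * w (-b) * e (b' - b) *
      (1 - x * chi (-b)) * (1 - η' / η * chi (b - b'))]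
  refine Finset.sum_congr rfl fun b _ => ?_
  have r := hR (b - β + 1)
  have k := hw (1 - b)
  have l := he (b' - b + 1)
  have c1 : chi (-(b - β + 1)) = chi (β - 1) * chi (-b) := by rw [← chi_add]; congr 1; ring
  have c2 : chi (-(b' - b + 1)) = chi (b - b') / om N := by
    rw [← chi_one, ← chi_sub]; congr 1; ring
  have c3 : chi (β - 1 - b') = chi (β - 1) * chi (-b) * chi (b - b') := by
    rw [← chi_add, ← chi_add]; congr 1; ring
  have c5 : chi (b - 1 - b') = chi (b - b') / om N := by
    rw [← chi_one, ← chi_sub]; congr 1; ring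
  have c6 : chi (1 - b) = om N * chi (-b) := by rw [← chi_one, ← chi_add]; congr 1; ring
  have d1 : b - β + 1 - 1 = b - β := by ring
  have d2 : 1 - b - 1 = -b := by ring
  have d3 : b' - b + 1 - 1 = b' - b := by ring
  have d4 : b - 1 - β + 1 = b - β := by ring
  have d5 : -(b - 1) = 1 - b := by ring
  have d6 : b' - (b - 1) = b' - b + 1 := by ring
  have d7 : b - (β - 1) = b - β + 1 := by ring
  rw [c1, d1] at r
  rw [c6, d2] at k
  rw [c2, d3] at l
  rw [c3, c5, d4, d5, d6, d7, c6]
  have ho := om_ne_zero (N := N)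
  generalize chi (β - 1) = D at *
  generalize chi (b - b') = B at *
  generalize chi (-b) = Z at *
  generalize om N = o at *
  have k' : η / x * D * R (b - β) * w (1 - b) * e (b' - b + 1) * (1 - x * (o * Z)) *
      (1 - η' / η * (B / o)) = η / x * D * R (b - β) * (y * w (-b)) *
        (ζ' / y' * (1 - o * x' / x * (B / o)) * e (b' - b)) := by
    linear_combination (η / x * D * R (b - β) * e (b' - b + 1) * (1 - η' / η * (B / o))) * k +
      η / x * D * R (b - β) * (y * w (-b)) * l
  rw [k']
  have r' : R (b - β) = R (b - β + 1) * (1 - η * (D * Z)) / ζ := by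
    rw [eq_div_iff hζ]; linear_combination -r
  rw [r']
  have q1 : y * (ζ' / y') = x * ζ * η' / (x' * η) := by
    field_simp; linear_combination cond
  have e1 : η / x * D * (R (b - β + 1) * (1 - η * (D * Z)) / ζ) * (y * w (-b)) *
      (ζ' / y' * (1 - o * x' / x * (B / o)) * e (b' - b)) =
      η / x * D * (R (b - β + 1) * (1 - η * (D * Z)) / ζ) * (w (-b)) *
      ((1 - o * x' / x * (B / o)) * e (b' - b)) * (y * (ζ' / y')) := by ring
  rw [e1, q1]
  field_simp
  ring

variable {v v' : ZMod N → ℂ} {ξ υ ξ' υ' X Y X' Y' : ℂ}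

/-- Second star-triangle relation: recursion in the outer variable. -/
theorem star_two_rec (hξ : ξ ≠ 0) (hX : X ≠ 0) (hY : Y ≠ 0) (hY' : Y' ≠ 0)
    (hw : ∀ n, w' n ≠ 0)
    (hv : ∀ n, v' n * (1 - ξ' * chi n) = υ' * v' (n - 1))
    (hw' : ∀ n, w' n * (1 - X' * chi n) = Y' * w' (n - 1))
    (he : ∀ k, e k * (1 - ξ' / ξ * chi (-k)) =
      υ * X / (Y * ξ) * (1 - om N * X' / X * chi (-k)) * e (k - 1))
    (cond : υ / Y = υ' / Y') (β c : ZMod N) :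
    υ * (1 - X * chi (-β)) *
        ∑ b, e (b - (β + 1)) * v' (c - b) * (w' (-b))⁻¹ * chi (-((b - (β + 1)) * c)) =
      Y * (1 - ξ * chi (c - β)) *
        ∑ b, e (b - β) * v' (c - b) * (w' (-b))⁻¹ * chi (-((b - β) * c)) := by
  rw [← sub_eq_zero, Finset.mul_sum, Finset.mul_sum, ← Finset.sum_sub_distrib,
    ← sum_sub_shift fun b => -Y * (1 - ξ' * chi (c - b)) * e (b - β) * v' (c - b) * (w' (-b))⁻¹ *
      chi (-((b - β) * c))]
  refine Finset.sum_congr rfl fun b _ => ?_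
  have r := hv (c - b + 1)
  have k := hw' (1 - b)
  have l := he (b - β)
  have c1 : chi (-(b - β)) = chi (β - b) := by congr 1; ring
  have c2 : chi (c - b) = chi c * chi (-b) := by rw [← chi_add]; congr 1; ring
  have c3 : chi (c - β) = chi c * chi (-b) / chi (β - b) := by
    rw [← chi_add, ← chi_sub]; congr 1; ring
  have c4 : chi (-β) = chi (-b) / chi (β - b) := by rw [← chi_sub]; congr 1; ring
  have c5 : chi (c - (b - 1)) = om N * (chi c * chi (-b)) := by
    rw [← chi_add, ← chi_one, ← chi_add]; congr 1; ring
  have c6 : chi (1 - b) = om N * chi (-b) := by rw [← chi_one, ← chi_add]; congr 1; ring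
  have c7 : chi (-((b - (β + 1)) * c)) = chi (-((b - β) * c)) * chi c := by
    rw [← chi_add]; congr 1; ring
  have c8 : chi (-((b - 1 - β) * c)) = chi (-((b - β) * c)) * chi c := by
    rw [← chi_add]; congr 1; ring
  have c9 : chi (c - b + 1) = om N * (chi c * chi (-b)) := by
    rw [← chi_add, ← chi_one, ← chi_add]; congr 1; ring
  have d1 : c - b + 1 - 1 = c - b := by ring
  have d2 : 1 - b - 1 = -b := by ring
  have d3 : b - (β + 1) = b - β - 1 := by ring
  have d4 : b - 1 - β = b - β - 1 := by ring
  have d5 : -(b - 1) = 1 - b := by ring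
  have d6 : c - (b - 1) = c - b + 1 := by ring
  rw [c9, d1] at r
  rw [c6, d2] at k
  rw [c1] at l
  rw [c7, c8, c5, d3, d4, d5, d6, c4, c2, c3]
  have ho := om_ne_zero (N := N)
  have hB := chi_ne_zero (β - b)
  have n1 := hw (1 - b)
  have n2 := hw (-b)
  generalize chi (β - b) = B at *
  generalize chi c = K at *
  generalize chi (-b) = Z at *
  generalize om N = o at *
  generalize chi (-((b - β) * c)) = f at *
  generalize e (b - β) = E at *
  generalize e (b - β - 1) = E' at *
  generalize w' (1 - b) = W1 at *
  generalize w' (-b) = W at *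
  generalize v' (c - b + 1) = V1 at *
  generalize v' (c - b) = V at *
  have hW : W1⁻¹ = W⁻¹ * ((1 - X' * (o * Z)) / Y') := by
    field_simp; linear_combination -k
  rw [hW]
  have e1 : -Y * (1 - ξ' * (o * (K * Z))) * E' * V1 * (W⁻¹ * ((1 - X' * (o * Z)) / Y')) * (f * K) =
      -Y * E' * (υ' / Y' * V) * (W⁻¹ * (1 - X' * (o * Z))) * (f * K) := by
    linear_combination -Y * E' * (W⁻¹ * ((1 - X' * (o * Z)) / Y')) * (f * K) * r
  rw [e1, ← cond]
  have l' : Y * (E * (1 - ξ' / ξ * B)) = υ * (X / ξ - o * X' / ξ * B) * E' := by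
    rw [l]; field_simp
  have q3 : ξ' = ξ' / ξ * ξ := by field_simp
  generalize ξ' / ξ = q at *
  rw [q3]
  have e2 : υ * (1 - X * (Z / B)) * (E' * V * W⁻¹ * (f * K)) -
      Y * (1 - ξ * (K * Z / B)) * (E * V * W⁻¹ * f) -
      (-Y * (1 - q * ξ * (K * Z)) * E * V * W⁻¹ * f -
        -Y * E' * (υ / Y * V) * (W⁻¹ * (1 - X' * (o * Z))) * (f * K)) =
      V * W⁻¹ * f * K * Z * ξ / B * (Y * (E * (1 - q * B)) - υ * (X / ξ - o * X' / ξ * B) * E') := by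
    field_simp
    ring
  rw [← sub_eq_zero, e2, l', sub_self, mul_zero]

/-- Second star-triangle relation: recursion in the inner variable. -/
theorem star_two_rec' (hξ : ξ ≠ 0) (hX : X ≠ 0) (hY : Y ≠ 0) (hY' : Y' ≠ 0)
    (hw : ∀ n, w' n ≠ 0) (hυ' : υ' ≠ 0) (hυ : υ ≠ 0)
    (hv : ∀ n, v' n * (1 - ξ' * chi n) = υ' * v' (n - 1))
    (hw' : ∀ n, w' n * (1 - X' * chi n) = Y' * w' (n - 1))
    (he : ∀ k, e k * (1 - ξ' / ξ * chi (-k)) =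
      υ * X / (Y * ξ) * (1 - om N * X' / X * chi (-k)) * e (k - 1))
    (cond : υ / Y = υ' / Y') (β c : ZMod N) :
    Y * (X' - ξ' * chi (c - 1)) * (1 - ξ * chi (c - β)) *
        ∑ b, e (b - β) * v' (c - b) * (w' (-b))⁻¹ * chi (-((b - β) * c)) =
      Y' * υ * (X - ξ * chi (c - 1)) *
        ∑ b, e (b - β) * v' (c - 1 - b) * (w' (-b))⁻¹ * chi (-((b - β) * (c - 1))) := by
  rw [← sub_eq_zero, Finset.mul_sum, Finset.mul_sum, ← Finset.sum_sub_distrib,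
    ← sum_sub_shift fun b => -(Y * X) * chi (b - β) * (1 - X' / X * chi (β - b)) *
      (1 - ξ' * chi (c - b)) * e (b - β) * v' (c - b) * (w' (-b))⁻¹ *
      chi (-((b - β) * c))]
  refine Finset.sum_congr rfl fun b _ => ?_
  have r := hv (c - b + 1)
  have r0 := hv (c - b)
  have k := hw' (1 - b)
  have l := he (b - β)
  have c1 : chi (-(b - β)) = chi (β - b) := by congr 1; ring
  have c2 : chi (c - b) = chi c * chi (-b) := by rw [← chi_add]; congr 1; ring
  have c3 : chi (c - β) = chi c * chi (-b) / chi (β - b) := by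
    rw [← chi_add, ← chi_sub]; congr 1; ring
  have c4 : chi (β - (b - 1)) = om N * chi (β - b) := by
    rw [← chi_one, ← chi_add]; congr 1; ring
  have c6 : chi (1 - b) = om N * chi (-b) := by rw [← chi_one, ← chi_add]; congr 1; ring
  have c7 : chi (-((b - β) * (c - 1))) = chi (-((b - β) * c)) / chi (β - b) := by
    rw [← chi_sub]; congr 1; ring
  have c8 : chi (-((b - 1 - β) * c)) = chi (-((b - β) * c)) * chi c := by
    rw [← chi_add]; congr 1; ring
  have c9 : chi (c - b + 1) = om N * (chi c * chi (-b)) := by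
    rw [← chi_add, ← chi_one, ← chi_add]; congr 1; ring
  have c10 : chi (b - β) = 1 / chi (β - b) := by
    rw [← chi_zero (N := N), ← chi_sub]; congr 1; ring
  have c11 : chi (b - 1 - β) = 1 / (om N * chi (β - b)) := by
    rw [← chi_zero (N := N), ← chi_one, ← chi_add, ← chi_sub]; congr 1; ring
  have c12 : chi (c - 1) = chi c / om N := by rw [← chi_one, ← chi_sub]
  have d1 : c - b + 1 - 1 = c - b := by ring
  have d2 : 1 - b - 1 = -b := by ring
  have d4 : b - 1 - β = b - β - 1 := by ring
  have d5 : -(b - 1) = 1 - b := by ring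
  have d6 : c - (b - 1) = c - b + 1 := by ring
  have d7 : c - 1 - b = c - b - 1 := by ring
  rw [c9, d1] at r
  rw [c2] at r0
  rw [c6, d2] at k
  rw [c1] at l
  rw [c4, c7, c8, c10, c11, c12, d4, d5, d6, d7, c2, c3, c9]
  have ho := om_ne_zero (N := N)
  have hB := chi_ne_zero (β - b)
  have n1 := hw (1 - b)
  have n2 := hw (-b)
  generalize chi (β - b) = B at *
  generalize chi c = K at *
  generalize chi (-b) = Z at *
  generalize om N = o at *
  generalize chi (-((b - β) * c)) = f at *
  generalize e (b - β) = E at *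
  generalize e (b - β - 1) = E' at *
  generalize w' (1 - b) = W1 at *
  generalize w' (-b) = W at *
  generalize v' (c - b + 1) = V1 at *
  generalize v' (c - b - 1) = V0 at *
  generalize v' (c - b) = V at *
  have hW : W1⁻¹ = W⁻¹ * ((1 - X' * (o * Z)) / Y') := by
    field_simp; linear_combination -k
  have hV : V0 = V * (1 - ξ' * (K * Z)) / υ' := by
    rw [eq_div_iff hυ']; linear_combination -r0
  rw [hW, hV]
  have e1 : -(Y * X) * (1 / (o * B)) * (1 - X' / X * (o * B)) * (1 - ξ' * (o * (K * Z))) * E' * V1 *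
      (W⁻¹ * ((1 - X' * (o * Z)) / Y')) * (f * K) =
      -(Y * X) * (1 / (o * B)) * (W⁻¹ * (1 - X' * (o * Z))) * (f * K) * V *
        (υ' / Y') * ((1 - o * X' / X * B) * E') := by
    linear_combination (-(Y * X) * (1 / (o * B)) * (1 - X' / X * (o * B)) * E' *
      (W⁻¹ * ((1 - X' * (o * Z)) / Y')) * (f * K)) * r
  have l' : (1 - o * X' / X * B) * E' = E * (1 - ξ' / ξ * B) * (Y * ξ / (υ * X)) := by
    rw [l]; field_simp
  have hY2 : Y' = υ' * Y / υ := by field_simp at cond ⊢; linear_combination cond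
  rw [e1, ← cond, l', hY2]
  field_simp
  ring

/-- The Fourier transform lemma for the local factor of the `Q`-operator. -/
theorem star_fourier {x1 y1 x2 y2 x3 y3 : ℂ} (h1 : Fermat N x1 y1) (h2 : Fermat N x2 y2)
    (h3 : Fermat N x3 y3) (hx : x3 = x1 * x2) {R v : ZMod N → ℂ} (hR0 : R 0 = 1) (hv0 : v 0 = 1)
    (hR : ∀ j, R j * (1 - y1 / y3 * chi (-j)) = x1 * (y2 / y3) * R (j - 1))
    (hv : ∀ n, v n * (1 - x2 * (y1 / y3) * chi n) = y2 / y3 * v (n - 1)) :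
    ∃ C : ℂ, C ≠ 0 ∧ ∀ n k, wFun N x1 y1 n * wFun N x2 y2 k / wFun N x3 y3 (n + k) =
      C * ∑ j, R j * v (k - j) * chi (j * n) := by
  set F : ZMod N → ZMod N → ℂ := fun n k => ∑ j, R j * v (k - j) * chi (j * n) with hF
  have n1 := h1.ne
  have n2 := h2.ne
  have n3 := h3.ne
  set η := y1 / y3 with hη
  set υ := y2 / y3 with hυ
  have hυ0 : υ ≠ 0 := div_ne_zero n2 n3
  have hη0 : η ≠ 0 := div_ne_zero n1 n3
  -- The recursions of `v` and of `R` give one linear relation each between `F n k`, `F (n - 1) k`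
  -- and `F n (k - 1)`. Solving the pair separates the two variables and produces the recursions of
  -- the product of weights.
  have a1 : ∀ n k, υ * F n (k - 1) = F n k - x2 * η * chi k * F (n - 1) k := by
    intro n k
    simp only [hF, Finset.mul_sum]
    rw [← Finset.sum_sub_distrib]
    refine Finset.sum_congr rfl fun j _ => ?_
    have := hv (k - j)
    have c1 : chi (k - j) * chi (j * n) = chi k * chi (j * (n - 1)) := by
      rw [← chi_add, ← chi_add]; congr 1; ring
    have d1 : k - 1 - j = k - j - 1 := by ring
    rw [d1]
    linear_combination -(R j * chi (j * n)) * this - R j * v (k - j) * x2 * η * c1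
  have a2 : ∀ n k, chi n * (x1 * υ) * F n (k - 1) = F n k - η * F (n - 1) k := by
    intro n k
    simp only [hF, Finset.mul_sum]
    rw [← Finset.sum_sub_distrib, ← Equiv.sum_comp (Equiv.subRight (1 : ZMod N))]
    refine Finset.sum_congr rfl fun j _ => ?_
    have := hR j
    have c1 : chi (j * (n - 1)) = chi (-j) * chi (j * n) := by
      rw [← chi_add]; congr 1; ring
    have c2 : chi n * chi ((j - 1) * n) = chi (j * n) := by
      rw [← chi_add]; congr 1; ring
    have d1 : k - 1 - (j - 1) = k - j := by ring
    simp only [Equiv.subRight_apply, d1, c1]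
    linear_combination -(v (k - j) * chi (j * n)) * this + x1 * υ * R (j - 1) * v (k - j) * c2
  have b1 : ∀ n k, F n k * (1 - x1 * chi n) = η * (1 - x3 * chi (n + k)) * F (n - 1) k := by
    intro n k
    refine mul_left_cancel₀ hυ0 ?_
    rw [chi_add, hx]
    linear_combination x1 * υ * chi n * a1 n k - υ * a2 n k
  have b2 : ∀ n k, F n k * (1 - x2 * chi k) = υ * (1 - x3 * chi (n + k)) * F n (k - 1) := by
    intro n k
    rw [chi_add, hx]
    linear_combination -a1 n k + x2 * chi k * a2 n k
  set G : ZMod N → ZMod N → ℂ := fun n k =>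
    wFun N x1 y1 n * wFun N x2 y2 k / wFun N x3 y3 (n + k) with hG
  have g1 : ∀ n k, G n k * (1 - x1 * chi n) = η * (1 - x3 * chi (n + k)) * G (n - 1) k := by
    intro n k
    have e1 := h1.wFun_rec n
    have e3 := h3.wFun_rec (n + k)
    have := h3.wFun_ne_zero (n + k)
    have := h3.wFun_ne_zero (n + k - 1)
    have d1 : n - 1 + k = n + k - 1 := by ring
    simp only [hG, hη, d1]
    have : (1 - x3 * chi (n + k)) = y3 * wFun N x3 y3 (n + k - 1) / wFun N x3 y3 (n + k) := by
      field_simp; linear_combination e3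
    rw [this]
    field_simp
    linear_combination wFun N x2 y2 k * e1
  have g2 : ∀ n k, G n k * (1 - x2 * chi k) = υ * (1 - x3 * chi (n + k)) * G n (k - 1) := by
    intro n k
    have e1 := h2.wFun_rec k
    have e3 := h3.wFun_rec (n + k)
    have := h3.wFun_ne_zero (n + k)
    have := h3.wFun_ne_zero (n + k - 1)
    have d1 : n + (k - 1) = n + k - 1 := by ring
    simp only [hG, hυ, d1]
    have : (1 - x3 * chi (n + k)) = y3 * wFun N x3 y3 (n + k - 1) / wFun N x3 y3 (n + k) := by
      field_simp; linear_combination e3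
    rw [this]
    field_simp
    linear_combination wFun N x1 y1 n * e1
  have hG0 : G 0 0 = 1 := by simp [hG]
  have main : ∀ n k, F n k = F 0 0 * G n k := by
    intro n k
    have s1 : ∀ n, F n 0 = F 0 0 * G n 0 := fun n =>
      eq_of_rec (fun n => h1.one_sub_ne_zero n) (b := fun n => η * (1 - x3 * chi (n + 0)))
        (fun n => b1 n 0) (g := fun n => F 0 0 * G n 0)
        (fun n => by linear_combination F 0 0 * g1 n 0) (n₀ := 0) (by simp [hG0]) n
    exact eq_of_rec (fun k => h2.one_sub_ne_zero k) (b := fun k => υ * (1 - x3 * chi (n + k)))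
      (fun k => b2 n k) (g := fun k => F 0 0 * G n k)
      (fun k => by linear_combination F 0 0 * g2 n k) (n₀ := 0) (s1 n) k
  -- Otherwise `F` vanishes identically, and injectivity of the Fourier transform contradicts `R 0 *
  -- v 0 = 1`.
  have hF0 : F 0 0 ≠ 0 := by
    intro h0
    have : R 0 * v (0 - 0) = 0 := eq_zero_of_fourier (f := fun j => R j * v (0 - j))
      (fun n => by have := main n 0; rw [h0, zero_mul] at this; exact this) 0
    simp [hR0, hv0] at this
  refine ⟨(F 0 0)⁻¹, inv_ne_zero hF0, fun n k => ?_⟩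
  change G n k = (F 0 0)⁻¹ * F n k
  rw [main n k, ← mul_assoc, inv_mul_cancel₀ hF0, one_mul]

end StarTriangle

/-! ### The two star-triangle relations and the local exchange -/

section Star

variable {N : ℕ} [NeZero N]

variable {R R' w w' e : ZMod N → ℂ} {η ζ η' ζ' x y x' y' : ℂ}

/-- As functions of `b'`, the sum and `R' (b' - β) * w' (-b')` satisfy the same first-order
recursion, so they are proportional. The recursion in `β` then passes to the factor `t`. -/
theorem star_one (hη : η ≠ 0) (hζ : ζ ≠ 0) (hx : x ≠ 0) (hx' : x' ≠ 0) (hy' : y' ≠ 0)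
    (hR : ∀ j, R j * (1 - η * chi (-j)) = ζ * R (j - 1))
    (hR' : ∀ j, R' j * (1 - η' * chi (-j)) = ζ' * R' (j - 1)) (hR0 : ∀ j, R' j ≠ 0)
    (hη' : η' ^ N ≠ 1)
    (hw : ∀ n, w n * (1 - x * chi n) = y * w (n - 1))
    (hw' : ∀ n, w' n * (1 - x' * chi n) = y' * w' (n - 1)) (hw0 : w' 0 = 1)
    (he : ∀ k, e k * (1 - η' / η * chi (-k)) =
      ζ' / y' * (1 - om N * x' / x * chi (-k)) * e (k - 1))
    (cond : ζ' * x' * y * η = x * ζ * y' * η') :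
    ∃ t : ZMod N → ℂ,
      (∀ β b', ∑ b, R (b - β) * w (-b) * e (b' - b) = t β * (R' (b' - β) * w' (-b'))) ∧
      ∀ β, t β * (ζ * (1 - η' / x' * chi (β - 1))) = ζ' * (1 - η / x * chi (β - 1)) * t (β - 1) := by
  have hI : ∀ β b', ∑ b, R (b - β) * w (-b) * e (b' - b) =
      (∑ b, R (b - β) * w (-b) * e (0 - b)) / R' (-β) * (R' (b' - β) * w' (-b')) := by
    intro β b'
    have := eq_smul_of_rec (f := fun b' => ∑ b, R (b - β) * w (-b) * e (b' - b))
      (g := fun b' => R' (b' - β) * w' (-b')) (a := fun b' => y' * (1 - η' * chi (β - b')))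
      (b := fun b' => ζ' * (1 - x' * chi (1 - b')))
      (fun n => mul_ne_zero hy' (one_sub_mul_chi_ne_zero hη' _))
      (fun n => by rw [mul_comm]; exact star_one_rec hη hζ hx hy' hR hw he cond β n)
      (fun n => ?_) (by simpa [hw0] using hR0 (-β)) b'
    · simpa [hw0] using this
    · have h1 := hR' (n - β)
      have h2 := hw' (1 - n)
      have d1 : n - β - 1 = n - 1 - β := by ring
      have d2 : 1 - n - 1 = -n := by ring
      have d3 : -(n - β) = β - n := by ring
      have d4 : -(n - 1) = 1 - n := by ring
      rw [d1, d3] at h1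
      rw [d2] at h2
      simp only [d4]
      linear_combination y' * w' (-n) * h1 - ζ' * R' (n - 1 - β) * h2
  refine ⟨fun β => (∑ b, R (b - β) * w (-b) * e (0 - b)) / R' (-β), hI, fun β => ?_⟩
  have h1 := star_one_rec' hη hζ hx hy' hx' hR hw he cond β 0
  have h2 := hR' (1 - β)
  have d1 : 1 - β - 1 = -β := by ring
  have d2 : -(1 - β) = β - 1 := by ring
  have d3 : -(β - 1) = 1 - β := by ring
  rw [d1, d2] at h2
  have n1 := hR0 (-β)
  have n2 := hR0 (1 - β)
  have n3 := one_sub_mul_chi_ne_zero hη' (β - 1)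
  rw [sub_zero] at h1
  simp only [d3]
  generalize ∑ b, R (b - β) * w (-b) * e (0 - b) = F at *
  generalize ∑ b, R (b - (β - 1)) * w (-b) * e (0 - b) = F1 at *
  generalize R' (-β) = r at *
  generalize R' (1 - β) = r1 at *
  have e1 : F / r * (ζ * (1 - η' / x' * chi (β - 1))) =
      ζ * (1 - η' / x' * chi (β - 1)) * F / r := by ring
  obtain ⟨G, rfl⟩ : ∃ G, F1 = G * r1 := ⟨F1 / r1, (div_mul_cancel₀ _ n2).symm⟩
  rw [e1, h1, div_eq_iff n1, mul_div_cancel_right₀ _ n2]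
  linear_combination (1 - η / x * chi (β - 1)) * G * h2

variable {v v' : ZMod N → ℂ} {ξ υ ξ' υ' X Y X' Y' : ℂ}

/-- The same mechanism as in `star_one`: proportionality comes from the recursion in `β`, and the
recursion in `c` becomes that of the factor `t`. -/
theorem star_two (hξ : ξ ≠ 0) (hX : X ≠ 0) (hY : Y ≠ 0) (hY' : Y' ≠ 0)
    (hυ' : υ' ≠ 0) (hυ : υ ≠ 0) (hw0 : ∀ n, w n ≠ 0) (hw0' : ∀ n, w' n ≠ 0) (hv0 : ∀ n, v n ≠ 0)
    (hw1 : w 0 = 1)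
    (hX1 : X ^ N ≠ 1) (hξ1 : ξ ^ N ≠ 1)
    (hv : ∀ n, v n * (1 - ξ * chi n) = υ * v (n - 1))
    (hw : ∀ n, w n * (1 - X * chi n) = Y * w (n - 1))
    (hv' : ∀ n, v' n * (1 - ξ' * chi n) = υ' * v' (n - 1))
    (hw' : ∀ n, w' n * (1 - X' * chi n) = Y' * w' (n - 1))
    (he : ∀ k, e k * (1 - ξ' / ξ * chi (-k)) =
      υ * X / (Y * ξ) * (1 - om N * X' / X * chi (-k)) * e (k - 1))
    (cond : υ / Y = υ' / Y') :
    ∃ t : ZMod N → ℂ,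
      (∀ β c, ∑ b, e (b - β) * v' (c - b) * (w' (-b))⁻¹ * chi (-((b - β) * c)) =
        t c * (v (c - β) * (w (-β))⁻¹)) ∧
      ∀ c, t c * (Y * (X' - ξ' * chi (c - 1))) = Y' * (X - ξ * chi (c - 1)) * t (c - 1) := by
  have hII : ∀ β c, ∑ b, e (b - β) * v' (c - b) * (w' (-b))⁻¹ * chi (-((b - β) * c)) =
      (∑ b, e (b - 0) * v' (c - b) * (w' (-b))⁻¹ * chi (-((b - 0) * c))) / v c *
        (v (c - β) * (w (-β))⁻¹) := by
    intro β c
    have := eq_smul_of_rec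
      (f := fun β => ∑ b, e (b - β) * v' (c - b) * (w' (-b))⁻¹ * chi (-((b - β) * c)))
      (g := fun β => v (c - β) * (w (-β))⁻¹) (a := fun β => υ * (1 - X * chi (-(β - 1))))
      (b := fun β => Y * (1 - ξ * chi (c - (β - 1))))
      (fun n => mul_ne_zero hυ (one_sub_mul_chi_ne_zero hX1 _))
      (fun n => ?_)
      (fun n => ?_) (by simpa [hw1] using hv0 c) β
    · simpa [hw1] using this
    · have := star_two_rec hξ hX hY hY' hw0' hv' hw' he cond (n - 1) c
      rw [sub_add_cancel] at this
      rw [mul_comm]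
      exact this
    · have h1 := hv (c - n + 1)
      have h2 := hw (1 - n)
      have d1 : c - n + 1 - 1 = c - n := by ring
      have d2 : 1 - n - 1 = -n := by ring
      have d3 : c - (n - 1) = c - n + 1 := by ring
      have d4 : -(n - 1) = 1 - n := by ring
      rw [d1] at h1
      rw [d2] at h2
      have n1 := hw0 (-n)
      have n2 := hw0 (1 - n)
      simp only [d3, d4]
      generalize w (-n) = W at *
      generalize w (1 - n) = W1 at *
      field_simp
      linear_combination υ * v (c - n) * h2 - Y * W * h1
  refine ⟨fun c => (∑ b, e (b - 0) * v' (c - b) * (w' (-b))⁻¹ * chi (-((b - 0) * c))) / v c, hII,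
    fun c => ?_⟩
  have h1 := star_two_rec' hξ hX hY hY' hw0' hυ' hυ hv' hw' he cond 0 c
  have h2 := hv c
  have n1 := hv0 c
  have n2 := hv0 (c - 1)
  have n3 := one_sub_mul_chi_ne_zero hξ1 c
  rw [sub_zero c] at h1
  simp only
  generalize ∑ b, e (b - 0) * v' (c - b) * (w' (-b))⁻¹ * chi (-((b - 0) * c)) = F at *
  generalize ∑ b, e (b - 0) * v' (c - 1 - b) * (w' (-b))⁻¹ * chi (-((b - 0) * (c - 1))) = F1 at *
  generalize v (c - 1) = V1 at *
  generalize v c = V at *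
  refine mul_right_cancel₀ n3 ?_
  rw [div_mul_eq_mul_div, div_mul_eq_mul_div, mul_div_assoc', div_mul_eq_mul_div, div_eq_div_iff n1 n2]
  linear_combination V1 * h1 - Y' * (X - ξ * chi (c - 1)) * F1 * h2

/-- The local operator of the product of two modified `Q`-operators. -/
def starKer (R v : ZMod N → ℂ) (q : ZMod N → ZMod N → ZMod N → ℂ) (c c' γ γ' : ZMod N) : ℂ :=
  ∑ β, R (β - c) * (v (c' - β) * chi (-(β * c'))) * q β γ γ'

/-- `e` is an auxiliary edge weight, created by one relation and absorbed by the other: the second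
relation expands the factor containing `v` and the third weight as a sum over `b`, and the first one
performs the sum over `β`. The weight of the second point is a spectator, which is why `x2`, `y2`
must be common to both sides. -/
theorem starKer_exchange {x2 y2 : ℂ} {x1 y1 x1' y1' x3 y3 x3' y3' : ℂ} {t t' : ZMod N → ℂ}
    (h1 : ∀ β b', ∑ b, R (b - β) * wFun N x1 y1 (-b) * e (b' - b) =
      t β * (R' (b' - β) * wFun N x1' y1' (-b')))
    (h2 : ∀ β c, ∑ b, e (b - β) * v' (c - b) * (wFun N x3' y3' (-b))⁻¹ * chi (-((b - β) * c)) =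
        t' c * (v (c - β) * (wFun N x3 y3 (-β))⁻¹)) (c c' γ γ' : ZMod N) :
    starKer R v (qLoc x1 y1 x2 y2 x3 y3) c c' γ γ' * t' (c' - γ') =
      t (c - γ) * starKer R' v' (qLoc x1' y1' x2 y2 x3' y3') c c' γ γ' := by
  have a1 : ∀ b', ∑ b, R (b - c) * wFun N x1 y1 (γ - b) * e (b' - b) =
      t (c - γ) * (R' (b' - c) * wFun N x1' y1' (γ - b')) := by
    intro b'
    have := h1 (c - γ) (b' - γ)
    rw [← Equiv.sum_comp (Equiv.subRight γ)] at this
    simp only [Equiv.subRight_apply] at this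
    have d1 : ∀ b, b - γ - (c - γ) = b - c := fun b => by ring
    have d2 : ∀ b, -(b - γ) = γ - b := fun b => by ring
    have d3 : ∀ b, b' - γ - (b - γ) = b' - b := fun b => by ring
    simpa only [d1, d2, d3] using this
  have a2 : ∀ β, ∑ b, e (b - β) * v' (c' - b) * (wFun N x3' y3' (γ' - b))⁻¹ *
      chi ((b - β) * (γ' - c')) = t' (c' - γ') * (v (c' - β) * (wFun N x3 y3 (γ' - β))⁻¹) := by
    intro β
    have := h2 (β - γ') (c' - γ')
    rw [← Equiv.sum_comp (Equiv.subRight γ')] at this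
    simp only [Equiv.subRight_apply] at this
    have d1 : ∀ b, b - γ' - (β - γ') = b - β := fun b => by ring
    have d2 : ∀ b, -(b - γ') = γ' - b := fun b => by ring
    have d3 : ∀ b, c' - γ' - (b - γ') = c' - b := fun b => by ring
    have d4 : ∀ b, -((b - β) * (c' - γ')) = (b - β) * (γ' - c') := fun b => by ring
    simpa only [d1, d2, d3, d4] using this
  have key : ∑ β, R (β - c) * wFun N x1 y1 (γ - β) * chi (β * (γ' - c')) *
      (t' (c' - γ') * (v (c' - β) * (wFun N x3 y3 (γ' - β))⁻¹)) =
      ∑ b, v' (c' - b) * (wFun N x3' y3' (γ' - b))⁻¹ * chi (b * (γ' - c')) *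
        (t (c - γ) * (R' (b - c) * wFun N x1' y1' (γ - b))) := by
    simp_rw [← a1, ← a2, Finset.mul_sum]
    rw [Finset.sum_comm]
    refine Finset.sum_congr rfl fun b _ => Finset.sum_congr rfl fun β _ => ?_
    have : chi (b * (γ' - c')) = chi (β * (γ' - c')) * chi ((b - β) * (γ' - c')) := by
      rw [← chi_add]; congr 1; ring
    rw [this]; ring
  have c1 : ∀ β, chi (-(β * c')) * chi ((β - γ) * γ') = chi (β * (γ' - c')) * chi (-(γ * γ')) := by
    intro β; rw [← chi_add, ← chi_add]; congr 1; ring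
  have e1 : starKer R v (qLoc x1 y1 x2 y2 x3 y3) c c' γ γ' * t' (c' - γ') =
      chi (-(γ * γ')) * wFun N x2 y2 (γ' - γ) *
      ∑ β, R (β - c) * wFun N x1 y1 (γ - β) * chi (β * (γ' - c')) *
      (t' (c' - γ') * (v (c' - β) * (wFun N x3 y3 (γ' - β))⁻¹)) := by
    rw [starKer, Finset.mul_sum, Finset.sum_mul]
    refine Finset.sum_congr rfl fun β _ => ?_
    rw [qLoc, div_eq_mul_inv]
    linear_combination R (β - c) * v (c' - β) * (wFun N x1 y1 (γ - β) * wFun N x2 y2 (γ' - γ) *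
      (wFun N x3 y3 (γ' - β))⁻¹) * t' (c' - γ') * c1 β
  have e2 : t (c - γ) * starKer R' v' (qLoc x1' y1' x2 y2 x3' y3') c c' γ γ' =
      chi (-(γ * γ')) * wFun N x2 y2 (γ' - γ) *
      ∑ b, v' (c' - b) * (wFun N x3' y3' (γ' - b))⁻¹ * chi (b * (γ' - c')) *
        (t (c - γ) * (R' (b - c) * wFun N x1' y1' (γ - b))) := by
    rw [starKer, Finset.mul_sum, Finset.mul_sum]
    refine Finset.sum_congr rfl fun β _ => ?_
    rw [qLoc, div_eq_mul_inv]
    linear_combination R' (β - c) * v' (c' - β) * (wFun N x1' y1' (γ - β) * wFun N x2 y2 (γ' - γ) *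
      (wFun N x3' y3' (γ' - β))⁻¹) * t (c - γ) * c1 β
  rw [e1, e2, key]

end Star

/-! ### Nonsingularity of the local factors -/

section Local

variable {N : ℕ} [NeZero N]

/-- The twisted circulant matrix of a point of the Fermat curve is nonsingular. -/
theorem eq_zero_of_twisted {x y : ℂ} (h : Fermat N x y) {f : ZMod N → ℂ}
    (hf : ∀ β, ∑ b, chi (-(β * b)) * wFun N x y (b - β) * f b = 0) (b : ZMod N) : f b = 0 := by
  -- The kernel is stable under multiplication by `χ(-b)`: the recursion of `w` expresses the new
  -- sum by the rows `β` and `β + 1` of the old one. Hence all Fourier coefficients of `w(b) f(b)`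
  -- in the row `β = 0` vanish.
  have key : ∀ g : ZMod N → ℂ, (∀ β, ∑ b, chi (-(β * b)) * wFun N x y (b - β) * g b = 0) →
      ∀ β, ∑ b, chi (-(β * b)) * wFun N x y (b - β) * (chi (-b) * g b) = 0 := by
    intro g hg β
    have h1 := hg (β + 1)
    have h2 := hg β
    have : ∑ b, chi (-(β * b)) * wFun N x y (b - β) * (chi (-b) * g b) =
        y * (∑ b, chi (-((β + 1) * b)) * wFun N x y (b - (β + 1)) * g b) + x * chi (-β) *
          ∑ b, chi (-(β * b)) * wFun N x y (b - β) * g b := by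
      rw [Finset.mul_sum, Finset.mul_sum, ← Finset.sum_add_distrib]
      refine Finset.sum_congr rfl fun b _ => ?_
      have r := h.wFun_rec (b - β)
      have c1 : chi (-((β + 1) * b)) = chi (-(β * b)) * chi (-b) := by
        rw [← chi_add]; congr 1; ring
      have c2 : chi (-b) * chi (b - β) = chi (-β) := by rw [← chi_add]; congr 1; ring
      have d : b - (β + 1) = b - β - 1 := by ring
      rw [c1, d, ← c2]
      linear_combination (chi (-(β * b)) * chi (-b) * g b) * r
    rw [this, h1, h2]; simp
  have hj : ∀ j : ℕ, ∀ β, ∑ b, chi (-(β * b)) * wFun N x y (b - β) * (chi (-((j : ZMod N) * b)) * f b) = 0 := by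
    intro j
    induction j with
    | zero => simpa using hf
    | succ j ih =>
      intro β
      rw [← key _ ih β]
      refine Finset.sum_congr rfl fun b _ => ?_
      have : chi (-(((j + 1 : ℕ) : ZMod N) * b)) = chi (-b) * chi (-((j : ZMod N) * b)) := by
        rw [← chi_add]; congr 1; push_cast; ring
      rw [this]; ring
  have h0 : wFun N x y (b - 0) * f b = 0 := by
    refine eq_zero_of_fourier (f := fun b => wFun N x y (b - 0) * f b) (fun n => ?_) b
    rw [← hj (-n).val 0]
    refine Finset.sum_congr rfl fun b _ => ?_
    rw [ZMod.natCast_zmod_val]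
    have : -(-n * b) = b * n := by ring
    rw [this]
    simp
    ring
  exact (mul_eq_zero.mp h0).resolve_left (h.wFun_ne_zero _)

variable {x1 y1 x2 y2 x3 y3 : ℂ}

/-- With left spin `0` the first and third weights only rescale rows and columns by nonzero numbers;
what is left is the twisted circulant matrix of the second point. -/
theorem eq_zero_of_qLoc (h1 : Fermat N x1 y1) (h2 : Fermat N x2 y2) (h3 : Fermat N x3 y3)
    {f : ZMod N → ℂ} (hf : ∀ β, ∑ b, qLoc x1 y1 x2 y2 x3 y3 0 β b * f b = 0) (b : ZMod N) :
    f b = 0 := by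
  have : (wFun N x3 y3 b)⁻¹ * f b = 0 := by
    refine eq_zero_of_twisted h2 (f := fun b => (wFun N x3 y3 b)⁻¹ * f b) (fun β => ?_) b
    have := hf β
    refine (mul_eq_zero.mp (?_ : wFun N x1 y1 β * _ = 0)).resolve_left (h1.wFun_ne_zero β)
    rw [← this, Finset.mul_sum]
    refine Finset.sum_congr rfl fun b _ => ?_
    rw [qLoc]
    simp only [zero_sub, sub_zero, neg_mul]
    ring
  exact (mul_eq_zero.mp this).resolve_left (inv_ne_zero (h3.wFun_ne_zero _))

/-- The matrix of the local factor of the `Q`-operator with fixed left spin. -/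
def qMat (x1 y1 x2 y2 x3 y3 : ℂ) (a : ZMod N) : Matrix (ZMod N) (ZMod N) ℂ :=
  Matrix.of fun b b' => qLoc x1 y1 x2 y2 x3 y3 a b b'

theorem det_qMat_ne_zero (h1 : Fermat N x1 y1) (h2 : Fermat N x2 y2) (h3 : Fermat N x3 y3) :
    (qMat (N := N) x1 y1 x2 y2 x3 y3 0).det ≠ 0 := by
  rw [← isUnit_iff_ne_zero, ← Matrix.isUnit_iff_isUnit_det, ← Matrix.mulVec_injective_iff_isUnit,
    ← Matrix.coe_mulVecLin, injective_iff_map_eq_zero]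
  intro f hf
  funext b
  exact eq_zero_of_qLoc h1 h2 h3 (fun β => congrFun hf β) b

theorem norm_chi (n : ZMod N) : ‖chi n‖ = 1 := by
  have h : ‖chi n‖ ^ N = 1 := by rw [← norm_pow, chi_pow_card, norm_one]
  exact (pow_eq_one_iff_of_nonneg (norm_nonneg _) (NeZero.ne N)).mp h

/-- Translating all spins by `a` reindexes the matrix and multiplies its rows by phases, so the
modulus of the determinant does not depend on the left spin. -/
theorem norm_det_qMat (a : ZMod N) :
    ‖(qMat x1 y1 x2 y2 x3 y3 a).det‖ = ‖(qMat (N := N) x1 y1 x2 y2 x3 y3 0).det‖ := by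
  have : qMat x1 y1 x2 y2 x3 y3 a = Matrix.of fun b b' => chi ((a - b) * a) *
      (Matrix.reindex (Equiv.addRight a) (Equiv.addRight a) (qMat (N := N) x1 y1 x2 y2 x3 y3 0)) b b' := by
    ext b b'
    simp only [qMat, qLoc, Matrix.of_apply, Matrix.reindex_apply, Matrix.submatrix_apply,
      Equiv.addRight_symm, Equiv.coe_addRight, ← sub_eq_add_neg]
    have c : chi ((a - b) * b') = chi ((a - b) * a) * chi ((0 - (b - a)) * (b' - a)) := by
      rw [← chi_add]; congr 1; ring
    have d : b' - a - (b - a) = b' - b := by ring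
    rw [c, d, sub_zero, sub_zero]
    ring
  rw [this, Matrix.det_mul_column, Matrix.det_reindex_self, norm_mul, norm_prod]
  simp [norm_chi]

end Local

/-! ### Parameters of the exchange relation and their matching between neighbouring sites -/

section Exchange

variable {N M : ℕ} [NeZero N] [NeZero M] {κ : ℂ}

namespace Step

variable (S : Step N M κ)

def η (m : ZMod M) : ℂ := S.y1 m / S.y3 m

def υ (m : ZMod M) : ℂ := S.y2 m / S.y3 m

theorem η_ne (m : ZMod M) : S.η m ≠ 0 := div_ne_zero (S.f1 m).ne (S.f3 m).ne

theorem υ_ne (m : ZMod M) : S.υ m ≠ 0 := div_ne_zero (S.f2 m).ne (S.f3 m).ne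

theorem gauge' (m : ZMod M) :
    S.w (m + 1) * S.υ (m + 1) * S.u m = S.u' m * S.υ m * S.w' (m + 1) := by
  have h := S.gauge m
  have h1 := S.w'_ne (m + 1)
  have h2 := S.u_ne m
  change S.w (m + 1) / S.w' (m + 1) * S.υ (m + 1) = S.u' m / S.u m * S.υ m at h
  rw [div_mul_eq_mul_div, div_mul_eq_mul_div, div_eq_div_iff h1 h2] at h
  exact h

theorem x1_eq' (hκ : κ ≠ 0) (m : ZMod M) :
    S.x1 m = S.δ * S.u' m / (omHalf N * κ * S.u m) := by
  rw [eq_div_iff (mul_ne_zero (mul_ne_zero omHalf_ne_zero hκ) (S.u_ne m)), S.x1_eq]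

theorem x2_eq' (m : ZMod M) : S.x2 m = κ * S.u' (m + 1) / (omHalf N * S.u' m) := by
  rw [eq_div_iff (mul_ne_zero omHalf_ne_zero (S.u'_ne m)), S.x2_eq]

theorem x3_eq' (m : ZMod M) : S.x3 m = S.δ * S.u' (m + 1) / (omHalf N ^ 2 * S.u m) := by
  rw [eq_div_iff (mul_ne_zero (pow_ne_zero 2 omHalf_ne_zero) (S.u_ne m)), omHalf_sq, S.x3_eq]

theorem x3_eq_mul (hκ : κ ≠ 0) (m : ZMod M) : S.x3 m = S.x1 m * S.x2 m := by
  rw [S.x1_eq' hκ, S.x2_eq', S.x3_eq']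
  have := S.u'_ne m
  have := S.u_ne m
  have := omHalf_ne_zero (N := N)
  field_simp

theorem η_eq (hκ : κ ≠ 0) (m : ZMod M) : S.η m = S.μ / (κ * S.w m * S.u' (m + 1)) := by
  have h1 := S.w_ne m
  have h2 := S.u'_ne (m + 1)
  rw [η, div_eq_div_iff (S.f3 m).ne (mul_ne_zero (mul_ne_zero hκ h1) h2), S.y13]

theorem μ_ne (hκ : κ ≠ 0) : S.μ ≠ 0 := by
  intro h
  have h1 := S.y13 0
  rw [h, zero_mul] at h1
  exact mul_ne_zero (S.f1 0).ne (mul_ne_zero (mul_ne_zero hκ (S.w_ne 0)) (S.u'_ne _)) h1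

theorem y1_eq (m : ZMod M) : S.y1 m = S.η m * S.y3 m := (div_mul_cancel₀ _ (S.f3 m).ne).symm

theorem y3_eq (m : ZMod M) : S.y3 m = S.y2 m / S.υ m := by
  have := (S.f2 m).ne
  have := (S.f3 m).ne
  rw [υ]; field_simp

theorem x1_ne (hκ : κ ≠ 0) (hδ : S.δ ≠ 0) (m : ZMod M) : S.x1 m ≠ 0 := by
  rw [S.x1_eq' hκ]
  exact div_ne_zero (mul_ne_zero hδ (S.u'_ne m))
    (mul_ne_zero (mul_ne_zero omHalf_ne_zero hκ) (S.u_ne m))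

theorem x2_ne (hκ : κ ≠ 0) (m : ZMod M) : S.x2 m ≠ 0 := by
  rw [S.x2_eq']
  exact div_ne_zero (mul_ne_zero hκ (S.u'_ne _)) (mul_ne_zero omHalf_ne_zero (S.u'_ne m))

/-- With `x3 = x1 * x2` the three Fermat equations combine into the period condition for the Fourier
image `R`. In the same way `fermat_xi` provides the Fermat point whose weight is the other factor
`v`. -/
theorem zeta_pow (hκ : κ ≠ 0) (m : ZMod M) : (S.x1 m * S.υ m) ^ N = 1 - S.η m ^ N := by
  have h1 := (S.f1 m).eq
  have h2 := (S.f2 m).eq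
  have h3 := (S.f3 m).eq
  have hx := congrArg (· ^ N) (S.x3_eq_mul hκ m)
  simp only [mul_pow] at hx
  have n3 := pow_ne_zero N (S.f3 m).ne
  rw [mul_pow, υ, η, div_pow, div_pow, eq_sub_iff_add_eq, mul_div_assoc', ← add_div, div_eq_one_iff_eq n3]
  linear_combination h1 - h3 + S.x1 m ^ N * h2 + hx

theorem fermat_xi (hκ : κ ≠ 0) (m : ZMod M) : Fermat N (S.x2 m * S.η m) (S.υ m) := by
  refine ⟨?_, S.υ_ne m⟩
  have h1 := (S.f1 m).eq
  have h2 := (S.f2 m).eq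
  have h3 := (S.f3 m).eq
  have hx := congrArg (· ^ N) (S.x3_eq_mul hκ m)
  simp only [mul_pow] at hx
  have n3 := pow_ne_zero N (S.f3 m).ne
  rw [mul_pow, υ, η, div_pow, div_pow, mul_div_assoc', ← add_div, div_eq_one_iff_eq n3]
  linear_combination S.x2 m ^ N * h1 + h2 - h3 + hx

theorem η_pow_ne_one (hκ : κ ≠ 0) (hδ : S.δ ≠ 0) (m : ZMod M) : S.η m ^ N ≠ 1 := by
  intro h
  have := S.zeta_pow hκ m
  rw [h, sub_self] at this
  exact pow_ne_zero N (mul_ne_zero (S.x1_ne hκ hδ m) (S.υ_ne m)) this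

/-- The matrix of the local factor with vanishing left spin. -/
def q0 (m : ZMod M) : Matrix (ZMod N) (ZMod N) ℂ :=
  qMat (S.x1 m) (S.y1 m) (S.x2 m) (S.y2 m) (S.x3 m) (S.y3 m) 0

/-- A measure of the normalisation of the `Q`-operator. -/
def rho : ℝ := ∏ m, ‖(S.q0 m).det‖

/-- A `Q`-operator may be singular, but its local blocks are not. Scaling the blocks by numbers `k
m` multiplies `rho` by `‖∏ k m‖ ^ N`, so `rho` measures scalar factors even where the determinant of
`Q` is of no help. -/
theorem rho_pos : 0 < S.rho :=
  Finset.prod_pos fun m _ => norm_pos_iff.mpr (det_qMat_ne_zero (S.f1 m) (S.f2 m) (S.f3 m))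

/-- The Fourier image `R` of the local factor. -/
theorem exists_fourier (hκ : κ ≠ 0) (hδ : S.δ ≠ 0) (m : ZMod M) :
    ∃ (R : ZMod N → ℂ) (C : ℂ), C ≠ 0 ∧ (∀ j, R j ≠ 0) ∧
      (∀ j, R j * (1 - S.η m * chi (-j)) = S.x1 m * S.υ m * R (j - 1)) ∧
      ∀ a b b', qLoc (S.x1 m) (S.y1 m) (S.x2 m) (S.y2 m) (S.x3 m) (S.y3 m) a b b' =
        C * ∑ c, chi (a * c) * (wFun N (S.x2 m * S.η m) (S.υ m) (c - b) * chi (-(b * c))) *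
          R (b' - c) := by
  obtain ⟨R, hR0, hR⟩ := exists_rec (N := N) (z := S.x1 m * S.υ m) (p := 0) (q := S.η m)
    (S.η_pow_ne_one hκ hδ m) (by rw [zero_pow (NeZero.ne N), S.zeta_pow hκ]; ring)
  simp only [zero_mul, sub_zero, mul_one] at hR
  have hζ := mul_ne_zero (S.x1_ne hκ hδ m) (S.υ_ne m)
  have hRn : ∀ j, R j ≠ 0 := by
    intro j hj
    have : R 0 = 0 := eq_of_rec (n₀ := j) (f := R) (g := fun _ => 0)
      (a := fun k => 1 - S.η m * chi (-k)) (b := fun _ => S.x1 m * S.υ m)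
      (fun n => one_sub_mul_chi_ne_zero (S.η_pow_ne_one hκ hδ m) _) hR (by simp) hj 0
    rw [hR0] at this
    exact one_ne_zero this
  obtain ⟨C, hC, h⟩ := star_fourier (S.f1 m) (S.f2 m) (S.f3 m) (S.x3_eq_mul hκ m) hR0
    (wFun_zero (S.x2 m * S.η m) (S.υ m)) hR (S.fermat_xi hκ m).wFun_rec
  refine ⟨R, C, hC, hRn, hR, fun a b b' => ?_⟩
  have e := h (b - a) (b' - b)
  have d : b - a + (b' - b) = b' - a := by ring
  rw [d] at e
  rw [qLoc, e, ← mul_assoc, mul_comm _ C, mul_assoc, Finset.mul_sum,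
    ← Equiv.sum_comp (Equiv.subLeft b')]
  congr 1
  refine Finset.sum_congr rfl fun c _ => ?_
  simp only [Equiv.subLeft_apply]
  have d1 : b' - b - (b' - c) = c - b := by ring
  have c1 : chi ((a - b) * b') * chi ((b' - c) * (b - a)) = chi (a * c) * chi (-(b * c)) := by
    rw [← chi_add, ← chi_add]; congr 1; ring
  rw [d1]
  linear_combination R (b' - c) * wFun N (S.x2 m * S.η m) (S.υ m) (c - b) * c1

end Step

/-- Two pairs of steps with common ends and interchanged spectral parameters. -/
structure Exchange (S S' H H' : Step N M κ) : Prop where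
  start_u : H.u = S.u
  start_w : H.w = S.w
  mid_u : S'.u = S.u'
  mid_w : S'.w = S.w'
  mid_u' : H'.u = H.u'
  mid_w' : H'.w = H.w'
  fin_u : H'.u' = S'.u'
  δ_eq : H.δ = S'.δ
  δ_eq' : H'.δ = S.δ
  μ_eq : H.μ = S'.μ
  μ_eq' : H'.μ = S.μ
  υ_eq : ∀ m, S.υ m * S'.υ m = H.υ m * H'.υ m
  y2_eq : H'.y2 = S'.y2
  gen1 : ∀ m, H.η m ^ N ≠ S.η m ^ N
  gen2 : ∀ m, H.η m ^ N ≠ H'.x1 (m + 1) ^ N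
  κ_ne : κ ≠ 0
  δ_ne : S.δ ≠ 0
  δ_ne' : S'.δ ≠ 0

namespace Exchange

variable {S S' H H' : Step N M κ} (E : Exchange S S' H H')

include E

theorem x2_eq (m : ZMod M) : H'.x2 m = S'.x2 m := by
  rw [H'.x2_eq', S'.x2_eq', E.fin_u]

theorem eta_ratio (m : ZMod M) : H.η m / S.η m =
    H.x2 (m + 1) * H.η (m + 1) / (S.x2 (m + 1) * S.η (m + 1)) := by
  have hκ := E.κ_ne
  simp only [H.η_eq hκ, S.η_eq hκ, H.x2_eq', S.x2_eq', E.start_w, E.μ_eq]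
  have := S.w_ne m
  have := S.w_ne (m + 1)
  have := S.u'_ne (m + 1)
  have := H.u'_ne (m + 1)
  have := S.u'_ne (m + 1 + 1)
  have := H.u'_ne (m + 1 + 1)
  have := S.μ_ne hκ
  have := S'.μ_ne hκ
  have := omHalf_ne_zero (N := N)
  field_simp

theorem x_ratio (m : ZMod M) : H'.x1 m / S'.x1 m = H'.x3 m / S'.x3 m := by
  have hκ := E.κ_ne
  have := S'.x2_ne hκ m
  rw [H'.x3_eq_mul hκ, S'.x3_eq_mul hκ, E.x2_eq, mul_div_mul_right _ _ this]

theorem υ_ratio (m : ZMod M) : S.υ m / S'.y3 m = H.υ m / H'.y3 m := by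
  rw [S'.y3_eq, H'.y3_eq, E.y2_eq, div_div_eq_mul_div, div_div_eq_mul_div, E.υ_eq]

/-- This is the hypothesis `cond` of the first star-triangle relation. It results from the gauge
relations of `S` and `H` at `m` combined with `υ_eq` at `m + 1`. -/
theorem cond_one (m : ZMod M) :
    H.x1 m * H.υ m * H'.x1 (m + 1) * S'.y1 (m + 1) * S.η m =
      S'.x1 (m + 1) * (S.x1 m * S.υ m) * H'.y1 (m + 1) * H.η m := by
  have hκ := E.κ_ne
  have g1 := S.gauge' m
  have g2 := H.gauge' m
  have hυ := E.υ_eq (m + 1)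
  rw [S'.y1_eq, H'.y1_eq, S'.y3_eq, H'.y3_eq]
  simp only [H.η_eq hκ, S.η_eq hκ, H'.η_eq hκ, S'.η_eq hκ, H.x1_eq' hκ, S.x1_eq' hκ,
    H'.x1_eq' hκ, S'.x1_eq' hκ, E.start_w, E.start_u, E.mid_u, E.mid_u', E.mid_w, E.mid_w', E.fin_u,
    E.δ_eq, E.δ_eq', E.μ_eq, E.μ_eq', E.y2_eq] at g2 ⊢
  have a1 := S.w_ne m
  have a2 := S.w'_ne (m + 1)
  have a3 := H.w'_ne (m + 1)
  have a4 := S.u'_ne (m + 1)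
  have a5 := H.u'_ne (m + 1)
  have a6 := S'.u'_ne (m + 1 + 1)
  have a7 := omHalf_ne_zero (N := N)
  have a8 := S.u_ne m
  have a9 := S'.υ_ne (m + 1)
  have a10 := H'.υ_ne (m + 1)
  have a11 := S.w_ne (m + 1)
  field_simp
  have key : H.u' m * H.υ m * H.w' (m + 1) * H'.υ (m + 1) =
      S.u' m * S.υ m * S.w' (m + 1) * S'.υ (m + 1) := by
    rw [← g1, ← g2]
    linear_combination -S.w (m + 1) * S.u m * hυ
  linear_combination S'.δ * S.δ * S'.u' (m + 1) * S'.μ * S'.y2 (m + 1) * S.μ * key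

/-- Together with `eta_ratio` and `x_ratio` it shows that the edge weight required by the first
relation at `m` is the one required by the second relation at `m + 1`, so a single function serves
both. -/
theorem eps_ratio (m : ZMod M) : H.x1 m * H.υ m / H'.y1 (m + 1) =
    S.υ (m + 1) * S'.x3 (m + 1) / (S'.y3 (m + 1) * (S.x2 (m + 1) * S.η (m + 1))) := by
  have hκ := E.κ_ne
  have g2 := H.gauge' m
  have hυ := E.υ_eq (m + 1)
  rw [H'.y1_eq, S'.y3_eq, H'.y3_eq]
  simp only [S.η_eq hκ, H'.η_eq hκ, H.x1_eq' hκ, S'.x3_eq', S.x2_eq', E.start_w, E.start_u, E.mid_u,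
    E.mid_w', E.fin_u, E.δ_eq, E.μ_eq', E.y2_eq] at g2 ⊢
  have a2 := S.w_ne (m + 1)
  have a3 := H.w'_ne (m + 1)
  have a4 := S.u'_ne (m + 1)
  have a5 := S.u'_ne (m + 1 + 1)
  have a6 := S'.u'_ne (m + 1 + 1)
  have a7 := omHalf_ne_zero (N := N)
  have a8 := S.u_ne m
  have a9 := S'.υ_ne (m + 1)
  have a10 := H'.υ_ne (m + 1)
  have a11 := (S'.f2 (m + 1)).ne
  have a12 := S.μ_ne hκ
  field_simp
  linear_combination S'.δ * ((-H'.υ (m + 1)) * g2 - S.w (m + 1) * S.u m * hυ)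

/-- With `tau_ratio'` and `tau_coef` it makes the recursions of the two proportionality factors at a
site identical. -/
theorem tau_ratio (m : ZMod M) : S.η m / S'.x1 (m + 1) = S.x2 m * S.η m / S'.x3 m := by
  have hκ := E.κ_ne
  rw [S'.x1_eq' hκ, S.x2_eq', S'.x3_eq', E.mid_u]
  have a4 := S.u'_ne (m + 1)
  have a6 := S'.u'_ne (m + 1)
  have a7 := omHalf_ne_zero (N := N)
  have a8 := S.u'_ne m
  have a12 := E.δ_ne'
  field_simp

theorem tau_ratio' (m : ZMod M) : H.η m / H'.x1 (m + 1) = H.x2 m * H.η m / H'.x3 m := by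
  have hκ := E.κ_ne
  rw [H'.x1_eq' hκ, H.x2_eq', H'.x3_eq', E.mid_u', E.δ_eq']
  have a4 := H.u'_ne (m + 1)
  have a6 := H'.u'_ne (m + 1)
  have a7 := omHalf_ne_zero (N := N)
  have a8 := H.u'_ne m
  have a12 := E.δ_ne
  field_simp

theorem tau_coef (m : ZMod M) : H.x1 m * H.υ m * (S'.y3 m * H'.x3 m) =
    S.x1 m * S.υ m * (H'.y3 m * S'.x3 m) := by
  have hκ := E.κ_ne
  have h := E.υ_ratio m
  rw [div_eq_div_iff (S'.f3 m).ne (H'.f3 m).ne] at h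
  simp only [H.x1_eq' hκ, S.x1_eq' hκ, S'.x3_eq', H'.x3_eq', E.start_u, E.mid_u, E.mid_u', E.fin_u,
    E.δ_eq, E.δ_eq']
  have a4 := S.u'_ne m
  have a6 := H.u'_ne m
  have a7 := omHalf_ne_zero (N := N)
  have a8 := S.u_ne m
  field_simp
  linear_combination -(S'.δ * S.δ * S'.u' (m + 1)) * h

/-- `gen1` keeps the leading coefficient of the recursion from vanishing. The period condition is
the `N`-th power of `υ_ratio`, rewritten by four Fermat equations. -/
theorem exists_edge (m : ZMod M) : ∃ e : ZMod N → ℂ, e 0 = 1 ∧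
    ∀ k, e k * (1 - H.x2 m * H.η m / (S.x2 m * S.η m) * chi (-k)) =
      S.υ m * S'.x3 m / (S'.y3 m * (S.x2 m * S.η m)) *
        (1 - om N * H'.x3 m / S'.x3 m * chi (-k)) * e (k - 1) := by
  have hκ := E.κ_ne
  have hξ := mul_ne_zero (S.x2_ne hκ m) (S.η_ne m)
  have hX : S'.x3 m ≠ 0 := by
    rw [S'.x3_eq_mul hκ]; exact mul_ne_zero (S'.x1_ne hκ E.δ_ne' m) (S'.x2_ne hκ m)
  refine exists_rec ?_ ?_
  · have := E.eta_ratio (m - 1)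
    rw [sub_add_cancel] at this
    rw [← this, div_pow, Ne, div_eq_one_iff_eq (pow_ne_zero N (S.η_ne _))]
    exact E.gen1 _
  · have f1 := (S.fermat_xi hκ m).eq
    have f2 := (H.fermat_xi hκ m).eq
    have f3 := (S'.f3 m).eq
    have f4 := (H'.f3 m).eq
    have h := E.υ_ratio m
    have n1 := (S'.f3 m).ne
    have n2 := (H'.f3 m).ne
    rw [div_eq_div_iff n1 n2] at h
    have h := congrArg (· ^ N) h
    simp only [mul_pow (S.υ m), mul_pow (H.υ m)] at h
    have o : (om N * H'.x3 m / S'.x3 m) ^ N = H'.x3 m ^ N / S'.x3 m ^ N := by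
      rw [div_pow, mul_pow, om_pow_card, one_mul]
    rw [o, div_pow, div_pow, mul_pow (S.υ m), mul_pow (S'.y3 m)]
    have m1 := pow_ne_zero N hξ
    have m2 := pow_ne_zero N hX
    have m3 := pow_ne_zero N n1
    generalize (S.x2 m * S.η m) ^ N = a1 at *
    generalize (H.x2 m * H.η m) ^ N = a2 at *
    generalize S'.x3 m ^ N = a3 at *
    generalize H'.x3 m ^ N = a4 at *
    have i1 : S.υ m ^ N = 1 - a1 := by linear_combination f1
    have i2 : H.υ m ^ N = 1 - a2 := by linear_combination f2
    have i3 : S'.y3 m ^ N = 1 - a3 := by linear_combination f3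
    have i4 : H'.y3 m ^ N = 1 - a4 := by linear_combination f4
    rw [i1, i2, i3, i4] at h
    rw [i3] at m3
    rw [i1, i3]
    field_simp
    linear_combination h

theorem exists_star (m : ZMod M) {R R' e₁ : ZMod N → ℂ}
    (hR : ∀ j, R j * (1 - S.η m * chi (-j)) = S.x1 m * S.υ m * R (j - 1))
    (hR' : ∀ j, R' j * (1 - H.η m * chi (-j)) = H.x1 m * H.υ m * R' (j - 1))
    (hR0 : ∀ j, R' j ≠ 0)
    (he : ∀ k, e₁ k * (1 - H.x2 (m + 1) * H.η (m + 1) / (S.x2 (m + 1) * S.η (m + 1)) * chi (-k)) =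
      S.υ (m + 1) * S'.x3 (m + 1) / (S'.y3 (m + 1) * (S.x2 (m + 1) * S.η (m + 1))) *
        (1 - om N * H'.x3 (m + 1) / S'.x3 (m + 1) * chi (-k)) * e₁ (k - 1)) :
    ∃ t : ZMod N → ℂ,
      (∀ β b', ∑ b, R (b - β) * wFun N (S'.x1 (m + 1)) (S'.y1 (m + 1)) (-b) * e₁ (b' - b) =
        t β * (R' (b' - β) * wFun N (H'.x1 (m + 1)) (H'.y1 (m + 1)) (-b'))) ∧
      ∀ β, t β * (S.x1 m * S.υ m * (1 - H.η m / H'.x1 (m + 1) * chi (β - 1))) =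
        H.x1 m * H.υ m * (1 - S.η m / S'.x1 (m + 1) * chi (β - 1)) * t (β - 1) := by
  have hκ := E.κ_ne
  have hδH : H.δ ≠ 0 := E.δ_eq ▸ E.δ_ne'
  have hδH' : H'.δ ≠ 0 := E.δ_eq' ▸ E.δ_ne
  refine star_one (S.η_ne m) (mul_ne_zero (S.x1_ne hκ E.δ_ne m) (S.υ_ne m))
    (S'.x1_ne hκ E.δ_ne' _) (H'.x1_ne hκ hδH' _) (H'.f1 _).ne hR hR' hR0
    (H.η_pow_ne_one hκ hδH m) (S'.f1 _).wFun_rec (H'.f1 _).wFun_rec (wFun_zero _ _) (fun k => ?_)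
    (E.cond_one m)
  rw [E.eta_ratio, mul_div_assoc (om N), E.x_ratio, E.eps_ratio, ← mul_div_assoc]
  exact he k

theorem exists_star' (m : ZMod M) {e : ZMod N → ℂ}
    (he : ∀ k, e k * (1 - H.x2 m * H.η m / (S.x2 m * S.η m) * chi (-k)) =
      S.υ m * S'.x3 m / (S'.y3 m * (S.x2 m * S.η m)) *
        (1 - om N * H'.x3 m / S'.x3 m * chi (-k)) * e (k - 1)) :
    ∃ t : ZMod N → ℂ,
      (∀ β c, ∑ b, e (b - β) * wFun N (H.x2 m * H.η m) (H.υ m) (c - b) *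
        (wFun N (H'.x3 m) (H'.y3 m) (-b))⁻¹ * chi (-((b - β) * c)) =
        t c * (wFun N (S.x2 m * S.η m) (S.υ m) (c - β) * (wFun N (S'.x3 m) (S'.y3 m) (-β))⁻¹)) ∧
      ∀ c, t c * (S'.y3 m * (H'.x3 m - H.x2 m * H.η m * chi (c - 1))) =
        H'.y3 m * (S'.x3 m - S.x2 m * S.η m * chi (c - 1)) * t (c - 1) := by
  have hκ := E.κ_ne
  have hξ := mul_ne_zero (S.x2_ne hκ m) (S.η_ne m)
  have hX : S'.x3 m ≠ 0 := by
    rw [S'.x3_eq_mul hκ]; exact mul_ne_zero (S'.x1_ne hκ E.δ_ne' m) (S'.x2_ne hκ m)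
  exact star_two hξ hX (S'.f3 m).ne (H'.f3 m).ne (H.υ_ne m) (S.υ_ne m)
    (S'.f3 m).wFun_ne_zero (H'.f3 m).wFun_ne_zero (S.fermat_xi hκ m).wFun_ne_zero (wFun_zero _ _)
    (S'.f3 m).pow_ne_one (S.fermat_xi hκ m).pow_ne_one (S.fermat_xi hκ m).wFun_rec
    (S'.f3 m).wFun_rec (H.fermat_xi hκ m).wFun_rec (H'.f3 m).wFun_rec he (E.υ_ratio m)

end Exchange

end Exchange

/-! ### The exchange relation for `Q`-operators, with control of the scalar -/

section Exchange

open scoped Kronecker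

variable {N M : ℕ} [NeZero N] [NeZero M] {κ : ℂ}

/-- The local operator of a product of two `Q`-operators as a matrix. -/
def kerMat (R v : ZMod N → ℂ) (q : ZMod N → ZMod N → ZMod N → ℂ) :
    Matrix (ZMod N × ZMod N) (ZMod N × ZMod N) ℂ :=
  Matrix.of fun p p' => starKer R v q p.2 p'.2 p.1 p'.1

def convMat (R : ZMod N → ℂ) : Matrix (ZMod N) (ZMod N) ℂ := Matrix.of fun c b => R (b - c)

def twistMat (v : ZMod N → ℂ) : Matrix (ZMod N) (ZMod N) ℂ :=
  Matrix.of fun b c => v (c - b) * chi (-(b * c))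

/-- With the middle spin as an extra index the kernel factors into a convolution, a block diagonal
matrix and a twisted convolution, the outer two acting on one tensor factor only. -/
theorem kerMat_det (R v : ZMod N → ℂ) (q : ZMod N → ZMod N → ZMod N → ℂ) :
    (kerMat R v q).det = (convMat R).det ^ N * (∏ b, (Matrix.of (q b)).det) *
      (twistMat v).det ^ N := by
  have : kerMat R v q = (1 : Matrix (ZMod N) (ZMod N) ℂ) ⊗ₖ convMat R *
      Matrix.blockDiagonal (fun b => Matrix.of (q b)) *
      (1 : Matrix (ZMod N) (ZMod N) ℂ) ⊗ₖ twistMat v := by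
    ext ⟨γ, c⟩ ⟨γ', c'⟩
    simp only [kerMat, starKer, Matrix.mul_apply, Fintype.sum_prod_type, Matrix.of_apply,
      Matrix.blockDiagonal_apply, Matrix.kroneckerMap_apply, Matrix.one_apply, convMat, twistMat,
      ite_mul, one_mul, zero_mul, mul_ite, mul_zero, Finset.sum_ite_eq, Finset.sum_ite_eq',
      Finset.mem_univ, if_true, Finset.sum_ite_irrel, Finset.sum_const_zero]
    refine Finset.sum_congr rfl fun b _ => ?_
    ring
  rw [this, Matrix.det_mul, Matrix.det_mul, Matrix.det_kronecker, Matrix.det_kronecker,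
    Matrix.det_blockDiagonal]
  simp [ZMod.card]

namespace Step

variable (S S' : Step N M κ)

/-- The local factors of the `Q`-operator. -/
def q (m : ZMod M) : ZMod N → ZMod N → ZMod N → ℂ :=
  qLoc (S.x1 m) (S.y1 m) (S.x2 m) (S.y2 m) (S.x3 m) (S.y3 m)

def v (m : ZMod M) : ZMod N → ℂ := wFun N (S.x2 m * S.η m) (S.υ m)

variable {S}

theorem norm_det_q (m : ZMod M) (a : ZMod N) : ‖(Matrix.of (S.q m a)).det‖ = ‖(S.q0 m).det‖ :=
  norm_det_qMat a

variable {R : ZMod M → ZMod N → ℂ} {C : ZMod M → ℂ}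
  (h : ∀ m a b b', S.q m a b b' =
    C m * ∑ c, chi (a * c) * (S.v m (c - b) * chi (-(b * c))) * R m (b' - c))

include h

/-- Once the Fourier variables `c` of the first operator are fixed, the sum over the intermediate
spins factorises over the sites. -/
theorem Q_mul (α γ : Conf N M) : (S.Q * S'.Q) α γ = (∏ m, C m) *
    ∑ c : Conf N M, (∏ m, chi (α m * c m)) *
      ∏ m, starKer (R m) (S.v (m + 1)) (S'.q (m + 1)) (c m) (c (m + 1)) (γ (m + 1))
        (γ (m + 1 + 1)) := by
  have e1 : ∀ β : Conf N M, S.Q α β * S'.Q β γ = (∏ m, C m) * ∑ c : Conf N M,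
      (∏ m, chi (α m * c m)) * ∏ m, R m (β (m + 1) - c m) *
        (S.v (m + 1) (c (m + 1) - β (m + 1)) * chi (-(β (m + 1) * c (m + 1)))) *
        S'.q (m + 1) (β (m + 1)) (γ (m + 1)) (γ (m + 1 + 1)) := by
    intro β
    have : S.Q α β = (∏ m, C m) * ∑ c : Conf N M, ∏ m, chi (α m * c m) *
        (S.v m (c m - β m) * chi (-(β m * c m))) * R m (β (m + 1) - c m) := by
      have hs := Finset.prod_univ_sum (fun _ : ZMod M => (Finset.univ : Finset (ZMod N)))
        (fun m c => chi (α m * c) * (S.v m (c - β m) * chi (-(β m * c))) * R m (β (m + 1) - c))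
      rw [Fintype.piFinset_univ] at hs
      rw [← hs, ← Finset.prod_mul_distrib]
      exact Finset.prod_congr rfl fun m _ => h m _ _ _
    rw [this, mul_assoc, Finset.sum_mul]
    congr 1
    refine Finset.sum_congr rfl fun c _ => ?_
    have : S'.Q β γ = ∏ m, S'.q (m + 1) (β (m + 1)) (γ (m + 1)) (γ (m + 1 + 1)) := by
      rw [prod_shift fun m => S'.q m (β m) (γ m) (γ (m + 1))]; rfl
    rw [this]
    simp only [Finset.prod_mul_distrib]
    rw [← prod_shift fun m => S.v m (c m - β m), ← prod_shift fun m => chi (-(β m * c m))]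
    ring
  rw [Matrix.mul_apply]
  simp_rw [e1]
  rw [← Finset.mul_sum, Finset.sum_comm]
  congr 1
  refine Finset.sum_congr rfl fun c _ => ?_
  rw [← Finset.mul_sum]
  congr 1
  simp_rw [starKer]
  rw [Finset.prod_univ_sum, Fintype.piFinset_univ,
    ← Equiv.sum_comp (Equiv.arrowCongr (Equiv.addRight (1 : ZMod M)) (Equiv.refl (ZMod N)))]
  refine Finset.sum_congr rfl fun β _ => Finset.prod_congr rfl fun m _ => ?_
  have : (Equiv.arrowCongr (Equiv.addRight (1 : ZMod M)) (Equiv.refl (ZMod N))) β (m + 1) = β m :=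
    congrArg β (add_neg_cancel_right m 1)
  rw [this]

theorem det_q0 (m : ZMod M) :
    (S.q0 m).det = C m ^ N * ((twistMat (S.v m)).det * (convMat (R m)).det) := by
  have : S.q0 m = C m • (twistMat (S.v m) * convMat (R m)) := by
    ext b b'
    change S.q m 0 b b' = _
    rw [h, Matrix.smul_apply, Matrix.mul_apply, smul_eq_mul]
    simp [twistMat, convMat]
  rw [this, Matrix.det_smul, Matrix.det_mul, Fintype.card, Finset.card_univ, ZMod.card]

/-- In the Fourier form the convolution is the innermost factor of the local matrix at left spin
`0`, so a null vector of it would be a null vector of a nonsingular matrix. -/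
theorem conv_injective (m : ZMod M) {f : ZMod N → ℂ} (hf : ∀ β, ∑ b, R m (b - β) * f b = 0)
    (b : ZMod N) : f b = 0 := by
  refine eq_zero_of_qLoc (S.f1 m) (S.f2 m) (S.f3 m) (fun β => ?_) b
  have : ∀ b, qLoc (S.x1 m) (S.y1 m) (S.x2 m) (S.y2 m) (S.x3 m) (S.y3 m) 0 β b * f b =
      ∑ c, C m * (chi (0 * c) * (S.v m (c - β) * chi (-(β * c)))) * (R m (b - c) * f b) := by
    intro b
    have := h m 0 β b
    rw [q] at this
    rw [this, Finset.mul_sum, Finset.sum_mul]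
    exact Finset.sum_congr rfl fun c _ => by ring
  simp_rw [this]
  rw [Finset.sum_comm]
  simp_rw [← Finset.mul_sum, hf, mul_zero, Finset.sum_const_zero]

/-- The determinants of the convolutions and twists reassemble, by `det_q0`, into the normalisation
of `S`, while the diagonal blocks give that of `S'`. The kernels are thus measured by `rho` alone.
-/
theorem prod_norm_det_kerMat : (∏ m, ‖C m‖) ^ (N * N) *
    ∏ m, ‖(kerMat (R m) (S.v (m + 1)) (S'.q (m + 1))).det‖ = (S.rho * S'.rho) ^ N := by
  have e1 : ∀ m, ‖(kerMat (R m) (S.v (m + 1)) (S'.q (m + 1))).det‖ =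
      ‖(convMat (R m)).det‖ ^ N * ‖(S'.q0 (m + 1)).det‖ ^ N * ‖(twistMat (S.v (m + 1))).det‖ ^ N := by
    intro m
    rw [kerMat_det, norm_mul, norm_mul, norm_pow, norm_pow, norm_prod]
    simp [norm_det_q, ZMod.card]
  simp_rw [e1, Finset.prod_mul_distrib]
  have s1 := Equiv.prod_comp (Equiv.addRight (1 : ZMod M)) fun m => ‖(S'.q0 m).det‖ ^ N
  have s2 := Equiv.prod_comp (Equiv.addRight (1 : ZMod M)) fun m => ‖(twistMat (S.v m)).det‖ ^ N
  simp only [Equiv.coe_addRight] at s1 s2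
  rw [s1, s2, rho, rho]
  simp only [det_q0 h, norm_mul, norm_pow, Finset.prod_mul_distrib, mul_pow, Finset.prod_pow,
    ← pow_mul]
  ring

end Step

namespace Exchange

variable {S S' H H' : Step N M κ} (E : Exchange S S' H H')

include E

/-- At each site the star-triangle relations give (kernel of `S, S'`) · `s` = `t` · (kernel of `H,
H'`). The factors `s` and `t` obey the same recursion, so `s = k t`, and the `t` cancel around the
closed chain. Determinants of the same site relations give the modulus of the constant. -/
theorem exists_smul : ∃ c : ℂ, S.Q * S'.Q = c • (H.Q * H'.Q) ∧
    ‖c‖ ^ N * (H.rho * H'.rho) = S.rho * S'.rho := by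
  have hκ := E.κ_ne
  have hδH : H.δ ≠ 0 := E.δ_eq ▸ E.δ_ne'
  have hδH' : H'.δ ≠ 0 := E.δ_eq' ▸ E.δ_ne
  choose R C hC hRn hR hq using S.exists_fourier hκ E.δ_ne
  choose R' C' hC' hRn' hR' hq' using H.exists_fourier hκ hδH
  choose e he0 he using E.exists_edge
  choose t ht htr using fun m => E.exists_star m (hR m) (hR' m) (hRn' m) (he (m + 1))
  choose s hs hsr using fun m => E.exists_star' m (he m)
  have hq : ∀ m a b b', S.q m a b b' =
    C m * ∑ c, chi (a * c) * (S.v m (c - b) * chi (-(b * c))) * R m (b' - c) := hq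
  have hq' : ∀ m a b b', H.q m a b b' =
    C' m * ∑ c, chi (a * c) * (H.v m (c - b) * chi (-(b * c))) * R' m (b' - c) := hq'
  have nX : ∀ m, S'.x3 m ≠ 0 := fun m => by
    rw [S'.x3_eq_mul hκ]; exact mul_ne_zero (S'.x1_ne hκ E.δ_ne' m) (S'.x2_ne hκ m)
  have nX' : ∀ m, H'.x3 m ≠ 0 := fun m => by
    rw [H'.x3_eq_mul hκ]; exact mul_ne_zero (H'.x1_ne hκ hδH' m) (H'.x2_ne hκ m)
  have n3 : ∀ (m : ZMod M) (j : ZMod N), 1 - H.η m / H'.x1 (m + 1) * chi j ≠ 0 := fun m j => by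
    refine one_sub_mul_chi_ne_zero ?_ j
    rw [div_pow, Ne, div_eq_one_iff_eq (pow_ne_zero N (H'.x1_ne hκ hδH' _))]
    exact E.gen2 m
  have nz : ∀ m, S.x1 m * S.υ m ≠ 0 := fun m => mul_ne_zero (S.x1_ne hκ E.δ_ne m) (S.υ_ne m)
  -- By `gen2` one zero of `t` spreads to all of `ZMod N`. The convolution with `R` would then
  -- annihilate a function whose value at `0` is `1`.
  have ht0 : ∀ (m : ZMod M) (j : ZMod N), t m j ≠ 0 := by
    intro m j hj
    have hz : ∀ i, t m i = 0 := fun i =>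
      eq_of_rec (f := t m) (g := fun _ => 0)
        (a := fun β => S.x1 m * S.υ m * (1 - H.η m / H'.x1 (m + 1) * chi (β - 1)))
        (b := fun β => H.x1 m * H.υ m * (1 - S.η m / S'.x1 (m + 1) * chi (β - 1)))
        (fun n => mul_ne_zero (nz m) (n3 m _)) (htr m) (by simp) hj i
    have := Step.conv_injective hq m (f := fun b => wFun N (S'.x1 (m + 1)) (S'.y1 (m + 1)) (-b) *
      e (m + 1) (0 - b)) (fun β => by
        have := ht m β 0
        rw [hz, zero_mul] at this
        rw [← this]
        exact Finset.sum_congr rfl fun b _ => by ring) 0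
    simp [he0] at this
  have hst : ∀ m, ∃ k : ℂ, ∀ j, s m j = k * t m j := by
    intro m
    refine ⟨s m 0 / t m 0, fun j => ?_⟩
    refine eq_smul_of_rec (f := s m) (g := t m)
        (a := fun β => S.x1 m * S.υ m * (1 - H.η m / H'.x1 (m + 1) * chi (β - 1)))
        (b := fun β => H.x1 m * H.υ m * (1 - S.η m / S'.x1 (m + 1) * chi (β - 1)))
        (fun n => mul_ne_zero (nz m) (n3 m _)) (fun c => ?_) (htr m) (ht0 m 0) j
    have h1 := hsr m c
    have h2 := E.tau_coef m
    have a1 : H'.x3 m - H.x2 m * H.η m * chi (c - 1) =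
        H'.x3 m * (1 - H.η m / H'.x1 (m + 1) * chi (c - 1)) := by
      rw [E.tau_ratio']; have := nX' m; field_simp
    have a2 : S'.x3 m - S.x2 m * S.η m * chi (c - 1) =
        S'.x3 m * (1 - S.η m / S'.x1 (m + 1) * chi (c - 1)) := by
      rw [E.tau_ratio]; have := nX m; field_simp
    rw [a1, a2] at h1
    refine mul_left_cancel₀ (mul_ne_zero (S'.f3 m).ne (nX' m)) ?_
    linear_combination S.x1 m * S.υ m * h1 -
      (1 - S.η m / S'.x1 (m + 1) * chi (c - 1)) * s m (c - 1) * h2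
  choose k hk using hst
  have hker : ∀ m c c' γ γ', starKer (R m) (S.v (m + 1)) (S'.q (m + 1)) c c' γ γ' *
      s (m + 1) (c' - γ') = t m (c - γ) *
        starKer (R' m) (H.v (m + 1)) (H'.q (m + 1)) c c' γ γ' := by
    intro m c c' γ γ'
    have := starKer_exchange (x2 := S'.x2 (m + 1)) (y2 := S'.y2 (m + 1)) (ht m) (hs (m + 1)) c c' γ γ'
    have e1 : H'.q (m + 1) = qLoc (H'.x1 (m + 1)) (H'.y1 (m + 1)) (S'.x2 (m + 1)) (S'.y2 (m + 1))
        (H'.x3 (m + 1)) (H'.y3 (m + 1)) := by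
      rw [Step.q, E.x2_eq, E.y2_eq]
    rw [e1]
    exact this
  have hprod : ∀ c γ : Conf N M,
      (∏ m, k m) * ∏ m, starKer (R m) (S.v (m + 1)) (S'.q (m + 1)) (c m) (c (m + 1)) (γ (m + 1))
        (γ (m + 1 + 1)) = ∏ m, starKer (R' m) (H.v (m + 1)) (H'.q (m + 1)) (c m) (c (m + 1))
          (γ (m + 1)) (γ (m + 1 + 1)) := by
    intro c γ
    have h1 : ∏ m, (starKer (R m) (S.v (m + 1)) (S'.q (m + 1)) (c m) (c (m + 1)) (γ (m + 1))
        (γ (m + 1 + 1)) * s (m + 1) (c (m + 1) - γ (m + 1 + 1))) =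
        ∏ m, (t m (c m - γ (m + 1)) * starKer (R' m) (H.v (m + 1)) (H'.q (m + 1)) (c m) (c (m + 1))
          (γ (m + 1)) (γ (m + 1 + 1))) := Finset.prod_congr rfl fun m _ => hker m _ _ _ _
    simp_rw [hk, Finset.prod_mul_distrib] at h1
    rw [prod_shift fun m => k m, prod_shift fun m => t m (c m - γ (m + 1))] at h1
    have : ∏ m, t m (c m - γ (m + 1)) ≠ 0 := Finset.prod_ne_zero_iff.mpr fun m _ => ht0 m _
    refine mul_left_cancel₀ this ?_
    linear_combination h1
  have hdet : (∏ m, ‖k m‖) ^ (N * N) *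
      ∏ m, ‖(kerMat (R m) (S.v (m + 1)) (S'.q (m + 1))).det‖ =
      ∏ m, ‖(kerMat (R' m) (H.v (m + 1)) (H'.q (m + 1))).det‖ := by
    have h1 : ∀ m, kerMat (R m) (S.v (m + 1)) (S'.q (m + 1)) *
        Matrix.diagonal (fun p : ZMod N × ZMod N => k (m + 1) * t (m + 1) (p.2 - p.1)) =
        Matrix.diagonal (fun p : ZMod N × ZMod N => t m (p.2 - p.1)) *
          kerMat (R' m) (H.v (m + 1)) (H'.q (m + 1)) := by
      intro m
      ext ⟨γ, c⟩ ⟨γ', c'⟩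
      rw [Matrix.mul_diagonal, Matrix.diagonal_mul]
      simp only [kerMat, Matrix.of_apply]
      rw [← hk]
      exact hker m c c' γ γ'
    have h2 : ∀ m, ‖(kerMat (R m) (S.v (m + 1)) (S'.q (m + 1))).det‖ *
        (‖k (m + 1)‖ ^ (N * N) * ∏ p : ZMod N × ZMod N, ‖t (m + 1) (p.2 - p.1)‖) =
        (∏ p : ZMod N × ZMod N, ‖t m (p.2 - p.1)‖) *
          ‖(kerMat (R' m) (H.v (m + 1)) (H'.q (m + 1))).det‖ := by
      intro m
      have := congrArg (fun A => ‖Matrix.det A‖) (h1 m)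
      simp only [Matrix.det_mul, Matrix.det_diagonal, norm_mul, norm_prod,
        Finset.prod_mul_distrib, Finset.prod_const, Finset.card_univ, Fintype.card_prod,
        ZMod.card, norm_pow] at this
      exact this
    have h3 := Finset.prod_congr (rfl : (Finset.univ : Finset (ZMod M)) = _) fun m _ => h2 m
    simp_rw [Finset.prod_mul_distrib, Finset.prod_pow] at h3
    have s1 := Equiv.prod_comp (Equiv.addRight (1 : ZMod M)) fun m => ‖k m‖
    have s2 := Equiv.prod_comp (Equiv.addRight (1 : ZMod M)) fun m =>
      ∏ p : ZMod N × ZMod N, ‖t m (p.2 - p.1)‖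
    simp only [Equiv.coe_addRight] at s1 s2
    rw [s1, s2] at h3
    have : ∏ m, ∏ p : ZMod N × ZMod N, ‖t m (p.2 - p.1)‖ ≠ 0 :=
      Finset.prod_ne_zero_iff.mpr fun m _ => Finset.prod_ne_zero_iff.mpr fun p _ =>
        norm_ne_zero_iff.mpr (ht0 m _)
    refine mul_left_cancel₀ this ?_
    linear_combination h3
  have d1 := Step.prod_norm_det_kerMat S' hq
  have d2 := Step.prod_norm_det_kerMat H' hq'
  have hK : ∏ m, k m ≠ 0 := by
    intro h0
    rw [← norm_prod, h0, norm_zero, zero_pow (mul_ne_zero (NeZero.ne N) (NeZero.ne N)), zero_mul] at hdet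
    rw [← hdet, mul_zero] at d2
    exact pow_ne_zero N (mul_pos H.rho_pos H'.rho_pos).ne' d2.symm
  have hC0 : ∏ m, C m ≠ 0 := Finset.prod_ne_zero_iff.mpr fun m _ => hC m
  have hC0' : ∏ m, C' m ≠ 0 := Finset.prod_ne_zero_iff.mpr fun m _ => hC' m
  refine ⟨(∏ m, C m) / ((∏ m, C' m) * ∏ m, k m), ?_, ?_⟩
  · ext α γ
    rw [Matrix.smul_apply, Step.Q_mul S' hq, Step.Q_mul H' hq', smul_eq_mul]
    simp_rw [← hprod]
    have : ∀ c : Conf N M, (∏ m, chi (α m * c m)) * ((∏ m, k m) * ∏ m, starKer (R m) (S.v (m + 1))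
        (S'.q (m + 1)) (c m) (c (m + 1)) (γ (m + 1)) (γ (m + 1 + 1))) =
        (∏ m, k m) * ((∏ m, chi (α m * c m)) * ∏ m, starKer (R m) (S.v (m + 1))
        (S'.q (m + 1)) (c m) (c (m + 1)) (γ (m + 1)) (γ (m + 1 + 1))) := fun c => by ring
    simp_rw [this, ← Finset.mul_sum]
    field_simp
  · rw [norm_div, norm_mul, norm_prod, norm_prod, norm_prod]
    have p1 : ∏ m, ‖C m‖ ≠ 0 := by rw [← norm_prod]; exact norm_ne_zero_iff.mpr hC0
    have p2 : ∏ m, ‖C' m‖ ≠ 0 := by rw [← norm_prod]; exact norm_ne_zero_iff.mpr hC0'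
    have p3 : ∏ m, ‖k m‖ ≠ 0 := by rw [← norm_prod]; exact norm_ne_zero_iff.mpr hK
    have r1 := mul_pos H.rho_pos H'.rho_pos
    have r2 := mul_pos S.rho_pos S'.rho_pos
    refine (pow_left_inj₀ (by positivity) r2.le (NeZero.ne N)).mp ?_
    rw [← hdet, ← mul_assoc] at d2
    rw [mul_pow, ← d1, ← d2, ← pow_mul, div_pow, mul_pow]
    field_simp

theorem exists_smul_ne : ∃ c : ℂ, c ≠ 0 ∧ S.Q * S'.Q = c • (H.Q * H'.Q) ∧
    ‖c‖ ^ N * (H.rho * H'.rho) = S.rho * S'.rho := by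
  obtain ⟨c, h1, h2⟩ := E.exists_smul
  refine ⟨c, ?_, h1, h2⟩
  rintro rfl
  rw [norm_zero, zero_pow (NeZero.ne N), zero_mul] at h2
  exact (mul_pos S.rho_pos S'.rho_pos).ne h2

end Exchange

end Exchange

/-! ### Changes of phases: Weyl monomials, and removal of the normalisation of `y2` -/

section Weyl

variable {N M : ℕ} [NeZero N] [NeZero M] {κ : ℂ}

/-- A phase of `x` translates the argument and a phase of `y` contributes an exponential; both sides
satisfy the same recursion and equal `1` at `0`. -/
theorem wFun_twist {x y : ℂ} (h : Fermat N x y) (a e n : ZMod N) :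
    wFun N (chi a * x) (chi e * y) n = chi (e * n) * wFun N x y (n + a) / wFun N x y a := by
  have h' : Fermat N (chi a * x) (chi e * y) :=
    ⟨by rw [mul_pow, mul_pow, chi_pow_card, chi_pow_card, one_mul, one_mul, h.eq],
      mul_ne_zero (chi_ne_zero _) h.ne⟩
  have ha := h.wFun_ne_zero a
  refine eq_of_rec (f := wFun N (chi a * x) (chi e * y))
    (g := fun n => chi (e * n) * wFun N x y (n + a) / wFun N x y a)
    (a := fun n => 1 - chi a * x * chi n) (b := fun _ => chi e * y) (fun n => h'.one_sub_ne_zero n)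
    h'.wFun_rec (fun n => ?_) (n₀ := 0) ?_ n
  · have r := h.wFun_rec (n + a)
    have c1 : chi (n + a) = chi a * chi n := by rw [← chi_add]; congr 1; ring
    have c2 : chi (e * n) = chi e * chi (e * (n - 1)) := by rw [← chi_add]; congr 1; ring
    have d : n + a - 1 = n - 1 + a := by ring
    rw [c1, d] at r
    rw [div_mul_eq_mul_div, mul_div_assoc', div_left_inj' ha, c2]
    linear_combination chi e * chi (e * (n - 1)) * r
  · simp [ha]

theorem weylOp_apply (a b α β : Conf N M) :
    weylOp N M a b α β = if α = β + a then ∏ m, chi (-(b m * β m)) else 0 := by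
  rw [weylOp, Matrix.of_apply]
  congr 1
  refine Finset.prod_congr rfl fun m _ => ?_
  rw [chi_neg]
  congr 1
  rw [← chi_natCast]
  simp

theorem mul_weylOp (A : Op N M) (a b α β : Conf N M) :
    (A * weylOp N M a b) α β = A α (β + a) * ∏ m, chi (-(b m * β m)) := by
  simp [Matrix.mul_apply, weylOp_apply]

theorem norm_det_submatrix {n : Type*} [Fintype n] [DecidableEq n] (A : Matrix n n ℂ)
    (e e' : Equiv.Perm n) : ‖(A.submatrix e e').det‖ = ‖A.det‖ := by
  have h1 : ∀ e : Equiv.Perm n, ‖((Equiv.Perm.sign e : ℤ) : ℂ)‖ = 1 := fun e => by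
    rcases Int.units_eq_one_or (Equiv.Perm.sign e) with h | h <;> simp [h]
  have : A.submatrix e e' = (A.submatrix id e').submatrix e id := rfl
  rw [this, Matrix.det_permute, Matrix.det_permute', norm_mul, norm_mul, h1, h1, one_mul, one_mul]

/-- Two steps with the same initial state whose final states differ by phases. -/
structure Twist (S H : Step N M κ) (s r : ZMod M → ZMod N) : Prop where
  u_eq : H.u = S.u
  w_eq : H.w = S.w
  δ_eq : H.δ = S.δ
  μ_eq : H.μ = S.μ
  u'_eq : ∀ m, H.u' m = chi (s (m - 1) - s m) * S.u' m
  υ_eq : ∀ m, H.υ m = chi (r m - s (m - 1)) * S.υ m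
  κ_ne : κ ≠ 0

namespace Twist

variable {S H : Step N M κ} {s r : ZMod M → ZMod N} (T : Twist S H s r)

include T

/-- The phases of the `x`-coordinates translate the spins of the local factor. The phase `g` of `y2`
is an unknown root of unity, but it enters all three weights and cancels, as the three spin
differences add up: `(b - a) + (b' - b) = b' - a`. -/
theorem exists_local (m : ZMod M) : ∃ k : ℂ, ∀ a b b', H.q m a b b' =
    k * chi (b * (s (m - 1) - r m) + b' * (r m - s m)) *
      S.q m a (b + (s (m - 1) - s m)) (b' + (s m - s (m + 1))) := by
  have hκ := T.κ_ne
  have e1 : H.x1 m = chi (s (m - 1) - s m) * S.x1 m := by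
    rw [H.x1_eq' hκ, S.x1_eq' hκ, T.δ_eq, T.u'_eq, T.u_eq]; ring
  have e2 : H.x2 m = chi ((s m - s (m + 1)) - (s (m - 1) - s m)) * S.x2 m := by
    rw [H.x2_eq', S.x2_eq', T.u'_eq, T.u'_eq, chi_sub (s m - s (m + 1)), add_sub_cancel_right]
    have := chi_ne_zero (s (m - 1) - s m)
    have := S.u'_ne m
    have := omHalf_ne_zero (N := N)
    field_simp
  have e3 : H.x3 m = chi (s m - s (m + 1)) * S.x3 m := by
    rw [H.x3_eq', S.x3_eq', T.δ_eq, T.u'_eq, T.u_eq, add_sub_cancel_right]; ring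
  obtain ⟨g, hg⟩ : ∃ g : ZMod N, H.y2 m = chi g * S.y2 m := by
    refine exists_chi_mul (S.f2 m).ne ?_
    have h1 := (S.f2 m).eq
    have h2 := (H.f2 m).eq
    rw [e2, mul_pow, chi_pow_card, one_mul] at h2
    linear_combination h2 - h1
  have g3 : H.y3 m = chi (g - (r m - s (m - 1))) * S.y3 m := by
    rw [H.y3_eq, S.y3_eq, hg, T.υ_eq, chi_sub g]
    have := chi_ne_zero (r m - s (m - 1))
    have := S.υ_ne m
    field_simp
  have g1 : H.y1 m = chi (g - (r m - s (m - 1)) - (s m - s (m + 1))) * S.y1 m := by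
    rw [H.y1_eq, S.y1_eq, g3, H.η_eq hκ, S.η_eq hκ, T.μ_eq, T.w_eq, T.u'_eq,
      add_sub_cancel_right, chi_sub _ (s m - s (m + 1))]
    have := chi_ne_zero (s m - s (m + 1))
    have := S.w_ne m
    have := S.u'_ne (m + 1)
    field_simp
  have n1 := (S.f1 m).wFun_ne_zero (s (m - 1) - s m)
  have n2 := (S.f2 m).wFun_ne_zero ((s m - s (m + 1)) - (s (m - 1) - s m))
  have n3 := (S.f3 m).wFun_ne_zero (s m - s (m + 1))
  refine ⟨wFun N (S.x3 m) (S.y3 m) (s m - s (m + 1)) / (wFun N (S.x1 m) (S.y1 m) (s (m - 1) - s m) *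
    wFun N (S.x2 m) (S.y2 m) ((s m - s (m + 1)) - (s (m - 1) - s m))) *
      chi ((s (m - 1) - s m) * (s m - s (m + 1))), fun a b b' => ?_⟩
  rw [Step.q, Step.q, qLoc, qLoc, e1, e2, e3, hg, g3, g1, wFun_twist (S.f1 m), wFun_twist (S.f2 m),
    wFun_twist (S.f3 m)]
  set A := s (m - 1) - s m with hA
  set A' := s m - s (m + 1) with hA'
  have d1 : b + A - a = b - a + A := by ring
  have d2 : b' + A' - (b + A) = b' - b + (A' - A) := by ring
  have d3 : b' + A' - a = b' - a + A' := by ring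
  rw [d1, d2, d3]
  have m3 := (S.f3 m).wFun_ne_zero (b' - a + A')
  have m4 := chi_ne_zero ((g - (r m - s (m - 1))) * (b' - a))
  have c : chi ((a - b) * b') * chi ((g - (r m - s (m - 1)) - A') * (b - a)) * chi (g * (b' - b)) =
      chi ((g - (r m - s (m - 1))) * (b' - a)) * chi (A * A') *
        chi (b * (s (m - 1) - r m) + b' * (r m - s m)) * chi ((a - (b + A)) * (b' + A')) := by
    simp only [← chi_add]
    congr 1
    simp only [hA, hA']
    ring
  field_simp
  linear_combination (wFun N (S.x1 m) (S.y1 m) (b - a + A) * wFun N (S.x2 m) (S.y2 m) (b' - b + (A' - A))) * c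

/-- The local translations and exponentials assemble along the chain into one Weyl monomial on the
right. Local determinants change only by phases and by `k m ^ N`, which gives the statement about
`rho`. -/
theorem exists_smul : ∃ c : ℂ, c ≠ 0 ∧
    H.Q = c • (S.Q * weylOp N M (fun m => s (m - 1) - s m) (fun m => r m - r (m - 1))) ∧
    ‖c‖ ^ N * S.rho = H.rho := by
  choose k hk using T.exists_local
  have hn : ‖∏ m, k m‖ ^ N * S.rho = H.rho := by
    rw [norm_prod, ← Finset.prod_pow, Step.rho, Step.rho, ← Finset.prod_mul_distrib]
    refine Finset.prod_congr rfl fun m _ => ?_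
    have : H.q0 m = k m • Matrix.of fun b b' => chi (b * (s (m - 1) - r m)) *
        (Matrix.of fun b b' => chi (b' * (r m - s m)) *
          ((S.q0 m).submatrix (Equiv.addRight (s (m - 1) - s m)) (Equiv.addRight (s m - s (m + 1))))
            b b') b b' := by
      ext b b'
      change H.q m 0 b b' = k m * (chi (b * (s (m - 1) - r m)) * (chi (b' * (r m - s m)) *
        S.q m 0 (b + (s (m - 1) - s m)) (b' + (s m - s (m + 1)))))
      rw [hk, chi_add]; ring
    rw [this, Matrix.det_smul, Matrix.det_mul_column, Matrix.det_mul_row, norm_mul, norm_mul,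
      norm_mul, norm_prod, norm_prod, norm_det_submatrix]
    simp [norm_chi, ZMod.card]
  refine ⟨∏ m, k m, ?_, ?_, hn⟩
  · intro h0
    rw [h0, norm_zero, zero_pow (NeZero.ne N), zero_mul] at hn
    exact H.rho_pos.ne hn
  · ext α β
    rw [Matrix.smul_apply, mul_weylOp, smul_eq_mul]
    change ∏ m, H.q m (α m) (β m) (β (m + 1)) = (∏ m, k m) * ((∏ m, S.q m (α m)
      (β m + (s (m - 1) - s m)) (β (m + 1) + (s (m + 1 - 1) - s (m + 1)))) * _)
    simp_rw [hk, chi_add, Finset.prod_mul_distrib, add_sub_cancel_right]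
    have h1 : ∏ m, chi (β (m + 1) * (r m - s m)) = ∏ m, chi (β m * (r (m - 1) - s (m - 1))) := by
      have := prod_shift fun m => chi (β m * (r (m - 1) - s (m - 1)))
      simpa only [add_sub_cancel_right] using this
    have h2 : ∏ m, chi (-((r m - r (m - 1)) * β m)) =
        (∏ m, chi (β m * (s (m - 1) - r m))) * ∏ m, chi (β m * (r (m - 1) - s (m - 1))) := by
      rw [← Finset.prod_mul_distrib]
      refine Finset.prod_congr rfl fun m _ => ?_
      rw [← chi_add]; congr 1; ring
    rw [h1, h2]
    ring

end Twist

/-- The same step with the points of the Fermat curve changed by common phases of the second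
coordinates. -/
def Step.rescale (S : Step N M κ) (g : ZMod M → ZMod N) : Step N M κ :=
  { S with
    y1 := fun m => chi (g m) * S.y1 m
    y2 := fun m => chi (g m) * S.y2 m
    y3 := fun m => chi (g m) * S.y3 m
    f1 := fun m => ⟨by rw [mul_pow, chi_pow_card, one_mul, (S.f1 m).eq],
      mul_ne_zero (chi_ne_zero _) (S.f1 m).ne⟩
    f2 := fun m => ⟨by rw [mul_pow, chi_pow_card, one_mul, (S.f2 m).eq],
      mul_ne_zero (chi_ne_zero _) (S.f2 m).ne⟩
    f3 := fun m => ⟨by rw [mul_pow, chi_pow_card, one_mul, (S.f3 m).eq],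
      mul_ne_zero (chi_ne_zero _) (S.f3 m).ne⟩
    y13 := fun m => by linear_combination chi (g m) * S.y13 m
    gauge := fun m => by
      simp only [mul_div_mul_left _ _ (chi_ne_zero _)]
      exact S.gauge m }

theorem weylOp_zero : weylOp N M 0 0 = 1 := by
  ext α β
  simp [weylOp_apply, Matrix.one_apply]

/-- This compares two steps with the same spectral data and the same `u`, `u'`, `υ`, which can
differ only through the choice of roots for the `y`-coordinates. -/
theorem Twist.exists_smul_of_zero {S H : Step N M κ} (T : Twist S H 0 0) :
    ∃ c : ℂ, c ≠ 0 ∧ H.Q = c • S.Q ∧ ‖c‖ ^ N * S.rho = H.rho := by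
  obtain ⟨c, h1, h2, h3⟩ := T.exists_smul
  refine ⟨c, h1, ?_, h3⟩
  rw [h2]
  congr 1
  have : weylOp N M (fun m => (0 : ZMod M → ZMod N) (m - 1) - (0 : ZMod M → ZMod N) m)
      (fun m => (0 : ZMod M → ZMod N) m - (0 : ZMod M → ZMod N) (m - 1)) = weylOp N M 0 0 := by
    congr 1 <;> · funext m; simp
  rw [this, weylOp_zero, mul_one]

/-- Two pairs of steps with common ends and interchanged spectral parameters. -/
structure Swap (S S' H H' : Step N M κ) : Prop where
  start_u : H.u = S.u
  start_w : H.w = S.w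
  mid_u : S'.u = S.u'
  mid_w : S'.w = S.w'
  mid_u' : H'.u = H.u'
  mid_w' : H'.w = H.w'
  fin_u : H'.u' = S'.u'
  δ_eq : H.δ = S'.δ
  δ_eq' : H'.δ = S.δ
  μ_eq : H.μ = S'.μ
  μ_eq' : H'.μ = S.μ
  υ_eq : ∀ m, S.υ m * S'.υ m = H.υ m * H'.υ m
  gen1 : ∀ m, H.η m ^ N ≠ S.η m ^ N
  gen2 : ∀ m, H.η m ^ N ≠ H'.x1 (m + 1) ^ N
  κ_ne : κ ≠ 0
  δ_ne : S.δ ≠ 0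
  δ_ne' : S'.δ ≠ 0

/-- `Swap` omits the requirement of `Exchange` that the last two steps have equal `y2`. Their `x2`
agree, so the `y2` differ by roots of unity; `rescale` removes these at the cost of a nonzero
scalar. -/
theorem Swap.exists_smul {S S' H H' : Step N M κ} (E : Swap S S' H H') :
    ∃ c : ℂ, c ≠ 0 ∧ S.Q * S'.Q = c • (H.Q * H'.Q) ∧
      ‖c‖ ^ N * (H.rho * H'.rho) = S.rho * S'.rho := by
  have h : ∀ m, ∃ g : ZMod N, S'.y2 m = chi g * H'.y2 m := fun m => by
    refine exists_chi_mul (H'.f2 m).ne ?_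
    have h1 := (S'.f2 m).eq
    have h2 := (H'.f2 m).eq
    rw [H'.x2_eq', E.fin_u, ← S'.x2_eq'] at h2
    linear_combination h1 - h2
  choose g hg using h
  have hυ : ∀ m, (H'.rescale g).υ m = H'.υ m := fun m =>
    mul_div_mul_left _ _ (chi_ne_zero _)
  have E' : Exchange S S' H (H'.rescale g) :=
    { E with
      υ_eq := fun m => by rw [hυ]; exact E.υ_eq m
      y2_eq := funext fun m => (hg m).symm }
  obtain ⟨c, c0, hc, hc'⟩ := E'.exists_smul_ne
  have T : Twist H' (H'.rescale g) 0 0 :=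
    { u_eq := rfl
      w_eq := rfl
      δ_eq := rfl
      μ_eq := rfl
      u'_eq := fun m => by simp [Step.rescale]
      υ_eq := fun m => by simp [hυ]
      κ_ne := E.κ_ne }
  obtain ⟨d, d0, hd, hd'⟩ := T.exists_smul_of_zero
  refine ⟨c * d, mul_ne_zero c0 d0, ?_, ?_⟩
  · rw [hc, hd, Matrix.mul_smul, smul_smul]
  · rw [← hc', ← hd', norm_mul, mul_pow]; ring

end Weyl

/-! ### Plücker relations and Fay's identity for rational Θ-functions -/

section Fay

/-- The quadratic relations satisfied by decomposable alternating forms. -/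
def Pluecker {V : Type*} [AddCommGroup V] [Module ℂ V] {r : ℕ} (f : V [⋀^Fin (r + 1)]→ₗ[ℂ] ℂ) :
    Prop :=
  ∀ (u : Fin r → V) (v : Fin (r + 2) → V),
    ∑ i : Fin (r + 2), (-1) ^ (i : ℕ) * f (Fin.snoc u (v i)) * f (v ∘ i.succAbove) = 0

/-- Expanding a determinant with a repeated column yields the linear relation `∑ (-1)^i det(v
without v_i) v_i = 0`; inserting it into the last slot of another determinant gives the quadratic
one. -/
theorem pluecker_det (s : ℕ) :
    Pluecker (Matrix.detRowAlternating : (Fin (s + 1) → ℂ) [⋀^Fin (s + 1)]→ₗ[ℂ] ℂ) := by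
  intro u v
  have h : ∀ j, ∑ i : Fin (s + 2), (-1) ^ (i : ℕ) * v i j * Matrix.det (v ∘ i.succAbove) = 0 := by
    intro j
    have := Matrix.det_succ_column_zero (Matrix.of fun i : Fin (s + 2) => Fin.cons (v i j) (v i))
    rw [Matrix.det_zero_of_column_eq (i := 0) (j := j.succ) (Fin.succ_ne_zero j).symm
      (fun i => by simp)] at this
    rw [this]
    refine Finset.sum_congr rfl fun i _ => ?_
    simp only [Matrix.of_apply, Fin.cons_zero]
    congr 1
  have hz : ∑ i : Fin (s + 2), ((-1) ^ (i : ℕ) * Matrix.det (v ∘ i.succAbove)) • v i = 0 := by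
    funext j
    rw [Finset.sum_apply, Pi.zero_apply, ← h j]
    refine Finset.sum_congr rfl fun i _ => ?_
    rw [Pi.smul_apply, smul_eq_mul]; ring
  have e : ∀ w, (Fin.snoc u w : Fin (s + 1) → Fin (s + 1) → ℂ) =
      Function.update (Fin.snoc u 0) (Fin.last s) w := fun w => by rw [Fin.update_snoc_last]
  have := (Matrix.detRowAlternating (R := ℂ) (n := Fin (s + 1))).map_update_sum
    Finset.univ (Fin.last s) (fun i : Fin (s + 2) => ((-1) ^ (i : ℕ) * Matrix.det (v ∘ i.succAbove)) • v i)
    (Fin.snoc u 0)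
  rw [hz, AlternatingMap.map_update_zero] at this
  rw [this]
  refine Finset.sum_congr rfl fun i _ => ?_
  rw [AlternatingMap.map_update_smul, e, smul_eq_mul]
  change _ * _ * Matrix.det (v ∘ i.succAbove) = _
  ring

/-- Prepend `l` to both families of vectors. The new term of the relation contains `l` twice and
vanishes; the others change sign together. -/
theorem Pluecker.curryLeft {V : Type*} [AddCommGroup V] [Module ℂ V] {r : ℕ}
    {f : V [⋀^Fin (r + 2)]→ₗ[ℂ] ℂ} (h : Pluecker f) (l : V) : Pluecker (f.curryLeft l) := by
  intro u v
  have := h (Fin.cons l u) (Fin.cons l v)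
  rw [Fin.sum_univ_succ] at this
  have h0 : f (Fin.snoc (Fin.cons l u : Fin (r + 1) → V) ((Fin.cons l v : Fin (r + 3) → V) 0)) = 0 := by
    refine f.map_eq_zero_of_eq _ (i := 0) (j := Fin.last (r + 1)) ?_ (Fin.last_pos).ne
    rw [Fin.snoc_last, Fin.cons_zero]
    have := Fin.snoc_castSucc (α := fun _ : Fin (r + 2) => V) l (Fin.cons l u : Fin (r + 1) → V) 0
    exact this
  rw [h0, mul_zero, zero_mul, zero_add] at this
  have h1 : ∑ i : Fin (r + 2), (-1) ^ (i : ℕ) * (f.curryLeft l) (Fin.snoc u (v i)) *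
      (f.curryLeft l) (v ∘ i.succAbove) = -∑ i : Fin (r + 2), (-1) ^ (i.succ : ℕ) *
      f (Fin.snoc (Fin.cons l u : Fin (r + 1) → V) ((Fin.cons l v : Fin (r + 3) → V) i.succ)) *
        f ((Fin.cons l v : Fin (r + 3) → V) ∘ i.succ.succAbove) := by
    rw [← Finset.sum_neg_distrib]
    refine Finset.sum_congr rfl fun i _ => ?_
    have e1 : (Fin.cons l v : Fin (r + 3) → V) ∘ i.succ.succAbove = Fin.cons l (v ∘ i.succAbove) := by
      funext j
      refine Fin.cases ?_ (fun j => ?_) j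
      · simp
      · simp
    rw [Fin.cons_succ, ← Fin.cons_snoc_eq_snoc_cons, e1, AlternatingMap.curryLeft_apply_apply,
      AlternatingMap.curryLeft_apply_apply, Fin.val_succ, pow_succ]
    simp only [Matrix.vecCons]
    ring
  rw [h1, this, neg_zero]


/-- The `Θ`-functions for general parameters `p`, `q` of the modes. -/
def th : (n : ℕ) → (Fin n → ℂ) → (Fin n → ℂ) → (Fin n → ℂ) → ℂ
  | 0, _, _, _ => 1
  | n + 1, p, q, F =>
      th n (Fin.init p) (Fin.init q) (Fin.init F) - F (Fin.last n) *
        th n (Fin.init p) (Fin.init q) fun k =>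
          (p k.castSucc - p (Fin.last n)) * (q k.castSucc - q (Fin.last n)) /
            ((p k.castSucc - q (Fin.last n)) * (q k.castSucc - p (Fin.last n))) * F k.castSucc

/-- The action of a point of the projective line on the amplitude of the mode `(p, q)`. -/
def sg (p q : ℂ) (X : ℂ × ℂ) : ℂ := (p * X.2 - X.1) / (q * X.2 - X.1)

/-- The homogeneous moment curve. -/
def mom (s : ℕ) (X : ℂ × ℂ) (j : Fin s) : ℂ := X.1 ^ (j : ℕ) * X.2 ^ (s - 1 - j)

/-- Without modes the form is the determinant, whose values on the moment curve are Vandermonde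
products. A mode `(p, q)` is added by contracting the form with a combination of the points `q` and
`p` of the curve: the point `q` yields the first term of the recursion of `th`, the point `p` the
second one with its phase shifts. -/
theorem exists_form (k : ℕ) : ∀ (r s : ℕ), r + 1 + k = s → ∀ (p q F : Fin k → ℂ),
    Function.Injective q → (∀ i j, p i ≠ q j) →
    ∃ (Φ : (Fin s → ℂ) [⋀^Fin (r + 1)]→ₗ[ℂ] ℂ) (c : ℂ), Pluecker Φ ∧ c ≠ 0 ∧
      ∀ X : Fin (r + 1) → ℂ × ℂ, (∀ i j, q j * (X i).2 - (X i).1 ≠ 0) →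
        Φ (fun i => mom s (X i)) =
          c * (∏ i, ∏ j ∈ Finset.Ioi i, ((X j).1 * (X i).2 - (X i).1 * (X j).2)) *
            (∏ i, ∏ j, ((X i).1 - q j * (X i).2)) *
            th k p q fun j => F j * ∏ i, sg (p j) (q j) (X i) := by
  induction k with
  | zero =>
    rintro r s rfl p q F - -
    refine ⟨Matrix.detRowAlternating, 1, pluecker_det r, one_ne_zero, fun X _ => ?_⟩
    have := Matrix.det_projVandermonde (fun i => (X i).1) (fun i => (X i).2)
    simp only [Finset.univ_eq_empty, Finset.prod_empty, Finset.prod_const_one, th, mul_one,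
      one_mul]
    refine Eq.trans ?_ (this.trans ?_)
    · change Matrix.det _ = _
      congr 1
      ext i j
      simp [mom, Matrix.projVandermonde, Matrix.rectVandermonde, Fin.val_rev]
      try congr 1
      try omega
    · refine Finset.prod_congr rfl fun i _ => Finset.prod_congr rfl fun j _ => ?_
      ring
  | succ k ih =>
    intro r s hs p q F hq hpq
    set pl := p (Fin.last k) with hpl
    set ql := q (Fin.last k) with hql
    have hqq : ∀ j : Fin k, q j.castSucc - ql ≠ 0 := fun j =>
      sub_ne_zero.2 fun h => (Fin.castSucc_lt_last j).ne (hq h)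
    have hpq' : ∀ i j, p i - q j ≠ 0 := fun i j => sub_ne_zero.2 (hpq i j)
    have hqp' : ∀ i j, q i - p j ≠ 0 := fun i j => sub_ne_zero.2 (hpq j i).symm
    -- The amplitudes are divided by the action of the new point `ql`. Contraction with `ql` then
    -- restores them, and contraction with `pl` multiplies them by the quotient of the two actions,
    -- which is the phase shift.
    obtain ⟨Φ, c, hΦ, hc, hX⟩ := ih (r + 1) s (by omega) (Fin.init p) (Fin.init q)
      (fun j => F j.castSucc / sg (p j.castSucc) (q j.castSucc) (ql, 1))
      (fun i j h => Fin.castSucc_injective _ (hq h)) (fun i j => hpq _ _)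
    set E : ℂ → ℂ := fun y => ∏ j : Fin k, (y - q j.castSucc) with hE
    have hEp : E pl ≠ 0 := Finset.prod_ne_zero_iff.2 fun j _ => hpq' _ _
    have hEq : E ql ≠ 0 := Finset.prod_ne_zero_iff.2 fun j _ => by
      rw [← neg_sub]; exact neg_ne_zero.2 (hqq j)
    have key : ∀ (y : ℂ), (∀ j : Fin k, q j.castSucc - y ≠ 0) → ∀ X : Fin (r + 1) → ℂ × ℂ,
        (∀ i j, q j * (X i).2 - (X i).1 ≠ 0) →
        Φ (Fin.cons (mom s (y, 1)) fun i => mom s (X i)) = c * E y *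
          (∏ i, ∏ j ∈ Finset.Ioi i, ((X j).1 * (X i).2 - (X i).1 * (X j).2)) *
          (∏ i, ∏ j : Fin k, ((X i).1 - q j.castSucc * (X i).2)) *
          (∏ i, ((X i).1 - y * (X i).2)) *
            th k (Fin.init p) (Fin.init q) fun j => sg (p j.castSucc) (q j.castSucc) (y, 1) /
              sg (p j.castSucc) (q j.castSucc) (ql, 1) *
              (F j.castSucc * ∏ i, sg (p j.castSucc) (q j.castSucc) (X i)) := by
      intro y hy X h
      have := hX (Fin.cons (y, 1) X) (fun i j => by
        refine Fin.cases ?_ (fun i => ?_) i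
        · simpa [Fin.init] using hy j
        · simpa [Fin.init] using h i j.castSucc)
      have e1 : (fun i => mom s ((Fin.cons (y, 1) X : Fin (r + 2) → ℂ × ℂ) i)) =
          Fin.cons (mom s (y, 1)) fun i => mom s (X i) := by
        funext i
        refine Fin.cases ?_ (fun i => ?_) i <;> simp
      rw [← e1, this]
      have e2 : (fun j : Fin k => F j.castSucc / sg (p j.castSucc) (q j.castSucc) (ql, 1) *
          ∏ i, sg (Fin.init p j) (Fin.init q j) ((Fin.cons (y, 1) X : Fin (r + 2) → ℂ × ℂ) i)) =
          fun j => sg (p j.castSucc) (q j.castSucc) (y, 1) /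
              sg (p j.castSucc) (q j.castSucc) (ql, 1) *
              (F j.castSucc * ∏ i, sg (p j.castSucc) (q j.castSucc) (X i)) := by
        funext j
        rw [Fin.prod_univ_succ]
        simp only [Fin.cons_zero, Fin.cons_succ, Fin.init]
        ring
      rw [e2, Fin.prod_univ_succ, Fin.prod_univ_succ (n := r + 1)]
      simp only [Fin.cons_zero, Fin.cons_succ, Fin.init, Fin.Ioi_zero_eq_map, Fin.Ioi_succ,
        Finset.prod_map, Fin.coe_succEmb, mul_one, E]
      ring
    refine ⟨Φ.curryLeft (mom s (ql, 1) - (F (Fin.last k) * E ql / E pl) • mom s (pl, 1)),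
      c * E ql, hΦ.curryLeft _, mul_ne_zero hc hEq, fun X h => ?_⟩
    rw [map_sub, map_smul, AlternatingMap.sub_apply, AlternatingMap.smul_apply,
      AlternatingMap.curryLeft_apply_apply, AlternatingMap.curryLeft_apply_apply]
    simp only [Matrix.vecCons]
    rw [key ql hqq X h, key pl (fun j => hqp' _ _) X h]
    have hs0 : ∀ j : Fin k, sg (p j.castSucc) (q j.castSucc) (ql, 1) ≠ 0 := fun j => by
      simp only [sg, mul_one]
      exact div_ne_zero (hpq' _ _) (hqq j)
    have e3 : ∏ i, ((X i).1 - pl * (X i).2) =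
        (∏ i, ((X i).1 - ql * (X i).2)) * ∏ i, sg pl ql (X i) := by
      rw [← Finset.prod_mul_distrib]
      refine Finset.prod_congr rfl fun i _ => ?_
      have h0 : ql * (X i).2 - (X i).1 ≠ 0 := h i (Fin.last k)
      rw [sg, mul_div_assoc', eq_div_iff h0]
      ring
    have e4 : (∏ i, ∏ j, ((X i).1 - q j * (X i).2)) =
        (∏ i, ∏ j : Fin k, ((X i).1 - q j.castSucc * (X i).2)) *
          ∏ i, ((X i).1 - ql * (X i).2) := by
      rw [← Finset.prod_mul_distrib]
      exact Finset.prod_congr rfl fun i _ => Fin.prod_univ_castSucc _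
    have e5 : (fun j : Fin k => sg (p j.castSucc) (q j.castSucc) (ql, 1) /
        sg (p j.castSucc) (q j.castSucc) (ql, 1) *
        (F j.castSucc * ∏ i, sg (p j.castSucc) (q j.castSucc) (X i))) =
        Fin.init fun j => F j * ∏ i, sg (p j) (q j) (X i) := by
      funext j
      rw [div_self (hs0 j), one_mul]; rfl
    have e6 : (fun j : Fin k => sg (p j.castSucc) (q j.castSucc) (pl, 1) /
        sg (p j.castSucc) (q j.castSucc) (ql, 1) *
        (F j.castSucc * ∏ i, sg (p j.castSucc) (q j.castSucc) (X i))) =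
        fun j : Fin k => (p j.castSucc - pl) * (q j.castSucc - ql) /
            ((p j.castSucc - ql) * (q j.castSucc - pl)) *
            (F j.castSucc * ∏ i, sg (p j.castSucc) (q j.castSucc) (X i)) := by
      funext j
      have := hqq j
      have h2 : p j.castSucc - ql ≠ 0 := hpq' _ _
      have h3 : q j.castSucc - pl ≠ 0 := hqp' _ _
      congr 1
      simp only [sg, mul_one]
      field_simp
    rw [e3, e4, e5, e6, th, ← hpl, ← hql]
    simp only [smul_eq_mul]
    field_simp
    try ring

/-- Fay's identity for the rational `Θ`-functions. -/
theorem fay {n : ℕ} (p q F : Fin n → ℂ) (hq : Function.Injective q) (hpq : ∀ i j, p i ≠ q j)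
    (hq0 : ∀ i, q i ≠ 0) (D e : ℂ) (hD : ∀ i, q i ≠ D) (he : ∀ i, q i ≠ e) :
    e * th n p q (fun k => F k * sg (p k) (q k) (D, 1)) *
        th n p q (fun k => F k * (p k / q k) * sg (p k) (q k) (e, 1)) -
      D * th n p q (fun k => F k * (p k / q k) * sg (p k) (q k) (D, 1)) *
        th n p q (fun k => F k * sg (p k) (q k) (e, 1)) +
      (D - e) * th n p q (fun k => F k * sg (p k) (q k) (D, 1) * sg (p k) (q k) (e, 1)) *
        th n p q (fun k => F k * (p k / q k)) = 0 := by
  -- A form in two vectors: the relation is the three-term Plücker relation for the points `0`, `e`,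
  -- `D` and infinity of the projective line.
  obtain ⟨Φ, c, hΦ, hc, hX⟩ := exists_form n 1 (n + 2) (by omega) p q F hq hpq
  have h := hΦ (fun _ => mom (n + 2) (0, 1))
    ![mom (n + 2) (e, 1), mom (n + 2) (D, 1), mom (n + 2) (1, 0)]
  have key : ∀ X Y : ℂ × ℂ, (∀ j, q j * X.2 - X.1 ≠ 0) → (∀ j, q j * Y.2 - Y.1 ≠ 0) →
      Φ ![mom (n + 2) X, mom (n + 2) Y] = c * (Y.1 * X.2 - X.1 * Y.2) *
        ((∏ j, (X.1 - q j * X.2)) * ∏ j, (Y.1 - q j * Y.2)) *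
        th n p q fun j => F j * (sg (p j) (q j) X * sg (p j) (q j) Y) := by
    intro X Y h1 h2
    have := hX ![X, Y] (fun i j => by fin_cases i <;> simp [h1, h2])
    have e : (fun i => mom (n + 2) ((![X, Y] : Fin 2 → ℂ × ℂ) i)) =
        ![mom (n + 2) X, mom (n + 2) Y] := by
      funext i; fin_cases i <;> rfl
    rw [e] at this
    rw [this]
    have i0 : Finset.Ioi (0 : Fin 2) = {1} := by decide
    have i1 : Finset.Ioi (1 : Fin 2) = ∅ := by decide
    simp [Fin.prod_univ_two, i0, i1]
  have n0 : ∀ j, q j * ((0, 1) : ℂ × ℂ).2 - ((0, 1) : ℂ × ℂ).1 ≠ 0 := fun j => by simp [hq0]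
  have nD : ∀ j, q j * ((D, 1) : ℂ × ℂ).2 - ((D, 1) : ℂ × ℂ).1 ≠ 0 := fun j => by
    simp [sub_ne_zero, hD]
  have ne : ∀ j, q j * ((e, 1) : ℂ × ℂ).2 - ((e, 1) : ℂ × ℂ).1 ≠ 0 := fun j => by
    simp [sub_ne_zero, he]
  have ni : ∀ j, q j * ((1, 0) : ℂ × ℂ).2 - ((1, 0) : ℂ × ℂ).1 ≠ 0 := fun j => by simp
  have s0 : ∀ j, sg (p j) (q j) (0, 1) = p j / q j := fun j => by simp [sg]
  have si : ∀ j, sg (p j) (q j) (1, 0) = 1 := fun j => by simp [sg]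
  have a : ∀ x, (Fin.snoc (fun _ : Fin 1 => mom (n + 2) (0, 1)) x : Fin 2 → Fin (n + 2) → ℂ) =
      ![mom (n + 2) (0, 1), x] := fun x => by funext i; fin_cases i <;> rfl
  have b0 : ∀ x y z : Fin (n + 2) → ℂ, (![x, y, z] ∘ (0 : Fin 3).succAbove) = ![y, z] :=
    fun x y z => by funext i; fin_cases i <;> rfl
  have b1 : ∀ x y z : Fin (n + 2) → ℂ, (![x, y, z] ∘ (1 : Fin 3).succAbove) = ![x, z] :=
    fun x y z => by funext i; fin_cases i <;> rfl
  have b2 : ∀ x y z : Fin (n + 2) → ℂ, (![x, y, z] ∘ (2 : Fin 3).succAbove) = ![x, y] :=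
    fun x y z => by funext i; fin_cases i <;> rfl
  replace h := (Fin.sum_univ_three _).symm.trans h
  simp only [a, b0, b1, b2, Matrix.cons_val_zero, Matrix.cons_val_one,
    Matrix.cons_val, key _ _ n0 ne, key _ _ n0 nD, key _ _ n0 ni, key _ _ nD ni, key _ _ ne ni,
    key _ _ ne nD, s0, si, mul_one, mul_zero, sub_zero, Finset.prod_const_one] at h
  set A := ∏ j, (0 - q j)
  set B := ∏ j, (e - q j) with hB
  set C := ∏ j, (D - q j) with hC
  have hA : A ≠ 0 := Finset.prod_ne_zero_iff.2 fun j _ => by simp [hq0]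
  have hB0 : B ≠ 0 := Finset.prod_ne_zero_iff.2 fun j _ => sub_ne_zero.2 (he j).symm
  have hC0 : C ≠ 0 := Finset.prod_ne_zero_iff.2 fun j _ => sub_ne_zero.2 (hD j).symm
  refine (mul_eq_zero.1 (?_ : (c ^ 2 * A * B * C) * _ = 0)).resolve_left
    (mul_ne_zero (mul_ne_zero (mul_ne_zero (pow_ne_zero 2 hc) hA) hB0) hC0)
  rw [← h]
  simp only [mul_assoc, Fin.val_zero, Fin.val_one, Fin.val_two, mul_comm (sg _ _ (e, 1))]
  ring


/-! ### Θ-functions of sets of modes -/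

section ThS
variable {ι : Type*} [LinearOrder ι]

/-- The phase shift of the modes `i`, `j`. -/
def dd (p q : ι → ℂ) (i j : ι) : ℂ :=
  (p i - p j) * (q i - q j) / ((p i - q j) * (q i - p j))

theorem dd_comm (p q : ι → ℂ) (i j : ι) : dd p q i j = dd p q j i := by
  simp only [dd]
  congr 1 <;> ring

/-- The product of the phase shifts of the pairs in `T`. -/
def pairProd (p q : ι → ℂ) (T : Finset ι) : ℂ :=
  ∏ i ∈ T, ∏ j ∈ T, if j < i then dd p q j i else 1

theorem pairProd_insert (p q : ι → ℂ) {a : ι} {T : Finset ι} (ha : a ∉ T) :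
    pairProd p q (insert a T) = pairProd p q T * ∏ k ∈ T, dd p q k a := by
  simp only [pairProd, Finset.prod_insert ha, lt_irrefl, if_false, one_mul,
    Finset.prod_mul_distrib]
  rw [mul_comm, mul_right_comm, ← Finset.prod_mul_distrib, mul_comm]
  congr 1
  refine Finset.prod_congr rfl fun k hk => ?_
  rcases lt_trichotomy k a with h | rfl | h
  · simp [h, h.le]
  · exact absurd hk ha
  · simp [h, h.le, dd_comm p q a k]

/-- The `Θ`-function of the set `S` of modes with amplitudes `F`. -/
def ThS (p q : ι → ℂ) (S : Finset ι) (F : ι → ℂ) : ℂ :=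
  ∑ T ∈ S.powerset, (∏ k ∈ T, -F k) * pairProd p q T

theorem ThS_insert (p q : ι → ℂ) {a : ι} {S : Finset ι} (ha : a ∉ S) (F : ι → ℂ) :
    ThS p q (insert a S) F = ThS p q S F - F a * ThS p q S fun k => dd p q k a * F k := by
  rw [ThS, Finset.sum_powerset_insert ha, sub_eq_add_neg, ThS, ThS, ← neg_mul, Finset.mul_sum]
  congr 1
  refine Finset.sum_congr rfl fun T hT => ?_
  have haT : a ∉ T := fun h => ha (Finset.mem_powerset.1 hT h)
  rw [Finset.prod_insert haT, pairProd_insert p q haT]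
  simp only [← mul_neg, Finset.prod_mul_distrib]
  ring

theorem ThS_congr (p q : ι → ℂ) {S : Finset ι} {F G : ι → ℂ} (h : ∀ i ∈ S, F i = G i) :
    ThS p q S F = ThS p q S G := by
  refine Finset.sum_congr rfl fun T hT => ?_
  rw [Finset.prod_congr rfl fun k hk => by rw [h k (Finset.mem_powerset.1 hT hk)]]

theorem ThS_insert_of_zero (p q : ι → ℂ) {a : ι} {S : Finset ι} (ha : a ∉ S) {F : ι → ℂ}
    (h0 : F a = 0) : ThS p q (insert a S) F = ThS p q S F := by
  rw [ThS_insert p q ha, h0, zero_mul, sub_zero]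

@[simp]
theorem ThS_empty (p q : ι → ℂ) (F : ι → ℂ) : ThS p q ∅ F = 1 := by
  simp [ThS, pairProd]

theorem ThS_zero (p q : ι → ℂ) (S : Finset ι) : ThS p q S (fun _ => 0) = 1 := by
  induction S using Finset.induction_on with
  | empty => simp
  | insert a S ha ih => rw [ThS_insert_of_zero p q ha rfl, ih]

/-- The recursion over an ordered list becomes a sum over subsets, in which the order is invisible.
This is the source of the order independence of the final `τ^N`, `θ^N`. -/
theorem th_comp (p q : ι → ℂ) : ∀ (n : ℕ) (l : Fin n → ι) (_ : Function.Injective l) (F : ι → ℂ),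
    th n (p ∘ l) (q ∘ l) (F ∘ l) = ThS p q (Finset.univ.image l) F
  | 0, l, _, F => by simp [th]
  | n + 1, l, hl, F => by
    have hl' : Function.Injective (Fin.init l) := fun i j h => Fin.castSucc_injective _ (hl h)
    have hi : Finset.univ.image l = insert (l (Fin.last n)) (Finset.univ.image (Fin.init l)) := by
      ext x
      simp only [Finset.mem_image, Finset.mem_univ, true_and, Finset.mem_insert, Fin.init]
      constructor
      · rintro ⟨i, rfl⟩
        refine Fin.lastCases (Or.inl rfl) (fun i => Or.inr ⟨i, rfl⟩) i
      · rintro (rfl | ⟨i, rfl⟩)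
        exacts [⟨_, rfl⟩, ⟨_, rfl⟩]
    have hn : l (Fin.last n) ∉ Finset.univ.image (Fin.init l) := by
      simp only [Finset.mem_image, Finset.mem_univ, true_and, Fin.init, not_exists]
      exact fun i h => (Fin.castSucc_lt_last i).ne (hl h)
    rw [hi, ThS_insert p q hn, ← th_comp p q n _ hl', ← th_comp p q n _ hl']
    rfl

/-- Fay's identity for sets of modes. -/
theorem ThS_fay (p q F : ι → ℂ) (S : Finset ι) (hq : Function.Injective q)
    (hpq : ∀ i j, p i ≠ q j) (hq0 : ∀ i, q i ≠ 0) {D e : ℂ} (hD : ∀ i, q i ≠ D)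
    (he : ∀ i, q i ≠ e) :
    e * ThS p q S (fun k => F k * sg (p k) (q k) (D, 1)) *
        ThS p q S (fun k => F k * (p k / q k) * sg (p k) (q k) (e, 1)) -
      D * ThS p q S (fun k => F k * (p k / q k) * sg (p k) (q k) (D, 1)) *
        ThS p q S (fun k => F k * sg (p k) (q k) (e, 1)) +
      (D - e) * ThS p q S (fun k => F k * sg (p k) (q k) (D, 1) * sg (p k) (q k) (e, 1)) *
        ThS p q S (fun k => F k * (p k / q k)) = 0 := by
  set l : Fin S.card → ι := fun i => S.equivFin.symm i with hl
  have hli : Function.Injective l := fun i j h => S.equivFin.symm.injective (Subtype.ext h)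
  have hS : Finset.univ.image l = S := by
    ext x
    simp only [Finset.mem_image, Finset.mem_univ, true_and, hl]
    constructor
    · rintro ⟨i, rfl⟩
      exact (S.equivFin.symm i).2
    · exact fun hx => ⟨S.equivFin ⟨x, hx⟩, by simp⟩
  have := fay (p ∘ l) (q ∘ l) (F ∘ l) (hq.comp hli) (fun i j => hpq _ _) (fun i => hq0 _) D e
    (fun i => hD _) (fun i => he _)
  rw [← hS]
  simp only [← th_comp p q _ l hli]
  exact this

end ThS
end Fay

/-! ### The spectral curve of the modes and the Bäcklund relations -/

section Modes
variable {ι : Type*} [LinearOrder ι] {M : ℕ} [NeZero M]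

/-- The function `m ↦ z^m` on `ZMod M`. -/
def zp (z : ℂ) (m : ZMod M) : ℂ := z ^ m.val

theorem zp_add_one {z : ℂ} (hz : z ^ M = 1) (m : ZMod M) : zp z (m + 1) = zp z m * z := by
  rw [zp, zp, ← pow_succ, ZMod.val_add, ← pow_eq_pow_mod _ hz]
  rcases Nat.lt_or_ge 1 M with h | h
  · have : Fact (1 < M) := ⟨h⟩
    rw [ZMod.val_one]
  · obtain rfl : M = 1 := le_antisymm h (NeZero.pos M)
    rw [pow_one] at hz
    simp [hz]

/-- The relations between the parameters `p = Δ`, `q = Δ*` of the modes. -/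
structure IsModes (M : ℕ) (k : ℂ) (p q : ι → ℂ) : Prop where
  q_inj : Function.Injective q
  p_ne_q : ∀ i j, p i ≠ q j
  p_ne : ∀ i, p i ≠ 0
  q_ne : ∀ i, q i ≠ 0
  quad : ∀ i, (p i - 1) * (q i - 1) = 1 + k
  k_ne : k ≠ 0
  k_ne' : 1 + k ≠ 0
  pow_eq : ∀ i, (p i / q i) ^ M = 1

/-- The `Θ`-function of the modes in `S` at the site `m`. -/
def TF (p q : ι → ℂ) (S : Finset ι) (f : ι → ℂ) (m : ZMod M) : ℂ :=
  ThS p q S fun i => f i * zp (p i / q i) m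

/-- `sd p q D i = (p_i - D) / (q_i - D)`. -/
def sd (p q : ι → ℂ) (D : ℂ) (i : ι) : ℂ := sg (p i) (q i) (D, 1)

variable {k : ℂ} {p q : ι → ℂ} (h : IsModes M k p q)
include h

theorem IsModes.p_ne_one (i) : p i - 1 ≠ 0 := fun e => h.k_ne' (by rw [← h.quad i, e, zero_mul])

theorem IsModes.q_ne_one (i) : q i - 1 ≠ 0 := fun e => h.k_ne' (by rw [← h.quad i, e, mul_zero])

theorem IsModes.p_add (i) : p i + k = q i * (p i - 1) := by
  linear_combination -(h.quad i)

theorem IsModes.q_add (i) : q i + k = p i * (q i - 1) := by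
  linear_combination -(h.quad i)

theorem IsModes.sd_one_ne (i) : sd p q 1 i ≠ 0 := by
  simp only [sd, sg, mul_one]
  exact div_ne_zero (h.p_ne_one i) (h.q_ne_one i)

theorem IsModes.z_ne (i) : p i / q i ≠ 0 := div_ne_zero (h.p_ne i) (h.q_ne i)

/-- By `quad`, `p + k = q (p - 1)` and `q + k = p (q - 1)`. The points `1` and `-k` therefore differ
by one lattice shift, which lets Fay's identity relate neighbouring sites. -/
theorem IsModes.sd_neg (i) : sd p q (-k) i = sd p q 1 i / (p i / q i) := by
  simp only [sd, sg, mul_one, sub_neg_eq_add, h.p_add, h.q_add]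
  have := h.q_ne_one i
  have := h.p_ne i
  have := h.q_ne i
  field_simp

/-- By `quad`, `(p_i - p_a)(p_i - q_a) = (p_i - 1)(p_i + q_i - p_a - q_a)`, and the same holds with
`q_i` in place of `p_i`; the common second factor cancels in the quotient. -/
theorem IsModes.sd_mul {i a : ι} (hia : i ≠ a) :
    sd p q (p a) i * sd p q (q a) i = sd p q 1 i := by
  simp only [sd, sg, mul_one]
  have h1 : q i - p a ≠ 0 := sub_ne_zero.2 (h.p_ne_q a i).symm
  have h2 : q i - q a ≠ 0 := sub_ne_zero.2 fun e => hia (h.q_inj e)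
  have h3 := h.q_ne_one i
  rw [div_mul_div_comm, div_eq_div_iff (mul_ne_zero h1 h2) h3]
  linear_combination (p i - q i) * (h.quad i - h.quad a)

theorem IsModes.TF_succ (S : Finset ι) (f : ι → ℂ) (m : ZMod M) :
    TF p q S f (m + 1) = TF p q S (fun i => f i * (p i / q i)) m := by
  simp only [TF, zp_add_one (h.pow_eq _)]
  congr 1
  funext i
  ring

theorem IsModes.TF_pred (S : Finset ι) (f : ι → ℂ) (m : ZMod M) :
    TF p q S f (m - 1) = TF p q S (fun i => f i / (p i / q i)) m := by
  conv_rhs => rw [← sub_add_cancel m 1, h.TF_succ]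
  congr 1
  funext i
  rw [div_mul_cancel₀ _ (h.z_ne i)]

/-- The quadratic relations between the `Θ`-functions of two states related by a Bäcklund
transformation with parameter `D`. -/
structure IsBacklund (k D : ℂ) (T H T' H' G : ZMod M → ℂ) : Prop where
  rel_two : ∀ m, T' (m - 1) * T' (m + 1) + k * T' m ^ 2 = (1 + k) * (H' m * G m)
  rel_three : ∀ m, T (m - 1) * T' (m + 1) - D * (T m * T' m) = (1 - D) * (H m * G m)
  rel_one : ∀ m, k * (T (m - 1) * T' m) + D * (T m * T' (m - 1)) = (k + D) * (H (m - 1) * G m)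

/-- Fay's identity for the pairs `(1, -k)`, `(D, 1)` and `(D, -k)`, with amplitudes divided by `sd p
q 1`; `sd_neg` rewrites the values at `-k` as lattice shifts. -/
theorem IsModes.isBacklund (S : Finset ι) (f : ι → ℂ) {D : ℂ} (hD : ∀ i, q i ≠ D) :
    IsBacklund (M := M) k D (TF p q S fun i => f i * (p i / q i) * sd p q D i / sd p q 1 i)
      (TF p q S fun i => f i * sd p q D i) (TF p q S f)
      (TF p q S fun i => f i * sd p q 1 i / (p i / q i))
      (TF p q S fun i => f i * (p i / q i) / sd p q 1 i) := by
  have h1 : ∀ i, q i ≠ 1 := fun i => sub_ne_zero.1 (h.q_ne_one i)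
  have hk : ∀ i, q i ≠ -k := fun i e => mul_ne_zero (h.p_ne i) (h.q_ne_one i)
    (by rw [← h.q_add, e, neg_add_cancel])
  constructor
  · intro m
    have := ThS_fay p q (fun i => f i * zp (p i / q i) m / sd p q 1 i) S h.q_inj h.p_ne_q h.q_ne
      h1 hk
    change -k * ThS p q S (fun i => f i * zp (p i / q i) m / sd p q 1 i * sd p q 1 i) *
      ThS p q S (fun i => f i * zp (p i / q i) m / sd p q 1 i * (p i / q i) * sd p q (-k) i) -
      1 * ThS p q S (fun i => f i * zp (p i / q i) m / sd p q 1 i * (p i / q i) * sd p q 1 i) *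
      ThS p q S (fun i => f i * zp (p i / q i) m / sd p q 1 i * sd p q (-k) i) +
      (1 - -k) * ThS p q S (fun i => f i * zp (p i / q i) m / sd p q 1 i * sd p q 1 i *
        sd p q (-k) i) * ThS p q S (fun i => f i * zp (p i / q i) m / sd p q 1 i *
          (p i / q i)) = 0 at this
    rw [h.TF_succ, h.TF_pred]
    simp only [TF]
    have e1 : (fun i => f i * zp (p i / q i) m / sd p q 1 i * sd p q 1 i) =
        fun i => f i * zp (p i / q i) m := by
      funext i; rw [div_mul_cancel₀ _ (h.sd_one_ne i)]
    have e2 : (fun i => f i * zp (p i / q i) m / sd p q 1 i * (p i / q i) * sd p q (-k) i) =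
        fun i => f i * zp (p i / q i) m := by
      funext i; rw [h.sd_neg]; have := h.sd_one_ne i; have := h.p_ne i; have := h.q_ne i; field_simp
    have e3 : (fun i => f i * zp (p i / q i) m / sd p q 1 i * (p i / q i) * sd p q 1 i) =
        fun i => f i * (p i / q i) * zp (p i / q i) m := by
      funext i; have := h.sd_one_ne i; field_simp
    have e4 : (fun i => f i * zp (p i / q i) m / sd p q 1 i * sd p q (-k) i) =
        fun i => f i / (p i / q i) * zp (p i / q i) m := by
      funext i; rw [h.sd_neg]; have := h.sd_one_ne i; field_simp
    have e5 : (fun i => f i * zp (p i / q i) m / sd p q 1 i * sd p q 1 i * sd p q (-k) i) =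
        fun i => f i * sd p q 1 i / (p i / q i) * zp (p i / q i) m := by
      funext i; rw [h.sd_neg]; have := h.sd_one_ne i; field_simp
    have e6 : (fun i => f i * zp (p i / q i) m / sd p q 1 i * (p i / q i)) =
        fun i => f i * (p i / q i) / sd p q 1 i * zp (p i / q i) m := by
      funext i; ring
    rw [e1, e2, e3, e4, e5, e6] at this
    linear_combination -this
  · intro m
    have := ThS_fay p q (fun i => f i * zp (p i / q i) m / sd p q 1 i) S h.q_inj h.p_ne_q h.q_ne
      hD h1
    change 1 * ThS p q S (fun i => f i * zp (p i / q i) m / sd p q 1 i * sd p q D i) *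
      ThS p q S (fun i => f i * zp (p i / q i) m / sd p q 1 i * (p i / q i) * sd p q 1 i) -
      D * ThS p q S (fun i => f i * zp (p i / q i) m / sd p q 1 i * (p i / q i) * sd p q D i) *
      ThS p q S (fun i => f i * zp (p i / q i) m / sd p q 1 i * sd p q 1 i) +
      (D - 1) * ThS p q S (fun i => f i * zp (p i / q i) m / sd p q 1 i * sd p q D i *
        sd p q 1 i) * ThS p q S (fun i => f i * zp (p i / q i) m / sd p q 1 i *
          (p i / q i)) = 0 at this
    rw [h.TF_succ, h.TF_pred]
    simp only [TF]
    have e1 : (fun i => f i * zp (p i / q i) m / sd p q 1 i * sd p q D i) =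
        fun i => f i * (p i / q i) * sd p q D i / sd p q 1 i / (p i / q i) *
          zp (p i / q i) m := by
      funext i; have := h.p_ne i; have := h.q_ne i; field_simp
    have e2 : (fun i => f i * zp (p i / q i) m / sd p q 1 i * (p i / q i) * sd p q 1 i) =
        fun i => f i * (p i / q i) * zp (p i / q i) m := by
      funext i; have := h.sd_one_ne i; field_simp
    have e3 : (fun i => f i * zp (p i / q i) m / sd p q 1 i * (p i / q i) * sd p q D i) =
        fun i => f i * (p i / q i) * sd p q D i / sd p q 1 i * zp (p i / q i) m := by
      funext i; ring
    have e4 : (fun i => f i * zp (p i / q i) m / sd p q 1 i * sd p q 1 i) =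
        fun i => f i * zp (p i / q i) m := by
      funext i; rw [div_mul_cancel₀ _ (h.sd_one_ne i)]
    have e5 : (fun i => f i * zp (p i / q i) m / sd p q 1 i * sd p q D i * sd p q 1 i) =
        fun i => f i * sd p q D i * zp (p i / q i) m := by
      funext i; have := h.sd_one_ne i; field_simp
    have e6 : (fun i => f i * zp (p i / q i) m / sd p q 1 i * (p i / q i)) =
        fun i => f i * (p i / q i) / sd p q 1 i * zp (p i / q i) m := by
      funext i; ring
    rw [e1, e2, e3, e4, e5, e6] at this
    linear_combination this
  · intro m
    have := ThS_fay p q (fun i => f i * zp (p i / q i) m / sd p q 1 i) S h.q_inj h.p_ne_q h.q_ne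
      hD hk
    change -k * ThS p q S (fun i => f i * zp (p i / q i) m / sd p q 1 i * sd p q D i) *
      ThS p q S (fun i => f i * zp (p i / q i) m / sd p q 1 i * (p i / q i) * sd p q (-k) i) -
      D * ThS p q S (fun i => f i * zp (p i / q i) m / sd p q 1 i * (p i / q i) * sd p q D i) *
      ThS p q S (fun i => f i * zp (p i / q i) m / sd p q 1 i * sd p q (-k) i) +
      (D - -k) * ThS p q S (fun i => f i * zp (p i / q i) m / sd p q 1 i * sd p q D i *
        sd p q (-k) i) * ThS p q S (fun i => f i * zp (p i / q i) m / sd p q 1 i *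
          (p i / q i)) = 0 at this
    rw [h.TF_pred, h.TF_pred, h.TF_pred]
    simp only [TF]
    have e1 : (fun i => f i * zp (p i / q i) m / sd p q 1 i * sd p q D i) =
        fun i => f i * (p i / q i) * sd p q D i / sd p q 1 i / (p i / q i) *
          zp (p i / q i) m := by
      funext i; have := h.p_ne i; have := h.q_ne i; field_simp
    have e2 : (fun i => f i * zp (p i / q i) m / sd p q 1 i * (p i / q i) * sd p q (-k) i) =
        fun i => f i * zp (p i / q i) m := by
      funext i; rw [h.sd_neg]; have := h.sd_one_ne i; have := h.p_ne i; have := h.q_ne i; field_simp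
    have e3 : (fun i => f i * zp (p i / q i) m / sd p q 1 i * (p i / q i) * sd p q D i) =
        fun i => f i * (p i / q i) * sd p q D i / sd p q 1 i * zp (p i / q i) m := by
      funext i; ring
    have e4 : (fun i => f i * zp (p i / q i) m / sd p q 1 i * sd p q (-k) i) =
        fun i => f i / (p i / q i) * zp (p i / q i) m := by
      funext i; rw [h.sd_neg]; have := h.sd_one_ne i; field_simp
    have e5 : (fun i => f i * zp (p i / q i) m / sd p q 1 i * sd p q D i * sd p q (-k) i) =
        fun i => f i * sd p q D i / (p i / q i) * zp (p i / q i) m := by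
      funext i; rw [h.sd_neg]; have := h.sd_one_ne i; field_simp
    have e6 : (fun i => f i * zp (p i / q i) m / sd p q 1 i * (p i / q i)) =
        fun i => f i * (p i / q i) / sd p q 1 i * zp (p i / q i) m := by
      funext i; ring
    rw [e1, e2, e3, e4, e5, e6] at this
    linear_combination -this

end Modes

/-! ### Steps in terms of `τ` and `θ`: Fermat equations from Bäcklund relations -/

section TauStep
variable {N M : ℕ} [NeZero N] [NeZero M] {κ : ℂ}

/-- `u_m = -ω^{-1/2} τ_{m-1} / τ_m`. -/
def uOf (N : ℕ) (τ : ZMod M → ℂ) (m : ZMod M) : ℂ := -(omHalf N)⁻¹ * (τ (m - 1) / τ m)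

/-- `w_m = -θ_m / θ_{m-1}`. -/
def wOf (θ : ZMod M → ℂ) (m : ZMod M) : ℂ := -(θ m / θ (m - 1))

theorem uOf_ne_zero {τ : ZMod M → ℂ} (h : ∀ m, τ m ≠ 0) (m : ZMod M) : uOf N τ m ≠ 0 :=
  mul_ne_zero (neg_ne_zero.2 (inv_ne_zero omHalf_ne_zero)) (div_ne_zero (h _) (h _))

theorem wOf_ne_zero {θ : ZMod M → ℂ} (h : ∀ m, θ m ≠ 0) (m : ZMod M) : wOf θ m ≠ 0 :=
  neg_ne_zero.2 (div_ne_zero (h _) (h _))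

/-- The coordinate `x_{1,m}` of a step between the states `τ` and `τ'`. -/
def xOne (N : ℕ) (κ δ : ℂ) (τ τ' : ZMod M → ℂ) (m : ZMod M) : ℂ :=
  (omHalf N)⁻¹ * (δ / κ) * ((τ m * τ' (m - 1)) / (τ (m - 1) * τ' m))

/-- The coordinate `x_{2,m}`. -/
def xTwo (N : ℕ) (κ : ℂ) (τ' : ZMod M → ℂ) (m : ZMod M) : ℂ :=
  (omHalf N)⁻¹ * κ * (τ' m ^ 2 / (τ' (m - 1) * τ' (m + 1)))

/-- The coordinate `x_{3,m}`. -/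
def xThree (N : ℕ) (δ : ℂ) (τ τ' : ZMod M → ℂ) (m : ZMod M) : ℂ :=
  (om N)⁻¹ * δ * ((τ m * τ' m) / (τ (m - 1) * τ' (m + 1)))

/-- The ratio `y_{1,m} / y_{3,m}`. -/
def etaOf (N : ℕ) (κ μ : ℂ) (θ τ' : ZMod M → ℂ) (m : ZMod M) : ℂ :=
  omHalf N * (μ / κ) * ((θ (m - 1) * τ' (m + 1)) / (θ m * τ' m))

/-- The ratio `y_{2,m} / y_{3,m}`. -/
def upsOf (N : ℕ) (ν : ℂ) (τ θ τ' θ' : ZMod M → ℂ) (m : ZMod M) : ℂ :=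
  omHalf N * ν * ((τ (m - 1) * θ' m) / (θ m * τ' (m - 1)))

/-- A Bäcklund step from the state `τ, θ` to the state `τ', θ'`. -/
structure TauStep (N M : ℕ) (κ : ℂ) where
  (τ θ τ' θ' y1 y2 y3 : ZMod M → ℂ)
  (δ μ ν : ℂ)
  κ_ne : κ ≠ 0
  τ_ne : ∀ m, τ m ≠ 0
  θ_ne : ∀ m, θ m ≠ 0
  τ'_ne : ∀ m, τ' m ≠ 0
  θ'_ne : ∀ m, θ' m ≠ 0
  f1 : ∀ m, Fermat N (xOne N κ δ τ τ' m) (y1 m)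
  f2 : ∀ m, Fermat N (xTwo N κ τ' m) (y2 m)
  f3 : ∀ m, Fermat N (xThree N δ τ τ' m) (y3 m)
  eta : ∀ m, y1 m / y3 m = etaOf N κ μ θ τ' m
  ups : ∀ m, y2 m / y3 m = upsOf N ν τ θ τ' θ' m

namespace TauStep

/-- The parameters of the step in terms of `u`, `w`. -/
def toStep (S : TauStep N M κ) : Step N M κ where
  u := uOf N S.τ
  w := wOf S.θ
  u' := uOf N S.τ'
  w' := wOf S.θ'
  x1 := xOne N κ S.δ S.τ S.τ'
  y1 := S.y1
  x2 := xTwo N κ S.τ'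
  y2 := S.y2
  x3 := xThree N S.δ S.τ S.τ'
  y3 := S.y3
  δ := S.δ
  μ := S.μ
  f1 := S.f1
  f2 := S.f2
  f3 := S.f3
  u_ne := uOf_ne_zero S.τ_ne
  w_ne := wOf_ne_zero S.θ_ne
  u'_ne := uOf_ne_zero S.τ'_ne
  w'_ne := wOf_ne_zero S.θ'_ne
  x1_eq m := by
    have := S.κ_ne; have := S.τ_ne m; have := S.τ_ne (m - 1); have := S.τ'_ne m
    have := S.τ'_ne (m - 1); have := omHalf_ne_zero (N := N)
    simp only [xOne, uOf]
    field_simp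
  x2_eq m := by
    have := S.κ_ne; have := S.τ'_ne m; have := S.τ'_ne (m + 1)
    have := S.τ'_ne (m - 1); have := omHalf_ne_zero (N := N)
    simp only [xTwo, uOf, add_sub_cancel_right]
    field_simp
  x3_eq m := by
    have := S.τ_ne m; have := S.τ'_ne m; have := S.τ'_ne (m + 1)
    have := S.τ_ne (m - 1); have := omHalf_ne_zero (N := N)
    simp only [xThree, uOf, add_sub_cancel_right, ← omHalf_sq]
    field_simp
  y13 m := by
    have := S.κ_ne; have := S.θ_ne m; have := S.θ_ne (m - 1); have := S.τ'_ne m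
    have := S.τ'_ne (m + 1); have := omHalf_ne_zero (N := N)
    have h := S.eta m
    rw [div_eq_iff (S.f3 m).ne] at h
    rw [h]
    simp only [etaOf, wOf, uOf, add_sub_cancel_right]
    field_simp
  gauge m := by
    have := S.θ_ne m; have := S.θ_ne (m + 1); have := S.τ'_ne m
    have := S.τ'_ne (m - 1); have := omHalf_ne_zero (N := N)
    have := S.θ'_ne m; have := S.θ'_ne (m + 1); have := S.τ_ne m
    have := S.τ_ne (m - 1)
    rw [S.ups, S.ups]
    simp only [upsOf, wOf, uOf, add_sub_cancel_right]
    field_simp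

theorem toStep_η (S : TauStep N M κ) : S.toStep.η = etaOf N κ S.μ S.θ S.τ' := funext S.eta

theorem toStep_υ (S : TauStep N M κ) : S.toStep.υ = upsOf N S.ν S.τ S.θ S.τ' S.θ' := funext S.ups

end TauStep

theorem ne_zero_of_pow_eq {x X : ℂ} (hx : x ^ N = X) (hX : X ≠ 0) : x ≠ 0 := fun e => hX <| by
  rw [← hx, e, zero_pow (NeZero.ne N)]

/-- The relations between a step and the classical data it is built from. -/
structure StepRoots (N : ℕ) (κ D : ℂ) (T H T' H' G τ θ τ' θ' : ZMod M → ℂ) (δ μ ν : ℂ) :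
    Prop where
  backlund : IsBacklund (κ ^ N) D T H T' H' G
  κ_ne : κ ≠ 0
  one_add_ne : 1 + κ ^ N ≠ 0
  D_ne : 1 - D ≠ 0
  D_add_ne : κ ^ N + D ≠ 0
  δ_pow : δ ^ N = D
  μ_pow : μ ^ N * (D - 1) = D + κ ^ N
  ν_pow : ν ^ N * (D - 1) = 1 + κ ^ N
  τ_pow : ∀ m, τ m ^ N = T m
  θ_pow : ∀ m, θ m ^ N = H m
  τ'_pow : ∀ m, τ' m ^ N = T' m
  θ'_pow : ∀ m, θ' m ^ N = H' m
  T_ne : ∀ m, T m ≠ 0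
  H_ne : ∀ m, H m ≠ 0
  T'_ne : ∀ m, T' m ≠ 0
  H'_ne : ∀ m, H' m ≠ 0

namespace StepRoots
variable {D : ℂ} {T H T' H' G τ θ τ' θ' : ZMod M → ℂ} {δ μ ν : ℂ}
  (h : StepRoots N κ D T H T' H' G τ θ τ' θ' δ μ ν)
include h


theorem τ_ne (m) : τ m ≠ 0 := ne_zero_of_pow_eq (h.τ_pow m) (h.T_ne m)
theorem θ_ne (m) : θ m ≠ 0 := ne_zero_of_pow_eq (h.θ_pow m) (h.H_ne m)
theorem τ'_ne (m) : τ' m ≠ 0 := ne_zero_of_pow_eq (h.τ'_pow m) (h.T'_ne m)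
theorem θ'_ne (m) : θ' m ≠ 0 := ne_zero_of_pow_eq (h.θ'_pow m) (h.H'_ne m)
theorem μ_ne : μ ≠ 0 := fun e => h.D_add_ne <| by
  rw [add_comm, ← h.μ_pow, e, zero_pow (NeZero.ne N), zero_mul]
theorem ν_ne : ν ≠ 0 := fun e => h.one_add_ne <| by
  rw [← h.ν_pow, e, zero_pow (NeZero.ne N), zero_mul]

theorem xOne_pow (m : ZMod M) :
    xOne N κ δ τ τ' m ^ N = -(D / κ ^ N * ((T m * T' (m - 1)) / (T (m - 1) * T' m))) := by
  simp only [xOne, mul_pow, div_pow, inv_pow, omHalf_pow_card, h.δ_pow, h.τ_pow, h.τ'_pow]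
  ring

theorem xTwo_pow (m : ZMod M) :
    xTwo N κ τ' m ^ N = -(κ ^ N * (T' m ^ 2 / (T' (m - 1) * T' (m + 1)))) := by
  simp only [xTwo, mul_pow, div_pow, inv_pow, omHalf_pow_card, ← pow_mul, mul_comm 2 N]
  simp only [pow_mul, h.τ'_pow]
  ring

theorem xThree_pow (m : ZMod M) :
    xThree N δ τ τ' m ^ N = D * ((T m * T' m) / (T (m - 1) * T' (m + 1))) := by
  simp only [xThree, mul_pow, div_pow, inv_pow, om_pow_card, h.δ_pow, h.τ_pow, h.τ'_pow]
  ring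

theorem etaOf_pow (m : ZMod M) : etaOf N κ μ θ τ' m ^ N =
    -(μ ^ N / κ ^ N * ((H (m - 1) * T' (m + 1)) / (H m * T' m))) := by
  simp only [etaOf, mul_pow, div_pow, omHalf_pow_card, h.θ_pow, h.τ'_pow]
  ring

theorem upsOf_pow (m : ZMod M) : upsOf N ν τ θ τ' θ' m ^ N =
    -(ν ^ N * ((T (m - 1) * H' m) / (H m * T' (m - 1)))) := by
  simp only [upsOf, mul_pow, div_pow, omHalf_pow_card, h.θ_pow, h.τ_pow, h.θ'_pow, h.τ'_pow]
  ring

theorem etaOf_ne (m) : etaOf N κ μ θ τ' m ≠ 0 :=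
  mul_ne_zero (mul_ne_zero omHalf_ne_zero (div_ne_zero h.μ_ne h.κ_ne))
    (div_ne_zero (mul_ne_zero (h.θ_ne _) (h.τ'_ne _)) (mul_ne_zero (h.θ_ne _) (h.τ'_ne _)))

theorem upsOf_ne (m) : upsOf N ν τ θ τ' θ' m ≠ 0 :=
  mul_ne_zero (mul_ne_zero omHalf_ne_zero h.ν_ne)
    (div_ne_zero (mul_ne_zero (h.τ_ne _) (h.θ'_ne _)) (mul_ne_zero (h.θ_ne _) (h.τ'_ne _)))

theorem one_sub_xThree_pow (m : ZMod M) :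
    1 - xThree N δ τ τ' m ^ N = (1 - D) * (H m * G m) / (T (m - 1) * T' (m + 1)) := by
  rw [h.xThree_pow, ← h.backlund.rel_three]
  have := h.T_ne (m - 1); have := h.T'_ne (m + 1)
  field_simp

/-- `rel_three` evaluates `1 - x3 ^ N`, so choosing `y3` is choosing an `N`-th root, and `y3 ≠ 0`
amounts to `G m ≠ 0`. -/
theorem fermat_three_iff (m : ZMod M) {y : ℂ} :
    Fermat N (xThree N δ τ τ' m) y ↔
      y ^ N = (1 - D) * (H m * G m) / (T (m - 1) * T' (m + 1)) ∧ G m ≠ 0 := by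
  rw [← h.one_sub_xThree_pow]
  constructor
  · intro f
    refine ⟨by rw [← f.eq]; ring, fun e => ?_⟩
    have := f.pow_ne_one
    rw [ne_comm, ← sub_ne_zero, h.one_sub_xThree_pow, e, mul_zero, mul_zero, zero_div] at this
    exact this rfl
  · rintro ⟨e, hG⟩
    refine ⟨by rw [e]; ring, ?_⟩
    refine ne_zero_of_pow_eq e ?_
    rw [h.one_sub_xThree_pow]
    exact div_ne_zero (mul_ne_zero h.D_ne (mul_ne_zero (h.H_ne m) hG))
      (mul_ne_zero (h.T_ne _) (h.T'_ne _))

/-- The step with a given choice of the coordinates `y_{3,m}`. -/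
def mkStep {y3 : ZMod M → ℂ} (f3 : ∀ m, Fermat N (xThree N δ τ τ' m) (y3 m)) :
    TauStep N M κ where
  τ := τ
  θ := θ
  τ' := τ'
  θ' := θ'
  y1 m := etaOf N κ μ θ τ' m * y3 m
  y2 m := upsOf N ν τ θ τ' θ' m * y3 m
  y3 := y3
  δ := δ
  μ := μ
  ν := ν
  κ_ne := h.κ_ne
  τ_ne := h.τ_ne
  θ_ne := h.θ_ne
  τ'_ne := h.τ'_ne
  θ'_ne := h.θ'_ne
  -- After insertion of the `N`-th powers this Fermat equation is `rel_one`, and the next one is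
  -- `rel_two`; the powers of `μ` and `ν` supply the constants.
  f1 m := by
    refine ⟨?_, mul_ne_zero (h.etaOf_ne m) (f3 m).ne⟩
    obtain ⟨e, -⟩ := (h.fermat_three_iff m).1 (f3 m)
    rw [h.xOne_pow, mul_pow, h.etaOf_pow, e]
    have := h.T_ne (m - 1); have := h.T'_ne (m + 1); have := h.H_ne m; have := h.T'_ne m
    have := pow_ne_zero N h.κ_ne
    field_simp
    linear_combination -(h.backlund.rel_one m) + H (m - 1) * G m * h.μ_pow
  f2 m := by
    refine ⟨?_, mul_ne_zero (h.upsOf_ne m) (f3 m).ne⟩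
    obtain ⟨e, -⟩ := (h.fermat_three_iff m).1 (f3 m)
    rw [h.xTwo_pow, mul_pow, h.upsOf_pow, e]
    have := h.T_ne (m - 1); have := h.T'_ne (m + 1); have := h.H_ne m; have := h.T'_ne (m - 1)
    field_simp
    linear_combination -(h.backlund.rel_two m) + H' m * G m * h.ν_pow
  f3 := f3
  eta m := mul_div_cancel_right₀ _ (f3 m).ne
  ups m := mul_div_cancel_right₀ _ (f3 m).ne

theorem exists_fermat (hG : ∀ m, G m ≠ 0) :
    ∃ y3 : ZMod M → ℂ, ∀ m, Fermat N (xThree N δ τ τ' m) (y3 m) := by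
  choose y hy using fun m => IsAlgClosed.exists_pow_nat_eq
    ((1 - D) * (H m * G m) / (T (m - 1) * T' (m + 1))) (NeZero.pos N)
  exact ⟨y, fun m => (h.fermat_three_iff m).2 ⟨hy m, hG m⟩⟩

end StepRoots
end TauStep

/-! ### Continuous deformation of steps -/

section Deform
variable {N M : ℕ} [NeZero N] [NeZero M] {κ : ℂ}

/-- The `N`-th root of `F` close to `r`, for `F` close to `r ^ N`. -/
def rootNear (N : ℕ) (r F : ℂ) : ℂ := r * (F / r ^ N) ^ ((N : ℂ)⁻¹)

theorem rootNear_pow {r : ℂ} (hr : r ≠ 0) (F : ℂ) : rootNear N r F ^ N = F := by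
  rw [rootNear, mul_pow, Complex.cpow_nat_inv_pow _ (NeZero.ne N),
    mul_div_cancel₀ _ (pow_ne_zero N hr)]

theorem rootNear_self {r : ℂ} (hr : r ≠ 0) : rootNear N r (r ^ N) = r := by
  rw [rootNear, div_self (pow_ne_zero N hr), Complex.one_cpow, mul_one]

theorem differentiableAt_rootNear {r : ℂ} (hr : r ≠ 0) :
    DifferentiableAt ℂ (rootNear N r) (r ^ N) := by
  unfold rootNear
  refine (DifferentiableAt.cpow (by fun_prop) (by fun_prop) ?_).const_mul r
  rw [div_self (pow_ne_zero N hr)]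
  exact Complex.one_mem_slitPlane

theorem tendsto_rootNear {J : Type*} {l : Filter J} {F : J → ℂ} {r : ℂ} (hr : r ≠ 0)
    (h : Tendsto F l (𝓝 (r ^ N))) : Tendsto (fun j => rootNear N r (F j)) l (𝓝 r) := by
  have := (differentiableAt_rootNear (N := N) hr).continuousAt.tendsto.comp h
  rwa [rootNear_self hr] at this

/-- The `Q`-operator in terms of the `τ`-functions. -/
def rawQ (N : ℕ) [NeZero N] (κ δ : ℂ) (τ τ' y1 y2 y3 : ZMod M → ℂ) : Op N M :=
  Matrix.of fun α β => ∏ m : ZMod M,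
    qLoc (xOne N κ δ τ τ' m) (y1 m) (xTwo N κ τ' m) (y2 m) (xThree N δ τ τ' m) (y3 m)
      (α m) (β m) (β (m + 1))

/-- The normalisation of `rawQ`. -/
def rawRho (N : ℕ) [NeZero N] (κ δ : ℂ) (τ τ' y1 y2 y3 : ZMod M → ℂ) : ℝ :=
  ∏ m : ZMod M, ‖(qMat (N := N) (xOne N κ δ τ τ' m) (y1 m) (xTwo N κ τ' m) (y2 m)
    (xThree N δ τ τ' m) (y3 m) 0).det‖

namespace TauStep

theorem y1_eq (S : TauStep N M κ) : S.y1 = fun m => etaOf N κ S.μ S.θ S.τ' m * S.y3 m :=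
  funext fun m => (div_eq_iff (S.f3 m).ne).1 (S.eta m)

theorem y2_eq (S : TauStep N M κ) :
    S.y2 = fun m => upsOf N S.ν S.τ S.θ S.τ' S.θ' m * S.y3 m :=
  funext fun m => (div_eq_iff (S.f3 m).ne).1 (S.ups m)

/-- The `Q`-operator of a step. -/
def Q (S : TauStep N M κ) : Op N M := S.toStep.Q

/-- The normalisation of the `Q`-operator of a step. -/
def rho (S : TauStep N M κ) : ℝ := S.toStep.rho

theorem rho_pos (S : TauStep N M κ) : 0 < S.rho := S.toStep.rho_pos

theorem Q_eq (S : TauStep N M κ) : S.Q = rawQ N κ S.δ S.τ S.τ' S.y1 S.y2 S.y3 := rfl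

theorem rho_eq (S : TauStep N M κ) : S.rho = rawRho N κ S.δ S.τ S.τ' S.y1 S.y2 S.y3 := rfl

end TauStep

section Tendsto
variable {J : Type*} {l : Filter J}

theorem Fermat.tendsto_wFun {x y : J → ℂ} {x₀ y₀ : ℂ} (h : Fermat N x₀ y₀)
    (hx : Tendsto x l (𝓝 x₀)) (hy : Tendsto y l (𝓝 y₀)) (n : ZMod N) :
    Tendsto (fun j => wFun N (x j) (y j) n) l (𝓝 (wFun N x₀ y₀ n)) := by
  refine tendsto_finsetProd _ fun i _ => hy.div (tendsto_const_nhds.sub (hx.mul_const _)) ?_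
  have := h.one_sub_ne_zero ((i + 1 : ℕ) : ZMod N)
  rwa [chi_natCast] at this

theorem tendsto_qLoc {x1 y1 x2 y2 x3 y3 : J → ℂ} {a1 b1 a2 b2 a3 b3 : ℂ}
    (h1 : Fermat N a1 b1) (h2 : Fermat N a2 b2) (h3 : Fermat N a3 b3)
    (t1 : Tendsto x1 l (𝓝 a1)) (s1 : Tendsto y1 l (𝓝 b1))
    (t2 : Tendsto x2 l (𝓝 a2)) (s2 : Tendsto y2 l (𝓝 b2))
    (t3 : Tendsto x3 l (𝓝 a3)) (s3 : Tendsto y3 l (𝓝 b3)) (a b b' : ZMod N) :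
    Tendsto (fun j => qLoc (x1 j) (y1 j) (x2 j) (y2 j) (x3 j) (y3 j) a b b') l
      (𝓝 (qLoc a1 b1 a2 b2 a3 b3 a b b')) :=
  (((h1.tendsto_wFun t1 s1 _).mul (h2.tendsto_wFun t2 s2 _)).div (h3.tendsto_wFun t3 s3 _)
    (h3.wFun_ne_zero _)).const_mul _

variable (S : TauStep N M κ) {δ : J → ℂ} {τ τ' y1 y2 y3 : J → ZMod M → ℂ}

theorem TauStep.tendsto_xOne (hδ : Tendsto δ l (𝓝 S.δ))
    (hτ : ∀ m, Tendsto (fun j => τ j m) l (𝓝 (S.τ m)))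
    (hτ' : ∀ m, Tendsto (fun j => τ' j m) l (𝓝 (S.τ' m))) (m : ZMod M) :
    Tendsto (fun j => xOne N κ (δ j) (τ j) (τ' j) m) l (𝓝 (xOne N κ S.δ S.τ S.τ' m)) :=
  ((hδ.div_const _).const_mul _).mul (((hτ _).mul (hτ' _)).div ((hτ _).mul (hτ' _))
    (mul_ne_zero (S.τ_ne _) (S.τ'_ne _)))

theorem TauStep.tendsto_xTwo
    (hτ' : ∀ m, Tendsto (fun j => τ' j m) l (𝓝 (S.τ' m))) (m : ZMod M) :
    Tendsto (fun j => xTwo N κ (τ' j) m) l (𝓝 (xTwo N κ S.τ' m)) :=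
  (((hτ' _).pow 2).div ((hτ' _).mul (hτ' _)) (mul_ne_zero (S.τ'_ne _) (S.τ'_ne _))).const_mul _

theorem TauStep.tendsto_xThree (hδ : Tendsto δ l (𝓝 S.δ))
    (hτ : ∀ m, Tendsto (fun j => τ j m) l (𝓝 (S.τ m)))
    (hτ' : ∀ m, Tendsto (fun j => τ' j m) l (𝓝 (S.τ' m))) (m : ZMod M) :
    Tendsto (fun j => xThree N (δ j) (τ j) (τ' j) m) l (𝓝 (xThree N S.δ S.τ S.τ' m)) :=
  (hδ.const_mul _).mul (((hτ _).mul (hτ' _)).div ((hτ _).mul (hτ' _))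
    (mul_ne_zero (S.τ_ne _) (S.τ'_ne _)))

theorem TauStep.tendsto_rawQ (hδ : Tendsto δ l (𝓝 S.δ))
    (hτ : ∀ m, Tendsto (fun j => τ j m) l (𝓝 (S.τ m)))
    (hτ' : ∀ m, Tendsto (fun j => τ' j m) l (𝓝 (S.τ' m)))
    (h1 : ∀ m, Tendsto (fun j => y1 j m) l (𝓝 (S.y1 m)))
    (h2 : ∀ m, Tendsto (fun j => y2 j m) l (𝓝 (S.y2 m)))
    (h3 : ∀ m, Tendsto (fun j => y3 j m) l (𝓝 (S.y3 m))) :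
    Tendsto (fun j => rawQ N κ (δ j) (τ j) (τ' j) (y1 j) (y2 j) (y3 j)) l (𝓝 S.Q) := by
  rw [S.Q_eq]
  refine tendsto_pi_nhds.2 fun α => tendsto_pi_nhds.2 fun β => ?_
  exact tendsto_finsetProd _ fun m _ => tendsto_qLoc (S.f1 m) (S.f2 m) (S.f3 m)
    (S.tendsto_xOne hδ hτ hτ' m) (h1 m) (S.tendsto_xTwo hτ' m) (h2 m)
    (S.tendsto_xThree hδ hτ hτ' m) (h3 m) _ _ _

theorem TauStep.tendsto_rawRho (hδ : Tendsto δ l (𝓝 S.δ))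
    (hτ : ∀ m, Tendsto (fun j => τ j m) l (𝓝 (S.τ m)))
    (hτ' : ∀ m, Tendsto (fun j => τ' j m) l (𝓝 (S.τ' m)))
    (h1 : ∀ m, Tendsto (fun j => y1 j m) l (𝓝 (S.y1 m)))
    (h2 : ∀ m, Tendsto (fun j => y2 j m) l (𝓝 (S.y2 m)))
    (h3 : ∀ m, Tendsto (fun j => y3 j m) l (𝓝 (S.y3 m))) :
    Tendsto (fun j => rawRho N κ (δ j) (τ j) (τ' j) (y1 j) (y2 j) (y3 j)) l (𝓝 S.rho) := by
  rw [S.rho_eq]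
  refine tendsto_finsetProd _ fun m _ => Tendsto.norm ?_
  refine ((continuous_id.matrix_det).tendsto _).comp ?_
  refine tendsto_pi_nhds.2 fun b => tendsto_pi_nhds.2 fun b' => ?_
  exact tendsto_qLoc (S.f1 m) (S.f2 m) (S.f3 m)
    (S.tendsto_xOne hδ hτ hτ' m) (h1 m) (S.tendsto_xTwo hτ' m) (h2 m)
    (S.tendsto_xThree hδ hτ hτ' m) (h3 m) _ _ _

/-- A step can be deformed along any deformation of its classical data. -/
theorem TauStep.exists_deformation {D : ℂ} {T H T' H' G : ZMod M → ℂ}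
    (h : StepRoots N κ D T H T' H' G S.τ S.θ S.τ' S.θ' S.δ S.μ S.ν)
    {D' μ ν : J → ℂ} {U V U' V' W : J → ZMod M → ℂ}
    (hb : ∀ᶠ j in l, IsBacklund (κ ^ N) (D' j) (U j) (V j) (U' j) (V' j) (W j))
    (hD : Tendsto D' l (𝓝 D)) (hδ : Tendsto δ l (𝓝 S.δ)) (hμ : Tendsto μ l (𝓝 S.μ))
    (hν : Tendsto ν l (𝓝 S.ν)) (δp : ∀ᶠ j in l, δ j ^ N = D' j)
    (μp : ∀ᶠ j in l, μ j ^ N * (D' j - 1) = D' j + κ ^ N)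
    (νp : ∀ᶠ j in l, ν j ^ N * (D' j - 1) = 1 + κ ^ N)
    (hU : ∀ m, Tendsto (fun j => U j m) l (𝓝 (T m)))
    (hV : ∀ m, Tendsto (fun j => V j m) l (𝓝 (H m)))
    (hU' : ∀ m, Tendsto (fun j => U' j m) l (𝓝 (T' m)))
    (hV' : ∀ m, Tendsto (fun j => V' j m) l (𝓝 (H' m)))
    (hW : ∀ m, Tendsto (fun j => W j m) l (𝓝 (G m))) :
    ∃ (A : J → Op N M) (r : J → ℝ), Tendsto A l (𝓝 S.Q) ∧ Tendsto r l (𝓝 S.rho) ∧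
      ∀ᶠ j in l, ∃ S' : TauStep N M κ, S'.τ = (fun m => rootNear N (S.τ m) (U j m)) ∧
        S'.θ = (fun m => rootNear N (S.θ m) (V j m)) ∧
        S'.τ' = (fun m => rootNear N (S.τ' m) (U' j m)) ∧
        S'.θ' = (fun m => rootNear N (S.θ' m) (V' j m)) ∧
        S'.δ = δ j ∧ S'.μ = μ j ∧ S'.ν = ν j ∧ S'.Q = A j ∧ S'.rho = r j := by
  have tτ : ∀ m, Tendsto (fun j => rootNear N (S.τ m) (U j m)) l (𝓝 (S.τ m)) := fun m =>
    tendsto_rootNear (S.τ_ne m) (by rw [h.τ_pow]; exact hU m)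
  have tθ : ∀ m, Tendsto (fun j => rootNear N (S.θ m) (V j m)) l (𝓝 (S.θ m)) := fun m =>
    tendsto_rootNear (S.θ_ne m) (by rw [h.θ_pow]; exact hV m)
  have tτ' : ∀ m, Tendsto (fun j => rootNear N (S.τ' m) (U' j m)) l (𝓝 (S.τ' m)) := fun m =>
    tendsto_rootNear (S.τ'_ne m) (by rw [h.τ'_pow]; exact hU' m)
  have tθ' : ∀ m, Tendsto (fun j => rootNear N (S.θ' m) (V' j m)) l (𝓝 (S.θ' m)) := fun m =>
    tendsto_rootNear (S.θ'_ne m) (by rw [h.θ'_pow]; exact hV' m)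
  set τ : J → ZMod M → ℂ := fun j m => rootNear N (S.τ m) (U j m) with hτ
  set θ : J → ZMod M → ℂ := fun j m => rootNear N (S.θ m) (V j m) with hθ
  set τ' : J → ZMod M → ℂ := fun j m => rootNear N (S.τ' m) (U' j m) with hτ'
  set θ' : J → ZMod M → ℂ := fun j m => rootNear N (S.θ' m) (V' j m) with hθ'
  -- Only `y3` needs a root of its own, taken close to the old one. `y1` and `y2` are then defined
  -- by the prescribed ratios, so all coordinates converge.
  set y3 : J → ZMod M → ℂ := fun j m => rootNear N (S.y3 m)
    (1 - xThree N (δ j) (τ j) (τ' j) m ^ N) with hy3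
  have t3 : ∀ m, Tendsto (fun j => y3 j m) l (𝓝 (S.y3 m)) := fun m => by
    refine tendsto_rootNear (S.f3 m).ne ?_
    rw [show S.y3 m ^ N = 1 - xThree N S.δ S.τ S.τ' m ^ N by rw [← (S.f3 m).eq]; ring]
    exact tendsto_const_nhds.sub ((S.tendsto_xThree hδ tτ tτ' m).pow N)
  have t1 : ∀ m, Tendsto (fun j => etaOf N κ (μ j) (θ j) (τ' j) m * y3 j m) l (𝓝 (S.y1 m)) := by
    intro m
    rw [S.y1_eq]
    exact (((hμ.div_const _).const_mul _).mul (((tθ _).mul (tτ' _)).div ((tθ _).mul (tτ' _))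
      (mul_ne_zero (S.θ_ne _) (S.τ'_ne _)))).mul (t3 m)
  have t2 : ∀ m, Tendsto (fun j => upsOf N (ν j) (τ j) (θ j) (τ' j) (θ' j) m * y3 j m) l
      (𝓝 (S.y2 m)) := by
    intro m
    rw [S.y2_eq]
    exact ((hν.const_mul _).mul (((tτ _).mul (tθ' _)).div ((tθ _).mul (tτ' _))
      (mul_ne_zero (S.θ_ne _) (S.τ'_ne _)))).mul (t3 m)
  refine ⟨_, _, S.tendsto_rawQ hδ tτ tτ' t1 t2 t3, S.tendsto_rawRho hδ tτ tτ' t1 t2 t3, ?_⟩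
  have hG : ∀ m, G m ≠ 0 := fun m => ((h.fermat_three_iff m).1 (S.f3 m)).2
  filter_upwards [hb, δp, μp, νp, (hD.const_sub 1).eventually_ne h.D_ne,
    (hD.const_add (κ ^ N)).eventually_ne h.D_add_ne,
    eventually_all.2 fun m => (hU m).eventually_ne (h.T_ne m),
    eventually_all.2 fun m => (hV m).eventually_ne (h.H_ne m),
    eventually_all.2 fun m => (hU' m).eventually_ne (h.T'_ne m),
    eventually_all.2 fun m => (hV' m).eventually_ne (h.H'_ne m),
    eventually_all.2 fun m => (hW m).eventually_ne (hG m)]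
    with j bj dj mj nj Dj Dj' uj vj uj' vj' wj
  have hj : StepRoots N κ (D' j) (U j) (V j) (U' j) (V' j) (W j) (τ j) (θ j) (τ' j) (θ' j)
      (δ j) (μ j) (ν j) :=
    { backlund := bj, κ_ne := h.κ_ne, one_add_ne := h.one_add_ne, D_ne := Dj, D_add_ne := Dj'
      δ_pow := dj, μ_pow := mj, ν_pow := nj
      τ_pow := fun m => rootNear_pow (S.τ_ne m) _
      θ_pow := fun m => rootNear_pow (S.θ_ne m) _
      τ'_pow := fun m => rootNear_pow (S.τ'_ne m) _
      θ'_pow := fun m => rootNear_pow (S.θ'_ne m) _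
      T_ne := uj, H_ne := vj, T'_ne := uj', H'_ne := vj' }
  refine ⟨hj.mkStep fun m => (hj.fermat_three_iff m).2 ⟨?_, wj m⟩, rfl, rfl, rfl, rfl, rfl, rfl,
    rfl, rfl, rfl⟩
  rw [← hj.one_sub_xThree_pow]
  exact rootNear_pow (S.f3 m).ne _

end Tendsto
end Deform

/-! ### States, edges between them, and squares of edges -/

section States
variable {ι : Type*} [LinearOrder ι] {N M : ℕ} [NeZero N] [NeZero M] {κ : ℂ}

/-- The function `s_i(ξ)`. -/
def sf (p q : ι → ℂ) (ξ : ℂ) (i : ι) : ℂ := q i / p i * ((p i - ξ) / (q i - ξ))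

theorem sf_eq (p q : ι → ℂ) (ξ : ℂ) (i : ι) : sf p q ξ i = sd p q ξ i / (p i / q i) := by
  simp only [sf, sd, sg, mul_one]
  rw [div_div_eq_mul_div]
  ring

/-- The amplitudes of the state with the modes in `S`. -/
def amp (p q g : ι → ℂ) (S : Finset ι) (i : ι) : ℂ := g i * ∏ j ∈ S.erase i, sf p q (q j) i

/-- The values `τ_m^N` of the state with the modes in `S`. -/
def ST (p q g : ι → ℂ) (S : Finset ι) (m : ZMod M) : ℂ := TF p q S (amp p q g S) m

/-- The values `θ_m^N` of the state with the modes in `S`. -/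
def SH (p q g : ι → ℂ) (S : Finset ι) (m : ZMod M) : ℂ :=
  TF p q S (fun i => amp p q g S i * sd p q 1 i / (p i / q i)) m

/-- The auxiliary `Θ`-functions which govern the coordinates `y`. -/
def SG (p q g : ι → ℂ) (S : Finset ι) (m : ZMod M) : ℂ :=
  TF p q S (fun i => amp p q g S i * (p i / q i) / sd p q 1 i) m

theorem amp_insert (p q g : ι → ℂ) {S : Finset ι} {a i : ι} (ha : a ∉ S) (hi : i ≠ a) :
    amp p q g (insert a S) i = amp p q g S i * (sd p q (q a) i / (p i / q i)) := by
  rw [amp, amp, Finset.erase_insert_of_ne hi.symm, Finset.prod_insert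
    fun h => ha (Finset.mem_of_mem_erase h), sf_eq]
  ring

/-- The state without the mode `a` is a Bäcklund transform of the state with it. -/
theorem IsModes.ST_eq {k : ℂ} {p q : ι → ℂ} (h : IsModes M k p q) (g : ι → ℂ)
    {S : Finset ι} {a : ι} (ha : a ∉ S) (m : ZMod M) :
    ST p q g S m = TF p q (insert a S) (fun i => amp p q g (insert a S) i * (p i / q i) *
      sd p q (p a) i / sd p q 1 i) m := by
  -- At `D = p a` the mode `a` drops out. For the other modes `sd_mul` cancels the factor which the
  -- presence of `a` put into their amplitudes.
  have h0 : sd p q (p a) a = 0 := by simp [sd, sg]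
  rw [TF, ThS_insert_of_zero p q ha (by simp [h0])]
  refine ThS_congr p q fun i hi => ?_
  have hia : i ≠ a := fun e => ha (e ▸ hi)
  rw [amp_insert p q g ha hia, ← h.sd_mul hia]
  have h1 := h.sd_one_ne i
  rw [← h.sd_mul hia] at h1
  have := h.z_ne i
  have h2 := left_ne_zero_of_mul h1
  have h3 := right_ne_zero_of_mul h1
  have := h.p_ne i
  have := h.q_ne i
  field_simp

theorem IsModes.SH_eq {k : ℂ} {p q : ι → ℂ} (h : IsModes M k p q) (g : ι → ℂ)
    {S : Finset ι} {a : ι} (ha : a ∉ S) (m : ZMod M) :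
    SH p q g S m = TF p q (insert a S) (fun i => amp p q g (insert a S) i * sd p q (p a) i) m := by
  have h0 : sd p q (p a) a = 0 := by simp [sd, sg]
  rw [TF, ThS_insert_of_zero p q ha (by simp [h0]), SH, TF]
  refine ThS_congr p q fun i hi => ?_
  have hia : i ≠ a := fun e => ha (e ▸ hi)
  rw [amp_insert p q g ha hia, ← h.sd_mul hia]
  ring

theorem IsModes.isBacklund_insert {k : ℂ} {p q : ι → ℂ} (h : IsModes M k p q) (g : ι → ℂ)
    {S : Finset ι} {a : ι} (ha : a ∉ S) :
    IsBacklund (M := M) k (p a) (ST p q g S) (SH p q g S) (ST p q g (insert a S))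
      (SH p q g (insert a S)) (SG p q g (insert a S)) := by
  rw [show ST p q g S = _ from funext fun m => h.ST_eq (M := M) g ha m,
    show SH p q g S = _ from funext fun m => h.SH_eq (M := M) g ha m]
  exact h.isBacklund (insert a S) (amp p q g (insert a S)) fun i => (h.p_ne_q a i).symm

/-- Roots `δ^N = p`, `μ^N = q`, `ν^N = q - 1`, one for each mode. -/
structure ModeRoots (N : ℕ) (p q : ι → ℂ) where
  (δ μ ν : ι → ℂ)
  δ_pow : ∀ i, δ i ^ N = p i
  μ_pow : ∀ i, μ i ^ N = q i
  ν_pow : ∀ i, ν i ^ N = q i - 1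

/-- A set of modes and values `τ_m`, `θ_m`. -/
structure PState (ι : Type*) (M : ℕ) where
  S : Finset ι
  (τ θ : ZMod M → ℂ)

/-- `τ_m`, `θ_m` are roots of the prescribed values. -/
structure PState.Valid (N : ℕ) (p q g : ι → ℂ) (A : PState ι M) : Prop where
  τ_pow : ∀ m, A.τ m ^ N = ST p q g A.S m
  θ_pow : ∀ m, A.θ m ^ N = SH p q g A.S m

/-- `X` is a step from the state `A` to the state `B`, which has the additional mode `a`. -/
structure IsEdge (g : ι → ℂ) {p q : ι → ℂ} (R : ModeRoots N p q) (a : ι) (A B : PState ι M)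
    (X : TauStep N M κ) : Prop where
  notMem : a ∉ A.S
  set_eq : B.S = insert a A.S
  validA : A.Valid N p q g
  validB : B.Valid N p q g
  τ_eq : X.τ = A.τ
  θ_eq : X.θ = A.θ
  τ'_eq : X.τ' = B.τ
  θ'_eq : X.θ' = B.θ
  δ_eq : X.δ = R.δ a
  μ_eq : X.μ = R.μ a
  ν_eq : X.ν = R.ν a

variable {p q g : ι → ℂ} (h : IsModes M (κ ^ N) p q) (R : ModeRoots N p q)

include h in
theorem IsModes.κ_ne : κ ≠ 0 := fun e => h.k_ne (by rw [e, zero_pow (NeZero.ne N)])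

include h in
theorem IsModes.stepRoots {a : ι} {A B : PState ι M} (ha : a ∉ A.S) (hB : B.S = insert a A.S)
    (vA : A.Valid N p q g) (vB : B.Valid N p q g) (hA : ∀ m, A.τ m ≠ 0 ∧ A.θ m ≠ 0)
    (hB' : ∀ m, B.τ m ≠ 0 ∧ B.θ m ≠ 0) :
    StepRoots N κ (p a) (ST p q g A.S) (SH p q g A.S) (ST p q g B.S) (SH p q g B.S)
      (SG p q g B.S) A.τ A.θ B.τ B.θ (R.δ a) (R.μ a) (R.ν a) where
  backlund := by rw [hB]; exact h.isBacklund_insert g ha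
  κ_ne := h.κ_ne
  one_add_ne := h.k_ne'
  D_ne := by rw [← neg_sub]; exact neg_ne_zero.2 (h.p_ne_one a)
  D_add_ne := by rw [add_comm, h.p_add]; exact mul_ne_zero (h.q_ne a) (h.p_ne_one a)
  δ_pow := R.δ_pow a
  μ_pow := by rw [R.μ_pow, h.p_add]
  ν_pow := by rw [R.ν_pow, mul_comm, h.quad]
  τ_pow := vA.τ_pow
  θ_pow := vA.θ_pow
  τ'_pow := vB.τ_pow
  θ'_pow := vB.θ_pow
  T_ne m := by rw [← vA.τ_pow]; exact pow_ne_zero N (hA m).1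
  H_ne m := by rw [← vA.θ_pow]; exact pow_ne_zero N (hA m).2
  T'_ne m := by rw [← vB.τ_pow]; exact pow_ne_zero N (hB' m).1
  H'_ne m := by rw [← vB.θ_pow]; exact pow_ne_zero N (hB' m).2

variable {R} {a : ι} {A B : PState ι M} {X : TauStep N M κ}

theorem IsEdge.neA (E : IsEdge g R a A B X) (m : ZMod M) : A.τ m ≠ 0 ∧ A.θ m ≠ 0 := by
  rw [← E.τ_eq, ← E.θ_eq]; exact ⟨X.τ_ne m, X.θ_ne m⟩

theorem IsEdge.neB (E : IsEdge g R a A B X) (m : ZMod M) : B.τ m ≠ 0 ∧ B.θ m ≠ 0 := by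
  rw [← E.τ'_eq, ← E.θ'_eq]; exact ⟨X.τ'_ne m, X.θ'_ne m⟩

include h in
theorem IsEdge.stepRoots (E : IsEdge g R a A B X) :
    StepRoots N κ (p a) (ST p q g A.S) (SH p q g A.S) (ST p q g B.S) (SH p q g B.S)
      (SG p q g B.S) X.τ X.θ X.τ' X.θ' X.δ X.μ X.ν := by
  rw [E.τ_eq, E.θ_eq, E.τ'_eq, E.θ'_eq, E.δ_eq, E.μ_eq, E.ν_eq]
  exact h.stepRoots R E.notMem E.set_eq E.validA E.validB E.neA E.neB

include h in
/-- The end state of an edge can be multiplied by arbitrary phases. -/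
theorem IsEdge.exists_twist (E : IsEdge g R a A B X) {s r : ZMod M → ZMod N} {C : PState ι M}
    (hS : C.S = B.S) (hτ : ∀ m, C.τ m = chi (s m) * B.τ m)
    (hθ : ∀ m, C.θ m = chi (r m) * B.θ m) :
    ∃ X' : TauStep N M κ, IsEdge g R a A C X' := by
  have H := E.stepRoots h
  have vC : C.Valid N p q g := by
    constructor <;> intro m
    · rw [hτ, mul_pow, chi_pow_card, one_mul, hS, E.validB.τ_pow]
    · rw [hθ, mul_pow, chi_pow_card, one_mul, hS, E.validB.θ_pow]
  have nC : ∀ m, C.τ m ≠ 0 ∧ C.θ m ≠ 0 := fun m => by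
    rw [hτ, hθ]
    exact ⟨mul_ne_zero (chi_ne_zero _) (E.neB m).1, mul_ne_zero (chi_ne_zero _) (E.neB m).2⟩
  have H' := h.stepRoots R E.notMem (hS.trans E.set_eq) E.validA vC E.neA nC
  refine ⟨H'.mkStep (y3 := X.y3) fun m => ?_, ⟨E.notMem, hS.trans E.set_eq, E.validA, vC, rfl, rfl,
    rfl, rfl, rfl, rfl, rfl⟩⟩
  rw [H'.fermat_three_iff, hS]
  exact (H.fermat_three_iff m).1 (X.f3 m)

include h in
/-- Two edges with the same start and mode, whose ends differ by phases. -/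
theorem IsEdge.twist (E : IsEdge g R a A B X) {s r : ZMod M → ZMod N} {C : PState ι M}
    {X' : TauStep N M κ} (E' : IsEdge g R a A C X')
    (hτ : ∀ m, C.τ m = chi (s m) * B.τ m) (hθ : ∀ m, C.θ m = chi (r m) * B.θ m) :
    Twist X.toStep X'.toStep s r where
  u_eq := by
    change uOf N X'.τ = uOf N X.τ
    rw [E.τ_eq, E'.τ_eq]
  w_eq := by
    change wOf X'.θ = wOf X.θ
    rw [E.θ_eq, E'.θ_eq]
  δ_eq := E'.δ_eq.trans E.δ_eq.symm
  μ_eq := E'.μ_eq.trans E.μ_eq.symm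
  u'_eq m := by
    change uOf N X'.τ' m = _ * uOf N X.τ' m
    rw [E.τ'_eq, E'.τ'_eq, uOf, uOf, hτ, hτ, chi_sub]
    have := chi_ne_zero (s m)
    have := (E.neB m).1
    field_simp
  υ_eq m := by
    rw [X.toStep_υ, X'.toStep_υ, E.τ_eq, E'.τ_eq, E.θ_eq, E'.θ_eq, E.τ'_eq, E'.τ'_eq, E.θ'_eq,
      E'.θ'_eq, E.ν_eq, E'.ν_eq, upsOf, upsOf, hτ, hθ, chi_sub]
    have := chi_ne_zero (s (m - 1))
    have := (E.neB (m - 1)).1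
    have := (E.neA m).2
    field_simp
  κ_ne := h.κ_ne

/-- Amplitudes for which all the exchange relations are available. -/
structure Generic (p q g : ι → ℂ) (M : ℕ) [NeZero M] : Prop where
  T_ne : ∀ S, ∀ m : ZMod M, ST p q g S m ≠ 0
  H_ne : ∀ S, ∀ m : ZMod M, SH p q g S m ≠ 0
  G_ne : ∀ S, ∀ m : ZMod M, SG p q g S m ≠ 0
  ne_one : ∀ S a b, a ≠ b → ∀ m : ZMod M,
    q b * (ST p q g (insert b S) (m + 1) * ST p q g (insert a S) m) -
      q a * (ST p q g (insert a S) (m + 1) * ST p q g (insert b S) m) ≠ 0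
  ne_two : ∀ S a b, a ≠ b → ∀ m : ZMod M,
    q a * (SH p q g S (m - 1) * ST p q g (insert b (insert a S)) (m + 1)) -
      p b * (ST p q g (insert b (insert a S)) m * SH p q g S m) ≠ 0

theorem PState.Valid.ne (hg : Generic p q g M) (vA : A.Valid N p q g) (m : ZMod M) :
    A.τ m ≠ 0 ∧ A.θ m ≠ 0 :=
  ⟨ne_zero_of_pow_eq (vA.τ_pow m) (hg.T_ne _ _), ne_zero_of_pow_eq (vA.θ_pow m) (hg.H_ne _ _)⟩

variable (R) in
include h in
theorem exists_isEdge (hg : Generic p q g M) (ha : a ∉ A.S) (hB : B.S = insert a A.S)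
    (vA : A.Valid N p q g) (vB : B.Valid N p q g) :
    ∃ X : TauStep N M κ, IsEdge g R a A B X := by
  have H := h.stepRoots R ha hB vA vB (vA.ne hg) (vB.ne hg)
  obtain ⟨y, hy⟩ := H.exists_fermat (hg.G_ne _)
  exact ⟨H.mkStep hy, ⟨ha, hB, vA, vB, rfl, rfl, rfl, rfl, rfl, rfl, rfl⟩⟩

include h in
/-- The two ways around a square of states. -/
theorem IsEdge.swap (hg : Generic p q g M) {b : ι} {B' C : PState ι M}
    {X' Y Y' : TauStep N M κ} (E : IsEdge g R a A B X) (E' : IsEdge g R b B C X')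
    (F : IsEdge g R b A B' Y) (F' : IsEdge g R a B' C Y') :
    Swap X.toStep X'.toStep Y.toStep Y'.toStep := by
  have hab : a ≠ b := fun e => E'.notMem (by rw [E.set_eq, e]; exact Finset.mem_insert_self _ _)
  have hC : C.S = insert b (insert a A.S) := by rw [E'.set_eq, E.set_eq]
  have hC' : C.S = insert a (insert b A.S) := by rw [F'.set_eq, F.set_eq]
  have sE := E.stepRoots h
  have sE' := E'.stepRoots h
  have sF := F.stepRoots h
  have sF' := F'.stepRoots h
  have hk := h.k_ne
  -- Equality would, after taking `N`-th powers, contradict `ne_two`; the condition `gen1` is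
  -- derived from `ne_one` in the same way.
  have key : ∀ {B : PState ι M} {X X' : TauStep N M κ}, IsEdge g R b A B X →
      IsEdge g R a B C X' → ∀ m, X.toStep.η m ^ N ≠ X'.toStep.x1 (m + 1) ^ N := by
    intro B X X' E E' m e
    have sE := E.stepRoots h
    have sE' := E'.stepRoots h
    have h1 := sE'.xOne_pow (m + 1)
    change X'.toStep.x1 (m + 1) ^ N = _ at h1
    rw [X.toStep_η, sE.etaOf_pow, h1, neg_inj, E.μ_eq, R.μ_pow, add_sub_cancel_right] at e
    refine hg.ne_two A.S b a hab.symm m ?_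
    rw [← E.set_eq, ← E'.set_eq]
    have a1 := sE.H_ne m
    have a2 := sE.T'_ne m
    have a3 := sE.T'_ne (m + 1)
    have a4 := sE'.T'_ne (m + 1)
    field_simp at e
    linear_combination e
  refine
    { start_u := ?_, start_w := ?_, mid_u := ?_, mid_w := ?_, mid_u' := ?_, mid_w' := ?_,
      fin_u := ?_, δ_eq := F.δ_eq.trans E'.δ_eq.symm,
      δ_eq' := F'.δ_eq.trans E.δ_eq.symm, μ_eq := F.μ_eq.trans E'.μ_eq.symm,
      μ_eq' := F'.μ_eq.trans E.μ_eq.symm, υ_eq := ?_, gen1 := ?_,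
      gen2 := key F F', κ_ne := h.κ_ne, δ_ne := ?_, δ_ne' := ?_ }
  · change uOf N Y.τ = uOf N X.τ
    rw [F.τ_eq, E.τ_eq]
  · change wOf Y.θ = wOf X.θ
    rw [F.θ_eq, E.θ_eq]
  · change uOf N X'.τ = uOf N X.τ'
    rw [E'.τ_eq, E.τ'_eq]
  · change wOf X'.θ = wOf X.θ'
    rw [E'.θ_eq, E.θ'_eq]
  · change uOf N Y'.τ = uOf N Y.τ'
    rw [F'.τ_eq, F.τ'_eq]
  · change wOf Y'.θ = wOf Y.θ'
    rw [F'.θ_eq, F.θ'_eq]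
  · change uOf N Y'.τ' = uOf N X'.τ'
    rw [F'.τ'_eq, E'.τ'_eq]
  · intro m
    rw [X.toStep_υ, X'.toStep_υ, Y.toStep_υ, Y'.toStep_υ, E.τ_eq, E.θ_eq, E.τ'_eq, E.θ'_eq,
      E'.τ_eq, E'.θ_eq, E'.τ'_eq, E'.θ'_eq, F.τ_eq, F.θ_eq, F.τ'_eq, F.θ'_eq,
      F'.τ_eq, F'.θ_eq, F'.τ'_eq, F'.θ'_eq, E.ν_eq, E'.ν_eq, F.ν_eq, F'.ν_eq]
    simp only [upsOf]
    have a1 := (E.neA m).2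
    have a2 := (E.neB (m - 1)).1
    have a3 := (E.neB m).2
    have a4 := (E'.neB (m - 1)).1
    have a5 := (F.neB (m - 1)).1
    have a6 := (F.neB m).2
    field_simp
  · intro m e
    rw [X.toStep_η, Y.toStep_η, sE.etaOf_pow, sF.etaOf_pow, neg_inj, E.μ_eq, F.μ_eq, R.μ_pow,
      R.μ_pow] at e
    refine hg.ne_one A.S a b hab m ?_
    rw [← E.set_eq, ← F.set_eq]
    have a1 := sE.H_ne m
    have a2 := sE.T'_ne m
    have a3 := sF.T'_ne m
    have a4 := sE.H_ne (m - 1)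
    field_simp at e
    linear_combination e
  · change X.δ ≠ 0
    exact ne_zero_of_pow_eq sE.δ_pow (h.p_ne a)
  · change X'.δ ≠ 0
    exact ne_zero_of_pow_eq sE'.δ_pow (h.p_ne b)

end States

/-! ### Paths of states and independence of the path for generic amplitudes -/

section Reach
variable {ι : Type*} [LinearOrder ι] {N M : ℕ} [NeZero N] [NeZero M] {κ : ℂ}

/-- Proportionality of operators with control of the factor by the normalisations. -/
def ProjEq (N : ℕ) {n : Type*} (K : Matrix n n ℂ) (r : ℝ) (K' : Matrix n n ℂ) (r' : ℝ) : Prop :=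
  ∃ c : ℂ, c ≠ 0 ∧ K = c • K' ∧ ‖c‖ ^ N * r' = r

namespace ProjEq
variable {n : Type*} [Fintype n] {K K' K'' L L' : Matrix n n ℂ} {r r' r'' s s' : ℝ}

theorem refl (K : Matrix n n ℂ) (r : ℝ) : ProjEq N K r K r :=
  ⟨1, one_ne_zero, by simp, by simp⟩

theorem symm (h : ProjEq N K r K' r') : ProjEq N K' r' K r := by
  obtain ⟨c, hc, h1, h2⟩ := h
  refine ⟨c⁻¹, inv_ne_zero hc, ?_, ?_⟩
  · rw [h1, smul_smul, inv_mul_cancel₀ hc, one_smul]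
  · rw [← h2, norm_inv, ← mul_assoc, ← mul_pow, inv_mul_cancel₀ (norm_ne_zero_iff.2 hc), one_pow,
      one_mul]

theorem trans (h : ProjEq N K r K' r') (h' : ProjEq N K' r' K'' r'') : ProjEq N K r K'' r'' := by
  obtain ⟨c, hc, rfl, rfl⟩ := h
  obtain ⟨d, hd, rfl, rfl⟩ := h'
  exact ⟨c * d, mul_ne_zero hc hd, by rw [smul_smul], by rw [norm_mul, mul_pow]; ring⟩

theorem mul (h : ProjEq N K r K' r') (h' : ProjEq N L s L' s') :
    ProjEq N (K * L) (r * s) (K' * L') (r' * s') := by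
  obtain ⟨c, hc, rfl, rfl⟩ := h
  obtain ⟨d, hd, rfl, rfl⟩ := h'
  refine ⟨c * d, mul_ne_zero hc hd, ?_, by rw [norm_mul, mul_pow]; ring⟩
  rw [smul_mul_assoc, mul_smul_comm, smul_smul]

end ProjEq

/-- `Reach g R A C K r`: there are steps from the state `A` to the state `C` with the product `K`
of the `Q`-operators and the product `r` of the normalisations. -/
inductive Reach (κ : ℂ) (g : ι → ℂ) {p q : ι → ℂ} (R : ModeRoots N p q) (A : PState ι M) :
    PState ι M → Op N M → ℝ → Prop
  | nil : Reach κ g R A A 1 1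
  | snoc {B C : PState ι M} {K : Op N M} {r : ℝ} {a : ι} {X : TauStep N M κ} :
      Reach κ g R A B K r → IsEdge g R a B C X → Reach κ g R A C (K * X.Q) (r * X.rho)

variable {p q g : ι → ℂ} {R : ModeRoots N p q} {A C : PState ι M} {K K' : Op N M} {r r' : ℝ}

theorem Reach.pos (h : Reach κ g R A C K r) : 0 < r := by
  induction h with
  | nil => exact one_pos
  | snoc _ _ ih => exact mul_pos ih (TauStep.rho_pos _)

theorem Reach.subset (h : Reach κ g R A C K r) : A.S ⊆ C.S := by
  induction h with
  | nil => exact subset_rfl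
  | snoc _ E ih => rw [E.set_eq]; exact ih.trans (Finset.subset_insert _ _)

theorem Reach.eq_nil (h : Reach κ g R A C K r) (hS : C.S ⊆ A.S) : C = A ∧ K = 1 ∧ r = 1 := by
  cases h with
  | nil => exact ⟨rfl, rfl, rfl⟩
  | snoc h' E =>
    refine absurd (h'.subset (hS ?_)) E.notMem
    rw [E.set_eq]
    exact Finset.mem_insert_self _ _

theorem PState.exists_valid (N : ℕ) [NeZero N] (p q g : ι → ℂ) (S : Finset ι) :
    ∃ B : PState ι M, B.S = S ∧ B.Valid N p q g := by
  choose τ hτ using fun m : ZMod M => IsAlgClosed.exists_pow_nat_eq (ST p q g S m) (NeZero.pos N)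
  choose θ hθ using fun m : ZMod M => IsAlgClosed.exists_pow_nat_eq (SH p q g S m) (NeZero.pos N)
  exact ⟨⟨S, τ, θ⟩, rfl, ⟨hτ, hθ⟩⟩

variable (hm : IsModes M (κ ^ N) p q)
include hm

-- For generic amplitudes any larger set of modes can be reached, which supplies the auxiliary
-- corners needed to fill in squares.
variable (R) in
theorem exists_reach (hg : Generic p q g M) (vA : A.Valid N p q g) {S : Finset ι} (hS : A.S ⊆ S) :
    ∃ (B : PState ι M) (K : Op N M) (r : ℝ), B.S = S ∧ B.Valid N p q g ∧ Reach κ g R A B K r := by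
  obtain ⟨U, rfl⟩ : ∃ U, S = U ∪ A.S := ⟨S, (Finset.union_eq_left.2 hS).symm⟩
  clear hS
  induction U using Finset.induction_on with
  | empty => exact ⟨A, 1, 1, by simp, vA, .nil⟩
  | insert a U ha ih =>
    obtain ⟨B, K, r, hB, vB, hr⟩ := ih
    by_cases haA : a ∈ A.S
    · refine ⟨B, K, r, ?_, vB, hr⟩
      rw [hB, Finset.insert_union, Finset.insert_eq_of_mem (Finset.mem_union_right _ haA)]
    · have haB : a ∉ B.S := by rw [hB]; simp [ha, haA]
      obtain ⟨C, hC, vC⟩ := PState.exists_valid (M := M) N p q g (insert a B.S)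
      obtain ⟨X, hX⟩ := exists_isEdge hm R hg haB hC vB vC
      exact ⟨C, _, _, by rw [hC, hB, Finset.insert_union], vC, hr.snoc hX⟩

/-- The product of the `Q`-operators between two states does not depend on the path. -/
theorem Reach.unique (hg : Generic p q g M) (vA : A.Valid N p q g) (n : ℕ) :
    ∀ {C : PState ι M} {K K' : Op N M} {r r' : ℝ}, (C.S \ A.S).card = n →
      Reach κ g R A C K r → Reach κ g R A C K' r' → ProjEq N K r K' r' := by
  induction n with
  | zero =>
    intro C K K' r r' hn h1 h2
    rw [Finset.card_eq_zero, Finset.sdiff_eq_empty_iff_subset] at hn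
    obtain ⟨-, rfl, rfl⟩ := h1.eq_nil hn
    obtain ⟨-, rfl, rfl⟩ := h2.eq_nil hn
    exact .refl _ _
  | succ n ih =>
    intro C K K' r r' hn h1 h2
    have card : ∀ {B : PState ι M} {a : ι} {X : TauStep N M κ} {K : Op N M} {r : ℝ},
        Reach κ g R A B K r → IsEdge g R a B C X → (B.S \ A.S).card = n := by
      intro B a X K r hr E
      have ha : a ∉ B.S \ A.S := fun h => E.notMem (Finset.mem_sdiff.1 h).1
      rw [E.set_eq, Finset.insert_sdiff_of_notMem _ fun h => E.notMem (hr.subset h),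
        Finset.card_insert_of_notMem ha] at hn
      omega
    -- The corner `D` has all modes of `C` except `a` and `b`. By induction both predecessors may be
    -- reached through `D`, and the square from `D` to `C` is an exchange relation.
    have diamond : ∀ {B B' : PState ι M} {a b : ι} {X Y : TauStep N M κ} {K K' : Op N M} {r r' : ℝ},
        a ≠ b → Reach κ g R A B K r → IsEdge g R a B C X → Reach κ g R A B' K' r' →
        IsEdge g R b B' C Y → ProjEq N (K * X.Q) (r * X.rho) (K' * Y.Q) (r' * Y.rho) := by
      intro B B' a b X Y K K' r r' hab h1 E h2 F
      have hC : insert a B.S = insert b B'.S := by rw [← E.set_eq, ← F.set_eq]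
      have hb : b ∈ B.S := (Finset.mem_insert.1 (hC ▸ Finset.mem_insert_self b B'.S)).resolve_left
        hab.symm
      have hBe : B.S.erase b = B'.S.erase a := by
        rw [← Finset.erase_insert E.notMem, hC, Finset.erase_right_comm,
          Finset.erase_insert F.notMem]
      have ha : a ∈ B'.S := (Finset.mem_insert.1 (hC ▸ Finset.mem_insert_self a B.S)).resolve_left
        hab
      obtain ⟨D, K0, r0, hD, vD, h0⟩ := exists_reach R hm hg vA (S := B.S.erase b) fun x hx =>
        Finset.mem_erase.2 ⟨fun e => F.notMem (h2.subset (e ▸ hx)), h1.subset hx⟩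
      obtain ⟨X0, E0⟩ := exists_isEdge (A := D) (B := B) hm R hg (a := b)
        (by rw [hD]; exact Finset.notMem_erase _ _)
        (by rw [hD, Finset.insert_erase hb]) vD E.validA
      obtain ⟨Y0, F0⟩ := exists_isEdge (A := D) (B := B') hm R hg (a := a)
        (by rw [hD, hBe]; exact Finset.notMem_erase _ _)
        (by rw [hD, hBe, Finset.insert_erase ha]) vD F.validA
      have i1 := ih (card h1 E) h1 (h0.snoc E0)
      have i2 := ih (card h2 F) h2 (h0.snoc F0)
      have sw : ProjEq N (X0.Q * X.Q) (X0.rho * X.rho) (Y0.Q * Y.Q) (Y0.rho * Y.rho) :=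
        (E0.swap hm hg E F0 F).exists_smul
      refine (i1.mul (.refl _ _)).trans (.trans ?_ (i2.symm.mul (.refl _ _)))
      rw [mul_assoc, mul_assoc, mul_assoc, mul_assoc]
      exact (ProjEq.refl _ _).mul sw
    cases h1 with
    | nil => simp at hn
    | @snoc B _ K1 r1 a X h1 E =>
      cases h2 with
      | nil => simp at hn
      | @snoc B' _ K2 r2 b Y h2 F =>
        by_cases hab : a = b
        · subst hab
          have hBB : B.S = B'.S := by
            rw [← Finset.erase_insert E.notMem, ← Finset.erase_insert F.notMem, ← E.set_eq,
              ← F.set_eq]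
          -- The predecessors have equal sets of modes but possibly different phases, so the
          -- induction hypothesis does not compare them. If `n = 0`, both are `A`, and the two steps
          -- differ only in their `y`-coordinates.
          rcases Nat.eq_zero_or_pos n with rfl | hn0
          · have c1 := card h1 E
            have c2 := card h2 F
            rw [Finset.card_eq_zero, Finset.sdiff_eq_empty_iff_subset] at c1 c2
            obtain ⟨rfl, rfl, rfl⟩ := h1.eq_nil c1
            obtain ⟨rfl, rfl, rfl⟩ := h2.eq_nil c2
            refine (ProjEq.refl _ _).mul ?_
            have T : Twist Y.toStep X.toStep 0 0 := F.twist hm E (by simp) (by simp)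
            exact T.exists_smul_of_zero
          -- A third path that ends with another mode `b` forms a square with each of the two given
          -- paths.
          · obtain ⟨b, hb⟩ := Finset.card_pos.1 ((card h1 E).symm ▸ hn0)
            rw [Finset.mem_sdiff] at hb
            have hba : b ≠ a := fun e => E.notMem (e ▸ hb.1)
            have hbC : b ∈ C.S := by rw [E.set_eq]; exact Finset.mem_insert_of_mem hb.1
            obtain ⟨D, K0, r0, hD, vD, h0⟩ := exists_reach R hm hg vA (S := C.S.erase b)
              fun x hx => Finset.mem_erase.2 ⟨fun e => hb.2 (e ▸ hx),
                E.set_eq ▸ Finset.mem_insert_of_mem (h1.subset hx)⟩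
            obtain ⟨Z, G⟩ := exists_isEdge (A := D) (B := C) hm R hg (a := b)
              (by rw [hD]; exact Finset.notMem_erase _ _)
              (by rw [hD, Finset.insert_erase hbC]) vD E.validB
            exact (diamond hba.symm h1 E h0 G).trans (diamond hba h0 G h2 F)
        · exact diamond hab h1 E h2 F

/-- Phases of the final state. -/
theorem Reach.exists_twist (hr : Reach κ g R A C K r) (hn : C ≠ A) {C' : PState ι M}
    {s t : ZMod M → ZMod N} (hS : C'.S = C.S) (hτ : ∀ m, C'.τ m = chi (s m) * C.τ m)
    (hθ : ∀ m, C'.θ m = chi (t m) * C.θ m) :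
    ∃ K' r', Reach κ g R A C' K' r' ∧ ∃ c : ℂ, c ≠ 0 ∧
      K' = c • (K * weylOp N M (fun m => s (m - 1) - s m) (fun m => t m - t (m - 1))) := by
  cases hr with
  | nil => exact absurd rfl hn
  | @snoc B _ K1 r1 a X h1 E =>
    obtain ⟨X', E'⟩ := E.exists_twist hm hS hτ hθ
    obtain ⟨c, hc, e, -⟩ := (E.twist hm E' hτ hθ).exists_smul
    refine ⟨_, _, h1.snoc E', c, hc, ?_⟩
    change K1 * X'.toStep.Q = _
    rw [e, mul_smul_comm, mul_assoc]
    rfl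

end Reach

/-! ### Passage from generic to arbitrary regular amplitudes -/

section Limit
variable {ι : Type*} [LinearOrder ι] {N M : ℕ} [NeZero N] [NeZero M] {κ : ℂ} {p q g : ι → ℂ}

@[fun_prop]
theorem continuous_amp (S : Finset ι) (i : ι) : Continuous fun g => amp p q g S i := by
  unfold amp; fun_prop

theorem continuous_TF {F : (ι → ℂ) → ι → ℂ} (hF : ∀ i, Continuous fun g => F g i) (S : Finset ι)
    (m : ZMod M) : Continuous fun g => TF p q S (F g) m := by
  unfold TF ThS
  fun_prop

theorem continuous_ST (S : Finset ι) (m : ZMod M) : Continuous fun g => ST p q g S m :=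
  continuous_TF (fun i => by fun_prop) S m

theorem continuous_SH (S : Finset ι) (m : ZMod M) : Continuous fun g => SH p q g S m :=
  continuous_TF (F := fun g i => amp p q g S i * sd p q 1 i / (p i / q i)) (fun i => by fun_prop) S m

theorem continuous_SG (S : Finset ι) (m : ZMod M) : Continuous fun g => SG p q g S m :=
  continuous_TF (F := fun g i => amp p q g S i * (p i / q i) / sd p q 1 i) (fun i => by fun_prop) S m

/-- The state close to `A` for amplitudes close to those of `A`. -/
def PState.deform (N : ℕ) (p q : ι → ℂ) (A : PState ι M) (g : ι → ℂ) : PState ι M where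
  S := A.S
  τ m := rootNear N (A.τ m) (ST p q g A.S m)
  θ m := rootNear N (A.θ m) (SH p q g A.S m)

theorem PState.valid_deform {A : PState ι M} (hA : ∀ m, A.τ m ≠ 0 ∧ A.θ m ≠ 0) (g : ι → ℂ) :
    (A.deform N p q g).Valid N p q g where
  τ_pow m := rootNear_pow (hA m).1 _
  θ_pow m := rootNear_pow (hA m).2 _

variable {R : ModeRoots N p q} {A C : PState ι M} {K K' : Op N M} {r r' : ℝ}
variable (hm : IsModes M (κ ^ N) p q) {J : Type*} {l : Filter J} {G : J → ι → ℂ}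

include hm

/-- A path is deformed edge by edge. The deformed states depend only on the state and the
amplitudes, so consecutive steps still fit together, and two paths with common ends keep common
ends. -/
theorem Reach.exists_deformation (hG : Tendsto G l (𝓝 g)) (hr : Reach κ g R A C K r) :
    ∃ (Kj : J → Op N M) (rj : J → ℝ), Tendsto Kj l (𝓝 K) ∧ Tendsto rj l (𝓝 r) ∧
      ∀ᶠ j in l, Reach κ (G j) R (A.deform N p q (G j)) (C.deform N p q (G j)) (Kj j) (rj j) := by
  induction hr with
  | nil => exact ⟨fun _ => 1, fun _ => 1, tendsto_const_nhds, tendsto_const_nhds,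
      Eventually.of_forall fun j => .nil⟩
  | @snoc B C K r a X h1 E ih =>
    obtain ⟨Kj, rj, tK, tr, hj⟩ := ih
    have tT : ∀ S, ∀ m : ZMod M, Tendsto (fun j => ST p q (G j) S m) l (𝓝 (ST p q g S m)) :=
      fun S m => ((continuous_ST S m).tendsto g).comp hG
    have tH : ∀ S, ∀ m : ZMod M, Tendsto (fun j => SH p q (G j) S m) l (𝓝 (SH p q g S m)) :=
      fun S m => ((continuous_SH S m).tendsto g).comp hG
    have tW : ∀ S, ∀ m : ZMod M, Tendsto (fun j => SG p q (G j) S m) l (𝓝 (SG p q g S m)) :=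
      fun S m => ((continuous_SG S m).tendsto g).comp hG
    have H := E.stepRoots hm
    obtain ⟨Aj, sj, tA, ts, hX⟩ := X.exists_deformation H (l := l) (D' := fun _ => p a)
      (δ := fun _ => X.δ) (μ := fun _ => X.μ) (ν := fun _ => X.ν)
      (U := fun j => ST p q (G j) B.S) (V := fun j => SH p q (G j) B.S)
      (U' := fun j => ST p q (G j) C.S) (V' := fun j => SH p q (G j) C.S)
      (W := fun j => SG p q (G j) C.S)
      (Eventually.of_forall fun j => by rw [E.set_eq]; exact hm.isBacklund_insert _ E.notMem)
      tendsto_const_nhds tendsto_const_nhds tendsto_const_nhds tendsto_const_nhds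
      (Eventually.of_forall fun j => H.δ_pow) (Eventually.of_forall fun j => H.μ_pow)
      (Eventually.of_forall fun j => H.ν_pow) (tT _) (tH _) (tT _) (tH _) (tW _)
    refine ⟨fun j => Kj j * Aj j, fun j => rj j * sj j, ?_, tr.mul ts, ?_⟩
    · exact tK.mul tA
    · filter_upwards [hj, hX] with j rj xj
      obtain ⟨Y, e1, e2, e3, e4, e5, e6, e7, e8, e9⟩ := xj
      rw [← e8, ← e9]
      refine rj.snoc (a := a) ⟨E.notMem, E.set_eq, PState.valid_deform E.neA _,
        PState.valid_deform E.neB _, ?_, ?_, ?_, ?_, e5.trans E.δ_eq, e6.trans E.μ_eq,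
        e7.trans E.ν_eq⟩
      · rw [e1, E.τ_eq]; rfl
      · rw [e2, E.θ_eq]; rfl
      · rw [e3, E.τ'_eq]; rfl
      · rw [e4, E.θ'_eq]; rfl

/-- The product of the `Q`-operators between two states does not depend on the path, for limits
of generic amplitudes. -/
theorem Reach.unique_of_tendsto [l.NeBot] (hG : Tendsto G l (𝓝 g))
    (hgen : ∀ᶠ j in l, Generic p q (G j) M) (hA : ∀ m, A.τ m ≠ 0 ∧ A.θ m ≠ 0)
    (h1 : Reach κ g R A C K r) (h2 : Reach κ g R A C K' r') : ∃ c : ℂ, c ≠ 0 ∧ K = c • K' := by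
  obtain ⟨K1, r1, tK1, tr1, e1⟩ := h1.exists_deformation hm hG
  obtain ⟨K2, r2, tK2, tr2, e2⟩ := h2.exists_deformation hm hG
  have hev : ∀ᶠ j in l, ∃ c : ℂ, K1 j = c • K2 j ∧ ‖c‖ ^ N * r2 j = r1 j := by
    filter_upwards [hgen, e1, e2] with j gj a1 a2
    obtain ⟨c, -, hc⟩ := a1.unique hm gj (PState.valid_deform hA _) _ rfl a2
    exact ⟨c, hc⟩
  obtain ⟨c, hc⟩ := hev.choice
  have hr' : 0 < r' := h2.pos
  have hr : 0 < r := h1.pos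
  have tq : Tendsto (fun j => r1 j / r2 j) l (𝓝 (r / r')) := tr1.div tr2 hr'.ne'
  -- The relation between the normalisations bounds the scalars, because `‖c j‖ ^ N` converges to `r
  -- / r'`.
  have hb : ∀ᶠ j in l, c j ∈ Metric.closedBall (0 : ℂ) (r / r' + 1) := by
    filter_upwards [hc, tq.eventually_le_const (lt_add_one _), tr2.eventually_const_lt hr']
      with j cj qj pj
    rw [mem_closedBall_zero_iff]
    rcases le_or_gt ‖c j‖ 1 with h | h
    · have := div_pos hr hr'
      linarith
    · refine (le_self_pow₀ h.le (NeZero.ne N)).trans (le_trans ?_ qj)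
      rw [le_div_iff₀ pj, cj.2]
  -- By compactness the scalars converge along an ultrafilter. The limit satisfies `‖c₀‖ ^ N * r' =
  -- r` with `r > 0` and is therefore not zero.
  let u : Ultrafilter J := Ultrafilter.of l
  have hu : (u : Filter J) ≤ l := Ultrafilter.of_le l
  obtain ⟨c₀, -, hc₀⟩ := (isCompact_closedBall (0 : ℂ) (r / r' + 1)).ultrafilter_le_nhds (u.map c)
    (le_principal_iff.2 (hu hb))
  have tc : Tendsto c u (𝓝 c₀) := hc₀
  have hK : K = c₀ • K' := by
    refine tendsto_nhds_unique (tK1.mono_left hu) (Tendsto.congr' ?_ (tc.smul (tK2.mono_left hu)))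
    filter_upwards [hu hc] with j hj using hj.1.symm
  have hn : ‖c₀‖ ^ N * r' = r := by
    refine tendsto_nhds_unique (Tendsto.congr' ?_ ((tc.norm.pow N).mul (tr2.mono_left hu)))
      (tr1.mono_left hu)
    filter_upwards [hu hc] with j hj using hj.2
  refine ⟨c₀, fun e => hr.ne ?_, hK⟩
  rw [← hn, e, norm_zero, zero_pow (NeZero.ne N), zero_mul]

end Limit

/-! ### Genericity as a polynomial condition on the amplitudes -/

section Poly
variable {ι : Type*}

/-- `Q` holds on the complement of an algebraic hypersurface which does not contain `0`. -/
def AlmostAll (Q : (ι → ℂ) → Prop) : Prop :=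
  ∃ P : MvPolynomial ι ℂ, MvPolynomial.eval 0 P ≠ 0 ∧ ∀ g, MvPolynomial.eval g P ≠ 0 → Q g

theorem AlmostAll.forall {I : Type*} [Finite I] {Q : I → (ι → ℂ) → Prop}
    (h : ∀ i, AlmostAll (Q i)) : AlmostAll fun g => ∀ i, Q i g := by
  cases nonempty_fintype I
  choose P hP using h
  refine ⟨∏ i, P i, ?_, fun g hg i => (hP i).2 g fun e => hg ?_⟩
  · rw [map_prod]
    exact Finset.prod_ne_zero_iff.2 fun i _ => (hP i).1
  · rw [map_prod]
    exact Finset.prod_eq_zero (Finset.mem_univ i) e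

theorem AlmostAll.imp {c : Prop} {Q : (ι → ℂ) → Prop} (h : c → AlmostAll Q) :
    AlmostAll fun g => c → Q g := by
  by_cases hc : c
  · obtain ⟨P, h0, hP⟩ := h hc
    exact ⟨P, h0, fun g hg _ => hP g hg⟩
  · exact ⟨1, by simp, fun g _ h => absurd h hc⟩

theorem AlmostAll.and {Q Q' : (ι → ℂ) → Prop} (h : AlmostAll Q) (h' : AlmostAll Q') :
    AlmostAll fun g => Q g ∧ Q' g := by
  obtain ⟨P, hP, h⟩ := h
  obtain ⟨P', hP', h'⟩ := h'
  refine ⟨P * P', by rw [map_mul]; exact mul_ne_zero hP hP', fun g hg => ?_⟩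
  rw [map_mul] at hg
  exact ⟨h g (left_ne_zero_of_mul hg), h' g (right_ne_zero_of_mul hg)⟩

/-- Polynomial functions. -/
def IsPoly (f : (ι → ℂ) → ℂ) : Prop :=
  ∃ P : MvPolynomial ι ℂ, ∀ g, MvPolynomial.eval g P = f g

namespace IsPoly
variable {f f' : (ι → ℂ) → ℂ}

theorem const (c : ℂ) : IsPoly fun _ : ι → ℂ => c := ⟨.C c, fun g => by simp⟩

theorem coord (i : ι) : IsPoly fun g : ι → ℂ => g i := ⟨.X i, fun g => by simp⟩

theorem mul (h : IsPoly f) (h' : IsPoly f') : IsPoly fun g => f g * f' g := by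
  obtain ⟨P, hP⟩ := h
  obtain ⟨P', hP'⟩ := h'
  exact ⟨P * P', fun g => by rw [map_mul, hP, hP']⟩

theorem sub (h : IsPoly f) (h' : IsPoly f') : IsPoly fun g => f g - f' g := by
  obtain ⟨P, hP⟩ := h
  obtain ⟨P', hP'⟩ := h'
  exact ⟨P - P', fun g => by rw [map_sub, hP, hP']⟩

theorem div_const (h : IsPoly f) (c : ℂ) : IsPoly fun g => f g / c := by
  simpa only [div_eq_mul_inv] using h.mul (const c⁻¹)

theorem neg (h : IsPoly f) : IsPoly fun g => -f g := by
  simpa using (const 0).sub h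

theorem prod {I : Type*} {F : I → (ι → ℂ) → ℂ} (s : Finset I) (h : ∀ i, IsPoly (F i)) :
    IsPoly fun g => ∏ i ∈ s, F i g := by
  choose P hP using h
  exact ⟨∏ i ∈ s, P i, fun g => by rw [map_prod]; simp only [hP]⟩

theorem sum {I : Type*} {F : I → (ι → ℂ) → ℂ} (s : Finset I) (h : ∀ i, IsPoly (F i)) :
    IsPoly fun g => ∑ i ∈ s, F i g := by
  choose P hP using h
  exact ⟨∑ i ∈ s, P i, fun g => by rw [map_sum]; simp only [hP]⟩

theorem almostAll (h : IsPoly f) (h0 : f 0 ≠ 0) : AlmostAll fun g => f g ≠ 0 := by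
  obtain ⟨P, hP⟩ := h
  exact ⟨P, by rwa [hP], fun g hg => by rwa [hP] at hg⟩

end IsPoly

/-- On the line `t ↦ g (1 - t)` the polynomial does not vanish at `t = 1`, where the amplitudes are
zero. It has finitely many zeros there, so every `g` is a limit of good amplitudes. -/
theorem AlmostAll.eventually {Q : (ι → ℂ) → Prop} (h : AlmostAll Q) (g : ι → ℂ) :
    ∀ᶠ t : ℂ in 𝓝[≠] 0, Q fun i => g i * (1 - t) := by
  obtain ⟨P, hP, hQ⟩ := h
  set U : Polynomial ℂ := MvPolynomial.aeval (fun i => Polynomial.C (g i) * (1 - Polynomial.X)) P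
    with hU
  have ev : ∀ t, U.eval t = MvPolynomial.eval (fun i => g i * (1 - t)) P := by
    intro t
    rw [hU]
    clear hU hP hQ
    induction P using MvPolynomial.induction_on with
    | C a => simp
    | add a b ha hb => simp only [map_add, Polynomial.eval_add, ha, hb]
    | mul_X a i ha => simp [ha]
  have hU0 : U ≠ 0 := fun e => hP <| by
    have := ev 1
    rw [e] at this
    simp only [Polynomial.eval_zero, sub_self, mul_zero] at this
    exact this.symm
  have : ∀ᶠ t : ℂ in 𝓝[≠] 0, U.eval t ≠ 0 := by
    refine nhdsNE_le_cofinite 0 ?_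
    rw [mem_cofinite]
    refine (U.roots.toFinset.finite_toSet).subset fun t ht => ?_
    simpa [hU0] using ht
  filter_upwards [this] with t ht
  exact hQ _ (by rwa [← ev])

variable [LinearOrder ι] {M : ℕ} [NeZero M] {p q : ι → ℂ}

theorem isPoly_amp (S : Finset ι) (i : ι) : IsPoly fun g => amp p q g S i :=
  (IsPoly.coord i).mul (.const _)

theorem isPoly_TF {F : (ι → ℂ) → ι → ℂ} (hF : ∀ i, IsPoly fun g => F g i) (S : Finset ι)
    (m : ZMod M) : IsPoly fun g => TF p q S (F g) m :=
  .sum _ fun T => (IsPoly.prod T fun i => ((hF i).mul (.const _)).neg).mul (.const _)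

theorem isPoly_ST (S : Finset ι) (m : ZMod M) : IsPoly fun g => ST p q g S m :=
  isPoly_TF (fun i => isPoly_amp S i) S m

theorem isPoly_SH (S : Finset ι) (m : ZMod M) : IsPoly fun g => SH p q g S m :=
  isPoly_TF (F := fun g i => amp p q g S i * sd p q 1 i / (p i / q i))
    (fun i => ((isPoly_amp S i).mul (.const _)).div_const _) S m

theorem isPoly_SG (S : Finset ι) (m : ZMod M) : IsPoly fun g => SG p q g S m :=
  isPoly_TF (F := fun g i => amp p q g S i * (p i / q i) / sd p q 1 i)
    (fun i => ((isPoly_amp S i).mul (.const _)).div_const _) S m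

theorem ST_zero (S : Finset ι) (m : ZMod M) : ST p q 0 S m = 1 := by
  simp [ST, TF, amp, ThS_zero]

theorem SH_zero (S : Finset ι) (m : ZMod M) : SH p q 0 S m = 1 := by
  simp [SH, TF, amp, ThS_zero]

theorem SG_zero (S : Finset ι) (m : ZMod M) : SG p q 0 S m = 1 := by
  simp [SG, TF, amp, ThS_zero]

/-- All conditions are polynomial. At `g = 0` every Θ-function is `1`, and the last two conditions
reduce to `q b ≠ q a` and `q a ≠ p b`. -/
theorem IsModes.almostAll_generic [Finite ι] {k : ℂ} (h : IsModes M k p q) :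
    AlmostAll fun g => Generic p q g M := by
  have a1 : AlmostAll fun g => ∀ S, ∀ m : ZMod M, ST p q g S m ≠ 0 :=
    .forall fun S => .forall fun m => (isPoly_ST S m).almostAll (by simp [ST_zero])
  have a2 : AlmostAll fun g => ∀ S, ∀ m : ZMod M, SH p q g S m ≠ 0 :=
    .forall fun S => .forall fun m => (isPoly_SH S m).almostAll (by simp [SH_zero])
  have a3 : AlmostAll fun g => ∀ S, ∀ m : ZMod M, SG p q g S m ≠ 0 :=
    .forall fun S => .forall fun m => (isPoly_SG S m).almostAll (by simp [SG_zero])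
  have a4 : AlmostAll fun g => ∀ S a b, ∀ (_ : a ≠ b) (m : ZMod M),
    q b * (ST p q g (insert b S) (m + 1) * ST p q g (insert a S) m) -
      q a * (ST p q g (insert a S) (m + 1) * ST p q g (insert b S) m) ≠ 0 :=
    .forall fun S => .forall fun a => .forall fun b => .imp fun hab => .forall fun m =>
      IsPoly.almostAll (((IsPoly.const _).mul ((isPoly_ST _ _).mul (isPoly_ST _ _))).sub
        ((IsPoly.const _).mul ((isPoly_ST _ _).mul (isPoly_ST _ _))))
        (by simpa [ST_zero, sub_eq_zero] using fun e => hab (h.q_inj e).symm)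
  have a5 : AlmostAll fun g => ∀ S a b, ∀ (_ : a ≠ b) (m : ZMod M),
    q a * (SH p q g S (m - 1) * ST p q g (insert b (insert a S)) (m + 1)) -
      p b * (ST p q g (insert b (insert a S)) m * SH p q g S m) ≠ 0 :=
    .forall fun S => .forall fun a => .forall fun b => .imp fun hab => .forall fun m =>
      IsPoly.almostAll (((IsPoly.const _).mul ((isPoly_SH _ _).mul (isPoly_ST _ _))).sub
        ((IsPoly.const _).mul ((isPoly_ST _ _).mul (isPoly_SH _ _))))
        (by simpa [ST_zero, SH_zero, sub_eq_zero] using (h.p_ne_q b a).symm)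
  obtain ⟨P, h0, hP⟩ := a1.and (a2.and (a3.and (a4.and a5)))
  refine ⟨P, h0, fun g hg => ?_⟩
  obtain ⟨b1, b2, b3, b4, b5⟩ := hP g hg
  exact ⟨b1, b2, b3, b4, b5⟩

end Poly

/-! ### The modes given by the angles, and their Θ-functions -/

section Angles
variable {N M : ℕ} [NeZero N] [NeZero M] {κ : ℂ} {rt : ℂ → ℂ}

theorem phi_pos (l : Fin (M - 1)) : 0 < phi M l := by
  have : 0 < M := NeZero.pos M
  unfold phi; positivity

theorem phi_lt_pi (l : Fin (M - 1)) : phi M l < Real.pi := by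
  have h : ((l.val : ℝ) + 1) < M := by
    have := l.2
    exact_mod_cast (by omega : l.val + 1 < M)
  have hM : (0 : ℝ) < M := by exact_mod_cast NeZero.pos M
  rw [phi, div_lt_iff₀ hM]
  exact mul_lt_mul_of_pos_left h Real.pi_pos

theorem phi_injective : Function.Injective (phi M) := by
  intro i j h
  have hM : (M : ℝ) ≠ 0 := by exact_mod_cast NeZero.ne M
  unfold phi at h
  rw [div_left_inj' hM, mul_right_inj' Real.pi_ne_zero, add_left_inj] at h
  exact Fin.ext (by exact_mod_cast h)

theorem exp_phi (φ : ℝ) : Complex.exp (Complex.I * φ) = ⟨Real.cos φ, Real.sin φ⟩ := by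
  apply Complex.ext
  · rw [mul_comm, Complex.exp_ofReal_mul_I_re]
  · rw [mul_comm, Complex.exp_ofReal_mul_I_im]

theorem exp_neg_phi (φ : ℝ) : Complex.exp (-(Complex.I * φ)) = ⟨Real.cos φ, -Real.sin φ⟩ := by
  have := exp_phi (-φ)
  simpa using this

theorem Del_div_DelStar (l : Fin (M - 1)) (hX : Del N M κ rt l ≠ 0) :
    Del N M κ rt l / DelStar N M κ rt l = Complex.exp (2 * Complex.I * phi M l) := by
  have hX' := right_ne_zero_of_mul hX
  rw [Del, DelStar, mul_div_mul_right _ _ hX', ← Complex.exp_sub]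
  congr 1
  ring

/-- Write `p = E X`, `q = E' X` with `E E' = 1`, `E + E' = 2 cos φ` and `X = r + cos φ`. Then `p q -
p - q = X² - 2 X cos φ = r² - cos² φ = κ^N`. For distinctness, angles strictly between `0` and `π`
put `E` in the upper and `E'` in the lower half plane. -/
theorem isModes_del (hrt : ∀ z, rt z ^ 2 = z) (hκ : κ ≠ 0)
    (hκN : ∀ l < M, κ ^ N + (Real.cos (Real.pi * l / M) : ℂ) ^ 2 ≠ 0) :
    IsModes M (κ ^ N) (Del N M κ rt) (DelStar N M κ rt) := by
  have hk : κ ^ N ≠ 0 := pow_ne_zero N hκ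
  have hk1 : 1 + κ ^ N ≠ 0 := by
    have := hκN 0 (NeZero.pos M)
    simpa [add_comm] using this
  set c : Fin (M - 1) → ℂ := fun l => (Real.cos (phi M l) : ℂ) with hc
  set r : Fin (M - 1) → ℂ := fun l => rt (c l ^ 2 + κ ^ N) with hr
  set E : Fin (M - 1) → ℂ := fun l => Complex.exp (Complex.I * phi M l) with hE
  set E' : Fin (M - 1) → ℂ := fun l => Complex.exp (-(Complex.I * phi M l)) with hE'
  have hD : ∀ l, Del N M κ rt l = E l * (r l + c l) := fun l => rfl
  have hDs : ∀ l, DelStar N M κ rt l = E' l * (r l + c l) := fun l => rfl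
  have hr2 : ∀ l, r l ^ 2 = c l ^ 2 + κ ^ N := fun l => hrt _
  have hr0 : ∀ l, r l ≠ 0 := fun l e => by
    have h1 := hr2 l
    rw [e] at h1
    have h2 := hκN (l.val + 1) (by have := l.2; omega)
    apply h2
    have : Real.pi * ((l.val + 1 : ℕ) : ℝ) / M = phi M l := by simp [phi]
    rw [this, add_comm]
    linear_combination -h1
  have hEE : ∀ l, E l * E' l = 1 := fun l => by rw [hE, hE', ← Complex.exp_add]; simp
  have hEs : ∀ l, E l + E' l = 2 * c l := fun l => by
    simp only [hE, hE', hc, exp_phi, exp_neg_phi]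
    apply Complex.ext <;> simp [two_mul, -Complex.ofReal_cos]
  have hEim : ∀ l, 0 < (E l).im := fun l => by
    simp only [hE, exp_phi]
    exact Real.sin_pos_of_pos_of_lt_pi (phi_pos l) (phi_lt_pi l)
  have hEim' : ∀ l, (E' l).im < 0 := fun l => by
    simp only [hE', exp_neg_phi]
    exact neg_neg_of_pos (Real.sin_pos_of_pos_of_lt_pi (phi_pos l) (phi_lt_pi l))
  have hX0 : ∀ l, r l + c l ≠ 0 := fun l e => hk <| by
    linear_combination -hr2 l + (r l - c l) * e
  have hE0 : ∀ l, E l ≠ 0 := fun l => Complex.exp_ne_zero _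
  have hE0' : ∀ l, E' l ≠ 0 := fun l => Complex.exp_ne_zero _
  have p0 : ∀ l, Del N M κ rt l ≠ 0 := fun l => mul_ne_zero (hE0 l) (hX0 l)
  have q0 : ∀ l, DelStar N M κ rt l ≠ 0 := fun l => mul_ne_zero (hE0' l) (hX0 l)
  have quad : ∀ l, (Del N M κ rt l - 1) * (DelStar N M κ rt l - 1) = 1 + κ ^ N := fun l => by
    rw [hD, hDs]
    linear_combination (r l + c l) ^ 2 * hEE l - (r l + c l) * hEs l + hr2 l
  have hcE : ∀ i j, E i = E j → i = j := fun i j e => by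
    have : Real.cos (phi M i) = Real.cos (phi M j) := by
      have := congrArg Complex.re e
      simpa only [hE, exp_phi] using this
    exact phi_injective (Real.injOn_cos ⟨(phi_pos i).le, (phi_lt_pi i).le⟩
      ⟨(phi_pos j).le, (phi_lt_pi j).le⟩ this)
  refine ⟨?_, ?_, p0, q0, quad, hk, hk1, ?_⟩
  · intro i j e
    have hq : DelStar N M κ rt j - 1 ≠ 0 := fun e' => hk1 (by rw [← quad j, e', mul_zero])
    have hp : Del N M κ rt i = Del N M κ rt j := by
      have h1 := quad i
      rw [e, ← quad j] at h1
      exact sub_left_inj.1 (mul_right_cancel₀ hq h1)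
    rw [hD, hD] at hp
    rw [hDs, hDs] at e
    have h2 : E i * E' j = E j * E' i := by
      have := mul_ne_zero (hX0 i) (hX0 j)
      refine mul_right_cancel₀ this ?_
      linear_combination E' j * (r j + c j) * hp - E j * (r j + c j) * e
    have h3 : (E i - E j) * (E i + E j) = 0 := by
      linear_combination E i * E j * h2 - E i ^ 2 * hEE j + E j ^ 2 * hEE i
    rcases mul_eq_zero.1 h3 with h4 | h4
    · exact hcE i j (sub_eq_zero.1 h4)
    · have := congrArg Complex.im h4
      rw [Complex.add_im, Complex.zero_im] at this
      linarith [hEim i, hEim j]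
  · intro i j e
    have hp1 : DelStar N M κ rt j - 1 ≠ 0 := fun e' => hk1 (by rw [← quad j, e', mul_zero])
    have e2 : DelStar N M κ rt i = Del N M κ rt j := by
      have h1 := quad i
      rw [e, ← quad j, mul_comm] at h1
      exact sub_left_inj.1 (mul_right_cancel₀ hp1 h1)
    rw [hD, hDs] at e
    rw [hD, hDs] at e2
    have h2 : E i * E j = E' i * E' j := by
      have := mul_ne_zero (hX0 i) (hX0 j)
      refine mul_right_cancel₀ this ?_
      linear_combination E j * (r j + c j) * e - E' j * (r j + c j) * e2
    have h3 : (E i - E' j) * (E i + E' j) = 0 := by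
      linear_combination E i * E' j * h2 - E i ^ 2 * hEE j + E' j ^ 2 * hEE i
    rcases mul_eq_zero.1 h3 with h4 | h4
    · have := congrArg Complex.im h4
      rw [Complex.sub_im, Complex.zero_im] at this
      linarith [hEim i, hEim' j]
    -- In this case the two angles add up to `π`. Their cosines are opposite, so the fixed branch
    -- gives equal roots, and `p i = q j` would force `r i = 0`, that is, `κ^N + cos² φ = 0`.
    · have h5 : c i = -c j := by
        have := congrArg Complex.re h4
        simp only [hE, hE', exp_phi, exp_neg_phi, Complex.add_re, Complex.zero_re] at this
        simp only [hc]
        rw [eq_neg_iff_add_eq_zero]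
        exact_mod_cast this
      have h6 : r i = r j := by simp only [hr, h5, neg_sq]
      have h7 : E i * (2 * r i) = 0 := by
        linear_combination e + (r j + c j) * h4 + E i * (h6 - h5)
      exact (mul_ne_zero (hE0 i) (mul_ne_zero two_ne_zero (hr0 i))) h7
  · intro l
    rw [Del_div_DelStar l (p0 l), ← Complex.exp_nat_mul]
    rw [Complex.exp_eq_one_iff]
    refine ⟨l.val + 1, ?_⟩
    have hM : (M : ℂ) ≠ 0 := by exact_mod_cast NeZero.ne M
    simp only [phi]
    push_cast
    field_simp

variable (hp : ∀ l, Del N M κ rt l ≠ 0)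
include hp

theorem Theta_eq_th (m : ZMod M) : ∀ (n : ℕ) (f : Fin n → ℂ) (l : Fin n → Fin (M - 1)),
    Theta N M κ rt n f l m = th n (Del N M κ rt ∘ l) (DelStar N M κ rt ∘ l)
      fun k => f k * zp (Del N M κ rt (l k) / DelStar N M κ rt (l k)) m
  | 0, _, _ => rfl
  | n + 1, f, l => by
    have hz : ∀ k, zp (Del N M κ rt (l k) / DelStar N M κ rt (l k)) m =
        Complex.exp (2 * Complex.I * m.val * phi M (l k)) := fun k => by
      rw [Del_div_DelStar _ (hp _), zp, ← Complex.exp_nat_mul]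
      congr 1
      ring
    rw [Theta, Theta_eq_th m n, Theta_eq_th m n, th, hz]
    congr 2
    refine congrArg (th n _ _) (funext fun k => ?_)
    simp only [shift, Function.comp_apply]
    ring

theorem ThetaG_eq (g : Fin (M - 1) → ℂ) {n : ℕ} {l : Fin n → Fin (M - 1)}
    (hl : Function.Injective l) (m : ZMod M) :
    ThetaG N M κ rt n (fun k => g (l k)) l m =
      ST (Del N M κ rt) (DelStar N M κ rt) g (Finset.univ.image l) m := by
  rw [ThetaG, Theta_eq_th hp, ST, TF, ← th_comp _ _ n l hl]
  congr 1
  funext k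
  simp only [Function.comp_apply, amp]
  congr 2
  have : (Finset.univ.image l).erase (l k) = (Finset.univ.erase k).image l := by
    rw [Finset.image_erase hl]
  rw [this, Finset.prod_image fun i _ j _ e => hl e]
  rfl

omit hp in
theorem modes_injective (σ : Equiv.Perm (Fin (M - 1))) (n : ℕ) (hn : n ≤ M - 1) :
    Function.Injective (modes σ n hn) :=
  σ.injective.comp (Fin.castLE_injective hn)

theorem tauPow_eq (g : Fin (M - 1) → ℂ) (σ : Equiv.Perm (Fin (M - 1))) (n : ℕ) (hn : n ≤ M - 1)
    (m : ZMod M) : tauPow N M κ rt g σ n hn m =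
      ST (Del N M κ rt) (DelStar N M κ rt) g (Finset.univ.image (modes σ n hn)) m :=
  ThetaG_eq hp g (modes_injective σ n hn) m

theorem thetaPow_eq (g : Fin (M - 1) → ℂ) (σ : Equiv.Perm (Fin (M - 1))) (n : ℕ)
    (hn : n ≤ M - 1) (m : ZMod M) : thetaPow N M κ rt g σ n hn m =
      SH (Del N M κ rt) (DelStar N M κ rt) g (Finset.univ.image (modes σ n hn)) m := by
  rw [thetaPow, ThetaG_eq hp (fun i => g i * sFun N M κ rt i 1) (modes_injective σ n hn), ST, SH]
  generalize Finset.univ.image (modes σ n hn) = S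
  congr 1
  funext i
  have e : sFun N M κ rt i 1 = sf (Del N M κ rt) (DelStar N M κ rt) 1 i := rfl
  rw [amp, amp, e, sf_eq]
  ring

end Angles

/-! ### Spectral invariance under phases, and invertibility of `Q` at `δ = 0` -/

section Phases
variable {N M : ℕ} [NeZero N] [NeZero M] {κ : ℂ}

theorem pathSum_smul {S : Type*} [Fintype S] (k : ZMod M → ℂ) (A : ZMod M → Matrix S S ℂ) :
    pathSum (fun m => k m • A m) = (∏ m, k m) * pathSum A := by
  simp only [pathSum, Finset.mul_sum, Matrix.smul_apply, smul_eq_mul, Finset.prod_mul_distrib]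

/-- Phases of `u`, `w` amount to a conjugation of the transfer matrix. -/
theorem charpoly_transfer_phase {u w u' w' : ZMod M → ℂ} (hu : ∀ m, u m ≠ 0) (hw : ∀ m, w m ≠ 0)
    (hu' : ∀ m, u' m ^ N = u m ^ N) (hw' : ∀ m, w' m ^ N = w m ^ N) (lam : ℂ) :
    (transfer N M κ u' w' lam).charpoly = (transfer N M κ u w lam).charpoly := by
  choose c hc using fun m => exists_chi_mul (hu m) (hu' m)
  choose d hd using fun m => exists_chi_mul (hw m) (hw' m)
  -- The phases `d` of `w` are undone by conjugation with this diagonal matrix, and the phases `c`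
  -- of `u` by translating all spins by `c`.
  set v : Conf N M → ℂ := fun α => chi (∑ m, d m * α m) with hv
  have hv0 : ∀ α, v α ≠ 0 := fun α => chi_ne_zero _
  set P : (Op N M)ˣ := ⟨Matrix.diagonal v, Matrix.diagonal fun α => (v α)⁻¹, by
    rw [Matrix.diagonal_mul_diagonal]; simp [hv0], by
    rw [Matrix.diagonal_mul_diagonal]; simp [hv0]⟩ with hP
  have key : transfer N M κ u' w' lam = P.val * Matrix.reindex (Equiv.addRight c).symm
      (Equiv.addRight c).symm (transfer N M κ u w lam) * P⁻¹.val := by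
    ext α β
    change _ = (Matrix.diagonal v * Matrix.reindex (Equiv.addRight c).symm
      (Equiv.addRight c).symm (transfer N M κ u w lam) * Matrix.diagonal fun α => (v α)⁻¹) α β
    rw [Matrix.mul_diagonal, Matrix.diagonal_mul, Matrix.reindex_apply, Matrix.submatrix_apply,
      transfer_apply, transfer_apply, mul_right_comm]
    have e : v α * (v β)⁻¹ = ∏ m, chi (d m * (α m - β m)) := by
      rw [← chi_sum, hv, ← div_eq_mul_inv, ← chi_sub, ← Finset.sum_sub_distrib]
      simp only [mul_sub]
    rw [e, ← pathSum_smul]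
    congr 1
    funext m
    simp only [Equiv.symm_symm, Equiv.coe_addRight, Pi.add_apply, laxE, hc, hd,
      add_right_comm _ (c m) 1, add_left_inj, chi_add]
    ext i j
    by_cases h1 : α m = β m
    · by_cases h2 : β m = β m + 1
      · have h3 : (1 : ZMod N) = 0 := by simpa using h2.symm
        have h4 : ∀ x : ZMod N, x = 0 := fun x => by rw [← one_mul x, h3, zero_mul]
        fin_cases i <;> fin_cases j <;> simp [h1, h3, h4 (d m), h4 (c m)]
      · fin_cases i <;> fin_cases j <;> simp [h1, h2]
        ring
    · by_cases h2 : α m = β m + 1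
      · have h3 : β m + 1 ≠ β m := h2 ▸ h1
        fin_cases i <;> fin_cases j <;> simp [h2, h3]
        ring
      · fin_cases i <;> fin_cases j <;> simp [h1, h2]
  rw [key, Matrix.coe_units_inv, Matrix.charpoly_units_conj, Matrix.charpoly_reindex]

/-- The Fourier matrix of the quantum space. -/
theorem det_fourier_ne_zero :
    (Matrix.of fun α β : Conf N M => ∏ m, (chi (α m * β (m + 1)) : ℂ)).det ≠ 0 := by
  have : (Matrix.of fun γ α : Conf N M => ∏ m, (chi (-(γ (m + 1) * α m)) : ℂ)) *
      (Matrix.of fun α β : Conf N M => ∏ m, (chi (α m * β (m + 1)) : ℂ)) =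
      ((N : ℂ) ^ M) • (1 : Op N M) := by
    ext γ β
    simp only [Matrix.mul_apply, Matrix.of_apply, ← Finset.prod_mul_distrib, ← chi_add]
    have e : ∀ α : Conf N M, ∏ m, (chi (-(γ (m + 1) * α m) + α m * β (m + 1)) : ℂ) =
        ∏ m, chi (α m * (β (m + 1) - γ (m + 1))) := fun α =>
      Finset.prod_congr rfl fun m _ => by congr 1; ring
    simp only [e]
    rw [← Fintype.prod_sum (fun (m : ZMod M) (x : ZMod N) => chi (x * (β (m + 1) - γ (m + 1))))]
    simp only [sum_chi_mul]
    rw [prod_shift (fun m => if β m - γ m = 0 then (N : ℂ) else 0)]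
    rw [Matrix.smul_apply, Matrix.one_apply]
    by_cases h : γ = β
    · subst h
      simp [ZMod.card]
    · rw [if_neg h, smul_zero]
      obtain ⟨m, hm⟩ := Function.ne_iff.1 h
      exact Finset.prod_eq_zero (Finset.mem_univ m) (if_neg (sub_ne_zero.2 (Ne.symm hm)))
  intro h0
  have h := congrArg Matrix.det this
  rw [Matrix.det_mul, h0, mul_zero, Matrix.det_smul, Matrix.det_one, mul_one] at h
  exact pow_ne_zero _ (pow_ne_zero _ (Nat.cast_ne_zero.2 (NeZero.ne N))) h.symm

theorem wFun_zero_left {e : ZMod N} (n : ZMod N) : wFun N 0 (chi e) n = chi (e * n) := by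
  rw [wFun]
  simp only [zero_mul, sub_zero, div_one, Finset.prod_const, Finset.card_range]
  rw [chi, ← pow_mul, ← Nat.cast_id (e.val * n.val), ← chi_natCast]
  simp

/-- For `δ = 0` the first and third points have `x = 0`, and their weights are pure exponentials.
The operator becomes a Fourier matrix between two invertible diagonal matrices. -/
theorem TauStep.det_Q_ne_zero (S : TauStep N M κ) (hδ : S.δ = 0) : S.Q.det ≠ 0 := by
  have x1 : ∀ m, xOne N κ S.δ S.τ S.τ' m = 0 := fun m => by simp [xOne, hδ]
  have x3 : ∀ m, xThree N S.δ S.τ S.τ' m = 0 := fun m => by simp [xThree, hδ]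
  have p1 : ∀ m, S.y1 m ^ N = 1 := fun m => by
    have := (S.f1 m).eq
    rwa [x1, zero_pow (NeZero.ne N), zero_add] at this
  have p3 : ∀ m, S.y3 m ^ N = 1 := fun m => by
    have := (S.f3 m).eq
    rwa [x3, zero_pow (NeZero.ne N), zero_add] at this
  choose e he using fun m => exists_chi_eq (p1 m)
  choose f hf using fun m => exists_chi_eq (p3 m)
  have key : S.Q = Matrix.diagonal (fun α => ∏ m, chi (f m * α m - e m * α m)) *
      (Matrix.of fun α β : Conf N M => ∏ m, (chi (α m * β (m + 1)) : ℂ)) *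
      Matrix.diagonal (fun β => ∏ m, chi (e m * β m - f m * β (m + 1) - β m * β (m + 1)) *
        wFun N (xTwo N κ S.τ' m) (S.y2 m) (β (m + 1) - β m)) := by
    ext α β
    rw [Matrix.mul_diagonal, Matrix.diagonal_mul, S.Q_eq, rawQ, Matrix.of_apply, Matrix.of_apply,
      ← Finset.prod_mul_distrib, ← Finset.prod_mul_distrib]
    refine Finset.prod_congr rfl fun m _ => ?_
    rw [qLoc, x1, x3, he, hf, wFun_zero_left, wFun_zero_left, mul_div_right_comm, ← chi_sub,
      ← mul_assoc, ← mul_assoc, ← chi_add, ← chi_add, ← chi_add]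
    congr 2
    ring
  rw [key, Matrix.det_mul, Matrix.det_mul, Matrix.det_diagonal, Matrix.det_diagonal]
  refine mul_ne_zero (mul_ne_zero ?_ det_fourier_ne_zero) ?_
  · exact Finset.prod_ne_zero_iff.2 fun α _ => Finset.prod_ne_zero_iff.2 fun m _ => chi_ne_zero _
  · exact Finset.prod_ne_zero_iff.2 fun α _ => Finset.prod_ne_zero_iff.2 fun m _ =>
      mul_ne_zero (chi_ne_zero _) ((S.f2 m).wFun_ne_zero _)

/-- An invertible `Q`-operator is a similarity of the transfer matrices. -/
theorem TauStep.charpoly_eq (S : TauStep N M κ) (h : S.Q.det ≠ 0) {lam : ℂ} (hl : lam ≠ 0) :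
    (transfer N M κ (uOf N S.τ) (wOf S.θ) lam).charpoly =
      (transfer N M κ (uOf N S.τ') (wOf S.θ') lam).charpoly := by
  obtain ⟨P, hP⟩ := (Matrix.isUnit_iff_isUnit_det _).2 (isUnit_iff_ne_zero.2 h)
  have e : transfer N M κ (uOf N S.τ) (wOf S.θ) lam * S.Q =
      S.Q * transfer N M κ (uOf N S.τ') (wOf S.θ') lam := S.toStep.intertwine S.κ_ne hl
  rw [← hP] at e
  rw [← Matrix.charpoly_units_conj' P, mul_assoc, e, ← Matrix.coe_units_inv, ← mul_assoc,
    Units.inv_mul, one_mul]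

end Phases

/-! ### Isospectrality along an edge, also for singular `Q` -/

section Isospectral
variable {ι : Type*} [LinearOrder ι] {N M : ℕ} [NeZero N] [NeZero M] {κ : ℂ} {p q g : ι → ℂ}

theorem exists_poly_ThS [Finite ι] (c : ι → ℂ) (S : Finset ι) : ∃ P : Polynomial ℂ, ∀ D : ℂ,
    (∀ i, q i ≠ D) → ThS p q S (fun i => c i * sd p q D i) * ∏ i ∈ S, (q i - D) = P.eval D := by
  refine ⟨∑ T ∈ S.powerset, .C ((∏ k ∈ T, -c k) * pairProd p q T) *
    ((∏ k ∈ T, (.C (p k) - .X)) * ∏ k ∈ S \ T, (.C (q k) - .X)), fun D hD => ?_⟩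
  rw [Polynomial.eval_finsetSum, ThS, Finset.sum_mul]
  refine Finset.sum_congr rfl fun T hT => ?_
  rw [← Finset.prod_sdiff (Finset.mem_powerset.1 hT)]
  simp only [Polynomial.eval_mul, Polynomial.eval_C, Polynomial.eval_prod, Polynomial.eval_sub,
    Polynomial.eval_X]
  have : (∏ k ∈ T, -(c k * sd p q D k)) * ∏ k ∈ T, (q k - D) =
      (∏ k ∈ T, -c k) * ∏ k ∈ T, (p k - D) := by
    rw [← Finset.prod_mul_distrib, ← Finset.prod_mul_distrib]
    refine Finset.prod_congr rfl fun k _ => ?_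
    have := sub_ne_zero.2 (hD k)
    simp only [sd, sg, mul_one]
    field_simp
  linear_combination pairProd p q T * (∏ k ∈ S \ T, (q k - D)) * this

/-- The `Θ`-functions of a Bäcklund transform vanish for finitely many parameters only. -/
theorem finite_zeros [Finite ι] (c : ι → ℂ) (S : Finset ι) {D₀ : ℂ} (hD₀ : ∀ i, q i ≠ D₀)
    (h0 : ThS p q S (fun i => c i * sd p q D₀ i) ≠ 0) :
    {D : ℂ | (∀ i, q i ≠ D) ∧ ThS p q S (fun i => c i * sd p q D i) = 0}.Finite := by
  obtain ⟨P, hP⟩ := exists_poly_ThS (p := p) (q := q) c S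
  have hP0 : P ≠ 0 := fun e => by
    have := hP D₀ hD₀
    rw [e, Polynomial.eval_zero, mul_eq_zero] at this
    exact this.elim h0 fun h => by
      obtain ⟨i, -, hi⟩ := Finset.prod_eq_zero_iff.1 h
      exact sub_ne_zero.2 (hD₀ i) hi
  refine (P.roots.toFinset.finite_toSet).subset fun D hD => ?_
  have := hP D hD.1
  rw [hD.2, zero_mul] at this
  simp [hP0, ← this]

theorem differentiableAt_ThS (c : ι → ℂ) (S : Finset ι) {D : ℂ} (hD : ∀ i, q i ≠ D) :
    DifferentiableAt ℂ (fun D => ThS p q S fun i => c i * sd p q D i) D := by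
  simp only [ThS, sd, sg, mul_one]
  refine DifferentiableAt.fun_sum fun T _ => DifferentiableAt.mul_const ?_ _
  refine DifferentiableAt.fun_finsetProd fun i _ => ?_
  have := sub_ne_zero.2 (hD i)
  fun_prop (disch := assumption)

theorem differentiableAt_det {n : Type*} [Fintype n] [DecidableEq n] {A : ℂ → Matrix n n ℂ}
    {z : ℂ} (h : ∀ i j, DifferentiableAt ℂ (fun x => A x i j) z) :
    DifferentiableAt ℂ (fun x => (A x).det) z := by
  simp only [Matrix.det_apply']
  exact DifferentiableAt.fun_sum fun s _ => (DifferentiableAt.fun_finsetProd fun i _ => h _ _).const_mul _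

/-- The characteristic polynomial of the transfer matrix at `s` in terms of `τ^N` and `θ^N`. -/
def charEval (N : ℕ) [NeZero N] (κ lam s : ℂ) (T H : ZMod M → ℂ) : ℂ :=
  (transfer N M κ (uOf N fun m => T m ^ ((N : ℂ)⁻¹)) (wOf fun m => H m ^ ((N : ℂ)⁻¹))
    lam).charpoly.eval s

/-- Phases of `τ` and `θ` do not affect the characteristic polynomial, so the principal roots in
`charEval` may be replaced by any others. Hence their discontinuity does no harm. -/
theorem charEval_eq {lam s : ℂ} {T H τ θ : ZMod M → ℂ} (hτ : ∀ m, τ m ^ N = T m)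
    (hθ : ∀ m, θ m ^ N = H m) (hT : ∀ m, T m ≠ 0) (hH : ∀ m, H m ≠ 0) :
    charEval N κ lam s T H = (transfer N M κ (uOf N τ) (wOf θ) lam).charpoly.eval s := by
  have nτ : ∀ m, τ m ≠ 0 := fun m => ne_zero_of_pow_eq (hτ m) (hT m)
  have nθ : ∀ m, θ m ≠ 0 := fun m => ne_zero_of_pow_eq (hθ m) (hH m)
  rw [charEval, charpoly_transfer_phase (uOf_ne_zero (N := N) nτ) (wOf_ne_zero nθ)]
  · intro m
    simp only [uOf, mul_pow, div_pow, Complex.cpow_nat_inv_pow _ (NeZero.ne N), hτ]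
  · intro m
    simp only [wOf, neg_pow (_ / _ : ℂ), div_pow, Complex.cpow_nat_inv_pow _ (NeZero.ne N), hθ]

/-- Near `z` the principal roots are exchanged for the holomorphic ones of `rootNear`, as
`charEval_eq` permits. -/
theorem differentiableAt_charEval {lam s : ℂ} (hl : lam ≠ 0) {T H : ℂ → ZMod M → ℂ} {z : ℂ}
    (hT : ∀ m, DifferentiableAt ℂ (fun x => T x m) z)
    (hH : ∀ m, DifferentiableAt ℂ (fun x => H x m) z)
    (nT : ∀ m, T z m ≠ 0) (nH : ∀ m, H z m ≠ 0) :
    DifferentiableAt ℂ (fun x => charEval N κ lam s (T x) (H x)) z := by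
  choose τ hτ using fun m => IsAlgClosed.exists_pow_nat_eq (T z m) (NeZero.pos N)
  choose θ hθ using fun m => IsAlgClosed.exists_pow_nat_eq (H z m) (NeZero.pos N)
  have nτ : ∀ m, τ m ≠ 0 := fun m => ne_zero_of_pow_eq (hτ m) (nT m)
  have nθ : ∀ m, θ m ≠ 0 := fun m => ne_zero_of_pow_eq (hθ m) (nH m)
  have dτ : ∀ m, DifferentiableAt ℂ (fun x => rootNear N (τ m) (T x m)) z := fun m =>
    DifferentiableAt.fun_comp' (g := rootNear N (τ m)) z
      (by rw [← hτ]; exact differentiableAt_rootNear (N := N) (nτ m)) (hT m)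
  have dθ : ∀ m, DifferentiableAt ℂ (fun x => rootNear N (θ m) (H x m)) z := fun m =>
    DifferentiableAt.fun_comp' (g := rootNear N (θ m)) z
      (by rw [← hθ]; exact differentiableAt_rootNear (N := N) (nθ m)) (hH m)
  have vτ : ∀ m, rootNear N (τ m) (T z m) ≠ 0 := fun m => by
    rw [← hτ, rootNear_self (nτ m)]; exact nτ m
  have vθ : ∀ m, rootNear N (θ m) (H z m) ≠ 0 := fun m => by
    rw [← hθ, rootNear_self (nθ m)]; exact nθ m
  have ev : (fun x => charEval N κ lam s (T x) (H x)) =ᶠ[𝓝 z] fun x =>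
      (Matrix.scalar (Conf N M) s - transfer N M κ (uOf N fun m => rootNear N (τ m) (T x m))
        (wOf fun m => rootNear N (θ m) (H x m)) lam).det := by
    filter_upwards [eventually_all.2 fun m => (hT m).continuousAt.eventually_ne (nT m),
      eventually_all.2 fun m => (hH m).continuousAt.eventually_ne (nH m)] with x h1 h2
    rw [charEval_eq (fun m => rootNear_pow (nτ m) _) (fun m => rootNear_pow (nθ m) _) h1 h2,
      Matrix.eval_charpoly]
  refine DifferentiableAt.congr_of_eventuallyEq ?_ ev
  refine differentiableAt_det fun α β => ?_
  simp only [Matrix.sub_apply]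
  refine (differentiableAt_const _).sub ?_
  refine transfer_differentiableAt (lam := fun _ => lam) (fun m => ?_) (fun m => ?_)
    (differentiableAt_const _) hl α β
  · exact ((dτ _).div (dτ _) (vτ m)).const_mul _
  · exact ((dθ _).div (dθ _) (vθ _)).neg

/-- The transfer matrices of the two states of an edge are isospectral. -/
theorem IsEdge.charpoly_eq [Finite ι] (hm : IsModes M (κ ^ N) p q) {R : ModeRoots N p q} {a : ι}
    {A B : PState ι M} {X : TauStep N M κ} (E : IsEdge g R a A B X) {lam : ℂ} (hl : lam ≠ 0) :
    (transfer N M κ (uOf N A.τ) (wOf A.θ) lam).charpoly =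
      (transfer N M κ (uOf N B.τ) (wOf B.θ) lam).charpoly := by
  have HE := E.stepRoots hm
  have hG : ∀ m, SG p q g B.S m ≠ 0 := fun m => ((HE.fermat_three_iff m).1 (X.f3 m)).2
  set f := amp p q g B.S with hf
  -- The final state is fixed, and the initial state is embedded in the family of Bäcklund
  -- transforms with parameter `D`; the given edge is the member `D = p a`.
  set PT : ℂ → ZMod M → ℂ := fun D m => ThS p q B.S fun i =>
    f i * (p i / q i) / sd p q 1 i * zp (p i / q i) m * sd p q D i with hPT
  set PH : ℂ → ZMod M → ℂ := fun D m => ThS p q B.S fun i =>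
    f i * zp (p i / q i) m * sd p q D i with hPH
  have eT : ∀ D, PT D = TF p q B.S fun i => f i * (p i / q i) * sd p q D i / sd p q 1 i :=
    fun D => funext fun m => ThS_congr p q fun i _ => by ring
  have eH : ∀ D, PH D = TF p q B.S fun i => f i * sd p q D i :=
    fun D => funext fun m => ThS_congr p q fun i _ => by ring
  have hb : ∀ D, (∀ i, q i ≠ D) → IsBacklund (κ ^ N) D (PT D) (PH D) (ST p q g B.S)
      (SH p q g B.S) (SG p q g B.S) := fun D hD => by
    rw [eT, eH]
    exact hm.isBacklund B.S f hD
  have s0 : ∀ i, sd p q 0 i = p i / q i := fun i => by simp [sd, sg]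
  have T0 : ∀ m, PT 0 m ≠ 0 := fun m => by
    have : PT 0 m = SG p q g B.S (m + 1) := by
      rw [SG, hm.TF_succ, eT]
      refine ThS_congr p q fun i _ => ?_
      simp only [s0]
      ring
    rw [this]
    exact hG _
  have H0 : ∀ m, PH 0 m ≠ 0 := fun m => by
    have : PH 0 m = ST p q g B.S (m + 1) := by
      rw [ST, hm.TF_succ, eH]
      refine ThS_congr p q fun i _ => ?_
      simp only [s0, hf]
    rw [this]
    exact HE.T'_ne _
  have dT : ∀ D, (∀ i, q i ≠ D) → ∀ m, DifferentiableAt ℂ (fun D => PT D m) D :=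
    fun D hD m => differentiableAt_ThS _ _ hD
  have dH : ∀ D, (∀ i, q i ≠ D) → ∀ m, DifferentiableAt ℂ (fun D => PH D m) D :=
    fun D hD m => differentiableAt_ThS _ _ hD
  -- In `Ω` neither a pole nor a zero of the Θ-functions occurs. Its complement is finite, so `Ω` is
  -- connected and contains both `0` and `p a`.
  set Ω : Set ℂ := {D | (∀ i, q i ≠ D) ∧ ∀ m, PT D m ≠ 0 ∧ PH D m ≠ 0} with hΩ
  have hfin : Ωᶜ.Finite := by
    refine (((Set.finite_range q).union (Set.finite_iUnion fun m =>
      finite_zeros (p := p) (q := q) _ B.S hm.q_ne (T0 m))).union (Set.finite_iUnion fun m =>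
      finite_zeros (p := p) (q := q) _ B.S hm.q_ne (H0 m))).subset fun D hD => ?_
    by_contra hD'
    simp only [Set.mem_union, Set.mem_iUnion, not_or, not_exists, Set.mem_range] at hD'
    exact hD ⟨hD'.1.1, fun m => ⟨fun e => hD'.1.2 m ⟨hD'.1.1, e⟩, fun e => hD'.2 m ⟨hD'.1.1, e⟩⟩⟩
  have hop : IsOpen Ω := by
    rw [← compl_compl Ω]
    exact hfin.isClosed.isOpen_compl
  have hconn : IsPreconnected Ω := by
    rw [← compl_compl Ω]
    refine (Set.Countable.isConnected_compl_of_one_lt_rank ?_ hfin.countable).isPreconnected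
    rw [Complex.rank_real_complex]
    exact Nat.one_lt_ofNat
  have m0 : (0 : ℂ) ∈ Ω := ⟨hm.q_ne, fun m => ⟨T0 m, H0 m⟩⟩
  have pT : PT (p a) = ST p q g A.S := funext fun m => by
    rw [hm.ST_eq g E.notMem, ← E.set_eq, eT]
  have pH : PH (p a) = SH p q g A.S := funext fun m => by
    rw [hm.SH_eq g E.notMem, ← E.set_eq, eH]
  have ma : p a ∈ Ω := ⟨fun i => (hm.p_ne_q a i).symm, fun m => by
    rw [pT, pH]
    exact ⟨HE.T_ne m, HE.H_ne m⟩⟩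
  refine Polynomial.funext fun s => ?_
  have an : AnalyticOnNhd ℂ (fun D => charEval N κ lam s (PT D) (PH D)) Ω :=
    DifferentiableOn.analyticOnNhd (fun D hD => (differentiableAt_charEval hl (dT D hD.1)
      (dH D hD.1) (fun m => (hD.2 m).1) fun m => (hD.2 m).2).differentiableWithinAt) hop
  -- With `D = δ ^ N`, the operator at `δ = 0` is invertible, hence so are its deformations for
  -- small `δ`, and an invertible intertwiner makes the two spectra equal.
  have freq : ∃ᶠ D in 𝓝[≠] (0 : ℂ), charEval N κ lam s (PT D) (PH D) =
      (transfer N M κ (uOf N B.τ) (wOf B.θ) lam).charpoly.eval s := by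
    choose τ hτ using fun m => IsAlgClosed.exists_pow_nat_eq (PT 0 m) (NeZero.pos N)
    choose θ hθ using fun m => IsAlgClosed.exists_pow_nat_eq (PH 0 m) (NeZero.pos N)
    obtain ⟨μ, hμ⟩ := IsAlgClosed.exists_pow_nat_eq (-κ ^ N) (NeZero.pos N)
    obtain ⟨ν, hν⟩ := IsAlgClosed.exists_pow_nat_eq (-(1 + κ ^ N)) (NeZero.pos N)
    have h0 : StepRoots N κ 0 (PT 0) (PH 0) (ST p q g B.S) (SH p q g B.S) (SG p q g B.S) τ θ B.τ B.θ
        0 μ ν :=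
      { backlund := hb 0 hm.q_ne, κ_ne := hm.κ_ne, one_add_ne := hm.k_ne'
        D_ne := by simp
        D_add_ne := by simpa using hm.k_ne
        δ_pow := zero_pow (NeZero.ne N), μ_pow := by rw [hμ]; ring, ν_pow := by rw [hν]; ring
        τ_pow := hτ, θ_pow := hθ, τ'_pow := E.validB.τ_pow, θ'_pow := E.validB.θ_pow
        T_ne := T0, H_ne := H0, T'_ne := HE.T'_ne, H'_ne := HE.H'_ne }
    -- At `δ = 0` the coordinate `x3` vanishes, so `y3 = 1` lies on the Fermat curve.
    set S₀ : TauStep N M κ := h0.mkStep (y3 := fun _ => 1) fun m =>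
      ⟨by simp [xThree, NeZero.ne N], one_ne_zero⟩ with hS₀
    have tn : Tendsto (fun δ : ℂ => δ) (𝓝[≠] 0) (𝓝 0) := tendsto_id.mono_left nhdsWithin_le_nhds
    have tD : Tendsto (fun δ : ℂ => δ ^ N) (𝓝[≠] 0) (𝓝 0) := by
      have := tn.pow N
      rwa [zero_pow (NeZero.ne N)] at this
    have hne : ∀ᶠ δ : ℂ in 𝓝[≠] 0, δ ^ N - 1 ≠ 0 :=
      (tD.sub_const 1).eventually_ne (by simp)
    have evΩ : ∀ᶠ δ : ℂ in 𝓝[≠] 0, δ ^ N ∈ Ω := tD (hop.mem_nhds m0)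
    have μ0 : μ ≠ 0 := h0.μ_ne
    have ν0 : ν ≠ 0 := h0.ν_ne
    obtain ⟨Aj, rj, tA, -, hj⟩ := S₀.exists_deformation (l := 𝓝[≠] (0 : ℂ)) h0
      (D' := fun δ => δ ^ N) (δ := fun δ => δ)
      (μ := fun δ => rootNear N μ ((δ ^ N + κ ^ N) / (δ ^ N - 1)))
      (ν := fun δ => rootNear N ν ((1 + κ ^ N) / (δ ^ N - 1)))
      (U := fun δ => PT (δ ^ N)) (V := fun δ => PH (δ ^ N)) (U' := fun _ => ST p q g B.S)
      (V' := fun _ => SH p q g B.S) (W := fun _ => SG p q g B.S)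
      (evΩ.mono fun δ h => hb _ h.1) tD tn
      (by
        refine tendsto_rootNear μ0 ?_
        have : Tendsto (fun δ : ℂ => (δ ^ N + κ ^ N) / (δ ^ N - 1)) (𝓝[≠] 0)
            (𝓝 ((0 + κ ^ N) / (0 - 1))) := (tD.add_const (κ ^ N)).div (tD.sub_const 1) (by simp)
        rw [hμ]
        convert this using 2
        ring)
      (by
        refine tendsto_rootNear ν0 ?_
        have : Tendsto (fun δ : ℂ => (1 + κ ^ N) / (δ ^ N - 1)) (𝓝[≠] 0)
            (𝓝 ((1 + κ ^ N) / (0 - 1))) := tendsto_const_nhds.div (tD.sub_const 1) (by simp)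
        rw [hν]
        convert this using 2
        ring)
      (Eventually.of_forall fun _ => rfl)
      (hne.mono fun δ h => by rw [rootNear_pow μ0, div_mul_cancel₀ _ h])
      (hne.mono fun δ h => by rw [rootNear_pow ν0, div_mul_cancel₀ _ h])
      (fun m => (dT 0 hm.q_ne m).continuousAt.tendsto.comp tD)
      (fun m => (dH 0 hm.q_ne m).continuousAt.tendsto.comp tD)
      (fun m => tendsto_const_nhds) (fun m => tendsto_const_nhds) (fun m => tendsto_const_nhds)
    have hdet : ∀ᶠ δ in 𝓝[≠] (0 : ℂ), (Aj δ).det ≠ 0 :=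
      ((continuous_id.matrix_det.tendsto _).comp tA).eventually_ne (S₀.det_Q_ne_zero rfl)
    have hev : ∀ᶠ δ in 𝓝[≠] (0 : ℂ), charEval N κ lam s (PT (δ ^ N)) (PH (δ ^ N)) =
        (transfer N M κ (uOf N B.τ) (wOf B.θ) lam).charpoly.eval s := by
      filter_upwards [hj, hdet, evΩ] with δ hj hd hδ
      obtain ⟨Y, e1, e2, e3, e4, -, -, -, e8, -⟩ := hj
      have c := Y.charpoly_eq (by rwa [e8]) hl
      have hτ' : Y.τ' = B.τ := by
        rw [e3]
        funext m
        change rootNear N (B.τ m) _ = _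
        rw [← E.validB.τ_pow, rootNear_self (E.neB m).1]
      have hθ' : Y.θ' = B.θ := by
        rw [e4]
        funext m
        change rootNear N (B.θ m) _ = _
        rw [← E.validB.θ_pow, rootNear_self (E.neB m).2]
      rw [hτ', hθ'] at c
      rw [← c]
      refine charEval_eq (fun m => ?_) (fun m => ?_) (fun m => (hδ.2 m).1) fun m => (hδ.2 m).2
      · rw [e1]
        exact rootNear_pow (h0.τ_ne m) _
      · rw [e2]
        exact rootNear_pow (h0.θ_ne m) _
    have tD' : Tendsto (fun δ : ℂ => δ ^ N) (𝓝[≠] 0) (𝓝[≠] 0) :=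
      tendsto_nhdsWithin_iff.2 ⟨tD, eventually_nhdsWithin_of_forall fun δ h => pow_ne_zero N h⟩
    exact tD'.frequently hev.frequently
  have := an.eqOn_of_preconnected_of_frequently_eq analyticOnNhd_const hconn m0 freq ma
  simp only at this
  rw [← this, pT, pH]
  exact (charEval_eq E.validA.τ_pow E.validA.θ_pow HE.T_ne HE.H_ne).symm

end Isospectral

/-! ### Intertwining, isospectrality and uniqueness for paths with arbitrary amplitudes -/

section General
variable {ι : Type*} [LinearOrder ι] {N M : ℕ} [NeZero N] [NeZero M] {κ : ℂ} {p q g : ι → ℂ}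
  {R : ModeRoots N p q} {A C : PState ι M} {K : Op N M} {r : ℝ}

theorem Reach.intertwine (hm : IsModes M (κ ^ N) p q) (h : Reach κ g R A C K r) {lam : ℂ}
    (hl : lam ≠ 0) : transfer N M κ (uOf N A.τ) (wOf A.θ) lam * K =
      K * transfer N M κ (uOf N C.τ) (wOf C.θ) lam := by
  induction h with
  | nil => rw [one_mul, mul_one]
  | @snoc B C K r a X _ E ih =>
    have e : transfer N M κ (uOf N X.τ) (wOf X.θ) lam * X.Q =
      X.Q * transfer N M κ (uOf N X.τ') (wOf X.θ') lam := X.toStep.intertwine hm.κ_ne hl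
    rw [E.τ_eq, E.θ_eq, E.τ'_eq, E.θ'_eq] at e
    rw [← mul_assoc, ih, mul_assoc, e, mul_assoc]

theorem Reach.charpoly_eq [Finite ι] (hm : IsModes M (κ ^ N) p q) (h : Reach κ g R A C K r)
    {lam : ℂ} (hl : lam ≠ 0) : (transfer N M κ (uOf N A.τ) (wOf A.θ) lam).charpoly =
      (transfer N M κ (uOf N C.τ) (wOf C.θ) lam).charpoly := by
  induction h with
  | nil => rfl
  | snoc _ E ih => exact ih.trans (E.charpoly_eq hm hl)

/-- The amplitudes `g (1 - t)` are generic for small `t ≠ 0` and tend to `g`, so the limit argument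
applies. -/
theorem Reach.unique_of_modes [Finite ι] {K' : Op N M} {r' : ℝ} (hm : IsModes M (κ ^ N) p q)
    (hA : ∀ m, A.τ m ≠ 0 ∧ A.θ m ≠ 0) (h1 : Reach κ g R A C K r) (h2 : Reach κ g R A C K' r') :
    ∃ c : ℂ, c ≠ 0 ∧ K = c • K' := by
  refine h1.unique_of_tendsto (l := 𝓝[≠] (0 : ℂ)) (G := fun t i => g i * (1 - t)) hm ?_
    (hm.almostAll_generic.eventually g) hA h2
  have : Continuous fun (t : ℂ) (i : ι) => g i * (1 - t) := by fun_prop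
  have := this.tendsto 0
  simp only [sub_zero, mul_one] at this
  exact this.mono_left nhdsWithin_le_nhds

end General

/-! ### Translation of the given data into paths of states -/

section Data
variable {N M : ℕ} [NeZero N] [NeZero M] {κ : ℂ} {rt : ℂ → ℂ} {g : Fin (M - 1) → ℂ}

/-- The first `n` modes of the ordering `σ`. -/
def level {L : ℕ} (σ : Equiv.Perm (Fin L)) (n : ℕ) : Finset (Fin L) :=
  Finset.univ.filter fun i => (σ.symm i).val < n

theorem level_zero {L : ℕ} (σ : Equiv.Perm (Fin L)) : level σ 0 = ∅ := by simp [level]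

theorem level_last {L : ℕ} (σ : Equiv.Perm (Fin L)) : level σ L = Finset.univ := by simp [level]

theorem level_succ {L : ℕ} (σ : Equiv.Perm (Fin L)) (n : Fin L) :
    level σ (n + 1) = insert (σ n) (level σ n) := by
  ext i
  simp only [level, Finset.mem_filter, Finset.mem_univ, true_and, Finset.mem_insert]
  rw [← Equiv.symm_apply_eq, Fin.ext_iff]
  omega

theorem notMem_level {L : ℕ} (σ : Equiv.Perm (Fin L)) (n : Fin L) : σ n ∉ level σ n := by
  simp [level]

theorem image_modes (σ : Equiv.Perm (Fin (M - 1))) (n : ℕ) (hn : n ≤ M - 1) :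
    Finset.univ.image (modes σ n hn) = level σ n := by
  ext i
  simp only [level, Finset.mem_filter, Finset.mem_univ, true_and, Finset.mem_image, modes]
  constructor
  · rintro ⟨k, rfl⟩
    simp
  · intro h
    exact ⟨⟨_, h⟩, by simp [Fin.castLE]⟩

/-- The roots for all modes. -/
def Roots.toModeRoots (hm : IsModes M (κ ^ N) (Del N M κ rt) (DelStar N M κ rt)) {R : Roots M}
    (hR : R.Valid N κ rt) : ModeRoots N (Del N M κ rt) (DelStar N M κ rt) where
  δ := R.δ
  μ l := R.lam l / R.δ l
  ν l := R.lam l / R.δ l * R.c l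
  δ_pow := hR.δ_pow
  μ_pow l := by
    rw [div_pow, hR.lam_pow, hR.δ_pow, mul_div_cancel_left₀ _ (hm.p_ne l)]
  ν_pow l := by
    rw [mul_pow, div_pow, hR.lam_pow, hR.δ_pow, mul_div_cancel_left₀ _ (hm.p_ne l), hR.c_pow,
      mul_div_cancel₀ _ (hm.q_ne l)]

/-- The state `n` of the data `T` for the ordering `σ`. -/
def TauTheta.state (T : TauTheta M) (σ : Equiv.Perm (Fin (M - 1))) (n : ℕ) :
    PState (Fin (M - 1)) M := ⟨level σ n, T.τ n, T.θ n⟩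

variable (hm : IsModes M (κ ^ N) (Del N M κ rt) (DelStar N M κ rt)) {R : Roots M}
  (hR : R.Valid N κ rt) {σ : Equiv.Perm (Fin (M - 1))} {T : TauTheta M}
  (hT : T.Valid N κ rt g σ)

include hm hT in
theorem TauTheta.state_valid {n : ℕ} (hn : n ≤ M - 1) :
    (T.state σ n).Valid N (Del N M κ rt) (DelStar N M κ rt) g where
  τ_pow m := by
    change T.τ n m ^ N = _
    rw [hT.τ_pow n hn, tauPow_eq hm.p_ne, image_modes]
    rfl
  θ_pow m := by
    change T.θ n m ^ N = _
    rw [hT.θ_pow n hn, thetaPow_eq hm.p_ne, image_modes]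
    rfl

variable {Y : YCoords M} (hN : T.Nonvanishing) (hY : Y.Valid N κ R σ T)

include hm hR hT hN hY in
theorem exists_isEdge_of_data (n : Fin (M - 1)) : ∃ X : TauStep N M κ,
    IsEdge g (Roots.toModeRoots hm hR) (σ n) (T.state σ n) (T.state σ (n + 1)) X ∧
      X.Q = Qop N κ R σ T Y n := by
  have hn : (n : ℕ) + 1 ≤ M - 1 := n.2
  have hδ : R.δ (σ n) ≠ 0 := ne_zero_of_pow_eq (hR.δ_pow _) (hm.p_ne _)
  refine ⟨{ τ := T.τ n, θ := T.θ n, τ' := T.τ (n + 1), θ' := T.θ (n + 1)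
            y1 := Y.y₁ n, y2 := Y.y₂ n, y3 := Y.y₃ n, δ := R.δ (σ n)
            μ := R.lam (σ n) / R.δ (σ n), ν := R.lam (σ n) / R.δ (σ n) * R.c (σ n)
            κ_ne := hm.κ_ne
            τ_ne := fun m => (hN n n.2.le m).1, θ_ne := fun m => (hN n n.2.le m).2
            τ'_ne := fun m => (hN _ hn m).1, θ'_ne := fun m => (hN _ hn m).2
            f1 := fun m => ⟨hY.fermat₁ n m, (hY.ne_zero n m).1⟩
            f2 := fun m => ⟨hY.fermat₂ n m, (hY.ne_zero n m).2.1⟩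
            f3 := fun m => ⟨hY.fermat₃ n m, (hY.ne_zero n m).2.2⟩
            eta := fun m => ?_, ups := fun m => ?_ },
    ⟨notMem_level σ n, level_succ σ n, T.state_valid hm hT n.2.le, T.state_valid hm hT hn,
      rfl, rfl, rfl, rfl, rfl, rfl, rfl⟩, rfl⟩
  · rw [hY.ratio₁₃, etaOf]
    have := hm.κ_ne
    field_simp
  · rw [← inv_div, hY.ratio₃₂, upsOf]
    rw [mul_inv, mul_inv, inv_inv, inv_div, inv_div]
    ring

include hm hR hT hN hY in
theorem exists_reach_of_data (n : ℕ) (hn : n ≤ M - 1) : ∃ r,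
    Reach κ g (Roots.toModeRoots hm hR) (⟨∅, fun _ => 1, fun _ => 1⟩ : PState (Fin (M - 1)) M)
      (T.state σ n) ((List.ofFn fun n : Fin (M - 1) => Qop N κ R σ T Y n).take n).prod r := by
  induction n with
  | zero =>
    refine ⟨1, ?_⟩
    have : T.state σ 0 = (⟨∅, fun _ => 1, fun _ => 1⟩ : PState (Fin (M - 1)) M) := by
      rw [TauTheta.state, level_zero, funext hT.τ_zero, funext hT.θ_zero]
    rw [this]
    exact .nil
  | succ n ih =>
    obtain ⟨r, hr⟩ := ih (Nat.le_of_succ_le hn)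
    obtain ⟨X, E, hX⟩ := exists_isEdge_of_data hm hR hT hN hY ⟨n, hn⟩
    refine ⟨r * X.rho, ?_⟩
    have h := hr.snoc E
    rw [List.prod_take_succ _ _ (by simpa using hn), List.getElem_ofFn, ← hX]
    exact h

include hm hR hT hN hY in
theorem exists_reach_Kop : ∃ r, Reach κ g (Roots.toModeRoots hm hR)
    (⟨∅, fun _ => 1, fun _ => 1⟩ : PState (Fin (M - 1)) M) (T.state σ (M - 1))
    (Kop N κ R σ T Y) r := by
  obtain ⟨r, hr⟩ := exists_reach_of_data hm hR hT hN hY (M - 1) le_rfl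
  rw [List.take_of_length_le (by simp)] at hr
  exact ⟨r, hr⟩

include hm hT in
theorem nonvanishing_of_generic (hg : Generic (Del N M κ rt) (DelStar N M κ rt) g M) :
    T.Nonvanishing := fun _ hn m => (T.state_valid hm hT hn).ne hg m

include hm hR hT in
theorem exists_yCoords (hg : Generic (Del N M κ rt) (DelStar N M κ rt) g M) :
    ∃ Y : YCoords M, Y.Valid N κ R σ T := by
  choose X hX using fun n : Fin (M - 1) => exists_isEdge hm (Roots.toModeRoots hm hR) hg
    (A := T.state σ n) (B := T.state σ (n + 1)) (notMem_level σ n) (level_succ σ n)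
    (T.state_valid hm hT n.2.le) (T.state_valid hm hT n.2)
  have hδ : ∀ n, R.δ (σ n) ≠ 0 := fun n => ne_zero_of_pow_eq (hR.δ_pow _) (hm.p_ne _)
  refine ⟨⟨fun n => (X n).y1, fun n => (X n).y2, fun n => (X n).y3⟩, ?_, ?_, ?_, ?_, ?_, ?_⟩
  · intro n m
    have := ((X n).f1 m).eq
    rw [(hX n).τ_eq, (hX n).τ'_eq, (hX n).δ_eq] at this
    exact this
  · intro n m
    have := ((X n).f2 m).eq
    rw [(hX n).τ'_eq] at this
    exact this
  · intro n m
    have := ((X n).f3 m).eq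
    rw [(hX n).τ_eq, (hX n).τ'_eq, (hX n).δ_eq] at this
    exact this
  · exact fun n m => ⟨((X n).f1 m).ne, ((X n).f2 m).ne, ((X n).f3 m).ne⟩
  · intro n m
    have := (X n).ups m
    rw [(hX n).τ_eq, (hX n).θ_eq, (hX n).τ'_eq, (hX n).θ'_eq, (hX n).ν_eq, upsOf] at this
    rw [← inv_div, this]
    change (omHalf N * (R.lam (σ n) / R.δ (σ n) * R.c (σ n)) *
      (T.τ n (m - 1) * T.θ (n + 1) m / (T.θ n m * T.τ (n + 1) (m - 1))))⁻¹ = _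
    rw [mul_inv, mul_inv, inv_div, mul_inv, inv_div, div_eq_mul_inv (R.δ _) (R.lam _ * _), mul_inv]
    ring
  · intro n m
    have := (X n).eta m
    rw [(hX n).θ_eq, (hX n).τ'_eq, (hX n).μ_eq, etaOf] at this
    rw [this]
    change omHalf N * (R.lam (σ n) / R.δ (σ n) / κ) * (T.θ n (m - 1) * T.τ (n + 1) (m + 1) /
      (T.θ n m * T.τ (n + 1) m)) = _
    rw [div_div, mul_comm (R.δ _) κ]

include hm hR hT hN hY in
/-- Two products of `Q`-operators for the same amplitudes. -/
theorem exists_Kop_eq {σ' : Equiv.Perm (Fin (M - 1))} {T' : TauTheta M} {Y' : YCoords M}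
    (hT' : T'.Valid N κ rt g σ') (hN' : T'.Nonvanishing) (hY' : Y'.Valid N κ R σ' T') :
    ∃ (a b : ZMod M → ZMod N) (c : ℂ), c ≠ 0 ∧
      (∀ m, T'.u N (M - 1) m = om N ^ (a m).val * T.u N (M - 1) m ∧
        T'.w (M - 1) m = om N ^ (b m).val * T.w (M - 1) m) ∧
      Kop N κ R σ' T' Y' = c • (Kop N κ R σ T Y * weylOp N M a b) := by
  have v := T.state_valid hm hT le_rfl
  have v' := T'.state_valid hm hT' le_rfl
  have hS : (T'.state σ' (M - 1)).S = (T.state σ (M - 1)).S := by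
    simp [TauTheta.state, level_last]
  have eτ : ∀ m, T'.τ (M - 1) m ^ N = T.τ (M - 1) m ^ N := fun m =>
    (v'.τ_pow m).trans (by rw [hS]; exact (v.τ_pow m).symm)
  have eθ : ∀ m, T'.θ (M - 1) m ^ N = T.θ (M - 1) m ^ N := fun m =>
    (v'.θ_pow m).trans (by rw [hS]; exact (v.θ_pow m).symm)
  have hne := hN (M - 1) le_rfl
  choose s hs using fun m => exists_chi_mul (hne m).1 (eτ m)
  choose t ht using fun m => exists_chi_mul (hne m).2 (eθ m)
  obtain ⟨r, hr⟩ := exists_reach_Kop hm hR hT hN hY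
  obtain ⟨r', hr'⟩ := exists_reach_Kop hm hR hT' hN' hY'
  -- Without modes the path is empty: there is no last step that could carry a change of phases, and
  -- both operators are `1`.
  rcases Nat.eq_zero_or_pos (M - 1) with hM | hM
  · have hk : ∀ F : Fin (M - 1) → Op N M, (List.ofFn F).prod = 1 := fun F => by
      have : List.ofFn F = [] := List.eq_nil_of_length_eq_zero (by rw [List.length_ofFn, hM])
      rw [this, List.prod_nil]
    refine ⟨0, 0, 1, one_ne_zero, fun m => ?_, ?_⟩
    · simp only [TauTheta.u, TauTheta.w, hM, hT.τ_zero, hT.θ_zero, hT'.τ_zero, hT'.θ_zero]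
      simp
    · rw [Kop, Kop, hk, hk, weylOp_zero, one_smul, one_mul]
  · have hne' : T.state σ (M - 1) ≠ (⟨∅, fun _ => 1, fun _ => 1⟩ : PState (Fin (M - 1)) M) :=
      fun e => by
        have := congrArg PState.S e
        simp only [TauTheta.state, level_last] at this
        exact Finset.notMem_empty (⟨0, hM⟩ : Fin (M - 1)) (this ▸ Finset.mem_univ _)
    -- The first path is redirected to the final state of the second one at the cost of a Weyl
    -- monomial; the two paths then have the same ends.
    obtain ⟨K₁, r₁, h₁, c, hc, e⟩ := hr.exists_twist hm hne' hS hs ht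
    obtain ⟨d, hd, e'⟩ := hr'.unique_of_modes hm (fun m => ⟨one_ne_zero, one_ne_zero⟩) h₁
    refine ⟨_, _, d * c, mul_ne_zero hd hc, fun m => ?_, by rw [e', e, smul_smul]⟩
    change T'.u N (M - 1) m = chi (s (m - 1) - s m) * T.u N (M - 1) m ∧
      T'.w (M - 1) m = chi (t m - t (m - 1)) * T.w (M - 1) m
    rw [TauTheta.u, TauTheta.u, TauTheta.w, TauTheta.w, hs, hs, ht, ht, chi_sub, chi_sub]
    have := chi_ne_zero (s m)
    have := chi_ne_zero (t (m - 1))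
    have := (hne m).1
    have := (hne (m - 1)).2
    constructor <;> field_simp

end Data

end RelToda

end

theorem mainTheorem5 (N M : ℕ) [NeZero N] [NeZero M] (κ : ℂ) (rt : ℂ → ℂ)
    (hrt : ∀ z, rt z ^ 2 = z) (hκ : κ ≠ 0)
    (hκN : ∀ l < M, κ ^ N + (Real.cos (Real.pi * l / M) : ℂ) ^ 2 ≠ 0) :
    -- for generic amplitudes every choice of phases, in every order, leads to regular data
    (∃ P : MvPolynomial (Fin (M - 1)) ℂ, P ≠ 0 ∧
      ∀ g : Fin (M - 1) → ℂ, MvPolynomial.eval g P ≠ 0 →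
        ∀ R : RelToda.Roots M, R.Valid N κ rt →
        ∀ (σ : Equiv.Perm (Fin (M - 1))) (T : RelToda.TauTheta M), T.Valid N κ rt g σ →
          T.Nonvanishing ∧ ∃ Y : RelToda.YCoords M, Y.Valid N κ R σ T) ∧
    -- the parameters of the final state do not depend on the order, up to phases
    (∀ (g : Fin (M - 1) → ℂ) (σ σ' : Equiv.Perm (Fin (M - 1))) (m : ZMod M),
      RelToda.tauPow N M κ rt g σ (M - 1) le_rfl m =
          RelToda.tauPow N M κ rt g σ' (M - 1) le_rfl m ∧
        RelToda.thetaPow N M κ rt g σ (M - 1) le_rfl m =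
          RelToda.thetaPow N M κ rt g σ' (M - 1) le_rfl m) ∧
    -- `K` transforms the homogeneous transfer matrix into the final one, which is isospectral
    (∀ (g : Fin (M - 1) → ℂ) (R : RelToda.Roots M), R.Valid N κ rt →
      ∀ (σ : Equiv.Perm (Fin (M - 1))) (T : RelToda.TauTheta M) (Y : RelToda.YCoords M),
        T.Valid N κ rt g σ → T.Nonvanishing → Y.Valid N κ R σ T →
        ∀ lam : ℂ, lam ≠ 0 →
          RelToda.transfer N M κ (fun _ => -(RelToda.omHalf N)⁻¹) (fun _ => -1) lam *
              RelToda.Kop N κ R σ T Y =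
            RelToda.Kop N κ R σ T Y *
              RelToda.transfer N M κ (T.u N (M - 1)) (T.w (M - 1)) lam ∧
          (IsUnit (RelToda.Kop N κ R σ T Y).det →
            (RelToda.Kop N κ R σ T Y)⁻¹ *
                RelToda.transfer N M κ (fun _ => -(RelToda.omHalf N)⁻¹) (fun _ => -1) lam *
                RelToda.Kop N κ R σ T Y =
              RelToda.transfer N M κ (T.u N (M - 1)) (T.w (M - 1)) lam) ∧
          (RelToda.transfer N M κ (fun _ => -(RelToda.omHalf N)⁻¹) (fun _ => -1) lam).charpoly =
            (RelToda.transfer N M κ (T.u N (M - 1)) (T.w (M - 1)) lam).charpoly) ∧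
    -- `K` does not depend on the order
    (∀ (g : Fin (M - 1) → ℂ) (R : RelToda.Roots M), R.Valid N κ rt →
      ∀ (σ σ' : Equiv.Perm (Fin (M - 1))) (T T' : RelToda.TauTheta M)
        (Y Y' : RelToda.YCoords M),
        T.Valid N κ rt g σ → T.Nonvanishing → Y.Valid N κ R σ T →
        T'.Valid N κ rt g σ' → T'.Nonvanishing → Y'.Valid N κ R σ' T' →
        -- with the same phases of the parameters of the final state: up to a scalar
        ((∀ m, T'.u N (M - 1) m = T.u N (M - 1) m ∧ T'.w (M - 1) m = T.w (M - 1) m) →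
          ∃ c : ℂ, c ≠ 0 ∧ RelToda.Kop N κ R σ' T' Y' = c • RelToda.Kop N κ R σ T Y) ∧
        -- with arbitrary phases: up to a scalar and the change of the phases of the final state
        (∃ (a b : ZMod M → ZMod N) (c : ℂ), c ≠ 0 ∧
          (∀ m, T'.u N (M - 1) m = RelToda.om N ^ (a m).val * T.u N (M - 1) m ∧
            T'.w (M - 1) m = RelToda.om N ^ (b m).val * T.w (M - 1) m) ∧
          RelToda.Kop N κ R σ' T' Y' =
            c • (RelToda.Kop N κ R σ T Y * RelToda.weylOp N M a b))) := by
  have hm := RelToda.isModes_del hrt hκ hκN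
  refine ⟨?_, fun g σ σ' m => ?_, fun g R hR σ T Y hT hN hY lam hl => ?_,
    fun g R hR σ σ' T T' Y Y' hT hN hY hT' hN' hY' => ?_⟩
  · obtain ⟨P, hP, h⟩ := hm.almostAll_generic
    refine ⟨P, fun e => hP (by rw [e, map_zero]), fun g hg R hR σ T hT => ?_⟩
    exact ⟨RelToda.nonvanishing_of_generic hm hT (h g hg),
      RelToda.exists_yCoords hm hR hT (h g hg)⟩
  · rw [RelToda.tauPow_eq hm.p_ne, RelToda.tauPow_eq hm.p_ne, RelToda.thetaPow_eq hm.p_ne,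
      RelToda.thetaPow_eq hm.p_ne]
    simp only [RelToda.image_modes, RelToda.level_last, and_self]
  · obtain ⟨r, hr⟩ := RelToda.exists_reach_Kop hm hR hT hN hY
    have hu : RelToda.uOf N (fun _ : ZMod M => 1) = fun _ => -(RelToda.omHalf N)⁻¹ := by
      funext m
      simp [RelToda.uOf]
    have hw : RelToda.wOf (fun _ : ZMod M => 1) = fun _ => -1 := by
      funext m
      simp [RelToda.wOf]
    have h := hr.intertwine hm hl
    have hc := hr.charpoly_eq hm hl
    rw [hu, hw] at h hc
    refine ⟨h, fun hdet => ?_, hc⟩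
    rw [mul_assoc, h, ← mul_assoc, Matrix.nonsing_inv_mul _ hdet, one_mul]
    rfl
  · obtain ⟨a, b, c, hc, hab, h⟩ := RelToda.exists_Kop_eq hm hR hT hN hY hT' hN' hY'
    refine ⟨fun e => ⟨c, hc, ?_⟩, a, b, c, hc, hab, h⟩
    have hne := hN (M - 1) le_rfl
    -- The final parameters are nonzero, so they determine their phases: equal parameters force `a =
    -- b = 0`, and the Weyl monomial is trivial.
    have key : ∀ {n : ZMod N} {z : ℂ}, z ≠ 0 → z = RelToda.om N ^ n.val * z → n = 0 :=
      fun hz h => RelToda.chi_injective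
        ((mul_eq_right₀ hz).1 h.symm |>.trans RelToda.chi_zero.symm)
    have ha : a = 0 := funext fun m =>
      key (RelToda.uOf_ne_zero (fun m => (hne m).1) m) ((e m).1.symm.trans (hab m).1)
    have hb : b = 0 := funext fun m =>
      key (RelToda.wOf_ne_zero (fun m => (hne m).2) m) ((e m).2.symm.trans (hab m).2)
    rw [h, ha, hb, RelToda.weylOp_zero, mul_one]
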